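/- Let $n\ge 2$ and let $\mathfrak g$ be $\mathfrak o_{2n+1}$, $\mathfrak{sp}_{2n}$ or $\mathfrak o_{2n}$, with index set $I=\{-n,\dots,n\}$ in the first case and $I=\{-n+1,\dots,n\}$ in the other two; put $N=|I|$. Let $i'=-i$ for $\mathfrak o_{2n+1}$ and $i'=-i+1$ otherwise; $\epsilon_i=1$ in the orthogonal cases and $\epsilon_i=-\operatorname{sgn}(i-\frac12)$ for $\mathfrak{sp}_{2n}$; $\kappa=N/2-1$ for $\mathfrak o_N$ and $\kappa=n+1$ for $\mathfrak{sp}_{2n}$. Put $$R(u,v)=1+\frac{c\,\mathbf P}{u-v}-\frac{c\,\mathbf Q}{u-v+c\kappa},\qquad \mathbf P=\sum_{i,j\in I} e_{ij}\otimes e_{ji},\qquad \mathbf Q=\sum_{i,j\in I}\epsilon_i\epsilon_j\,e_{ij}\otimes e_{i'j'},\qquad (M^{\rm t})_{ij}=\epsilon_i\epsilon_jM_{j'i'} .$$ The Yangian double $\mathcal DY(\mathfrak g)$ is the $c$-adically complete, $c$-torsion free $\mathbb C[[c]]$-algebra topologically generated by $t_{ij}[\ell]$ ($i,j\in I$, $\ell\in\mathbb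 Z$), where the series $$T^+_{ij}(u)=\delta_{ij}+c\sum_{\ell\ge0}t_{ij}[\ell]u^{-\ell-1},\qquad T^-_{ij}(u)=\delta_{ij}+c\sum_{\ell<0}t_{ij}[\ell]u^{-\ell-1}$$ are subject to $R(u,v)T_1^\mu(u)T_2^\nu(v)=T_2^\nu(v)T_1^\mu(u)R(u,v)$ for $\mu,\nu=\pm$ (multiplied by the common denominator $(u-v)(u-v+c\kappa)$) and $T^\pm(u-c\kappa)^{\rm t}\,T^\pm(u)=T^\pm(u)\,T^\pm(u-c\kappa)^{\rm t}=1$; that is, it is the quotient of the completed free algebra by the smallest closed, $c$-saturated two-sided ideal containing these relations. Then $T^\pm(u)$ has a unique Gauss decomposition $$T^\pm_{i,j}(u)=\sum_{\ell=\max(i,j)}^{n}{\rm F}^\pm_{\ell,i}(u)\,k^\pm_\ell(u)\,{\rm E}^\pm_{j,\ell}(u),$$ with ${\rm F}^\pm_{i,i}={\rm E}^\pm_{i,i}=1$, ${\rm F}^\pm_{i,j}={\rm E}^\pm_{j,i}=0$ for $i<j$, and $k^\pm_\ell$ invertible, and the following holds. * For $\mathcal DY(\mathfrak o_{2n+1})$: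 $${\rm F}^\pm_{-i,-i-1}(u)=-{\rm F}^\pm_{i+1,i}(u-c(i-\tfrac12)),\quad {\rm E}^\pm_{-i-1,-i}(u)=-{\rm E}^\pm_{i,i+1}(u-c(i-\tfrac12))\qquad(0\le i\le n-1),$$ $$k^\pm_{-\ell}(u)=\frac1{k^\pm_\ell(u-c(\ell-\frac12))}\prod_{s=\ell+1}^n\frac{k^\pm_s(u-c(s-\frac32))}{k^\pm_s(u-c(s-\frac12))}\qquad(0\le\ell\le n).$$ * For $\mathcal DY(\mathfrak{sp}_{2n})$: $${\rm F}^\pm_{-i+1,-i}(u)=-{\rm F}^\pm_{i+1,i}(u-c(i+1)),\quad {\rm E}^\pm_{-i,-i+1}(u)=-{\rm E}^\pm_{i,i+1}(u-c(i+1))\qquad(1\le i\le n-1),$$ $$k^\pm_{-\ell+1}(u)=\frac1{k^\pm_\ell(u-c(\ell+1))}\prod_{s=\ell+1}^n\frac{k^\pm_s(u-cs)}{k^\pm_s(u-c(s+1))}\qquad(1\le\ell\le n).$$ * For $\mathcal DY(\mathfrak o_{2n})$: $${\rm F}^\pm_{-i+1,-i}(u)=-{\rm F}^\pm_{i+1,i}(u-c(i-1)),\quad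 {\rm E}^\pm_{-i,-i+1}(u)=-{\rm E}^\pm_{i,i+1}(u-c(i-1))\qquad(1\le i\le n-1),$$ $$k^\pm_{-\ell+1}(u)=\frac1{k^\pm_\ell(u-c(\ell-1))}\prod_{s=\ell+1}^n\frac{k^\pm_s(u-c(s-2))}{k^\pm_s(u-c(s-1))}\qquad(1\le\ell\le n).$$ (The factors are written in the order of increasing $s$.) Moreover, the following are independent generating sets: * for $\mathcal DY(\mathfrak o_{2n+1})$: ${\rm F}^\pm_{i+1,i}(u)$, ${\rm E}^\pm_{i,i+1}(u)$ ($0\le i\le n-1$), $k^\pm_j(u)$ ($1\le j\le n$); and also ${\rm F}^\pm_{i+1,i}(u)$, ${\rm E}^\pm_{i,i+1}(u)$ ($-n\le i\le-1$), $k^\pm_j(u)$ ($-n\le j\le-1$); * for $\mathcal DY(\mathfrak{sp}_{2n})$: ${\rm F}^\pm_{i+1,i}(u)$, ${\rm E}^\pm_{i,i+1}(u)$ ($0\le i\le n-1$), $k^\pm_j(u)$ ($1\le j\le n$); * for $\mathcal DY(\mathfrak o_{2n})$: ${\rm F}^\pm_{2,0}(u)$, ${\rm E}^\pm_{0,2}(u)$,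 ${\rm F}^\pm_{i+1,i}(u)$, ${\rm E}^\pm_{i,i+1}(u)$ ($1\le i\le n-1$), $k^\pm_j(u)$ ($1\le j\le n$). Here the modes of a set of series are the coefficients, divided by $c$, of the series ${\rm F}^\pm,{\rm E}^\pm$ and $k^\pm-1$ in it (powers $u^{-p-1}$ for $+$ and $u^{p}$ for $-$, $p\ge0$). "Independent generating set" means: the modes generate $\mathcal DY(\mathfrak g)$ as a $c$-adically closed $\mathbb C[[c]]$-subalgebra; the modes of the series with sign $+$ generate in the same sense the Borel subalgebra generated by the modes $t_{ij}[\ell]$, $\ell\ge0$, of $T^+(u)$; and, for every total order on the modes, the ordered monomials in the modes are linearly independent over $\mathbb C[[c]]$. -/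

import Mathlib

noncomputable section

namespace YangianDouble

open PowerSeries

/-! ### Formal series over `ℂ⟦c⟧`-algebras

The deformation parameter `c` is the variable of `ℂ⟦X⟧`. Everything below is over `ℂ⟦X⟧`, with the
`c`-adic topology. -/

/-- The deformation parameter `c`, as an element of the base ring. -/
def c : ℂ⟦X⟧ := PowerSeries.X

/-- The two types of series: `plus` for series in `u⁻¹`, `minus` for series in `u`. -/
inductive Sgn | plus | minus

section General

variable {R : Type*} [Ring R] [Algebra ℂ⟦X⟧ R]

/-- `s` is the sum of the series `∑ m, g m` in the `c`-adic topology, where `g m` is divisible by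
`c ^ m`. -/
def IsCSum (g : ℕ → R) (s : R) : Prop :=
  ∀ N : ℕ, ∃ y : R, s - ∑ m ∈ Finset.range N, g m = c ^ N • y

/-- The `c`-adic sum of `∑ m, g m` (see `csum_spec_free`, `csum_spec` below for its existence and
uniqueness in the algebras in question). -/
def csum (g : ℕ → R) : R := Classical.epsilon (IsCSum g)

/-- The element `x / c` (unique in a `c`-torsion free algebra, if it exists). -/
def cdiv (x : R) : R := Classical.epsilon fun y => c • y = x

/-- Spectral shift `f(u) ↦ f(u - a c)`. A power series with coefficients `f_p` stands for
`f(u) = ∑ f_p u⁻ᵖ` if the sign is `plus`, and for `f(u) = ∑ f_p uᵖ` if the sign is `minus`.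
In the first case `(u - a c)⁻ᵖ = ∑ m, (p + m - 1).choose m * (a c) ^ m * u ^ (-p - m)`, in the second
one `(u - a c)ᵖ = ∑ m, p.choose m * (-a c) ^ m * u ^ (p - m)`. -/
def shift : Sgn → ℂ → R⟦X⟧ → R⟦X⟧
  | .plus, a, f => PowerSeries.mk fun q => ∑ p ∈ Finset.range (q + 1),
      (((q - 1).choose (q - p) : ℂ⟦X⟧) * (PowerSeries.C a * c) ^ (q - p)) • coeff p f
  | .minus, a, f => PowerSeries.mk fun q => csum fun m =>
      (((q + m).choose m : ℂ⟦X⟧) * (-(PowerSeries.C a * c)) ^ m) • coeff (q + m) f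

/-- The coefficient of `uᵉ`, `e ∈ ℤ`, of the series in `u⁻¹` or in `u` given by `f`. -/
def coeffZ : Sgn → R⟦X⟧ → ℤ → R
  | .plus, f, e => if e ≤ 0 then coeff (-e).toNat f else 0
  | .minus, f, e => if 0 ≤ e then coeff e.toNat f else 0

end General

/-! ### The classical series: indices, signs, involution, `κ` -/

/-- The series `B`, `C`, `D`: the algebras `𝔬_{2n+1}`, `𝔰𝔭_{2n}`, `𝔬_{2n}`. -/
inductive Series | B | C | D

/-- The least index: `-n` for `𝔬_{2n+1}` and `-n+1` for `𝔰𝔭_{2n}`, `𝔬_{2n}`. -/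
def lo (g : Series) (n : ℕ) : ℤ :=
  match g with
  | .B => -n
  | .C => -n + 1
  | .D => -n + 1

/-- The index set `{lo, …, n}`. -/
abbrev Ix (g : Series) (n : ℕ) : Type := ↥(Finset.Icc (lo g n) (n : ℤ))

/-- The involution `i ↦ i'`: `i' = -i` for `𝔬_{2n+1}` and `i' = -i+1` for `𝔰𝔭_{2n}`, `𝔬_{2n}`. -/
def opp {g : Series} {n : ℕ} (i : Ix g n) : Ix g n :=
  ⟨match g with
    | .B => -i.1
    | .C => -i.1 + 1
    | .D => -i.1 + 1, by
    have h := Finset.mem_Icc.1 i.2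
    rw [Finset.mem_Icc]
    cases g <;> simp only [lo] at h ⊢ <;> omega⟩

/-- The signs: `ε_i = 1` in the orthogonal case, `ε_i = -sgn(i - 1/2)` in the symplectic case. -/
def eps {g : Series} {n : ℕ} (i : Ix g n) : ℤ :=
  match g with
  | .B => 1
  | .C => if 1 ≤ i.1 then -1 else 1
  | .D => 1

/-- `κ = N/2 - 1` for `𝔬_N`, and `κ = n + 1` for `𝔰𝔭_{2n}`. -/
def kappa (g : Series) (n : ℕ) : ℂ :=
  match g with
  | .B => (2 * n + 1) / 2 - 1
  | .C => n + 1
  | .D => (2 * n) / 2 - 1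

section Relations

variable {R : Type*} [Ring R] [Algebra ℂ⟦X⟧ R] {g : Series} {n : ℕ}

/-- The `T`-operators `T^±(u)` with modes `t`:
`T⁺_{ij}(u) = δ_{ij} + c ∑_{ℓ ≥ 0} t_{ij}[ℓ] u^{-ℓ-1}` and
`T⁻_{ij}(u) = δ_{ij} + c ∑_{ℓ < 0} t_{ij}[ℓ] u^{-ℓ-1}`. -/
def tOp (t : Ix g n → Ix g n → ℤ → R) : Sgn → Matrix (Ix g n) (Ix g n) R⟦X⟧
  | .plus => fun i j => PowerSeries.mk fun p =>
      if p = 0 then (if i = j then 1 else 0) else c • t i j ((p : ℤ) - 1)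
  | .minus => fun i j => PowerSeries.mk fun p =>
      (if p = 0 ∧ i = j then 1 else 0) + c • t i j (-(p : ℤ) - 1)

/-- Transposition `(Mᵗ)_{ij} = ε_i ε_j M_{j'i'}`. -/
def transp {S : Type*} [Ring S] (M : Matrix (Ix g n) (Ix g n) S) : Matrix (Ix g n) (Ix g n) S :=
  fun i j => (eps i * eps j) • M (opp j) (opp i)

variable (R g n) in
/-- Endomorphisms of `ℂᴺ ⊗ ℂᴺ` with entries in `R`. -/
abbrev Mat2 : Type _ := Matrix (Ix g n × Ix g n) (Ix g n × Ix g n) R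

/-- `𝐏 = ∑ e_{ij} ⊗ e_{ji}`. -/
def opP : Mat2 R g n := fun x y => if x.1 = y.2 ∧ x.2 = y.1 then 1 else 0

/-- `𝐐 = ∑ ε_i ε_j e_{ij} ⊗ e_{i'j'}`. -/
def opQ : Mat2 R g n := fun x y =>
  if x.2 = opp x.1 ∧ y.2 = opp y.1 then ((eps x.1 * eps y.1 : ℤ) : R) else 0

/-- The coefficient of `uᵃ vᵇ` in `(T^μ(u) ⊗ 𝐈)(𝐈 ⊗ T^ν(v))`. -/
def prod12 (t : Ix g n → Ix g n → ℤ → R) (μ ν : Sgn) (a b : ℤ) : Mat2 R g n := fun x y =>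
  coeffZ μ (tOp t μ x.1 y.1) a * coeffZ ν (tOp t ν x.2 y.2) b

/-- The coefficient of `uᵃ vᵇ` in `(𝐈 ⊗ T^ν(v))(T^μ(u) ⊗ 𝐈)`. -/
def prod21 (t : Ix g n → Ix g n → ℤ → R) (μ ν : Sgn) (a b : ℤ) : Mat2 R g n := fun x y =>
  coeffZ ν (tOp t ν x.2 y.2) b * coeffZ μ (tOp t μ x.1 y.1) a

/-- Multiplication of a formal distribution `∑ f_{a,b} uᵃ vᵇ` by `u - v + x`. -/
def mulLin (x : ℂ⟦X⟧) (f : ℤ → ℤ → Mat2 R g n) (a b : ℤ) : Mat2 R g n :=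
  f (a - 1) b - f a (b - 1) + x • f a b

/-- The coefficient of `uᵃ vᵇ` in
`R(u,v) T₁^μ(u) T₂^ν(v) - T₂^ν(v) T₁^μ(u) R(u,v)`, where
`R(u,v) = 1 + c 𝐏 / (u - v) - c 𝐐 / (u - v + c κ)`, after multiplication by the common denominator
`(u - v)(u - v + c κ)`. -/
def rttDefect (t : Ix g n → Ix g n → ℤ → R) (μ ν : Sgn) (a b : ℤ) : Mat2 R g n :=
  let cκ : ℂ⟦X⟧ := PowerSeries.C (kappa g n) * c
  (mulLin 0 (mulLin cκ (prod12 t μ ν)) a b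
      + c • mulLin cκ (fun a b => opP * prod12 t μ ν a b) a b
      - c • mulLin 0 (fun a b => opQ * prod12 t μ ν a b) a b)
    - (mulLin 0 (mulLin cκ (prod21 t μ ν)) a b
      + c • mulLin cκ (fun a b => prod21 t μ ν a b * opP) a b
      - c • mulLin 0 (fun a b => prod21 t μ ν a b * opQ) a b)

/-- `T^μ(u - c κ)`. -/
def tOpShift (t : Ix g n → Ix g n → ℤ → R) (μ : Sgn) : Matrix (Ix g n) (Ix g n) R⟦X⟧ :=
  (tOp t μ).map (shift μ (kappa g n))

/-- The elements of `R` that have to vanish for the modes `t` to satisfy the defining relations of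
the Yangian double: the coefficients of the `RTT` relations and those of
`T^μ(u - cκ)ᵗ T^μ(u) = T^μ(u) T^μ(u - cκ)ᵗ = 1`. -/
def relators (t : Ix g n → Ix g n → ℤ → R) : Set R :=
  {r | ∃ μ ν a b x y, r = rttDefect t μ ν a b x y} ∪
  {r | ∃ μ i j p, r = coeff p ((transp (tOpShift t μ) * tOp t μ - 1) i j)} ∪
  {r | ∃ μ i j p, r = coeff p ((tOp t μ * transp (tOpShift t μ) - 1) i j)}

end Relations

/-! ### The Yangian double -/

/-- The `c`-adic completion of the free `ℂ⟦c⟧`-algebra on the modes `t_{ij}[ℓ]`: power series in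
the central variable `c` over the free `ℂ`-algebra. -/
def FreeMode (g : Series) (n : ℕ) : Type :=
  PowerSeries (FreeAlgebra ℂ (Ix g n × Ix g n × ℤ))

instance (g : Series) (n : ℕ) : Ring (FreeMode g n) :=
  inferInstanceAs (Ring (PowerSeries (FreeAlgebra ℂ (Ix g n × Ix g n × ℤ))))

theorem map_algebraMap_comm {A : Type*} [Ring A] [Algebra ℂ A] (f : ℂ⟦X⟧) (x : A⟦X⟧) :
    PowerSeries.map (algebraMap ℂ A) f * x = x * PowerSeries.map (algebraMap ℂ A) f := by
  ext m
  rw [PowerSeries.coeff_mul, PowerSeries.coeff_mul, ← Finset.Nat.sum_antidiagonal_swap]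
  refine Finset.sum_congr rfl fun p _ => ?_
  simp [Algebra.commutes]

instance (g : Series) (n : ℕ) : Algebra ℂ⟦X⟧ (FreeMode g n) :=
  RingHom.toAlgebra' (PowerSeries.map (algebraMap ℂ (FreeAlgebra ℂ (Ix g n × Ix g n × ℤ))))
    map_algebraMap_comm

/-- The free mode `t_{ij}[ℓ]`. -/
def freeMode {g : Series} {n : ℕ} (i j : Ix g n) (l : ℤ) : FreeMode g n :=
  PowerSeries.C (FreeAlgebra.ι ℂ (i, j, l))

/-- The two-sided ideals that contain the relators, are `c`-saturated (the quotient has no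
`c`-torsion) and closed in the `c`-adic topology. -/
def admissibleIdeals (g : Series) (n : ℕ) : Set (TwoSidedIdeal (FreeMode g n)) :=
  {K | relators (freeMode (g := g) (n := n)) ⊆ (K : Set (FreeMode g n)) ∧
    (∀ x : FreeMode g n, c • x ∈ K → x ∈ K) ∧
    (∀ x : FreeMode g n, (∀ N : ℕ, ∃ y ∈ K, ∃ z, x - y = c ^ N • z) → x ∈ K)}

/-- The closed saturated ideal generated by the defining relations. -/
def relIdeal (g : Series) (n : ℕ) : TwoSidedIdeal (FreeMode g n) := sInf (admissibleIdeals g n)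

/-- The Yangian double `𝒟Y(𝔤)`: the `c`-adically complete, `c`-torsion free algebra generated by
the modes `t_{ij}[ℓ]`, `ℓ ∈ ℤ`, with the `RTT` relations and `z^±(u) = 1`. -/
def DY (g : Series) (n : ℕ) : Type := (relIdeal g n).ringCon.Quotient

instance (g : Series) (n : ℕ) : Ring (DY g n) :=
  inferInstanceAs (Ring (relIdeal g n).ringCon.Quotient)

instance (g : Series) (n : ℕ) : Algebra ℂ⟦X⟧ (DY g n) :=
  inferInstanceAs (Algebra ℂ⟦X⟧ (relIdeal g n).ringCon.Quotient)

/-- The quotient map. -/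
def proj (g : Series) (n : ℕ) : FreeMode g n →ₐ[ℂ⟦X⟧] DY g n :=
  RingCon.mkₐ ℂ⟦X⟧ (relIdeal g n).ringCon

/-- The modes `t_{ij}[ℓ]` of the Yangian double. -/
def mode {g : Series} {n : ℕ} (i j : Ix g n) (l : ℤ) : DY g n := proj g n (freeMode i j l)

/-- The `T`-operators `T^±(u)` of the Yangian double. -/
def T (g : Series) (n : ℕ) (μ : Sgn) : Matrix (Ix g n) (Ix g n) (DY g n)⟦X⟧ := tOp mode μ

/-! ### The `c`-adic topology of the Yangian double -/

theorem c_smul_free {g : Series} {n : ℕ} (N : ℕ) (y : FreeMode g n) :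
    c ^ N • y = (PowerSeries.X ^ N * y : PowerSeries (FreeAlgebra ℂ (Ix g n × Ix g n × ℤ))) := by
  rw [Algebra.smul_def, map_pow]
  congr 2
  exact PowerSeries.map_X _

theorem csum_spec_free {g : Series} {n : ℕ} (f : ℕ → FreeMode g n)
    (hf : ∀ m, ∃ y, f m = c ^ m • y) : IsCSum f (csum f) := by
  refine Classical.epsilon_spec (p := IsCSum f)
    ⟨PowerSeries.mk fun r => ∑ m ∈ Finset.range (r + 1), PowerSeries.coeff r (f m), fun N => ?_⟩
  have hz : ∀ m r, r < m → PowerSeries.coeff r (f m) = 0 := by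
    intro m r hr
    obtain ⟨y, hy⟩ := hf m
    refine (congrArg (PowerSeries.coeff r) (hy.trans (c_smul_free m y))).trans ?_
    exact (PowerSeries.coeff_X_pow_mul' _ _ _).trans (if_neg (by omega))
  have hd : ∀ s : PowerSeries (FreeAlgebra ℂ (Ix g n × Ix g n × ℤ)),
      (∀ r < N, PowerSeries.coeff r s = 0) → ∃ y : FreeMode g n, s = c ^ N • y := by
    intro s hs
    refine ⟨PowerSeries.mk fun r => PowerSeries.coeff (r + N) s, ?_⟩
    refine Eq.trans (PowerSeries.ext fun r => ?_) (c_smul_free N _).symm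
    refine Eq.trans ?_ (PowerSeries.coeff_X_pow_mul' _ _ _).symm
    split_ifs with h
    · rw [PowerSeries.coeff_mk, Nat.sub_add_cancel h]
    · exact hs r (by omega)
  refine hd _ fun r hr => ?_
  have h1 : ∀ s : Finset ℕ, PowerSeries.coeff r
      (∑ m ∈ s, f m : PowerSeries (FreeAlgebra ℂ (Ix g n × Ix g n × ℤ)))
        = ∑ m ∈ s, PowerSeries.coeff r (f m) := fun s => map_sum _ _ _
  refine (map_sub (PowerSeries.coeff r) _ _).trans ?_
  rw [PowerSeries.coeff_mk]
  refine sub_eq_zero.2 (Eq.trans ?_ (h1 _).symm)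
  refine Finset.sum_subset (Finset.range_subset_range.2 (by omega)) fun m _ hm => hz m r ?_
  simpa using hm

theorem relIdeal_admissible (g : Series) (n : ℕ) : relIdeal g n ∈ admissibleIdeals g n := by
  refine ⟨fun r hr => ?_, fun x hx => ?_, fun x hx => ?_⟩
  · exact (TwoSidedIdeal.mem_sInf _).2 fun K hK => hK.1 hr
  · exact (TwoSidedIdeal.mem_sInf _).2 fun K hK => hK.2.1 x ((TwoSidedIdeal.mem_sInf _).1 hx K hK)
  · refine (TwoSidedIdeal.mem_sInf _).2 fun K hK => hK.2.2 x fun N => ?_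
    obtain ⟨y, hy, z, hz⟩ := hx N
    exact ⟨y, (TwoSidedIdeal.mem_sInf _).1 hy K hK, z, hz⟩

theorem proj_surjective (g : Series) (n : ℕ) : Function.Surjective (proj g n) :=
  RingCon.mkₐ_surjective _

theorem proj_eq_zero {g : Series} {n : ℕ} (x : FreeMode g n) :
    proj g n x = 0 ↔ x ∈ relIdeal g n := by
  rw [TwoSidedIdeal.mem_iff]
  exact RingCon.eq (relIdeal g n).ringCon

/-- The Yangian double has no `c`-torsion. -/
theorem c_smul_eq_zero {g : Series} {n : ℕ} (x : DY g n) (hx : c • x = 0) : x = 0 := by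
  obtain ⟨x, rfl⟩ := proj_surjective g n x
  rw [← map_smul, proj_eq_zero] at hx
  exact (proj_eq_zero x).2 ((relIdeal_admissible g n).2.1 x hx)

/-- The Yangian double is `c`-adically separated. -/
theorem separated {g : Series} {n : ℕ} (x : DY g n) (hx : ∀ N : ℕ, ∃ y, x = c ^ N • y) : x = 0 := by
  obtain ⟨x, rfl⟩ := proj_surjective g n x
  refine (proj_eq_zero x).2 ((relIdeal_admissible g n).2.2 x fun N => ?_)
  obtain ⟨y, hy⟩ := hx N
  obtain ⟨y, rfl⟩ := proj_surjective g n y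
  refine ⟨x - c ^ N • y, (proj_eq_zero _).1 ?_, y, by abel⟩
  rw [map_sub, map_smul, hy, sub_self]

/-- The Yangian double is `c`-adically complete. -/
theorem csum_spec {g : Series} {n : ℕ} (f : ℕ → DY g n)
    (hf : ∀ m, ∃ y, f m = c ^ m • y) : IsCSum f (csum f) := by
  choose y hy using hf
  choose z hz using fun m => proj_surjective g n (y m)
  refine Classical.epsilon_spec (p := IsCSum f) ⟨proj g n (csum fun m => c ^ m • z m), fun N => ?_⟩
  obtain ⟨w, hw⟩ := csum_spec_free (fun m => c ^ m • z m) (fun m => ⟨z m, rfl⟩) N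
  refine ⟨proj g n w, ?_⟩
  rw [← map_smul, ← hw, map_sub, map_sum]
  simp only [map_smul, hz, hy]

/-- The `c`-adically closed `ℂ⟦c⟧`-subalgebra generated by a set. -/
def closedAdjoin {g : Series} {n : ℕ} (S : Set (DY g n)) : Set (DY g n) :=
  {x | ∀ N : ℕ, ∃ y ∈ Algebra.adjoin ℂ⟦X⟧ S, ∃ z, x - y = c ^ N • z}

/-- The standard Borel subalgebra generated by the modes of `T⁺(u)`. -/
def borelPlus (g : Series) (n : ℕ) : Set (DY g n) :=
  closedAdjoin {x | ∃ i j : Ix g n, ∃ l : ℤ, 0 ≤ l ∧ x = mode i j l}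

/-! ### Gauss coordinates -/

/-- Gauss coordinates `F_{j,i}(u)`, `E_{i,j}(u)`, `k_ℓ(u)`, written `F j i`, `E i j`, `k ℓ`. -/
@[ext] structure Gauss (g : Series) (n : ℕ) where
  F : ℤ → ℤ → (DY g n)⟦X⟧
  E : ℤ → ℤ → (DY g n)⟦X⟧
  k : ℤ → (DY g n)⟦X⟧

/-- `G` is the Gauss decomposition
`T_{i,j}(u) = ∑_{ℓ = max(i,j)}^{n} F_{ℓ,i}(u) k_ℓ(u) E_{j,ℓ}(u)` of `M`, where `F_{i,i} = E_{i,i} = 1`,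
`F_{j,i} = E_{i,j} = 0` for `j < i`, and `k_ℓ` is invertible. Outside the index set all coordinates
are zero. -/
structure IsGauss {g : Series} {n : ℕ} (M : Matrix (Ix g n) (Ix g n) (DY g n)⟦X⟧)
    (G : Gauss g n) : Prop where
  F_diag : ∀ i ∈ Finset.Icc (lo g n) (n : ℤ), G.F i i = 1
  E_diag : ∀ i ∈ Finset.Icc (lo g n) (n : ℤ), G.E i i = 1
  F_zero : ∀ i j : ℤ, ¬(lo g n ≤ i ∧ i ≤ j ∧ j ≤ n) → G.F j i = 0
  E_zero : ∀ i j : ℤ, ¬(lo g n ≤ i ∧ i ≤ j ∧ j ≤ n) → G.E i j = 0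
  k_unit : ∀ l ∈ Finset.Icc (lo g n) (n : ℤ), IsUnit (G.k l)
  k_zero : ∀ l ∉ Finset.Icc (lo g n) (n : ℤ), G.k l = 0
  decomp : ∀ i j : Ix g n,
    M i j = ∑ l ∈ Finset.Icc (max i.1 j.1) (n : ℤ), G.F l i.1 * G.k l * G.E j.1 l

/-! ### Independent generating sets -/

/-- The modes `x[p]` of a series `x` with `x(u) = c ∑_{p ≥ 0} x[p] u^{-p-1}` (sign `plus`) or
`x(u) = c ∑_{p ≥ 0} x[p] uᵖ` (sign `minus`). -/
def seriesMode {g : Series} {n : ℕ} : Sgn → (DY g n)⟦X⟧ → ℕ → DY g n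
  | .plus, f, p => cdiv (coeff (p + 1) f)
  | .minus, f, p => cdiv (coeff p f)

/-- The modes of the series `x_a^±(u)`, `a ∈ J`, are an independent generating set of the Yangian
double: they generate it topologically, the modes of the `x_a^+(u)` generate the Borel subalgebra
of `T⁺(u)` topologically, and for every total order on the modes the ordered monomials are linearly
independent over `ℂ⟦c⟧`. -/
structure IsIndependentGeneratingSet {g : Series} {n : ℕ} {J : Type}
    (x : Sgn → J → (DY g n)⟦X⟧) : Prop where
  generates : closedAdjoin {y | ∃ μ a p, y = seriesMode μ (x μ a) p} = Set.univ
  generates_borel : closedAdjoin {y | ∃ a p, y = seriesMode .plus (x .plus a) p} = borelPlus g n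
  independent : ∀ r : Sgn × J × ℕ → Sgn × J × ℕ → Prop, IsLinearOrder (Sgn × J × ℕ) r →
    LinearIndependent ℂ⟦X⟧ fun L : {L : List (Sgn × J × ℕ) // L.Pairwise r} =>
      (L.1.map fun s => seriesMode s.1 (x s.1 s.2.1) s.2.2).prod

/-- The series `F_{i+1,i}`, `E_{i,i+1}`, `0 ≤ i ≤ n-1`, and `k_j - 1`, `1 ≤ j ≤ n`. -/
def simpleSeries {g : Series} {n : ℕ} (G : Sgn → Gauss g n) (μ : Sgn) :
    Fin n ⊕ Fin n ⊕ Fin n → (DY g n)⟦X⟧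
  | .inl i => (G μ).F ((i : ℤ) + 1) i
  | .inr (.inl i) => (G μ).E i ((i : ℤ) + 1)
  | .inr (.inr j) => (G μ).k ((j : ℤ) + 1) - 1

/-- The series `F_{i+1,i}`, `E_{i,i+1}`, `-n ≤ i ≤ -1`, and `k_j - 1`, `-n ≤ j ≤ -1`. The elements
of `Fin n` stand for `-i - 1` and `-j - 1`. -/
def simpleSeriesNeg {g : Series} {n : ℕ} (G : Sgn → Gauss g n) (μ : Sgn) :
    Fin n ⊕ Fin n ⊕ Fin n → (DY g n)⟦X⟧
  | .inl m => (G μ).F (-(m : ℤ)) (-(m : ℤ) - 1)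
  | .inr (.inl m) => (G μ).E (-(m : ℤ) - 1) (-(m : ℤ))
  | .inr (.inr m) => (G μ).k (-(m : ℤ) - 1) - 1

/-- The series `F_{2,0}`, `E_{0,2}`, `F_{i+1,i}`, `E_{i,i+1}`, `1 ≤ i ≤ n-1`, and `k_j - 1`,
`1 ≤ j ≤ n`. -/
def simpleSeriesD {g : Series} {n : ℕ} (G : Sgn → Gauss g n) (μ : Sgn) :
    Fin n ⊕ Fin n ⊕ Fin n → (DY g n)⟦X⟧
  | .inl i => if (i : ℕ) = 0 then (G μ).F 2 0 else (G μ).F ((i : ℤ) + 1) i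
  | .inr (.inl i) => if (i : ℕ) = 0 then (G μ).E 0 2 else (G μ).E i ((i : ℤ) + 1)
  | .inr (.inr j) => (G μ).k ((j : ℤ) + 1) - 1

/-- `1 / k_ℓ(u - c(ℓ + σ)) * ∏_{s=ℓ+1}^{n} k_s(u - c(s + σ - 1)) / k_s(u - c(s + σ))`, the factors
being written in the order of increasing `s`. -/
def cartanRHS {g : Series} {n : ℕ} (G : Gauss g n) (μ : Sgn) (σ : ℂ) (l : ℕ) : (DY g n)⟦X⟧ :=
  Ring.inverse (shift μ (l + σ) (G.k l)) *
    ((List.range' (l + 1) (n - l)).map fun s : ℕ =>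
      shift μ (s + σ - 1) (G.k s) * Ring.inverse (shift μ (s + σ) (G.k s))).prod

end YangianDouble

end

/-! The spectral shift is exp(-ac d/du). In a `c`-adically complete algebra it is a ring
homomorphism (`shift_eq_sigma`), and an identity between T(u) and T(v) can be expanded at v = u - h
with a formal central variable h, divided by regular elements, and evaluated at h = ac.

Formulas for the Gauss coordinates. The decomposition exists because the pivots are 1 modulo `c`,
hence invertible. When neither the two row indices nor the two column indices are opposite, Q drops
out of the RTT relation and the entries obey the relations of the Yangian of 𝔤𝔩_N (`glSer_of_rtt`).
Stripping the top index off the decomposition is a Schur complement, and Schur complements satisfy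
the same relations (`GLRel.schur_schur`). Unitarity says that the inverse of T is its shifted
transpose; the inverse of a Schur complement is a block of the old inverse, so the coordinates with
the lowest indices are read off the transpose in terms of those with the highest ones (`Stage.k_eq`,
`Stage.fe_eq`). Eliminating the top index m from T and the opposite index from the inverse
reproduces the situation in rank m - 1, with κ lowered by one and an additional factor k_m(u-(κ-1)c)
k_m(u-κc)⁻¹ that commutes with the reduced entries (`Stage.step`). The 𝔤𝔩-relation at u - v = c
makes the two eliminations match. Iteration gives the products over s.

Generation. Modulo `c` the modes of F, E and k - 1 are modes t_{ij}[ℓ] (`GaussData.Near`), unitarity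
becomes t_{ij} + ε_i ε_j t_{j'i'} = 0 (`Allowed.symm_mode`), and bracketing with t_{ij}[0] is the
bracket of the loop algebra of 𝔤 (`mode_bracket`). The root vectors and Cartan elements of the list
therefore generate everything modulo `c`, and successive approximation (`exists_approx`) gives
topological generation, for the double and for the Borel subalgebra.

Independence. There is no `c`-torsion, so it is enough to show that the coefficients of any relation
vanish modulo `c`. The matrices f(u) R(u-a) solve the defining relations for a suitable scalar
series f (`exists_vectorSol`), and solutions can be multiplied. On a product of d such solutions,
apply in every factor a functional that kills the identity matrix: modulo `c` a word of at most d
modes takes the value ∑ ∏ over the bijections from factors to letters (`exists_model`). Combining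
evaluation points at roots of unity isolates single modes (`exists_delta`), so the functional
attached to a longest word of a relation vanishes on every other ordered word that could interfere
(`linearIndependent_monomials`). -/

noncomputable section

namespace YangianDouble

open PowerSeries Finset.HasAntidiagonal

/-! ### `c`-adically complete algebras -/

section CAdic

variable {S : Type*} [Ring S] [Algebra ℂ⟦X⟧ S]

variable (S) in
/-- The multiples of `c ^ N`. -/
def cPow (N : ℕ) : Submodule ℂ⟦X⟧ S := LinearMap.range (c ^ N • (LinearMap.id : S →ₗ[ℂ⟦X⟧] S))

theorem mem_cPow {N : ℕ} {x : S} : x ∈ cPow S N ↔ ∃ z, x = c ^ N • z := by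
  simp only [cPow, LinearMap.mem_range, LinearMap.smul_apply, LinearMap.id_apply, eq_comm]

theorem smul_mem_cPow (N : ℕ) (x : S) : c ^ N • x ∈ cPow S N := mem_cPow.2 ⟨x, rfl⟩

theorem mul_mem_cPow_left {N : ℕ} (y : S) {x : S} (hx : x ∈ cPow S N) : y * x ∈ cPow S N := by
  obtain ⟨z, rfl⟩ := mem_cPow.1 hx
  rw [mul_smul_comm]
  exact smul_mem_cPow _ _

theorem mul_mem_cPow_right {N : ℕ} (y : S) {x : S} (hx : x ∈ cPow S N) : x * y ∈ cPow S N := by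
  obtain ⟨z, rfl⟩ := mem_cPow.1 hx
  rw [smul_mul_assoc]
  exact smul_mem_cPow _ _

theorem cPow_anti {M N : ℕ} (h : M ≤ N) : cPow S N ≤ cPow S M := by
  intro x hx
  obtain ⟨z, rfl⟩ := mem_cPow.1 hx
  obtain ⟨k, rfl⟩ := Nat.exists_eq_add_of_le h
  rw [pow_add, mul_smul]
  exact smul_mem_cPow _ _

theorem isCSum_iff {g : ℕ → S} {s : S} :
    IsCSum g s ↔ ∀ N, s - ∑ m ∈ Finset.range N, g m ∈ cPow S N := by
  simp only [IsCSum, mem_cPow]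

variable (S) in
/-- An algebra without `c`-torsion that is separated and complete in the `c`-adic topology. -/
class CComplete : Prop where
  torsion_free : ∀ x : S, c • x = 0 → x = 0
  separated : ∀ x : S, (∀ N : ℕ, x ∈ cPow S N) → x = 0
  complete : ∀ g : ℕ → S, ∃ s, IsCSum (fun m => c ^ m • g m) s

variable [CComplete S]

theorem c_smul_inj {x y : S} (h : c • x = c • y) : x = y := by
  rw [← sub_eq_zero] at h ⊢
  exact CComplete.torsion_free _ (by rw [smul_sub, h])

theorem cdiv_smul (x : S) : cdiv (c • x) = x :=
  c_smul_inj (Classical.epsilon_spec (p := fun y => c • y = c • x) ⟨x, rfl⟩)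

theorem IsCSum.unique {g : ℕ → S} {s t : S} (hs : IsCSum g s) (ht : IsCSum g t) : s = t := by
  rw [isCSum_iff] at hs ht
  refine sub_eq_zero.1 (CComplete.separated _ fun N => ?_)
  simpa using Submodule.sub_mem _ (hs N) (ht N)

theorem isCSum_csum {g : ℕ → S} (hg : ∀ m, g m ∈ cPow S m) : IsCSum g (csum g) := by
  choose y hy using fun m => mem_cPow.1 (hg m)
  obtain rfl : g = fun m => c ^ m • y m := funext hy
  exact Classical.epsilon_spec (CComplete.complete y)

theorem IsCSum.csum_eq {g : ℕ → S} {s : S} (h : IsCSum g s) : csum g = s :=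
  (Classical.epsilon_spec (p := IsCSum g) ⟨s, h⟩).unique h

omit [CComplete S] in
theorem smul_pow_mem_cPow (a : ℂ) (m : ℕ) (x : S) :
    (PowerSeries.C a * c) ^ m • x ∈ cPow S m := by
  rw [mul_pow, mul_comm, mul_smul]
  exact smul_mem_cPow _ _

/-- Evaluation of a formal series in an auxiliary variable `h` at `h = a c`. -/
def evc (a : ℂ) (G : S⟦X⟧) : S := csum fun m => (PowerSeries.C a * c) ^ m • coeff m G

theorem isCSum_evc (a : ℂ) (G : S⟦X⟧) :
    IsCSum (fun m => (PowerSeries.C a * c) ^ m • coeff m G) (evc a G) :=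
  isCSum_csum fun m => smul_pow_mem_cPow a m _

omit [CComplete S] in
theorem IsCSum.mem_of_succ {g : ℕ → S} {s : S}
    (h : ∀ N, s - ∑ m ∈ Finset.range (N + 1), g m ∈ cPow S (N + 1)) :
    IsCSum g s := by
  refine isCSum_iff.2 fun N => ?_
  cases N with
  | zero => exact mem_cPow.2 ⟨s, by simp⟩
  | succ N => exact h N

theorem evc_eq_add (a : ℂ) (G : S⟦X⟧) :
    evc a G = coeff 0 G + (PowerSeries.C a * c) • evc a (PowerSeries.mk fun m => coeff (m + 1) G) := by
  refine IsCSum.csum_eq (IsCSum.mem_of_succ fun N => ?_)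
  have h := isCSum_iff.1 (isCSum_evc a (PowerSeries.mk fun m => coeff (m + 1) G)) N
  obtain ⟨z, hz⟩ := mem_cPow.1 h
  rw [Finset.sum_range_succ']
  refine mem_cPow.2 ⟨PowerSeries.C a • z, ?_⟩
  have hs : ∑ m ∈ Finset.range N, (PowerSeries.C a * c) ^ (m + 1) • coeff (m + 1) G =
      (PowerSeries.C a * c) • ∑ m ∈ Finset.range N, (PowerSeries.C a * c) ^ m •
        coeff m (PowerSeries.mk fun m => coeff (m + 1) G) := by
    rw [Finset.smul_sum]
    refine Finset.sum_congr rfl fun m _ => ?_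
    rw [← mul_smul, ← pow_succ', coeff_mk]
  rw [hs, pow_zero, one_smul]
  have : (c ^ (N + 1) • PowerSeries.C a • z : S) = (PowerSeries.C a * c) • (c ^ N • z) := by
    rw [← mul_smul, ← mul_smul]; congr 1; ring
  rw [this, ← hz, smul_sub]
  abel

/-- Division with remainder by `X - a c`; the quotient has as coefficients the values of the tails
of `G`. With the uniqueness in `evc_unique`, evaluation becomes reduction modulo a central element,
and its multiplicativity needs no rearrangement of convergent sums. -/
theorem evc_div (a : ℂ) (G : S⟦X⟧) :
    G = C (evc a G) + (X - C ((PowerSeries.C a * c) • 1)) *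
      PowerSeries.mk fun m => evc a (PowerSeries.mk fun k => coeff (m + 1 + k) G) := by
  ext m
  have key : ∀ m : ℕ, evc a (PowerSeries.mk fun k => coeff (m + k) G) = coeff m G +
      (PowerSeries.C a * c) • evc a (PowerSeries.mk fun k => coeff (m + 1 + k) G) := by
    intro m
    rw [evc_eq_add]
    simp only [coeff_mk, add_zero, add_assoc, add_comm 1]
  rw [map_add, sub_mul, map_sub, coeff_C_mul, coeff_mk, smul_mul_assoc, one_mul]
  cases m with
  | zero =>
    rw [coeff_zero_X_mul]
    have h := key 0
    simp only [zero_add] at h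
    have hG : (PowerSeries.mk fun k => coeff k G) = G := by ext; simp
    rw [hG] at h
    rw [coeff_zero_C, h]
    simp
  | succ m =>
    rw [coeff_succ_X_mul, coeff_mk, key (m + 1)]
    simp

theorem exists_evc_div (a : ℂ) (G : S⟦X⟧) :
    ∃ H, G = C (evc a G) + (X - C ((PowerSeries.C a * c) • 1)) * H := ⟨_, evc_div a G⟩

/-- Comparing coefficients, each coefficient of `H` is `a c` times the next one, hence divisible by
every power of `c`, hence zero. -/
theorem evc_unique (a : ℂ) {s : S} {H : S⟦X⟧}
    (h : C s + (X - C ((PowerSeries.C a * c) • (1 : S))) * H = 0) : s = 0 := by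
  have h0 : s = (PowerSeries.C a * c) • coeff 0 H := by
    have := congrArg (coeff 0) h
    rw [map_add, sub_mul, map_sub, coeff_C_mul, coeff_zero_X_mul, coeff_zero_C, map_zero,
      smul_mul_assoc, one_mul, zero_sub, ← sub_eq_add_neg, sub_eq_zero] at this
    exact this
  have h1 : ∀ m, coeff m H = (PowerSeries.C a * c) • coeff (m + 1) H := by
    intro m
    have := congrArg (coeff (m + 1)) h
    rw [map_add, sub_mul, map_sub, coeff_C_mul, coeff_succ_X_mul, map_zero,
      smul_mul_assoc, one_mul, coeff_C, if_neg (Nat.succ_ne_zero _), zero_add, sub_eq_zero] at this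
    exact this
  have h2 : ∀ N m, coeff m H ∈ cPow S N := by
    intro N
    induction N with
    | zero => exact fun m => mem_cPow.2 ⟨coeff m H, by simp⟩
    | succ N ih =>
      intro m
      obtain ⟨z, hz⟩ := mem_cPow.1 (ih (m + 1))
      rw [h1, hz, mem_cPow]
      exact ⟨PowerSeries.C a • z, by rw [← mul_smul, ← mul_smul]; congr 1; ring⟩
  rw [h0, CComplete.separated (coeff 0 H) fun N => h2 N 0, smul_zero]

theorem evc_eq {a : ℂ} {G : S⟦X⟧} {s : S} {H : S⟦X⟧}
    (h : G = C s + (X - C ((PowerSeries.C a * c) • (1 : S))) * H) : evc a G = s := by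
  refine sub_eq_zero.1 (evc_unique a (s := evc a G - s)
    (H := (PowerSeries.mk fun m => evc a (PowerSeries.mk fun k => coeff (m + 1 + k) G)) - H) ?_)
  rw [map_sub, mul_sub]
  have h' := evc_div a G
  calc _ = (C (evc a G) + (X - C ((PowerSeries.C a * c) • 1)) *
      PowerSeries.mk fun m => evc a (PowerSeries.mk fun k => coeff (m + 1 + k) G)) -
      (C s + (X - C ((PowerSeries.C a * c) • (1 : S))) * H) := by abel
    _ = 0 := by rw [← h', ← h, sub_self]

variable (S) in
/-- Evaluation at `h = a c` as a ring homomorphism. -/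
def evHom (a : ℂ) : S⟦X⟧ →+* S where
  toFun := evc a
  map_one' := evc_eq (H := 0) (by simp)
  map_zero' := evc_eq (H := 0) (by simp)
  map_add' G G' := by
    obtain ⟨H, hH⟩ := exists_evc_div a G
    obtain ⟨H', hH'⟩ := exists_evc_div a G'
    refine evc_eq (H := H + H') ?_
    rw [map_add, mul_add, add_add_add_comm, ← hH, ← hH']
  map_mul' G G' := by
    obtain ⟨H, hH⟩ := exists_evc_div a G
    obtain ⟨H', hH'⟩ := exists_evc_div a G'
    -- With D = X - ac and s, s' the values: (s + DH)G' = s(s' + DH') + DHG' = ss' + D(sH' + HG').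
    refine evc_eq (H := C (evc a G) * H' + H * G') ?_
    have hc : C (evc a G) * (X - C ((PowerSeries.C a * c) • (1 : S))) =
        (X - C ((PowerSeries.C a * c) • (1 : S))) * C (evc a G) := by
      rw [mul_sub, sub_mul, (commute_X (C (evc a G))).eq]
      rw [← map_mul, ← map_mul, mul_smul_comm, smul_mul_assoc, mul_one, one_mul]
    generalize X - C ((PowerSeries.C a * c) • (1 : S)) = D at *
    rw [map_mul, mul_add, ← mul_assoc D, ← hc, ← add_assoc, mul_assoc (C _) D, ← mul_add, ← hH',
      ← mul_assoc D, ← add_mul, ← hH]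

theorem evHom_apply (a : ℂ) (G : S⟦X⟧) : evHom S a G = evc a G := rfl

theorem evHom_C (a : ℂ) (s : S) : evHom S a (C s) = s := evc_eq (H := 0) (by simp)

theorem evHom_X (a : ℂ) : evHom S a X = (PowerSeries.C a * c) • 1 :=
  evc_eq (H := 1) (by simp)

theorem evHom_smul (a : ℂ) (r : ℂ⟦X⟧) (G : S⟦X⟧) : evHom S a (r • G) = r • evHom S a G := by
  have : r • G = C (r • 1) * G := by ext; simp
  rw [this, map_mul, evHom_C, smul_mul_assoc, one_mul]

end CAdic

/-! ### Taylor expansion and spectral shifts -/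

section Taylor

variable {S : Type*} [Ring S] [Algebra ℂ⟦X⟧ S]

/-- The divided powers `∂ᵐ / m!` of a linear map. -/
def hasse (d : S →ₗ[ℂ⟦X⟧] S) (m : ℕ) : S →ₗ[ℂ⟦X⟧] S :=
  (PowerSeries.C ((m.factorial : ℂ)⁻¹) : ℂ⟦X⟧) • d ^ m

theorem hasse_zero (d : S →ₗ[ℂ⟦X⟧] S) : hasse d 0 = LinearMap.id := by
  simp [hasse, Module.End.one_eq_id]

theorem hasse_succ (d : S →ₗ[ℂ⟦X⟧] S) (m : ℕ) (f : S) :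
    d (hasse d m f) = ((m + 1 : ℕ) : ℂ⟦X⟧) • hasse d (m + 1) f := by
  simp only [hasse, LinearMap.smul_apply, map_smul, ← mul_smul]
  rw [pow_succ', Module.End.mul_apply]
  congr 1
  have : (((m + 1 : ℕ) : ℂ⟦X⟧)) = PowerSeries.C ((m + 1 : ℕ) : ℂ) := by simp
  rw [this, ← map_mul, Nat.factorial_succ, Nat.cast_mul, mul_inv, ← mul_assoc,
    mul_inv_cancel₀ (Nat.cast_ne_zero.2 (Nat.succ_ne_zero m)), one_mul]

theorem natCast_smul_inj {m : ℕ} {x y : S}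
    (h : ((m + 1 : ℕ) : ℂ⟦X⟧) • x = ((m + 1 : ℕ) : ℂ⟦X⟧) • y) : x = y := by
  have h2 : (PowerSeries.C (((m + 1 : ℕ) : ℂ)⁻¹) : ℂ⟦X⟧) * ((m + 1 : ℕ) : ℂ⟦X⟧) = 1 := by
    have : (((m + 1 : ℕ) : ℂ⟦X⟧)) = PowerSeries.C ((m + 1 : ℕ) : ℂ) := by simp
    rw [this, ← map_mul, inv_mul_cancel₀ (Nat.cast_ne_zero.2 (Nat.succ_ne_zero m)), map_one]
  rw [← one_smul ℂ⟦X⟧ x, ← one_smul ℂ⟦X⟧ y, ← h2, mul_smul, mul_smul, h]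

/-- Since m + 1 is invertible over ℂ, the recursion d G_m = (m+1) G_{m+1} determines all divided
powers. Explicit formulas for `hasse` are proved by checking it. -/
theorem hasse_ext {d : S →ₗ[ℂ⟦X⟧] S} {G : ℕ → S} {f : S} (h0 : G 0 = f)
    (hs : ∀ m, d (G m) = ((m + 1 : ℕ) : ℂ⟦X⟧) • G (m + 1)) (m : ℕ) : hasse d m f = G m := by
  induction m with
  | zero => rw [hasse_zero, h0, LinearMap.id_apply]
  | succ m ih => exact natCast_smul_inj (by rw [← hasse_succ, ih, hs])

theorem hasse_mul {d : S →ₗ[ℂ⟦X⟧] S} (hd : ∀ f g, d (f * g) = d f * g + f * d g) (f g : S)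
    (m : ℕ) : hasse d m (f * g) =
      ∑ p ∈ antidiagonal m, hasse d p.1 f * hasse d p.2 g := by
  refine hasse_ext (G := fun m => ∑ p ∈ antidiagonal m, hasse d p.1 f * hasse d p.2 g)
    (by simp [hasse_zero]) (fun m => ?_) m
  have h1 : ∀ p ∈ antidiagonal (m + 1), ((m + 1 : ℕ) : ℂ⟦X⟧) • (hasse d p.1 f * hasse d p.2 g)
      = (p.1 : ℂ⟦X⟧) • (hasse d p.1 f * hasse d p.2 g) +
        (p.2 : ℂ⟦X⟧) • (hasse d p.1 f * hasse d p.2 g) := by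
    intro p hp
    rw [← mem_antidiagonal.1 hp, Nat.cast_add, add_smul]
  rw [Finset.smul_sum, Finset.sum_congr rfl h1, Finset.sum_add_distrib,
    Finset.Nat.sum_antidiagonal_succ (f := fun p => (p.1 : ℂ⟦X⟧) • (hasse d p.1 f * hasse d p.2 g)),
    Finset.Nat.sum_antidiagonal_succ' (f := fun p => (p.2 : ℂ⟦X⟧) • (hasse d p.1 f * hasse d p.2 g)),
    map_sum]
  simp only [hd, hasse_succ, Finset.sum_add_distrib, Nat.cast_zero, zero_smul, zero_add,
    smul_mul_assoc, mul_smul_comm]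

theorem hasse_hasse (d : S →ₗ[ℂ⟦X⟧] S) (i j : ℕ) (f : S) :
    hasse d i (hasse d j f) = ((i + j).choose i : ℂ⟦X⟧) • hasse d (i + j) f := by
  simp only [hasse, LinearMap.smul_apply, map_smul, ← mul_smul]
  rw [pow_add, Module.End.mul_apply]
  congr 1
  have : (((i + j).choose i : ℕ) : ℂ⟦X⟧) = PowerSeries.C ((i + j).choose i : ℂ) := by simp
  rw [this, ← map_mul, ← map_mul]
  congr 1
  have hi : (i.factorial : ℂ) ≠ 0 := Nat.cast_ne_zero.2 i.factorial_ne_zero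
  have hj : (j.factorial : ℂ) ≠ 0 := Nat.cast_ne_zero.2 j.factorial_ne_zero
  have hij : ((i + j).factorial : ℂ) ≠ 0 := Nat.cast_ne_zero.2 (i + j).factorial_ne_zero
  have h := congrArg (Nat.cast (R := ℂ)) (Nat.add_choose_mul_factorial_mul_factorial i j)
  rw [← Nat.choose_symm_add] at h
  push_cast at h
  field_simp
  linear_combination -h

/-- A linear derivation of a possibly noncommutative algebra. -/
structure Deriv (S : Type*) [Ring S] [Algebra ℂ⟦X⟧ S] where
  map : S →ₗ[ℂ⟦X⟧] S
  leibniz : ∀ f g, map (f * g) = map f * g + f * map g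

theorem Deriv.map_one (d : Deriv S) : d.map 1 = 0 := by
  simpa using d.leibniz 1 1

theorem hasse_one (d : Deriv S) (m : ℕ) : hasse d.map m 1 = if m = 0 then 1 else 0 := by
  refine hasse_ext (G := fun m => if m = 0 then (1 : S) else 0) (by simp) (fun m => ?_) m
  by_cases h : m = 0 <;> simp [h, d.map_one]

/-- The Taylor expansion `f(u) ↦ f(u - h)`. -/
def taylor (d : Deriv S) : S →+* S⟦X⟧ where
  toFun f := PowerSeries.mk fun m => (-1 : ℂ⟦X⟧) ^ m • hasse d.map m f
  map_one' := by
    ext m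
    rw [coeff_mk, hasse_one, coeff_one]
    by_cases h : m = 0 <;> simp [h]
  map_zero' := by ext; simp
  map_add' f g := by ext; simp
  map_mul' f g := by
    ext m
    rw [coeff_mk, hasse_mul d.leibniz, coeff_mul, Finset.smul_sum]
    refine Finset.sum_congr rfl fun p hp => ?_
    rw [coeff_mk, coeff_mk, smul_mul_smul_comm, ← pow_add, mem_antidiagonal.1 hp]

theorem coeff_taylor (d : Deriv S) (f : S) (m : ℕ) :
    coeff m (taylor d f) = (-1 : ℂ⟦X⟧) ^ m • hasse d.map m f :=
  coeff_mk (R := S) m fun m => (-1 : ℂ⟦X⟧) ^ m • hasse d.map m f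

theorem taylor_smul (d : Deriv S) (r : ℂ⟦X⟧) (f : S) : taylor d (r • f) = r • taylor d f := by
  ext m
  rw [coeff_taylor, map_smul, smul_comm]
  simp [coeff_taylor]

variable [CComplete S]

/-- The shift `f(u) ↦ f(u - a c)`. -/
def sigma (d : Deriv S) (a : ℂ) : S →+* S := (evHom S a).comp (taylor d)

theorem isCSum_sigma (d : Deriv S) (a : ℂ) (f : S) :
    IsCSum (fun m => (-(PowerSeries.C a * c)) ^ m • hasse d.map m f) (sigma d a f) := by
  have h := isCSum_evc a (taylor d f)
  refine (congrArg (fun g => IsCSum g (sigma d a f)) (funext fun m => ?_)).mp h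
  rw [coeff_taylor, ← mul_smul, ← mul_pow]
  congr 2
  ring

theorem sigma_smul (d : Deriv S) (a : ℂ) (r : ℂ⟦X⟧) (f : S) :
    sigma d a (r • f) = r • sigma d a f := by
  rw [sigma, RingHom.comp_apply, taylor_smul, evHom_smul]
  rfl

theorem sigma_sub_mem (d : Deriv S) (a : ℂ) (f : S) : sigma d a f - f ∈ cPow S 1 := by
  simpa [hasse_zero] using isCSum_iff.1 (isCSum_sigma d a f) 1

theorem sigma_zero (d : Deriv S) (f : S) : sigma d 0 f = f := by
  refine (isCSum_sigma d 0 f).unique (IsCSum.mem_of_succ fun N => ?_)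
  rw [Finset.sum_range_succ']
  simp [hasse_zero]

-- The terms of the square outside the triangle have i + j ≥ N. This is the only rearrangement of a
-- double series that is needed, in `sigma_sigma`.
omit [CComplete S] in
theorem sum_square_sub_triangle_mem (N : ℕ) (y : ℕ → ℕ → S) (hy : ∀ i j, y i j ∈ cPow S (i + j)) :
    ∑ i ∈ Finset.range N, ∑ j ∈ Finset.range N, y i j -
      ∑ m ∈ Finset.range N, ∑ p ∈ antidiagonal m, y p.1 p.2 ∈ cPow S N := by
  rw [← Finset.sum_product', Finset.sum_sigma']
  have h : ∑ p ∈ (Finset.range N).sigma fun m => antidiagonal m, y p.2.1 p.2.2 =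
      ∑ p ∈ ((Finset.range N) ×ˢ (Finset.range N)).filter (fun p => p.1 + p.2 < N), y p.1 p.2 := by
    refine Finset.sum_bij' (fun p _ => p.2) (fun p _ => ⟨p.1 + p.2, p⟩) ?_ ?_ ?_ ?_ ?_
    · rintro ⟨m, i, j⟩ h
      simp at h ⊢
      omega
    · rintro ⟨i, j⟩ h
      simp at h ⊢
      omega
    · rintro ⟨m, i, j⟩ h
      simp at h ⊢
      omega
    · intro p _
      rfl
    · intro p _
      rfl
  rw [h, ← Finset.sum_filter_add_sum_filter_not _ (fun p : ℕ × ℕ => p.1 + p.2 < N),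
    add_sub_cancel_left]
  refine Submodule.sum_mem _ fun p hp => ?_
  simp at hp
  exact cPow_anti hp.2 (hy _ _)

/-- exp(-ac∂) exp(-bc∂) = exp(-(a+b)c∂): modulo c^N all sums are finite, and the binomial theorem
applies on each antidiagonal. -/
theorem sigma_sigma (d : Deriv S) (a b : ℂ) (f : S) :
    sigma d a (sigma d b f) = sigma d (a + b) f := by
  refine (isCSum_sigma d a _).unique (t := _) (isCSum_iff.2 fun N => ?_)
  set A : ℂ⟦X⟧ := -(PowerSeries.C a * c)
  set B : ℂ⟦X⟧ := -(PowerSeries.C b * c)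
  have hA : ∀ m (x : S), A ^ m • x ∈ cPow S m := by
    intro m x
    have : A ^ m • x = (PowerSeries.C a * c) ^ m • ((-1 : ℂ⟦X⟧) ^ m • x) := by
      rw [← mul_smul, ← mul_pow]; congr 2; ring
    rw [this]
    exact smul_pow_mem_cPow _ _ _
  have hB : ∀ m (x : S), B ^ m • x ∈ cPow S m := by
    intro m x
    have : B ^ m • x = (PowerSeries.C b * c) ^ m • ((-1 : ℂ⟦X⟧) ^ m • x) := by
      rw [← mul_smul, ← mul_pow]; congr 2; ring
    rw [this]
    exact smul_pow_mem_cPow _ _ _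
  have h1 := isCSum_iff.1 (isCSum_sigma d (a + b) f) N
  set y : ℕ → ℕ → S := fun i j => (A ^ i * B ^ j) • hasse d.map i (hasse d.map j f)
  have hy : ∀ i j, y i j ∈ cPow S (i + j) := by
    intro i j
    obtain ⟨z, hz⟩ := mem_cPow.1 (hB j (hasse d.map i (hasse d.map j f)))
    obtain ⟨w, hw⟩ := mem_cPow.1 (hA i z)
    refine mem_cPow.2 ⟨w, ?_⟩
    simp only [y]
    rw [mul_smul, hz, smul_comm, hw, add_comm, pow_add, mul_smul]
  have h2 := sum_square_sub_triangle_mem N y hy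
  have h3 : ∀ m, ∑ p ∈ antidiagonal m, y p.1 p.2 =
      (-(PowerSeries.C (a + b) * c)) ^ m • hasse d.map m f := by
    intro m
    have hab : -(PowerSeries.C (a + b) * c) = A + B := by
      simp only [A, B, map_add]; ring
    rw [hab, (Commute.all A B).add_pow', Finset.sum_smul]
    refine Finset.sum_congr rfl fun p hp => ?_
    have := mem_antidiagonal.1 hp
    simp only [y]
    rw [hasse_hasse, ← mul_smul, this, nsmul_eq_mul, mul_comm]
  simp only [h3] at h2
  -- Replacing the inner shift by its N-th partial sum changes each term by a multiple of c^N.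
  have h4 : ∑ i ∈ Finset.range N, A ^ i • hasse d.map i (sigma d b f) -
      ∑ i ∈ Finset.range N, ∑ j ∈ Finset.range N, y i j ∈ cPow S N := by
    rw [← Finset.sum_sub_distrib]
    refine Submodule.sum_mem _ fun i _ => ?_
    obtain ⟨z, hz⟩ := mem_cPow.1 (isCSum_iff.1 (isCSum_sigma d b f) N)
    rw [sub_eq_iff_eq_add] at hz
    rw [hz]
    simp only [map_add, map_smul, map_sum, smul_add, y, Finset.smul_sum, mul_smul, B,
      add_sub_cancel_right]
    rw [smul_comm]
    exact smul_mem_cPow _ _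
  have h5 := Submodule.sub_mem _ h1 (Submodule.add_mem _ h4 h2)
  rw [sub_add_sub_cancel, sub_sub_sub_cancel_right] at h5
  exact h5

end Taylor

end YangianDouble

end
noncomputable section

namespace YangianDouble

open PowerSeries Finset.HasAntidiagonal

/-! ### Completeness of power series, matrices and the double -/

section Instances

variable {R : Type*} [Ring R] [Algebra ℂ⟦X⟧ R]

theorem mem_cPow_powerSeries {N : ℕ} {f : R⟦X⟧} :
    f ∈ cPow R⟦X⟧ N ↔ ∀ q, coeff q f ∈ cPow R N := by
  constructor
  · intro h q
    obtain ⟨z, rfl⟩ := mem_cPow.1 h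
    exact mem_cPow.2 ⟨coeff q z, by simp⟩
  · intro h
    choose z hz using fun q => mem_cPow.1 (h q)
    exact mem_cPow.2 ⟨PowerSeries.mk z, by ext q; simp [hz]⟩

theorem isCSum_powerSeries {g : ℕ → R⟦X⟧} {s : R⟦X⟧} :
    IsCSum g s ↔ ∀ q, IsCSum (fun m => coeff q (g m)) (coeff q s) := by
  simp only [isCSum_iff, mem_cPow_powerSeries, map_sub, map_sum]
  exact forall_comm

theorem mem_cPow_matrix {ι : Type*} [Fintype ι] [DecidableEq ι] {N : ℕ} {M : Matrix ι ι R} :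
    M ∈ cPow (Matrix ι ι R) N ↔ ∀ i j, M i j ∈ cPow R N := by
  constructor
  · intro h i j
    obtain ⟨z, rfl⟩ := mem_cPow.1 h
    exact mem_cPow.2 ⟨z i j, by simp⟩
  · intro h
    choose z hz using fun i j => mem_cPow.1 (h i j)
    exact mem_cPow.2 ⟨Matrix.of z, by ext i j; simp [hz]⟩

theorem isCSum_matrix {ι : Type*} [Fintype ι] [DecidableEq ι] {g : ℕ → Matrix ι ι R}
    {s : Matrix ι ι R} : IsCSum g s ↔ ∀ i j, IsCSum (fun m => g m i j) (s i j) := by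
  simp only [isCSum_iff, mem_cPow_matrix, Matrix.sub_apply, Matrix.sum_apply]
  exact ⟨fun h i j N => h N i j, fun h N i j => h i j N⟩

instance [CComplete R] : CComplete R⟦X⟧ where
  torsion_free f hf := by
    ext q
    rw [map_zero]
    exact CComplete.torsion_free _ (by simpa using congrArg (coeff q) hf)
  separated f hf := by
    ext q
    rw [map_zero]
    exact CComplete.separated _ fun N => mem_cPow_powerSeries.1 (hf N) q
  complete g := by
    choose s hs using fun q => CComplete.complete fun m => coeff q (g m)
    exact ⟨PowerSeries.mk s, isCSum_powerSeries.2 fun q => by simpa using hs q⟩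

instance {ι : Type*} [Fintype ι] [DecidableEq ι] [CComplete R] : CComplete (Matrix ι ι R) where
  torsion_free f hf := by
    ext i j
    exact CComplete.torsion_free _ (by simpa using congrFun (congrFun hf i) j)
  separated f hf := by
    ext i j
    exact CComplete.separated _ fun N => mem_cPow_matrix.1 (hf N) i j
  complete g := by
    choose s hs using fun i j => CComplete.complete fun m => g m i j
    exact ⟨Matrix.of s, isCSum_matrix.2 fun i j => by simpa using hs i j⟩

theorem mem_cPow_base {N : ℕ} {f : ℂ⟦X⟧} : f ∈ cPow ℂ⟦X⟧ N ↔ ∀ m < N, coeff m f = 0 := by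
  rw [← X_pow_dvd_iff, mem_cPow]
  rfl

instance : CComplete ℂ⟦X⟧ where
  torsion_free f hf := by
    have : (c : ℂ⟦X⟧) ≠ 0 := X_ne_zero
    simpa [this] using hf
  separated f hf := by
    ext q
    exact mem_cPow_base.1 (hf (q + 1)) q (Nat.lt_succ_self q)
  complete g := by
    refine ⟨PowerSeries.mk fun r => ∑ m ∈ Finset.range (r + 1), coeff r (c ^ m • g m), ?_⟩
    refine isCSum_iff.2 fun N => mem_cPow_base.2 fun r hr => ?_
    rw [map_sub, coeff_mk, map_sum, sub_eq_zero]
    refine Finset.sum_subset (Finset.range_subset_range.2 (by omega)) fun m _ hm => ?_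
    exact mem_cPow_base.1 (smul_mem_cPow m (g m)) r (by simpa using hm)

instance (g : Series) (n : ℕ) : CComplete (DY g n) where
  torsion_free := c_smul_eq_zero
  separated x hx := separated x fun N => mem_cPow.1 (hx N)
  complete f := ⟨_, csum_spec _ fun m => ⟨f m, rfl⟩⟩

theorem isCSum_of_eq_zero {g : ℕ → R} (hg : ∀ m, g m ∈ cPow R m) (M : ℕ)
    (h0 : ∀ m, M ≤ m → g m = 0) : IsCSum g (∑ m ∈ Finset.range M, g m) := by
  refine isCSum_iff.2 fun N => ?_
  rcases le_total N M with h | h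
  · rw [← Finset.sum_Ico_eq_sub _ h]
    exact Submodule.sum_mem _ fun m hm => cPow_anti (Finset.mem_Ico.1 hm).1 (hg m)
  · rw [← neg_mem_iff, neg_sub, ← Finset.sum_Ico_eq_sub _ h,
      Finset.sum_eq_zero fun m hm => h0 m (Finset.mem_Ico.1 hm).1]
    exact Submodule.zero_mem _

end Instances

/-! ### The shift of the statement as the exponential of d/du -/

section Shift

variable {R : Type*} [Ring R] [Algebra ℂ⟦X⟧ R]

/-- The derivation `d / du` on series in `u⁻¹` or in `u`. -/
def dU : Sgn → Deriv R⟦X⟧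
  | .plus =>
    { map :=
        { toFun := fun f => PowerSeries.mk fun q => -((q - 1 : ℕ) : ℂ⟦X⟧) • coeff (q - 1) f
          map_add' := fun f g => by ext; simp
          map_smul' := fun r f => by ext; simp [smul_comm r] }
      leibniz := fun f g => by
        ext q
        cases q with
        | zero => simp [coeff_mul]
        | succ q =>
          simp only [LinearMap.coe_mk, AddHom.coe_mk, map_add, coeff_mk, Nat.add_sub_cancel]
          rw [coeff_mul, coeff_mul, coeff_mul, Finset.Nat.sum_antidiagonal_succ,
            Finset.Nat.sum_antidiagonal_succ' (n := q), Finset.smul_sum]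
          simp only [coeff_mk, Nat.add_sub_cancel, Nat.zero_sub, Nat.cast_zero, neg_zero, zero_smul,
            zero_mul, mul_zero, zero_add]
          rw [← Finset.sum_add_distrib]
          refine Finset.sum_congr rfl fun p hp => ?_
          rw [← mem_antidiagonal.1 hp, smul_mul_assoc, mul_smul_comm, ← add_smul]
          congr 1
          push_cast
          ring }
  | .minus =>
    { map :=
        { toFun := fun f => PowerSeries.mk fun q => ((q + 1 : ℕ) : ℂ⟦X⟧) • coeff (q + 1) f
          map_add' := fun f g => by ext; simp
          map_smul' := fun r f => by ext; simp [smul_comm r] }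
      leibniz := fun f g => by
        ext m
        simp only [LinearMap.coe_mk, AddHom.coe_mk, map_add, coeff_mk]
        rw [coeff_mul, coeff_mul, coeff_mul]
        have h1 : ∀ p ∈ antidiagonal (m + 1),
            ((m + 1 : ℕ) : ℂ⟦X⟧) • (coeff p.1 f * coeff p.2 g)
            = (p.1 : ℂ⟦X⟧) • (coeff p.1 f * coeff p.2 g) +
              (p.2 : ℂ⟦X⟧) • (coeff p.1 f * coeff p.2 g) := by
          intro p hp
          rw [← mem_antidiagonal.1 hp, Nat.cast_add, add_smul]
        rw [Finset.smul_sum, Finset.sum_congr rfl h1, Finset.sum_add_distrib,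
          Finset.Nat.sum_antidiagonal_succ
            (f := fun p => (p.1 : ℂ⟦X⟧) • (coeff p.1 f * coeff p.2 g)),
          Finset.Nat.sum_antidiagonal_succ'
            (f := fun p => (p.2 : ℂ⟦X⟧) • (coeff p.1 f * coeff p.2 g))]
        simp only [coeff_mk, Nat.cast_zero, zero_smul, zero_add, smul_mul_assoc, mul_smul_comm] }

theorem coeff_zero_dU_plus (f : R⟦X⟧) : coeff 0 ((dU .plus).map f) = 0 :=
  (coeff_mk (R := R) 0 fun q => -((q - 1 : ℕ) : ℂ⟦X⟧) • coeff (q - 1) f).trans (by simp)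

theorem coeff_succ_dU_plus (f : R⟦X⟧) (q : ℕ) :
    coeff (q + 1) ((dU .plus).map f) = -(q : ℂ⟦X⟧) • coeff q f :=
  coeff_mk (R := R) (q + 1) fun q => -((q - 1 : ℕ) : ℂ⟦X⟧) • coeff (q - 1) f

theorem coeff_dU_minus (f : R⟦X⟧) (q : ℕ) :
    coeff q ((dU .minus).map f) = ((q + 1 : ℕ) : ℂ⟦X⟧) • coeff (q + 1) f :=
  coeff_mk (R := R) q fun q => ((q + 1 : ℕ) : ℂ⟦X⟧) • coeff (q + 1) f

/-- The m-th divided derivative of u⁻ᵖ is (-1)^m (p+m-1 choose m) u^{-p-m}, and q = p + m. The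
truncated `q - 1` is harmless: for q = 0 only m = 0 occurs, where the binomial coefficient is 1. -/
theorem coeff_hasse_plus (f : R⟦X⟧) (m q : ℕ) : coeff q (hasse (dU .plus).map m f) =
    if m ≤ q then ((-1 : ℂ⟦X⟧) ^ m * ((q - 1).choose m : ℂ⟦X⟧)) • coeff (q - m) f else 0 := by
  have h := hasse_ext (d := (dU .plus).map) (f := f) (G := fun m => PowerSeries.mk fun q =>
    if m ≤ q then ((-1 : ℂ⟦X⟧) ^ m * ((q - 1).choose m : ℂ⟦X⟧)) • coeff (q - m) f else 0)
    (by ext; simp) (fun m => ?_) m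
  · rw [h, coeff_mk]
  · ext q
    cases q with
    | zero => rw [coeff_zero_dU_plus]; simp
    | succ q =>
      rw [coeff_succ_dU_plus, coeff_mk, PowerSeries.coeff_smul, coeff_mk]
      simp only [Nat.add_le_add_iff_right, Nat.add_sub_add_right, Nat.add_sub_cancel]
      split_ifs
      · rw [← mul_smul, ← mul_smul]
        congr 1
        have h : q * (q - 1).choose m = (m + 1) * q.choose (m + 1) := by
          cases q with
          | zero => simp
          | succ q => rw [Nat.add_sub_cancel, Nat.add_one_mul_choose_eq, mul_comm]
        have h := congrArg (Nat.cast (R := ℂ⟦X⟧)) h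
        push_cast at h ⊢
        linear_combination (-(-1) ^ m) * h
      · simp

theorem coeff_hasse_minus (f : R⟦X⟧) (m q : ℕ) : coeff q (hasse (dU .minus).map m f) =
    ((q + m).choose m : ℂ⟦X⟧) • coeff (q + m) f := by
  have h := hasse_ext (d := (dU .minus).map) (f := f) (G := fun m => PowerSeries.mk fun q =>
    ((q + m).choose m : ℂ⟦X⟧) • coeff (q + m) f)
    (by ext; simp) (fun m => ?_) m
  · rw [h, coeff_mk]
  · ext q
    rw [coeff_dU_minus, coeff_mk, PowerSeries.coeff_smul, coeff_mk, ← mul_smul, ← mul_smul,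
      show q + 1 + m = q + (m + 1) by ring]
    congr 1
    have h := Nat.choose_succ_right_eq (q + (m + 1)) m
    rw [show q + (m + 1) - m = q + 1 by omega] at h
    have h := congrArg (Nat.cast (R := ℂ⟦X⟧)) h
    push_cast at h ⊢
    linear_combination -h

variable [CComplete R]

/-- This makes the binomial formulas of `shift` multiplicative and additive in a. For series in u⁻¹
each coefficient of the exponential receives finitely many terms, in reversed order; for series in u
it is the same `c`-adic sum. -/
theorem shift_eq_sigma (μ : Sgn) (a : ℂ) (f : R⟦X⟧) : shift μ a f = sigma (dU μ) a f := by
  refine IsCSum.unique (isCSum_powerSeries.2 fun q => ?_) (isCSum_sigma (dU μ) a f)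
  have key : ∀ m, coeff q ((-(PowerSeries.C a * c)) ^ m • hasse (dU μ).map m f) ∈ cPow R m := by
    intro m
    have : (-(PowerSeries.C a * c) : ℂ⟦X⟧) ^ m = (PowerSeries.C a * c) ^ m * (-1) ^ m := by
      rw [← mul_pow]; congr 1; ring
    rw [PowerSeries.coeff_smul, this, mul_smul]
    exact smul_pow_mem_cPow _ _ _
  cases μ with
  | plus =>
    have h := isCSum_of_eq_zero key (q + 1) fun m hm => by
      rw [PowerSeries.coeff_smul, coeff_hasse_plus, if_neg (by omega), smul_zero]
    convert h using 1
    rw [← Finset.sum_range_reflect]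
    simp only [shift, coeff_mk]
    refine Finset.sum_congr rfl fun p hp => ?_
    have hp : p ≤ q := Nat.lt_succ_iff.1 (Finset.mem_range.1 hp)
    rw [PowerSeries.coeff_smul, coeff_hasse_plus, if_pos (by omega), ← mul_smul,
      show q + 1 - 1 - p = q - p by omega, show q - (q - p) = p by omega]
    congr 1
    rw [← mul_assoc, ← mul_pow, mul_comm]
    congr 2
    ring
  | minus =>
    have h := isCSum_csum key
    convert h using 1
    simp only [shift, coeff_mk]
    congr 1
    funext m
    rw [PowerSeries.coeff_smul, coeff_hasse_minus, ← mul_smul, mul_comm]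

end Shift

end YangianDouble

end
noncomputable section

namespace YangianDouble

open PowerSeries Finset.HasAntidiagonal

/-! ### Quasi-determinants and the relations of `𝔤𝔩`-type -/

section Schur

variable {K W ι : Type*} [CommRing K] [Ring W] [Algebra K W]

/-- The quasi-determinant `t_{ij} - t_{in} t_{nn}⁻¹ t_{nj}`, where `q = t_{nn}⁻¹`. -/
def schur (t : ι → ι → W) (q : W) (n : ι) (i j : ι) : W := t i j - t i n * q * t n j

/-- The relation of `𝔤𝔩`-type between `t_{ij}` and `s_{kl}`. -/
def GLRel (h e : K) (t s : ι → ι → W) (i k j l : ι) : Prop :=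
  h • (t i j * s k l - s k l * t i j) = e • (t i l * s k j - s i l * t k j)

variable {h e : K} {t s : ι → ι → W} {n : ι} {q r : W}

/-- With four equal indices the relation reads h[t,s] = e[t,s]. -/
theorem GLRel.comm_diag (hr : ∀ x : W, (h - e) • x = 0 → x = 0) (H : GLRel h e t s n n n n) :
    t n n * s n n = s n n * t n n := by
  refine sub_eq_zero.1 (hr _ ?_)
  rw [sub_smul, H, sub_self]

theorem inv_comm {a b q : W} (h1 : q * a = 1) (h2 : a * q = 1) (hab : a * b = b * a) :
    q * b = b * q := by
  calc q * b = q * (b * a) * q := by rw [mul_assoc, mul_assoc, h2, mul_one]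
    _ = b * q := by rw [← hab, ← mul_assoc, h1, one_mul]

section

variable (hq : q * t n n = 1) (hq' : t n n * q = 1) (hk : t n n * s n n = s n n * t n n)

include hq hq' hk

/-- This and the following lemmas compute the commutators of q t_{nj}, t_{in} q and the
quasi-determinants with the entries of `s` in row or column n. Each is a combination of the given
relations, multiplied by q and simplified by q t_{nn} = t_{nn} q = 1. -/
theorem GLRel.comm_row {j : ι} (H : GLRel h e t s n n j n) :
    h • (q * t n j * s n n - s n n * (q * t n j)) = e • (s n j - s n n * (q * t n j)) := by
  have hc := inv_comm hq hq' hk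
  unfold GLRel at H
  linear_combination (norm := skip) q * H + h • (hc * t n j) + e • (hq * s n j) - e • (hc * t n j)
  simp only [mul_sub, sub_mul, smul_sub, mul_assoc, mul_smul_comm, one_mul]
  module

theorem GLRel.comm_col {i : ι} (H : GLRel h e t s i n n n) :
    h • (t i n * q * s n n - s n n * (t i n * q)) = e • (t i n * q * s n n - s i n) := by
  have hc := inv_comm hq hq' hk
  unfold GLRel at H
  linear_combination (norm := skip) H * q + h • (t i n * hc) - e • (t i n * hc) + e • (-s i n * hq')
  simp only [mul_sub, sub_mul, smul_sub, mul_assoc, smul_mul_assoc, mul_one, neg_mul, mul_neg]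
  module

theorem GLRel.comm_schur (hr : ∀ x : W, h • x = 0 → x = 0) {i j : ι} (H1 : GLRel h e t s i n j n)
    (H2 : GLRel h e t s i n n n) (H3 : GLRel h e t s n n j n) :
    schur t q n i j * s n n = s n n * schur t q n i j := by
  have H3 := H3.comm_row hq hq' hk
  refine sub_eq_zero.1 (hr _ ?_)
  unfold GLRel at H1 H2
  unfold schur
  linear_combination (norm := skip) H1 - H2 * (q * t n j) - t i n * H3 + e • (s i n * hq' * t n j)
  simp only [mul_sub, sub_mul, smul_sub, mul_assoc, smul_mul_assoc, mul_smul_comm, one_mul]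
  module

end

section

variable (hq : q * t n n = 1) (hq' : t n n * q = 1)

include hq hq'

theorem GLRel.row_row {j l : ι} (H1 : GLRel h e t s n n j l) (H2 : GLRel h e t s n n n l) :
    h • (q * t n j * s n l - s n l * (q * t n j)) =
      e • (q * t n l * (s n j - s n n * (q * t n j))) := by
  unfold GLRel at H1 H2
  linear_combination (norm := skip) q * H1 - q * H2 * (q * t n j) + h • (hq * s n l * (q * t n j))
    - h • (q * s n l * hq' * t n j) + e • (q * s n l * hq' * t n j)
  simp only [mul_sub, sub_mul, smul_sub, mul_assoc, smul_mul_assoc, mul_smul_comm, one_mul]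
  module

theorem GLRel.schur_row {i j l : ι} (H1 : GLRel h e t s i n j l) (H2 : GLRel h e t s i n n l)
    (H3 : GLRel h e t s n n j l) (H4 : GLRel h e t s n n n l) :
    h • (schur t q n i j * s n l - s n l * schur t q n i j) =
      e • (schur t q n i l * (s n j - s n n * (q * t n j))) := by
  have H := GLRel.row_row hq hq' H3 H4
  unfold GLRel at H1 H2
  unfold schur
  linear_combination (norm := skip) H1 - H2 * (q * t n j) - t i n * H
    + e • (s i l * hq' * t n j)
  simp only [mul_sub, sub_mul, smul_sub, mul_assoc, smul_mul_assoc, mul_smul_comm, one_mul]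
  module

theorem GLRel.col_col {i k : ι} (H1 : GLRel h e t s i k n n) (H2 : GLRel h e t s n k n n) :
    h • (t i n * q * s k n - s k n * (t i n * q)) =
      e • ((t i n * q * s n n - s i n) * (t k n * q)) := by
  unfold GLRel at H1 H2
  linear_combination (norm := skip) H1 * q - t i n * q * H2 * q + h • (t i n * hq * s k n * q)
    - h • (t i n * q * s k n * hq') - e • (t i n * hq * s k n * q)
  simp only [mul_sub, sub_mul, smul_sub, mul_assoc, smul_mul_assoc, mul_smul_comm, one_mul, mul_one]
  module

theorem GLRel.schur_col {i k j : ι} (H1 : GLRel h e t s i k j n) (H2 : GLRel h e t s n k j n)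
    (H3 : GLRel h e t s i k n n) (H4 : GLRel h e t s n k n n) :
    h • (schur t q n i j * s k n - s k n * schur t q n i j) =
      e • ((t i n * q * s n n - s i n) * schur t q n k j) := by
  have H := GLRel.col_col hq hq' H3 H4
  unfold GLRel at H1 H2
  unfold schur
  linear_combination (norm := skip) H1 - t i n * q * H2 - H * t n j
    - e • (t i n * hq * s k j)
  simp only [mul_sub, sub_mul, smul_sub, mul_assoc, smul_mul_assoc, mul_smul_comm, one_mul]
  module

theorem GLRel.col_row {i j : ι} (H1 : GLRel h e t s i n n j) (H2 : GLRel h e t s n n n j) :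
    h • (t i n * q * s n j - s n j * (t i n * q)) =
      e • (schur t q n i j * s n n * q - s i j + t i n * q * s n j) := by
  unfold GLRel at H1 H2
  unfold schur
  linear_combination (norm := skip) H1 * q - t i n * q * H2 * q
    + h • (t i n * hq * s n j * q - t i n * q * s n j * hq')
    + e • (t i n * q * s n j * hq' - s i j * hq')
  simp only [mul_sub, sub_mul, smul_sub, smul_add, mul_assoc, smul_mul_assoc, mul_smul_comm,
    one_mul, mul_one]
  module

/-- The reduction of the rank. Expanding the quasi-determinant of `s` leaves a defect that is e
times commutators with the last row and column of `s`; a further multiplication by h turns these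
into known expressions, which cancel. This is why h has to be regular. -/
theorem GLRel.schur_schur (hr : ∀ x : W, h • x = 0 → x = 0) (hp : r * s n n = 1)
    (hp' : s n n * r = 1) {i k j l : ι}
    (hc : ∀ i' ∈ [i, k], ∀ j' ∈ [j, l], schur t q n i' j' * s n n = s n n * schur t q n i' j')
    (hR : ∀ i' ∈ [i, k], h • (schur t q n i' j * s n l - s n l * schur t q n i' j) =
      e • (schur t q n i' l * (s n j - s n n * (q * t n j))))
    (hC : ∀ j' ∈ [j, l], h • (schur t q n i j' * s k n - s k n * schur t q n i j') =
      e • ((t i n * q * s n n - s i n) * schur t q n k j'))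
    (H1 : GLRel h e t s i k j l) (H2 : GLRel h e t s i k n l) (H3 : GLRel h e t s n k j l)
    (H4 : GLRel h e t s n k n l) :
    GLRel h e (schur t q n) (schur s r n) i k j l := by
  have cr : ∀ i' ∈ [i, k], ∀ j' ∈ [j, l], r * schur t q n i' j' = schur t q n i' j' * r :=
    fun i' hi j' hj => inv_comm hp hp' (hc i' hi j' hj).symm
  have dD : ∀ i j, t i j = schur t q n i j + t i n * q * t n j := fun i j => by simp [schur]
  -- the commutator with `s k l`
  have hE : h • (q * t n j * s k l - s k l * (q * t n j)) =
      e • (q * t n l * (s k j - s k n * (q * t n j)) - q * s n l * schur t q n k j) := by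
    unfold GLRel at H3 H4
    unfold schur
    linear_combination (norm := skip) q * H3 - q * H4 * (q * t n j)
      + h • (hq * s k l * (q * t n j)) - h • (q * s k l * hq' * t n j)
    simp only [mul_sub, sub_mul, smul_sub, mul_assoc, smul_mul_assoc, mul_smul_comm, one_mul]
    module
  have hT : h • (schur t q n i j * s k l - s k l * schur t q n i j) =
      e • (schur t q n i l * (s k j - s k n * (q * t n j)) -
        (s i l - t i n * q * s n l) * schur t q n k j) := by
    unfold GLRel at H1 H2
    unfold schur at hE ⊢
    linear_combination (norm := skip) H1 - H2 * (q * t n j) - t i n * hE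
    simp only [mul_sub, sub_mul, smul_sub, mul_assoc, smul_mul_assoc, mul_smul_comm, one_mul]
    module
  have c1 := hc i (by simp) j (by simp)
  have c2 := hc k (by simp) l (by simp)
  have r1 := cr k (by simp) j (by simp)
  have r2 := cr i (by simp) l (by simp)
  have r3 := cr i (by simp) j (by simp)
  have R1 := hR i (by simp)
  have R2 := hR k (by simp)
  have C1 := hC j (by simp)
  have C2 := hC l (by simp)
  have sD : ∀ i j, schur s r n i j = s i j - s i n * r * s n j := fun i j => rfl
  generalize schur t q n = D at *
  have c3 := hc k (by simp) j (by simp)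
  have r4 := cr k (by simp) j (by simp)
  generalize schur s r n = D' at *
  -- The defect of the relation, in terms of the commutators of D with s_{kn} and s_{nl} only.
  have hX : h • (D i j * D' k l - D' k l * D i j) - e • (D i l * D' k j - D' i l * D k j) =
      e • ((D i l * s k n - s k n * D i l) * (r * s n j - q * t n j) -
        (t i n * q - s i n * r) * (D k j * s n l - s n l * D k j)) := by
    rw [sD, sD, sD]
    linear_combination (norm := skip) hT - C1 * (r * s n l) - s k n * r * R1
      + h • (s k n * r3 * s n l)
      + e • (t i n * q * c3 * r * s n l - t i n * q * D k j * hp' * s n l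
        - s k n * r2 * (s n j - s n n * (q * t n j)) + s k n * D i l * hp * (q * t n j)
        - s i n * r4 * s n l)
    simp only [mul_sub, sub_mul, smul_sub, smul_add, mul_assoc, smul_mul_assoc, mul_smul_comm,
      one_mul]
    module
  refine sub_eq_zero.1 (hr _ ?_)
  rw [hX]
  linear_combination (norm := skip) e • (C2 * (r * s n j - q * t n j) -
      (t i n * q - s i n * r) * R2) - (e * e) • ((t i n * q - s i n * r) * c2 * (r * s n j - q * t n j)
      - (t i n * q - s i n * r) * D k l * hp' * s n j)
    + (e * e) • (s i n * hp * D k l * (r * s n j - q * t n j))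
  simp only [mul_sub, sub_mul, smul_sub, smul_add, mul_assoc, smul_mul_assoc, mul_smul_comm,
    one_mul]
  module

end

end Schur

end YangianDouble

end
noncomputable section

namespace YangianDouble

open PowerSeries Finset.HasAntidiagonal

/-! ### Mutually inverse families -/

section MutInv

variable {S ι : Type*} [Ring S] [DecidableEq ι]

/-- The families `x` and `y`, restricted to `J`, are mutually inverse matrices. -/
def MutInv (J : Finset ι) (x y : ι → ι → S) : Prop :=
  (∀ i ∈ J, ∀ j ∈ J, ∑ l ∈ J, x i l * y l j = if i = j then 1 else 0) ∧
  ∀ i ∈ J, ∀ j ∈ J, ∑ l ∈ J, y i l * x l j = if i = j then 1 else 0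

theorem MutInv.symm {J : Finset ι} {x y : ι → ι → S} (h : MutInv J x y) : MutInv J y x :=
  ⟨h.2, h.1⟩

theorem MutInv.congr {J : Finset ι} {x y x' y' : ι → ι → S} (h : MutInv J x y)
    (hx : ∀ i ∈ J, ∀ j ∈ J, x i j = x' i j) (hy : ∀ i ∈ J, ∀ j ∈ J, y i j = y' i j) :
    MutInv J x' y' := by
  refine ⟨fun i hi j hj => ?_, fun i hi j hj => ?_⟩
  · rw [← h.1 i hi j hj]
    exact Finset.sum_congr rfl fun l hl => by rw [hx i hi l hl, hy l hl j hj]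
  · rw [← h.2 i hi j hj]
    exact Finset.sum_congr rfl fun l hl => by rw [hx l hl j hj, hy i hi l hl]

/-- Block inversion: the complementary block of the inverse is the inverse of the Schur complement,
so `y` need not be changed when n is eliminated from `x`. -/
theorem MutInv.schur {J : Finset ι} {x y : ι → ι → S} (h : MutInv J x y) {n : ι} (hn : n ∈ J)
    {q : S} (hq : q * x n n = 1) (hq' : x n n * q = 1) :
    MutInv (J.erase n) (schur x q n) y := by
  refine ⟨fun i hi j hj => ?_, fun i hi j hj => ?_⟩
  · obtain ⟨hin, hi⟩ := Finset.mem_erase.1 hi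
    obtain ⟨hjn, hj⟩ := Finset.mem_erase.1 hj
    have h1 := h.1 i hi j hj
    have h2 := h.1 n hn j hj
    rw [← Finset.add_sum_erase _ _ hn] at h1 h2
    rw [if_neg (Ne.symm hjn)] at h2
    simp only [YangianDouble.schur, sub_mul, Finset.sum_sub_distrib, mul_assoc _ (x n _), ← Finset.mul_sum]
    rw [eq_sub_of_add_eq' h1, eq_sub_of_add_eq' h2, zero_sub, mul_neg, mul_assoc (x i n),
      ← mul_assoc q, hq, one_mul]
    abel
  · obtain ⟨hin, hi⟩ := Finset.mem_erase.1 hi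
    obtain ⟨hjn, hj⟩ := Finset.mem_erase.1 hj
    have h1 := h.2 i hi j hj
    have h2 := h.2 i hi n hn
    rw [← Finset.add_sum_erase _ _ hn] at h1 h2
    rw [if_neg hin] at h2
    simp only [YangianDouble.schur, mul_sub, Finset.sum_sub_distrib, ← mul_assoc, ← Finset.sum_mul]
    rw [eq_sub_of_add_eq' h1, eq_sub_of_add_eq' h2, zero_sub, neg_mul, mul_assoc (y i n), hq']
    simp

end MutInv

/-! ### Relations of `𝔤𝔩`-type for series -/

section GLSeries

variable {S : Type*} [Ring S] [Algebra ℂ⟦X⟧ S]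

variable (S) in
/-- The auxiliary variable `h` as a central element. -/
def hCen : Subring.center S⟦X⟧ :=
  ⟨X, Subring.mem_center_iff.2 fun g => (commute_X g).eq⟩

variable (S) in
/-- The parameter `c` as a central element. -/
def cCen : Subring.center S⟦X⟧ :=
  ⟨C (c • 1), Subring.mem_center_iff.2 fun g => by ext; simp⟩

omit [Algebra ℂ⟦X⟧ S] in
theorem hCen_smul (x : S⟦X⟧) : hCen S • x = X * x := rfl

theorem cCen_smul (x : S⟦X⟧) : cCen S • x = c • x := by
  change C (c • 1) * x = _
  ext
  simp

theorem hCen_reg (x : S⟦X⟧) (hx : hCen S • x = 0) : x = 0 := by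
  rw [hCen_smul] at hx
  ext m
  simpa [coeff_succ_X_mul] using congrArg (coeff (m + 1)) hx

variable [CComplete S]

theorem hCen_sub_reg (x : S⟦X⟧) (hx : (hCen S - cCen S) • x = 0) : x = 0 := by
  rw [sub_smul, hCen_smul, cCen_smul] at hx
  ext m
  rw [map_zero]
  refine CComplete.torsion_free _ ?_
  induction m with
  | zero => simpa using congrArg (coeff 0) hx
  | succ m ih =>
    have h := congrArg (coeff (m + 1)) hx
    have h0 : coeff m x = 0 := CComplete.torsion_free _ ih
    simpa [coeff_succ_X_mul, h0] using h

/-- The relation of `𝔤𝔩`-type between `T_{ij}(u)` and `T_{kl}(v)`, where `v = u - h`. -/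
def GLSer (d : Deriv S) {ι : Type*} (T : ι → ι → S) (i k j l : ι) : Prop :=
  GLRel (hCen S) (cCen S) (fun i j => C (T i j)) (fun i j => taylor d (T i j)) i k j l

/-- At h = c, that is v = u - c, both sides carry the factor `c`, which can be cancelled. All shifts
by `c` in the formulas arise from this specialisation. -/
theorem ev_rel {x y : S⟦X⟧} (h : hCen S • x = cCen S • y) : evHom S 1 x = evHom S 1 y := by
  rw [hCen_smul, cCen_smul] at h
  have h := congrArg (evHom S 1) h
  rw [map_mul, evHom_smul, evHom_X, map_one, one_mul, smul_mul_assoc, one_mul] at h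
  exact c_smul_inj h

variable {d : Deriv S} {ι : Type*} {T : ι → ι → S} {n : ι} {q : S}

omit [Algebra ℂ⟦X⟧ S] [CComplete S] in
theorem schur_C (i j : ι) :
    schur (fun i j => C (T i j)) (C q) n i j = C (schur T q n i j) := by
  simp [schur]

omit [CComplete S] in
theorem schur_taylor (i j : ι) :
    schur (fun i j => taylor d (T i j)) (taylor d q) n i j = taylor d (schur T q n i j) := by
  simp [schur]

section

variable (hq : q * T n n = 1) (hq' : T n n * q = 1) (H0 : GLSer d T n n n n)

include hq hq' H0

theorem GLSer.comm_schur {i j : ι} (H1 : GLSer d T i n j n) (H2 : GLSer d T i n n n)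
    (H3 : GLSer d T n n j n) :
    C (schur T q n i j) * taylor d (T n n) = taylor d (T n n) * C (schur T q n i j) := by
  have h := GLRel.comm_schur (q := C q) (by rw [← map_mul, hq, map_one])
    (by rw [← map_mul, hq', map_one]) (GLRel.comm_diag hCen_sub_reg H0) hCen_reg H1 H2 H3
  rwa [schur_C] at h

theorem GLSer.comm_sigma {i j : ι} (H1 : GLSer d T i n j n) (H2 : GLSer d T i n n n)
    (H3 : GLSer d T n n j n) (a b : ℂ) :
    Commute (sigma d a (schur T q n i j)) (sigma d b (T n n)) := by
  have h := congrArg (evHom S (b - a)) (GLSer.comm_schur hq hq' H0 H1 H2 H3)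
  rw [map_mul, map_mul, evHom_C] at h
  have h := congrArg (sigma d a) h
  rw [map_mul, map_mul] at h
  have e : sigma d a (evHom S (b - a) (taylor d (T n n))) = sigma d b (T n n) := by
    refine (sigma_sigma d a (b - a) (T n n)).trans ?_
    rw [add_sub_cancel]
  rwa [e] at h

/-- At h = c the relation `GLRel.comm_col` has the term T_{in} q T_{nn}(u-c) on both sides. What
remains trades the factor q on the right of a column entry for a shift by `c`. -/
theorem GLSer.shift_col {i : ι} (H : GLSer d T i n n n) :
    sigma d 1 (T n n) * (T i n * q) = sigma d 1 (T i n) := by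
  have h := ev_rel (GLRel.comm_col (q := C q) (by rw [← map_mul, hq, map_one])
    (by rw [← map_mul, hq', map_one]) (GLRel.comm_diag hCen_sub_reg H0) H)
  simp only [map_mul, map_sub, evHom_C] at h
  exact sub_right_inj.1 h

theorem GLSer.shift_row {j : ι} (H : GLSer d T n n j n) :
    q * T n j * sigma d 1 (T n n) = sigma d 1 (T n j) := by
  have h := ev_rel (GLRel.comm_row (q := C q) (by rw [← map_mul, hq, map_one])
    (by rw [← map_mul, hq', map_one]) (GLRel.comm_diag hCen_sub_reg H0) H)
  simp only [map_mul, map_sub, evHom_C] at h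
  exact sub_left_inj.1 h

end

/-- `GLRel.col_row` at h = c. The left side becomes a Schur complement of the shifted transpose, the
right side is the quasi-determinant with a diagonal factor: the comparison needed in `Stage.step`.
-/
theorem GLSer.shift_schur (hq : q * T n n = 1) (hq' : T n n * q = 1) {i j : ι}
    (H1 : GLSer d T i n n j) (H2 : GLSer d T n n n j) :
    sigma d 1 (T i j) - sigma d 1 (T n j) * (T i n * q) =
      schur T q n i j * sigma d 1 (T n n) * q := by
  have h := ev_rel (GLRel.col_row (q := C q) (by rw [← map_mul, hq, map_one])
    (by rw [← map_mul, hq', map_one]) H1 H2)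
  simp only [schur_C, map_mul, map_sub, map_add, evHom_C] at h
  change _ - sigma d 1 (T n j) * _ = _ * sigma d 1 (T n n) * _ - sigma d 1 (T i j) + _ at h
  rw [sub_eq_iff_eq_add] at h ⊢
  have h' : ∀ x y z w : S, x = y - z + x + w → z = y + w := by
    intro x y z w h
    have := sub_eq_zero.2 h
    have e : x - (y - z + x + w) = z - (y + w) := by abel
    rw [e] at this
    exact sub_eq_zero.1 this
  exact h' _ _ _ _ h

/-- Only relations whose row pair is (i,k) or contains n, and likewise for columns, are required. In
the application a pair such as (i,i) can be opposite, and then its relation is not available. -/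
theorem GLSer.schur (hq : q * T n n = 1) (hq' : T n n * q = 1) {i k j l : ι}
    (H : ∀ a ∈ [i, k, n], ∀ b ∈ [i, k, n], ∀ a' ∈ [j, l, n], ∀ b' ∈ [j, l, n],
      (a = n ∨ b = n ∨ (a = i ∧ b = k)) → (a' = n ∨ b' = n ∨ (a' = j ∧ b' = l)) →
        GLSer d T a b a' b') :
    GLSer d (schur T q n) i k j l := by
  have q1 : C q * C (T n n) = 1 := by rw [← map_mul, hq, map_one]
  have q2 : C (T n n) * C q = 1 := by rw [← map_mul, hq', map_one]
  have q3 : taylor d q * taylor d (T n n) = 1 := by rw [← map_mul, hq, map_one]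
  have q4 : taylor d (T n n) * taylor d q = 1 := by rw [← map_mul, hq', map_one]
  have hk := GLRel.comm_diag hCen_sub_reg
    (H n (by simp) n (by simp) n (by simp) n (by simp) (by simp) (by simp))
  have := GLRel.schur_schur (h := hCen S) (e := cCen S) (t := fun i j => C (T i j))
    (s := fun i j => taylor d (T i j)) (n := n) (q := C q) (r := taylor d q) q1 q2 hCen_reg q3 q4
    (i := i) (k := k) (j := j) (l := l) ?_ ?_ ?_ ?_ ?_ ?_ ?_
  · simp only [GLRel, schur_C, schur_taylor] at this
    exact this
  · intro i' hi j' hj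
    have hi' : i' ∈ [i, k, n] := by simp at hi ⊢; tauto
    have hj' : j' ∈ [j, l, n] := by simp at hj ⊢; tauto
    exact GLRel.comm_schur q1 q2 hk hCen_reg
      (H _ hi' n (by simp) _ hj' n (by simp) (by simp) (by simp))
      (H _ hi' n (by simp) n (by simp) n (by simp) (by simp) (by simp))
      (H n (by simp) n (by simp) _ hj' n (by simp) (by simp) (by simp))
  · intro i' hi
    have hi' : i' ∈ [i, k, n] := by simp at hi ⊢; tauto
    exact GLRel.schur_row q1 q2
      (H _ hi' n (by simp) _ (by simp) _ (by simp) (by simp) (by simp))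
      (H _ hi' n (by simp) n (by simp) _ (by simp) (by simp) (by simp))
      (H n (by simp) n (by simp) _ (by simp) _ (by simp) (by simp) (by simp))
      (H n (by simp) n (by simp) n (by simp) _ (by simp) (by simp) (by simp))
  · intro j' hj
    have hj' : j' ∈ [j, l, n] := by simp at hj ⊢; tauto
    exact GLRel.schur_col q1 q2
      (H _ (by simp) _ (by simp) _ hj' n (by simp) (by simp) (by simp))
      (H n (by simp) _ (by simp) _ hj' n (by simp) (by simp) (by simp))
      (H _ (by simp) _ (by simp) n (by simp) n (by simp) (by simp) (by simp))
      (H n (by simp) _ (by simp) n (by simp) n (by simp) (by simp) (by simp))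
  · exact H _ (by simp) _ (by simp) _ (by simp) _ (by simp) (by simp) (by simp)
  · exact H _ (by simp) _ (by simp) _ (by simp) _ (by simp) (by simp) (by simp)
  · exact H _ (by simp) _ (by simp) _ (by simp) _ (by simp) (by simp) (by simp)
  · exact H _ (by simp) _ (by simp) _ (by simp) _ (by simp) (by simp) (by simp)

end GLSeries

end YangianDouble

end
noncomputable section

namespace YangianDouble

open PowerSeries Finset.HasAntidiagonal

/-! ### Reduction of the rank -/

section Reduction

variable {S : Type*} [Ring S]

/-- Gauss coordinates on the indices `a ≤ i ≤ b`, with the inverses of the diagonal ones. -/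
structure GaussData (S : Type*) [Ring S] (a b : ℤ) where
  F : ℤ → ℤ → S
  E : ℤ → ℤ → S
  k : ℤ → S
  ki : ℤ → S
  F_diag : ∀ i ∈ Finset.Icc a b, F i i = 1
  E_diag : ∀ i ∈ Finset.Icc a b, E i i = 1
  ki_mul : ∀ i ∈ Finset.Icc a b, ki i * k i = 1
  mul_ki : ∀ i ∈ Finset.Icc a b, k i * ki i = 1

namespace GaussData

variable {a b : ℤ} (G : GaussData S a b)

/-- The matrix composed of the Gauss coordinates with indices up to `m`. -/
def part (m i j : ℤ) : S := ∑ l ∈ Finset.Icc (max i j) m, G.F l i * G.k l * G.E j l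

theorem part_succ {m i j : ℤ} (hi : i < m) (hj : j < m) :
    G.part m i j = G.part (m - 1) i j + G.F m i * G.k m * G.E j m := by
  have : Finset.Icc (max i j) m = insert m (Finset.Icc (max i j) (m - 1)) := by
    ext x
    simp only [Finset.mem_insert, Finset.mem_Icc]
    have := max_lt hi hj
    omega
  rw [part, this, Finset.sum_insert (by simp), add_comm]
  rfl

theorem part_right {m i : ℤ} (hm : m ∈ Finset.Icc a b) (hi : i ≤ m) :
    G.part m i m = G.F m i * G.k m := by
  rw [part, max_eq_right hi, Finset.Icc_self, Finset.sum_singleton, G.E_diag m hm, mul_one]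

theorem part_left {m j : ℤ} (hm : m ∈ Finset.Icc a b) (hj : j ≤ m) :
    G.part m m j = G.k m * G.E j m := by
  rw [part, max_eq_left hj, Finset.Icc_self, Finset.sum_singleton, G.F_diag m hm, one_mul]

theorem part_diag {m : ℤ} (hm : m ∈ Finset.Icc a b) : G.part m m m = G.k m := by
  rw [G.part_right hm le_rfl, G.F_diag m hm, one_mul]

/-- The summand F_{m,i} k_m E_{j,m} is (row entry)(pivot)⁻¹(column entry), so removing it is Gauss
elimination of m. -/
theorem part_schur {m i j : ℤ} (hm : m ∈ Finset.Icc a b) (hi : i < m) (hj : j < m) :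
    schur (G.part m) (G.ki m) m i j = G.part (m - 1) i j := by
  rw [schur, G.part_right hm hi.le, G.part_left hm hj.le, G.part_succ hi hj,
    mul_assoc (G.F m i * G.k m), ← mul_assoc (G.ki m), G.ki_mul m hm, one_mul,
    add_sub_cancel_right]

/-- Repeated elimination of the top index keeps the same inverse `y`, restricted to the remaining
indices. Low Gauss coordinates thereby become visible in the low corner of `y`. -/
theorem mutInv_part {m : ℤ} {y : ℤ → ℤ → S} (hm : m ≤ b) {a' : ℤ} (ha : a ≤ a')
    (h : MutInv (Finset.Icc a' m) (G.part m) y) (r : ℕ) (hr : a' ≤ m - r) :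
    MutInv (Finset.Icc a' (m - r)) (G.part (m - r)) y := by
  induction r with
  | zero => simpa using h
  | succ r ih =>
    have ih := ih (by push_cast at hr; omega)
    push_cast at hr
    have hmr : m - r ∈ Finset.Icc a b := by rw [Finset.mem_Icc]; omega
    have h2 := ih.schur (n := m - r) (by rw [Finset.mem_Icc]; omega) (q := G.ki (m - r))
      (by rw [G.part_diag hmr, G.ki_mul _ hmr]) (by rw [G.part_diag hmr, G.mul_ki _ hmr])
    have e : (Finset.Icc a' (m - r)).erase (m - r) = Finset.Icc a' (m - (r + 1 : ℕ)) := by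
      ext x
      simp only [Finset.mem_erase, Finset.mem_Icc]
      push_cast
      omega
    rw [e] at h2
    refine h2.congr (fun i hi j hj => ?_) fun _ _ _ _ => rfl
    rw [Finset.mem_Icc] at hi hj
    push_cast at hi hj ⊢
    rw [G.part_schur hmr (by omega) (by omega), sub_sub]

theorem inv_corner {m : ℤ} {y : ℤ → ℤ → S} (hm : m ≤ b) {a' : ℤ} (ha : a ≤ a') (ham : a' ≤ m)
    (h : MutInv (Finset.Icc a' m) (G.part m) y) :
    G.k a' * y a' a' = 1 ∧ y a' a' * G.k a' = 1 := by
  have h := G.mutInv_part hm ha h (m - a').toNat (by omega)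
  rw [show m - ((m - a').toNat : ℤ) = a' by omega, Finset.Icc_self] at h
  have h1 := h.1 a' (by simp) a' (by simp)
  have h2 := h.2 a' (by simp) a' (by simp)
  rw [Finset.sum_singleton, G.part_diag (by rw [Finset.mem_Icc]; omega), if_pos rfl] at h1 h2
  exact ⟨h1, h2⟩

/-- After reduction to the block of a' and a'+1, the off-diagonal equations of the inverse carry a
common factor k_{a'+1}, which is cancelled. -/
theorem inv_adjacent {m : ℤ} {y : ℤ → ℤ → S} (hm : m ≤ b) {a' : ℤ} (ha : a ≤ a') (ham : a' < m)
    (h : MutInv (Finset.Icc a' m) (G.part m) y) :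
    y a' (a' + 1) = -(y a' a' * G.F (a' + 1) a') ∧
      y (a' + 1) a' = -(G.E a' (a' + 1) * y a' a') := by
  have h := G.mutInv_part hm ha h (m - (a' + 1)).toNat (by omega)
  have e : Finset.Icc a' (a' + 1) = {a', a' + 1} := by
    ext x
    simp only [Finset.mem_insert, Finset.mem_singleton, Finset.mem_Icc]
    omega
  have hmem : a' + 1 ∈ Finset.Icc a b := by rw [Finset.mem_Icc]; omega
  rw [show m - ((m - (a' + 1)).toNat : ℤ) = a' + 1 by omega, e] at h
  have h1 := h.2 a' (by simp) (a' + 1) (by simp)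
  have h2 := h.1 (a' + 1) (by simp) a' (by simp)
  rw [Finset.sum_pair (by omega), G.part_diag hmem, G.part_right hmem (by omega),
    if_neg (by omega)] at h1
  rw [Finset.sum_pair (by omega), G.part_diag hmem, G.part_left hmem (by omega),
    if_neg (by omega)] at h2
  constructor
  · have := congrArg (· * G.ki (a' + 1)) h1
    simp only [add_mul, mul_assoc, G.mul_ki _ hmem, mul_one, zero_mul] at this
    exact eq_neg_of_add_eq_zero_right this
  · have := congrArg (G.ki (a' + 1) * ·) h2
    simp only [mul_add, ← mul_assoc, G.ki_mul _ hmem, one_mul, mul_zero] at this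
    exact eq_neg_of_add_eq_zero_right this

end GaussData

variable [Algebra ℂ⟦X⟧ S] [CComplete S]

/-- The symmetry data: the involution `i ↦ s - i`, signs and the parameter `κ_m = m + σ` for the
indices `s - m, …, m`. -/
structure SymData where
  s : ℤ
  ε : ℤ → ℤ
  ε_sq : ∀ i, ε i * ε i = 1
  σ : ℂ

/-- The family inverse to the `T`-operator: `ε_i ε_j T_{j'i'}(u - κ c) v(u)⁻¹`. -/
def SymData.dual (D : SymData) (d : Deriv S) (T : ℤ → ℤ → S) (m : ℤ) (vi : S) (i j : ℤ) : S :=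
  (D.ε i * D.ε j) • (sigma d (m + D.σ) (T (D.s - j) (D.s - i)) * vi)

/-- The relations satisfied by the reduced `T`-operator of rank `m`. -/
structure Stage (D : SymData) (d : Deriv S) (T : ℤ → ℤ → S) (m : ℤ) (v vi : S) : Prop where
  gl : ∀ i ∈ Finset.Icc (D.s - m) m, ∀ k ∈ Finset.Icc (D.s - m) m, ∀ j ∈ Finset.Icc (D.s - m) m,
    ∀ l ∈ Finset.Icc (D.s - m) m, i + k ≠ D.s → j + l ≠ D.s → GLSer d T i k j l
  inv : MutInv (Finset.Icc (D.s - m) m) T (D.dual d T m vi)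
  v_mul : v * vi = 1
  mul_v : vi * v = 1
  comm : ∀ i ∈ Finset.Icc (D.s - m) m, ∀ j ∈ Finset.Icc (D.s - m) m, ∀ x : ℂ,
    Commute v (sigma d x (T i j))

variable {D : SymData} {d : Deriv S} {a b m : ℤ} {G : GaussData S a b} {v vi : S}

/-- The lowest diagonal entry of the inverse is k_{D.s-m}⁻¹ by elimination, and k_m(u-κ_m c) v⁻¹ by
the symmetry, where κ_m = m + σ. -/
theorem Stage.k_eq (h : Stage D d (G.part m) m v vi) (ha : a ≤ D.s - m) (hb : m ≤ b)
    (hm : D.s ≤ 2 * m) : G.k (D.s - m) = sigma d (m + D.σ) (G.ki m) * v := by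
  have h1 := (G.inv_corner hb ha (by omega) h.inv).1
  have hmem : m ∈ Finset.Icc a b := by rw [Finset.mem_Icc]; omega
  rw [SymData.dual, D.ε_sq, one_smul, sub_sub_cancel, G.part_diag hmem] at h1
  have c1 := h.comm m (by rw [Finset.mem_Icc]; omega) m (by rw [Finset.mem_Icc]; omega) (m + D.σ)
  rw [G.part_diag hmem] at c1
  have e1 : sigma d (m + D.σ) (G.k m) * sigma d (m + D.σ) (G.ki m) = 1 := by
    rw [← map_mul, G.mul_ki m hmem, map_one]
  have e2 : sigma d (m + D.σ) (G.ki m) * sigma d (m + D.σ) (G.k m) = 1 := by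
    rw [← map_mul, G.ki_mul m hmem, map_one]
  have c2 : sigma d (m + D.σ) (G.ki m) * v = v * sigma d (m + D.σ) (G.ki m) :=
    inv_comm e2 e1 c1.eq.symm
  calc G.k (D.s - m) = G.k (D.s - m) * (sigma d (m + D.σ) (G.k m) * (vi * v) *
        sigma d (m + D.σ) (G.ki m)) := by rw [h.mul_v, mul_one, e1, mul_one]
    _ = (G.k (D.s - m) * (sigma d (m + D.σ) (G.k m) * vi)) * (v * sigma d (m + D.σ) (G.ki m)) := by
      simp only [mul_assoc]
    _ = _ := by rw [h1, one_mul, c2]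

/-- Properties of the top index of a stage. -/
theorem Stage.fe_eq (h : Stage D d (G.part m) m v vi) (ha : a ≤ D.s - m) (hb : m ≤ b)
    (hm : D.s + 1 < 2 * m) (hε : D.ε (D.s - m) * D.ε (D.s - m + 1) = 1) :
    G.F (D.s - m + 1) (D.s - m) = -sigma d (m + D.σ - 1) (G.F m (m - 1)) ∧
      G.E (D.s - m) (D.s - m + 1) = -sigma d (m + D.σ - 1) (G.E (m - 1) m) := by
  have hmem : m ∈ Finset.Icc a b := by rw [Finset.mem_Icc]; omega
  have hJ : m ∈ Finset.Icc (D.s - m) m := by rw [Finset.mem_Icc]; omega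
  have hJ' : m - 1 ∈ Finset.Icc (D.s - m) m := by rw [Finset.mem_Icc]; omega
  obtain ⟨h1, h2⟩ := G.inv_adjacent hb ha (by omega) h.inv
  have hd := G.part_diag hmem
  have hq : G.ki m * G.part m m m = 1 := by rw [hd, G.ki_mul m hmem]
  have hq' : G.part m m m * G.ki m = 1 := by rw [hd, G.mul_ki m hmem]
  have g0 := h.gl m hJ m hJ m hJ m hJ (by omega) (by omega)
  have g1 := GLSer.shift_col hq hq' g0
    (h.gl (m - 1) hJ' m hJ m hJ m hJ (by omega) (by omega))
  have g2 := GLSer.shift_row hq hq' g0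
    (h.gl m hJ m hJ (m - 1) hJ' m hJ (by omega) (by omega))
  have pr := G.part_right hmem (i := m - 1) (by omega)
  have pl := G.part_left hmem (j := m - 1) (by omega)
  have eF : G.part m (m - 1) m * G.ki m = G.F m (m - 1) := by
    rw [pr, mul_assoc, G.mul_ki m hmem, mul_one]
  have eE : G.ki m * G.part m m (m - 1) = G.E (m - 1) m := by
    rw [pl, ← mul_assoc, G.ki_mul m hmem, one_mul]
  rw [eF] at g1
  rw [eE] at g2
  -- Shifting the relation at v = u - c by κ_m - 1 expresses T_{m-1,m}(u-κ_m c) through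
  -- F_{m,m-1}(u-(κ_m-1)c). This is where the shift of F and E becomes one less than κ_m.
  have g1 := congrArg (sigma d (m + D.σ - 1)) g1
  have g2 := congrArg (sigma d (m + D.σ - 1)) g2
  rw [map_mul, sigma_sigma, sigma_sigma, sub_add_cancel, hd] at g1 g2
  have cF := h.comm (m - 1) hJ' m hJ (m + D.σ)
  have cK := h.comm m hJ m hJ (m + D.σ)
  rw [hd] at cK
  have e1 : sigma d (m + D.σ) (G.k m) * sigma d (m + D.σ) (G.ki m) = 1 := by
    rw [← map_mul, G.mul_ki m hmem, map_one]
  have e2 : sigma d (m + D.σ) (G.ki m) * sigma d (m + D.σ) (G.k m) = 1 := by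
    rw [← map_mul, G.ki_mul m hmem, map_one]
  simp only [SymData.dual, D.ε_sq, one_smul, sub_sub_cancel, hd, hε,
    mul_comm (D.ε (D.s - m + 1)), show D.s - (D.s - m + 1) = m - 1 by ring] at h1 h2
  constructor
  · set f := sigma d (m + D.σ - 1) (G.F m (m - 1))
    set K := sigma d (m + D.σ) (G.k m)
    set Ki := sigma d (m + D.σ) (G.ki m)
    have cK2 := (inv_comm e2 e1 cK.eq.symm)
    have cf : v * f = f * v := by
      have : f = Ki * sigma d (m + D.σ) (G.part m (m - 1) m) := by
        rw [← g1, ← mul_assoc, e2, one_mul]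
      rw [this, ← mul_assoc, ← cK2, mul_assoc, cF.eq, mul_assoc]
    rw [← g1] at h1
    have h3 := congrArg (fun x => v * Ki * x) h1
    simp only [mul_neg] at h3
    rw [eq_neg_iff_add_eq_zero] at h3 ⊢
    have e3 : v * Ki * (K * f * vi) = f := by
      calc _ = v * (Ki * K) * f * vi := by simp only [mul_assoc]
        _ = f := by rw [e2, mul_one, cf, mul_assoc, h.v_mul, mul_one]
    have e4 : v * Ki * (K * vi * G.F (D.s - m + 1) (D.s - m)) = G.F (D.s - m + 1) (D.s - m) := by
      calc _ = v * (Ki * K) * vi * G.F (D.s - m + 1) (D.s - m) := by simp only [mul_assoc]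
        _ = _ := by rw [e2, mul_one, h.v_mul, one_mul]
    rw [e3, e4] at h3
    rw [add_comm, h3]
  · rw [← g2] at h2
    have h3 := congrArg (fun x => x * (v * sigma d (m + D.σ) (G.ki m))) h2
    have e3 : ∀ x : S, x * sigma d (m + D.σ) (G.k m) * vi * (v * sigma d (m + D.σ) (G.ki m)) = x := by
      intro x
      calc _ = x * (sigma d (m + D.σ) (G.k m) * (vi * v) * sigma d (m + D.σ) (G.ki m)) := by
            simp only [mul_assoc]
        _ = x := by rw [h.mul_v, mul_one, e1, mul_one]
    simp only [neg_mul] at h3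
    rw [← mul_assoc (G.E _ _), e3, e3] at h3
    rw [h3, neg_neg]

/-- The induction on the rank. The index m disappears from T by a Schur complement, and the opposite
index disappears from the inverse by another one; the result is again a shifted transpose, with
κ_{m-1} = κ_m - 1. The discrepancy between the two complements is the ratio of k_m at consecutive
shifts, which is absorbed in `v`. -/
theorem Stage.step (h : Stage D d (G.part m) m v vi) (ha : a ≤ D.s - m) (hb : m ≤ b)
    (hm : D.s < 2 * m) :
    Stage D d (G.part (m - 1)) (m - 1)
      (sigma d (m + D.σ - 1) (G.k m) * sigma d (m + D.σ) (G.ki m) * v)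
      (vi * (sigma d (m + D.σ) (G.k m) * sigma d (m + D.σ - 1) (G.ki m))) := by
  have hmem : m ∈ Finset.Icc a b := by rw [Finset.mem_Icc]; omega
  have hJ : m ∈ Finset.Icc (D.s - m) m := by rw [Finset.mem_Icc]; omega
  have hd := G.part_diag hmem
  have hq : G.ki m * G.part m m m = 1 := by rw [hd, G.ki_mul m hmem]
  have hq' : G.part m m m * G.ki m = 1 := by rw [hd, G.mul_ki m hmem]
  have sub : ∀ i ∈ Finset.Icc (D.s - (m - 1)) (m - 1),
      i ∈ Finset.Icc (D.s - m) m ∧ i < m ∧ i + m ≠ D.s := by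
    intro i hi
    rw [Finset.mem_Icc] at hi ⊢
    omega
  have opp : ∀ i ∈ Finset.Icc (D.s - (m - 1)) (m - 1),
      D.s - i ∈ Finset.Icc (D.s - (m - 1)) (m - 1) := by
    intro i hi
    rw [Finset.mem_Icc] at hi ⊢
    omega
  have g0 := h.gl m hJ m hJ m hJ m hJ (by omega) (by omega)
  have hs : ∀ i < m, ∀ j < m, G.part (m - 1) i j = schur (G.part m) (G.ki m) m i j :=
    fun i hi j hj => (G.part_schur hmem hi hj).symm
  have e1 : ∀ x, sigma d x (G.k m) * sigma d x (G.ki m) = 1 := fun x => by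
    rw [← map_mul, G.mul_ki m hmem, map_one]
  have e2 : ∀ x, sigma d x (G.ki m) * sigma d x (G.k m) = 1 := fun x => by
    rw [← map_mul, G.ki_mul m hmem, map_one]
  have cv : ∀ x, Commute v (sigma d x (G.k m)) := fun x => by
    rw [← hd]; exact h.comm m hJ m hJ x
  have cvi : ∀ x, Commute v (sigma d x (G.ki m)) := fun x =>
    (inv_comm (e2 x) (e1 x) (cv x).eq.symm : _ = _).symm
  refine ⟨?_, ?_, ?_, ?_, ?_⟩
  · intro i hi k hk j hj l hl hik hjl
    have key : GLSer d (schur (G.part m) (G.ki m) m) i k j l := by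
      refine GLSer.schur hq hq' ?_
      intro x hx y hy x' hx' y' hy' hxy hxy'
      have mem : ∀ i k x, i ∈ Finset.Icc (D.s - (m - 1)) (m - 1) →
          k ∈ Finset.Icc (D.s - (m - 1)) (m - 1) → x ∈ [i, k, m] →
          x ∈ Finset.Icc (D.s - m) m ∧ (x + m ≠ D.s) := by
        intro i k x hi hk hx
        simp only [List.mem_cons, List.not_mem_nil, or_false] at hx
        rcases hx with rfl | rfl | rfl
        · exact ⟨(sub _ hi).1, (sub _ hi).2.2⟩
        · exact ⟨(sub _ hk).1, (sub _ hk).2.2⟩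
        · exact ⟨hJ, by omega⟩
      refine h.gl x (mem i k x hi hk hx).1 y (mem i k y hi hk hy).1 x' (mem j l x' hj hl hx').1
        y' (mem j l y' hj hl hy').1 ?_ ?_
      · rcases hxy with rfl | rfl | ⟨rfl, rfl⟩
        · rw [add_comm]; exact (mem i k y hi hk hy).2
        · exact (mem i k x hi hk hx).2
        · exact hik
      · rcases hxy' with rfl | rfl | ⟨rfl, rfl⟩
        · rw [add_comm]; exact (mem j l y' hj hl hy').2
        · exact (mem j l x' hj hl hx').2
        · exact hjl
    unfold GLSer GLRel at key ⊢
    simpa only [hs _ (sub i hi).2.1 _ (sub j hj).2.1, hs _ (sub k hk).2.1 _ (sub l hl).2.1,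
      hs _ (sub i hi).2.1 _ (sub l hl).2.1, hs _ (sub k hk).2.1 _ (sub j hj).2.1] using key
  -- After m is eliminated from T, the roles of T and its inverse are exchanged and the opposite
  -- index is eliminated from the inverse; the pivot there is k_m(u-κ_m c) v⁻¹.
  · have i1 := (h.inv.schur hJ hq hq').symm
    have hn' : D.s - m ∈ (Finset.Icc (D.s - m) m).erase m := by
      rw [Finset.mem_erase, Finset.mem_Icc]; omega
    have yd : D.dual d (G.part m) m vi (D.s - m) (D.s - m) = sigma d (m + D.σ) (G.k m) * vi := by
      rw [SymData.dual, D.ε_sq, one_smul, sub_sub_cancel, hd]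
    have i2 := (i1.schur hn' (q := v * sigma d (m + D.σ) (G.ki m))
      (by
        rw [yd]
        calc _ = v * (sigma d (m + D.σ) (G.ki m) * sigma d (m + D.σ) (G.k m)) * vi := by
              simp only [mul_assoc]
          _ = 1 := by rw [e2, mul_one, h.v_mul])
      (by
        rw [yd]
        calc _ = sigma d (m + D.σ) (G.k m) * (vi * v) * sigma d (m + D.σ) (G.ki m) := by
              simp only [mul_assoc]
          _ = 1 := by rw [h.mul_v, mul_one, e1])).symm
    have hJJ : ((Finset.Icc (D.s - m) m).erase m).erase (D.s - m) =
        Finset.Icc (D.s - (m - 1)) (m - 1) := by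
      ext x
      simp only [Finset.mem_erase, Finset.mem_Icc]
      omega
    rw [hJJ] at i2
    refine i2.congr (fun i hi j hj => (hs _ (sub i hi).2.1 _ (sub j hj).2.1).symm)
      fun i hi j hj => ?_
    have hp := sub _ (opp j hj)
    have hq2 := sub _ (opp i hi)
    -- The Schur complement of the dual family has its inverse pivot in the middle, whereas
    -- `shift_schur` has it at the end; `shift_col` moves it. A shift by κ_m - 1 then gives the
    -- required identity.
    have r1 := GLSer.shift_schur hq hq' (h.gl _ hp.1 m hJ m hJ _ hq2.1 hp.2.2 (by omega))
      (h.gl m hJ m hJ m hJ _ hq2.1 (by omega) (by omega))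
    have r2 := GLSer.shift_col hq hq' g0 (h.gl _ hp.1 m hJ m hJ m hJ hp.2.2 (by omega))
    have r3 : G.part m (D.s - j) m * G.ki m =
        sigma d 1 (G.ki m) * sigma d 1 (G.part m (D.s - j) m) := by
      rw [← r2, ← mul_assoc, hd, e2, one_mul]
    rw [r3] at r1
    have r4 := congrArg (sigma d (m + D.σ - 1)) r1
    simp only [map_mul, map_sub, sigma_sigma, sub_add_cancel, hd] at r4
    rw [YangianDouble.schur]
    simp only [SymData.dual, sub_sub_cancel]
    have hε : (D.ε i * D.ε (D.s - m)) * (D.ε (D.s - m) * D.ε j) = D.ε i * D.ε j := by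
      rw [mul_assoc, ← mul_assoc (D.ε (D.s - m)), D.ε_sq, one_mul]
    simp only [smul_mul_assoc, mul_smul_comm, ← mul_smul]
    rw [mul_comm (D.ε (D.s - m) * D.ε j), hε, ← smul_sub]
    congr 1
    have e5 : ((m - 1 : ℤ) : ℂ) + D.σ = m + D.σ - 1 := by push_cast; ring
    rw [hs _ hp.2.1 _ hq2.2.1, e5]
    set A := sigma d (m + D.σ) (G.part m (D.s - j) (D.s - i))
    set B := sigma d (m + D.σ) (G.part m m (D.s - i))
    set A' := sigma d (m + D.σ) (G.part m (D.s - j) m)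
    set K := sigma d (m + D.σ) (G.k m)
    set Ki := sigma d (m + D.σ) (G.ki m)
    have cx : Commute vi (K * sigma d (m + D.σ - 1) (G.ki m)) :=
      inv_comm h.mul_v h.v_mul ((cv _).mul_right (cvi _)).eq
    rw [cx.eq, ← mul_assoc _ (K * _) vi, ← mul_assoc _ K, ← r4, sub_mul]
    congr 1
    calc B * vi * (v * Ki) * (A' * vi) = B * (vi * v) * Ki * A' * vi := by simp only [mul_assoc]
      _ = _ := by rw [h.mul_v, mul_one, mul_assoc B]
  · calc _ = sigma d (m + D.σ - 1) (G.k m) * (sigma d (m + D.σ) (G.ki m) * (v * vi) *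
        sigma d (m + D.σ) (G.k m)) * sigma d (m + D.σ - 1) (G.ki m) := by simp only [mul_assoc]
      _ = 1 := by rw [h.v_mul, mul_one, e2, mul_one, e1]
  · calc _ = vi * (sigma d (m + D.σ) (G.k m) * (sigma d (m + D.σ - 1) (G.ki m) *
        sigma d (m + D.σ - 1) (G.k m)) * sigma d (m + D.σ) (G.ki m)) * v := by simp only [mul_assoc]
      _ = 1 := by rw [e2, mul_one, e1, mul_one, h.mul_v]
  · intro i hi j hj x
    rw [hs _ (sub i hi).2.1 _ (sub j hj).2.1]
    have c1 : ∀ y, Commute (sigma d x (schur (G.part m) (G.ki m) m i j)) (sigma d y (G.k m)) := by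
      intro y
      have := GLSer.comm_sigma hq hq' g0
        (h.gl i (sub i hi).1 m hJ j (sub j hj).1 m hJ (sub i hi).2.2 (sub j hj).2.2)
        (h.gl i (sub i hi).1 m hJ m hJ m hJ (sub i hi).2.2 (by omega))
        (h.gl m hJ m hJ j (sub j hj).1 m hJ (by omega) (sub j hj).2.2) x y
      rwa [hd] at this
    have c2 : ∀ y, Commute (sigma d x (schur (G.part m) (G.ki m) m i j)) (sigma d y (G.ki m)) :=
      fun y => (inv_comm (e2 y) (e1 y) (c1 y).eq.symm : _ = _).symm
    -- The old factor commutes with all entries from which the quasi-determinant is built; the new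
    -- ratio of diagonal coordinates commutes with it by `GLSer.comm_sigma`.
    have c3 : Commute v (sigma d x (schur (G.part m) (G.ki m) m i j)) := by
      simp only [YangianDouble.schur, map_sub, map_mul]
      exact (h.comm i (sub i hi).1 j (sub j hj).1 x).sub_right
        (((h.comm i (sub i hi).1 m hJ x).mul_right (cvi x)).mul_right
          (h.comm m hJ j (sub j hj).1 x))
    exact ((c1 _).symm.mul_left (c2 _).symm).mul_left c3

end Reduction

end YangianDouble

end
noncomputable section

namespace YangianDouble

open PowerSeries Finset.HasAntidiagonal

/-! ### Series in two variables -/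

section TwoVariables

variable {R : Type*} [Ring R]

/-- The restriction of a series in two variables to the diagonal. -/
def diag : R⟦X⟧⟦X⟧ →+* R⟦X⟧ where
  toFun F := PowerSeries.mk fun q => ∑ p ∈ antidiagonal q, coeff p.1 (coeff p.2 F)
  map_one' := by
    ext q
    rw [coeff_mk, coeff_one]
    rw [Finset.sum_eq_single (q, 0)]
    · simp [coeff_one]
    · rintro ⟨a, b⟩ h hne
      have hb : b ≠ 0 := by
        rintro rfl
        simp at h
        exact hne (by simp [h])
      simp [coeff_one, hb]
    · intro h
      simp at h
  map_zero' := by ext; simp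
  map_add' F G := by ext; simp [Finset.sum_add_distrib]
  map_mul' F G := by
    ext q
    rw [coeff_mk, coeff_mul]
    simp only [coeff_mk, coeff_mul, map_sum, Finset.sum_mul_sum]
    rw [Finset.sum_sigma', Finset.sum_sigma', Finset.sum_sigma', Finset.sum_sigma']
    refine Finset.sum_bij'
      (fun p _ => ⟨⟨(p.2.1 + p.1.2.1, p.2.2 + p.1.2.2), (p.2.1, p.1.2.1)⟩, (p.2.2, p.1.2.2)⟩)
      (fun p _ => ⟨⟨(p.1.2.1 + p.2.1, p.1.2.2 + p.2.2), (p.1.2.2, p.2.2)⟩, (p.1.2.1, p.2.1)⟩)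
      ?_ ?_ ?_ ?_ ?_
    · rintro ⟨⟨⟨a, b⟩, ⟨b1, b2⟩⟩, ⟨a1, a2⟩⟩ h
      simp at h ⊢
      omega
    · rintro ⟨⟨⟨a, b⟩, ⟨b1, b2⟩⟩, ⟨a1, a2⟩⟩ h
      simp at h ⊢
      omega
    · rintro ⟨⟨⟨a, b⟩, ⟨b1, b2⟩⟩, ⟨a1, a2⟩⟩ h
      simp at h ⊢
      omega
    · rintro ⟨⟨⟨a, b⟩, ⟨b1, b2⟩⟩, ⟨a1, a2⟩⟩ h
      simp at h ⊢
      omega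
    · rintro ⟨⟨⟨a, b⟩, ⟨b1, b2⟩⟩, ⟨a1, a2⟩⟩ h
      rfl

theorem coeff_diag (F : R⟦X⟧⟦X⟧) (q : ℕ) :
    coeff q (diag F) = ∑ p ∈ antidiagonal q, coeff p.1 (coeff p.2 F) :=
  coeff_mk (R := R) q fun q => ∑ p ∈ antidiagonal q, coeff p.1 (coeff p.2 F)

/-- A series in the first variable. -/
def inl : R⟦X⟧ →+* R⟦X⟧⟦X⟧ := C

/-- A series in the second variable. -/
def inr : R⟦X⟧ →+* R⟦X⟧⟦X⟧ := PowerSeries.map C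

theorem diag_inl (f : R⟦X⟧) : diag (inl f) = f := by
  ext q
  rw [coeff_diag, Finset.sum_eq_single (q, 0)]
  · simp [inl]
  · rintro ⟨a, b⟩ h hne
    have hb : b ≠ 0 := by
      rintro rfl
      simp at h
      exact hne (by simp [h])
    simp [inl, coeff_C, hb]
  · intro h
    simp at h

theorem diag_inr (f : R⟦X⟧) : diag (inr f) = f := by
  ext q
  rw [coeff_diag, Finset.sum_eq_single (0, q)]
  · simp [inr]
  · rintro ⟨a, b⟩ h hne
    have hb : a ≠ 0 := by
      rintro rfl
      simp at h
      exact hne (by simp [h])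
    simp [inr, coeff_C, hb]
  · intro h
    simp at h

/-- The variable `u` is the quotient `num / den` of series in `u⁻¹` or in `u`. -/
def num : Sgn → R⟦X⟧
  | .plus => 1
  | .minus => X

/-- See `num`. -/
def den : Sgn → R⟦X⟧
  | .plus => X
  | .minus => 1

theorem num_comm (μ : Sgn) (f : R⟦X⟧) : num μ * f = f * num μ := by
  cases μ
  · simp [num]
  · exact (commute_X f).symm.eq

theorem den_comm (μ : Sgn) (f : R⟦X⟧) : den μ * f = f * den μ := by
  cases μ
  · exact (commute_X f).symm.eq
  · simp [den]

theorem inr_num (μ : Sgn) : inr (num μ : R⟦X⟧) = num μ := by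
  cases μ <;> simp [num, inr]

theorem inr_den (μ : Sgn) : inr (den μ : R⟦X⟧) = den μ := by
  cases μ <;> simp [den, inr]

theorem inl_comm {f : R⟦X⟧} (hf : ∀ g, f * g = g * f) (F : R⟦X⟧⟦X⟧) : inl f * F = F * inl f := by
  ext1 q
  simp [inl, hf]

variable [Algebra ℂ⟦X⟧ R]

/-- The expansion of a series in `u` and `v` at `v = u - h`. -/
def theta (μ : Sgn) : R⟦X⟧⟦X⟧ →+* R⟦X⟧⟦X⟧ := (PowerSeries.map diag).comp (taylor (dU μ))

theorem hasse_C (μ : Sgn) (r : R) (m : ℕ) :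
    hasse (dU μ).map m (C r) = if m = 0 then C r else 0 := by
  have h0 : (dU μ).map (C r) = 0 := by
    ext q
    cases μ with
    | plus =>
      cases q with
      | zero => rw [coeff_zero_dU_plus, map_zero]
      | succ q =>
        rw [coeff_succ_dU_plus, coeff_C]
        split_ifs with h <;> simp [h]
    | minus => rw [coeff_dU_minus, coeff_C]; simp
  refine hasse_ext (G := fun m => if m = 0 then C r else 0) (by simp) (fun m => ?_) m
  by_cases h : m = 0 <;> simp [h, h0]

theorem theta_inl (μ : Sgn) (f : R⟦X⟧) : theta μ (inl f) = C f := by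
  ext1 m
  rw [theta, RingHom.comp_apply, PowerSeries.coeff_map, coeff_taylor, inl, hasse_C]
  by_cases h : m = 0
  · subst h
    simpa [inl] using diag_inl f
  · simp [h, coeff_C]

theorem theta_inr (μ : Sgn) (f : R⟦X⟧) : theta μ (inr f) = taylor (dU μ) f := by
  ext1 m
  rw [theta, RingHom.comp_apply, PowerSeries.coeff_map, coeff_taylor, coeff_taylor]
  have : (-1 : ℂ⟦X⟧) ^ m • hasse (dU μ).map m (inr f) =
      inr ((-1 : ℂ⟦X⟧) ^ m • hasse (dU μ).map m f) := by
    ext q r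
    rw [inr, PowerSeries.coeff_smul, PowerSeries.coeff_map, PowerSeries.coeff_smul (n := q)]
    cases μ with
    | plus =>
      rw [coeff_hasse_plus, coeff_hasse_plus, PowerSeries.coeff_map]
      split_ifs <;> by_cases hr : r = 0 <;> simp [coeff_C, hr]
    | minus =>
      rw [coeff_hasse_minus, coeff_hasse_minus, PowerSeries.coeff_map]
      by_cases hr : r = 0 <;> simp [coeff_C, hr]
  rw [this, diag_inr]

/-- For series in u⁻¹ this is the recursion of the geometric series: w = 1/(u-h) satisfies w = u⁻¹ +
h u⁻¹ w. -/
theorem taylor_X_plus : taylor (dU .plus) (X : R⟦X⟧) = C X + X * (C X * taylor (dU .plus) X) := by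
  have key : ∀ m, coeff m (taylor (dU .plus) (X : R⟦X⟧)) = X ^ (m + 1) := by
    intro m
    ext q
    rw [coeff_taylor, PowerSeries.coeff_smul, coeff_hasse_plus, coeff_X, coeff_X_pow]
    by_cases h : q = m + 1
    · subst h
      rw [if_pos (by omega), Nat.add_sub_cancel, Nat.choose_self, Nat.add_sub_cancel_left,
        if_pos rfl, if_pos rfl, ← mul_smul, ← mul_assoc, ← mul_pow]
      simp
    · rw [if_neg h]
      split_ifs with h1 h2
      · omega
      · simp
      · simp
  ext1 m
  cases m with
  | zero => simp [key]
  | succ m =>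
    rw [key, map_add, coeff_succ_X_mul, coeff_C_mul, key, coeff_C, if_neg (Nat.succ_ne_zero m),
      zero_add, ← pow_succ']

theorem taylor_X_minus : taylor (dU .minus) (X : R⟦X⟧) = C X - X := by
  ext m q
  rw [coeff_taylor, PowerSeries.coeff_smul, coeff_hasse_minus, coeff_X]
  rcases m with _ | _ | m
  · simp [coeff_X]
  · by_cases hq : q = 0 <;> simp [coeff_X, coeff_one, hq]
  · rw [if_neg (by omega)]
    simp [coeff_X]

/-- The common denominator after the specialisation. -/
def rho (μ : Sgn) : R⟦X⟧⟦X⟧ := C (den μ) * taylor (dU μ) (den μ)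

theorem theta_den (μ : Sgn) : theta μ (inl (den μ) * inr (den μ) : R⟦X⟧⟦X⟧) = rho μ := by
  rw [map_mul, theta_inl, theta_inr, rho]

/-- The substitution v = u - h turns u - v into h. Both sides carry the common denominator, since u
itself is not a series in u⁻¹. -/
theorem theta_diff (μ : Sgn) :
    theta μ (inl (num μ) * inr (den μ) - inl (den μ) * inr (num μ) : R⟦X⟧⟦X⟧) = X * rho μ := by
  rw [map_sub, map_mul, map_mul, theta_inl, theta_inr, theta_inl, theta_inr, rho]
  cases μ with
  | plus =>
    simp only [num, den, map_one, one_mul, mul_one]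
    rw [sub_eq_iff_eq_add, add_comm]
    exact taylor_X_plus
  | minus =>
    simp only [num, den, map_one, one_mul, mul_one]
    rw [taylor_X_minus, sub_sub_cancel]

omit [Algebra ℂ⟦X⟧ R] in
theorem C_X_reg (F : R⟦X⟧⟦X⟧) (h : C X * F = 0) : F = 0 := by
  ext m q
  have := congrArg (fun G => coeff (q + 1) (coeff m G)) h
  simpa [coeff_C_mul, coeff_succ_X_mul] using this

/-- For series in u⁻¹ the denominator is u⁻¹v⁻¹. If it kills F then v⁻¹F = 0, and u⁻¹ = v⁻¹ - h u⁻¹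
v⁻¹ shows that u⁻¹F = 0 as well. -/
theorem rho_reg (μ : Sgn) (F : R⟦X⟧⟦X⟧) (h : rho μ * F = 0) : F = 0 := by
  cases μ with
  | plus =>
    have h1 := C_X_reg _ ((mul_assoc _ _ _).symm.trans h)
    simp only [den] at h1
    refine C_X_reg _ ?_
    have h2 : (C X : R⟦X⟧⟦X⟧) = taylor (dU .plus) X - X * C X * taylor (dU .plus) X := by
      rw [mul_assoc, eq_sub_iff_add_eq]
      exact taylor_X_plus.symm
    rw [h2, sub_mul, mul_assoc, h1, mul_zero, sub_zero]
  | minus => simpa [rho, den] using h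

theorem taylor_den_comm (μ : Sgn) (F : R⟦X⟧⟦X⟧) :
    taylor (dU μ) (den μ) * F = F * taylor (dU μ) (den μ) := by
  cases μ with
  | minus => simp [den]
  | plus =>
    simp only [den]
    have hc : ∀ m, ∀ f : R⟦X⟧, coeff m (taylor (dU .plus) (X : R⟦X⟧)) * f =
        f * coeff m (taylor (dU .plus) (X : R⟦X⟧)) := by
      intro m
      induction m with
      | zero =>
        intro f
        have : coeff 0 (taylor (dU .plus) (X : R⟦X⟧)) = X := by
          rw [taylor_X_plus]; simp
        rw [this, (commute_X f).eq]
      | succ m ih =>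
        intro f
        have : coeff (m + 1) (taylor (dU .plus) (X : R⟦X⟧)) =
            X * coeff m (taylor (dU .plus) (X : R⟦X⟧)) := by
          conv_lhs => rw [taylor_X_plus]
          simp [coeff_succ_X_mul]
        rw [this, mul_assoc, ih, ← mul_assoc, ← mul_assoc, (commute_X f).eq]
    ext1 q
    rw [coeff_mul, coeff_mul, ← Finset.Nat.sum_antidiagonal_swap]
    exact Finset.sum_congr rfl fun p _ => hc _ _

theorem rho_comm (μ : Sgn) (F : R⟦X⟧⟦X⟧) : rho μ * F = F * rho μ := by
  rw [rho, mul_assoc, taylor_den_comm, ← mul_assoc,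
    show C (den μ) * F = F * C (den μ) from inl_comm (den_comm μ) F, mul_assoc]

theorem theta_smul (μ : Sgn) (r : ℂ⟦X⟧) (F : R⟦X⟧⟦X⟧) : theta μ (r • F) = r • theta μ F := by
  have h : ∀ G : R⟦X⟧⟦X⟧, r • G = inl (C (r • 1)) * G := by
    intro G
    ext
    simp [inl]
  rw [h, h, map_mul, theta_inl, inl]

end TwoVariables

end YangianDouble

end
noncomputable section

namespace YangianDouble

open PowerSeries Finset.HasAntidiagonal

/-! ### The `RTT` relations in matrix form -/

section RTT

variable {R : Type*} [Ring R]

/-- The coefficient of `uᵃ` in `f / den ^ k`. -/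
def cf (μ : Sgn) (k : ℤ) (f : R⟦X⟧) (a : ℤ) : R :=
  match μ with
  | .plus => if a ≤ k then coeff (k - a).toNat f else 0
  | .minus => if 0 ≤ a then coeff a.toNat f else 0

theorem cf_zero (μ : Sgn) (f : R⟦X⟧) (a : ℤ) : cf μ 0 f a = coeffZ μ f a := by
  cases μ <;> simp [cf, coeffZ]

theorem cf_add (μ : Sgn) (k : ℤ) (f f' : R⟦X⟧) (a : ℤ) :
    cf μ k (f + f') a = cf μ k f a + cf μ k f' a := by
  cases μ <;> simp only [cf] <;> split_ifs <;> simp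

theorem cf_C_mul (μ : Sgn) (k : ℤ) (r : R) (f : R⟦X⟧) (a : ℤ) :
    cf μ k (C r * f) a = r * cf μ k f a := by
  cases μ <;> simp only [cf] <;> split_ifs <;> simp

theorem cf_mul_C (μ : Sgn) (k : ℤ) (r : R) (f : R⟦X⟧) (a : ℤ) :
    cf μ k (f * C r) a = cf μ k f a * r := by
  cases μ <;> simp only [cf] <;> split_ifs <;> simp

theorem cf_num_mul (μ : Sgn) (k : ℤ) (f : R⟦X⟧) (a : ℤ) :
    cf μ (k + 1) (num μ * f) a = cf μ k f (a - 1) := by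
  cases μ with
  | plus => simp only [cf, num, one_mul, sub_le_iff_le_add, sub_sub_eq_add_sub]
  | minus =>
    simp only [cf, num]
    by_cases h : 1 ≤ a
    · obtain ⟨m, rfl⟩ : ∃ m : ℕ, a = m + 1 := ⟨(a - 1).toNat, by omega⟩
      rw [if_pos (by omega), if_pos (by omega), show ((m : ℤ) + 1).toNat = m + 1 by omega,
        coeff_succ_X_mul]
      simp
    · rw [if_neg (by omega : ¬ 0 ≤ a - 1)]
      split_ifs
      · rw [show a.toNat = 0 by omega, coeff_zero_X_mul]
      · rfl

theorem cf_den_mul (μ : Sgn) (k : ℤ) (f : R⟦X⟧) (a : ℤ) :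
    cf μ (k + 1) (den μ * f) a = cf μ k f a := by
  cases μ with
  | minus => simp only [cf, den, one_mul]
  | plus =>
    simp only [cf, den]
    by_cases h : a ≤ k
    · obtain ⟨m, hm⟩ : ∃ m : ℕ, k - a = m := ⟨(k - a).toNat, by omega⟩
      rw [if_pos (by omega), if_pos (by omega), show (k + 1 - a).toNat = m + 1 by omega,
        coeff_succ_X_mul, hm, Int.toNat_natCast]
    · rw [if_neg h]
      split_ifs
      · rw [show (k + 1 - a).toNat = 0 by omega, coeff_zero_X_mul]
      · rfl

theorem cf_ext (μ : Sgn) (k : ℤ) (f : R⟦X⟧) (h : ∀ a, cf μ k f a = 0) : f = 0 := by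
  ext m
  cases μ with
  | plus =>
    have := h (k - m)
    rw [cf, if_pos (by omega), sub_sub_cancel] at this
    simpa using this
  | minus =>
    have := h m
    rw [cf, if_pos (by omega)] at this
    simpa using this

/-- The coefficient of `uᵃ vᵇ` in `F / (den_u den_v) ^ k`. -/
def cW (μ ν : Sgn) (k : ℤ) (F : R⟦X⟧⟦X⟧) (a b : ℤ) : R := cf μ k (cf ν k F b) a

theorem cW_add (μ ν : Sgn) (k : ℤ) (F G : R⟦X⟧⟦X⟧) (a b : ℤ) :
    cW μ ν k (F + G) a b = cW μ ν k F a b + cW μ ν k G a b := by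
  simp only [cW, cf_add]

/-- `cW` as an additive map. -/
def cWHom (μ ν : Sgn) (k : ℤ) (a b : ℤ) : R⟦X⟧⟦X⟧ →+ R where
  toFun F := cW μ ν k F a b
  map_zero' := by simpa using cW_add μ ν k (0 : R⟦X⟧⟦X⟧) 0 a b
  map_add' F G := cW_add μ ν k F G a b

theorem cW_sub (μ ν : Sgn) (k : ℤ) (F G : R⟦X⟧⟦X⟧) (a b : ℤ) :
    cW μ ν k (F - G) a b = cW μ ν k F a b - cW μ ν k G a b := map_sub (cWHom μ ν k a b) F G

theorem cW_sum {ι : Type*} (s : Finset ι) (μ ν : Sgn) (k : ℤ) (F : ι → R⟦X⟧⟦X⟧) (a b : ℤ) :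
    cW μ ν k (∑ i ∈ s, F i) a b = ∑ i ∈ s, cW μ ν k (F i) a b :=
  map_sum (cWHom μ ν k a b) F s

theorem cW_C_C_mul (μ ν : Sgn) (k : ℤ) (r : R) (F : R⟦X⟧⟦X⟧) (a b : ℤ) :
    cW μ ν k (C (C r) * F) a b = r * cW μ ν k F a b := by
  rw [cW, cf_C_mul, cf_C_mul, cW]

theorem cW_mul_C_C (μ ν : Sgn) (k : ℤ) (r : R) (F : R⟦X⟧⟦X⟧) (a b : ℤ) :
    cW μ ν k (F * C (C r)) a b = cW μ ν k F a b * r := by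
  rw [cW, cf_mul_C, cf_mul_C, cW]

theorem cf_inr (ν : Sgn) (k : ℤ) (f : R⟦X⟧) (b : ℤ) : cf ν k (inr f) b = C (cf ν k f b) := by
  cases ν <;> simp only [cf, inr] <;> split_ifs <;> simp

theorem cW_inl_inr (μ ν : Sgn) (f f' : R⟦X⟧) (a b : ℤ) :
    cW μ ν 0 (inl f * inr f') a b = coeffZ μ f a * coeffZ ν f' b := by
  rw [cW, inl, cf_C_mul, cf_inr, cf_mul_C, cf_zero, cf_zero]

theorem cf_mul_C' (ν : Sgn) (k : ℤ) (f : R⟦X⟧) (f' : R⟦X⟧) (b : ℤ) :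
    cf ν k (inr f' * inl f) b = C (cf ν k f' b) * f := by
  rw [inl, cf_mul_C, cf_inr]

theorem cW_inr_inl (μ ν : Sgn) (f f' : R⟦X⟧) (a b : ℤ) :
    cW μ ν 0 (inr f' * inl f) a b = coeffZ ν f' b * coeffZ μ f a := by
  rw [cW, cf_mul_C', cf_C_mul, cf_zero, cf_zero]

theorem cW_ext (μ ν : Sgn) (k : ℤ) (F : R⟦X⟧⟦X⟧) (h : ∀ a b, cW μ ν k F a b = 0) : F = 0 :=
  cf_ext ν k F fun b => cf_ext μ k _ fun a => h a b

theorem inl_num_comm (μ : Sgn) (F : R⟦X⟧⟦X⟧) : inl (num μ) * F = F * inl (num μ) :=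
  inl_comm (num_comm μ) F

theorem inl_den_comm (μ : Sgn) (F : R⟦X⟧⟦X⟧) : inl (den μ) * F = F * inl (den μ) :=
  inl_comm (den_comm μ) F

theorem inr_num_comm (μ : Sgn) (F : R⟦X⟧⟦X⟧) : inr (num μ) * F = F * inr (num μ) := by
  rw [inr_num, num_comm]

theorem inr_den_comm (μ : Sgn) (F : R⟦X⟧⟦X⟧) : inr (den μ) * F = F * inr (den μ) := by
  rw [inr_den, den_comm]

theorem mem_center_mul {W : Type*} [Ring W] {x y : W} (hx : ∀ z, x * z = z * x)
    (hy : ∀ z, y * z = z * y) : x * y ∈ Subring.center W :=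
  Subring.mul_mem _ (Subring.mem_center_iff.2 fun g => (hx g).symm)
    (Subring.mem_center_iff.2 fun g => (hy g).symm)

variable (R) in
/-- The numerator of `u - v`, a central element. -/
def dCen (μ ν : Sgn) : Subring.center R⟦X⟧⟦X⟧ :=
  ⟨inl (num μ) * inr (den ν), mem_center_mul (inl_num_comm μ) (inr_den_comm ν)⟩ -
    ⟨inl (den μ) * inr (num ν), mem_center_mul (inl_den_comm μ) (inr_num_comm ν)⟩

variable (R) in
/-- The denominator of `u - v`, a central element. -/
def rCen (μ ν : Sgn) : Subring.center R⟦X⟧⟦X⟧ :=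
  ⟨inl (den μ) * inr (den ν), mem_center_mul (inl_den_comm μ) (inr_den_comm ν)⟩

theorem cW_rCen (μ ν : Sgn) (k : ℤ) (F : R⟦X⟧⟦X⟧) (a b : ℤ) :
    cW μ ν (k + 1) (rCen R μ ν • F) a b = cW μ ν k F a b := by
  change cW μ ν (k + 1) (inl (den μ) * inr (den ν) * F) a b = _
  rw [mul_assoc, cW, inl, cf_C_mul, cf_den_mul, inr_den, cf_den_mul, cW]

theorem cW_dCen (μ ν : Sgn) (k : ℤ) (F : R⟦X⟧⟦X⟧) (a b : ℤ) :
    cW μ ν (k + 1) (dCen R μ ν • F) a b = cW μ ν k F (a - 1) b - cW μ ν k F a (b - 1) := by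
  have : dCen R μ ν • F = inl (num μ) * (inr (den ν) * F) - inl (den μ) * (inr (num ν) * F) := by
    rw [← mul_assoc, ← mul_assoc, ← sub_mul]
    rfl
  rw [this, cW_sub]
  simp only [cW, inl, cf_C_mul, cf_den_mul, cf_num_mul, inr_den, inr_num]

variable [Algebra ℂ⟦X⟧ R]

theorem cf_smul (μ : Sgn) (k : ℤ) (r : ℂ⟦X⟧) (f : R⟦X⟧) (a : ℤ) :
    cf μ k (r • f) a = r • cf μ k f a := by
  cases μ <;> simp only [cf] <;> split_ifs <;> simp

theorem cW_smul (μ ν : Sgn) (k : ℤ) (r : ℂ⟦X⟧) (F : R⟦X⟧⟦X⟧) (a b : ℤ) :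
    cW μ ν k (r • F) a b = r • cW μ ν k F a b := by
  rw [cW, cf_smul, cf_smul, cW]

variable (R) in
/-- A scalar as a central element. -/
def sCen (r : ℂ⟦X⟧) : Subring.center R⟦X⟧⟦X⟧ :=
  ⟨C (C (r • 1)), Subring.mem_center_iff.2 fun g => by ext; simp⟩

theorem sCen_smul (r : ℂ⟦X⟧) (F : R⟦X⟧⟦X⟧) : sCen R r • F = r • F := by
  change C (C (r • 1)) * F = _
  ext
  simp

variable {g : Series} {n : ℕ}

/-- The coefficient of `uᵃ vᵇ` in `F / (den_u den_v) ^ k`, for a matrix `F`. -/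
def cM (μ ν : Sgn) (k : ℤ) (F : Mat2 R⟦X⟧⟦X⟧ g n) (a b : ℤ) : Mat2 R g n :=
  fun x y => cW μ ν k (F x y) a b

theorem mulLin_cM (μ ν : Sgn) (k : ℤ) (z : ℂ⟦X⟧) (F : Mat2 R⟦X⟧⟦X⟧ g n) :
    mulLin z (cM μ ν k F) = cM μ ν (k + 1) ((dCen R μ ν + sCen R z * rCen R μ ν) • F) := by
  funext a b
  ext x y
  simp only [mulLin, cM, Matrix.sub_apply, Matrix.add_apply, Matrix.smul_apply, add_smul, mul_smul,
    cW_add, cW_dCen, sCen_smul, cW_smul, cW_rCen]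

theorem cM_succ (μ ν : Sgn) (k : ℤ) (F : Mat2 R⟦X⟧⟦X⟧ g n) :
    cM μ ν k F = cM μ ν (k + 1) (rCen R μ ν • F) := by
  funext a b
  ext x y
  simp only [cM, Matrix.smul_apply, cW_rCen]

theorem smul_cM (μ ν : Sgn) (k : ℤ) (z : ℂ⟦X⟧) (F : Mat2 R⟦X⟧⟦X⟧ g n) (a b : ℤ) :
    z • cM μ ν k F a b = cM μ ν k (sCen R z • F) a b := by
  ext x y
  simp only [cM, Matrix.smul_apply, sCen_smul, cW_smul]

theorem C_C_opP (x y : Ix g n × Ix g n) :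
    (opP x y : R⟦X⟧⟦X⟧) = C (C (opP x y : R)) := by
  simp only [opP]; split_ifs <;> simp

theorem C_C_opQ (x y : Ix g n × Ix g n) :
    (opQ x y : R⟦X⟧⟦X⟧) = C (C (opQ x y : R)) := by
  simp only [opQ]; split_ifs <;> simp

theorem opP_mul_cM (μ ν : Sgn) (k : ℤ) (F : Mat2 R⟦X⟧⟦X⟧ g n) (a b : ℤ) :
    opP * cM μ ν k F a b = cM μ ν k (opP * F) a b := by
  ext x y
  simp only [cM, Matrix.mul_apply, cW_sum, C_C_opP, cW_C_C_mul]

theorem cM_mul_opP (μ ν : Sgn) (k : ℤ) (F : Mat2 R⟦X⟧⟦X⟧ g n) (a b : ℤ) :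
    cM μ ν k F a b * opP = cM μ ν k (F * opP) a b := by
  ext x y
  simp only [cM, Matrix.mul_apply, cW_sum, C_C_opP, cW_mul_C_C]

theorem opQ_mul_cM (μ ν : Sgn) (k : ℤ) (F : Mat2 R⟦X⟧⟦X⟧ g n) (a b : ℤ) :
    opQ * cM μ ν k F a b = cM μ ν k (opQ * F) a b := by
  ext x y
  simp only [cM, Matrix.mul_apply, cW_sum, C_C_opQ, cW_C_C_mul]

theorem cM_mul_opQ (μ ν : Sgn) (k : ℤ) (F : Mat2 R⟦X⟧⟦X⟧ g n) (a b : ℤ) :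
    cM μ ν k F a b * opQ = cM μ ν k (F * opQ) a b := by
  ext x y
  simp only [cM, Matrix.mul_apply, cW_sum, C_C_opQ, cW_mul_C_C]

/-- The product `T₁(u) T₂(v)`. -/
def mat12 (T T' : Matrix (Ix g n) (Ix g n) R⟦X⟧) : Mat2 R⟦X⟧⟦X⟧ g n :=
  fun x y => inl (T x.1 y.1) * inr (T' x.2 y.2)

/-- The product `T₂(v) T₁(u)`. -/
def mat21 (T T' : Matrix (Ix g n) (Ix g n) R⟦X⟧) : Mat2 R⟦X⟧⟦X⟧ g n :=
  fun x y => inr (T' x.2 y.2) * inl (T x.1 y.1)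

variable (R) in
/-- The shift `c κ` in the denominator of the `R`-matrix. -/
def kCen (g : Series) (n : ℕ) (μ ν : Sgn) : Subring.center R⟦X⟧⟦X⟧ :=
  dCen R μ ν + sCen R (PowerSeries.C (kappa g n) * c) * rCen R μ ν

variable (R) in
/-- The `R`-matrix multiplied by the common denominator. -/
def rMat (g : Series) (n : ℕ) (μ ν : Sgn) : Mat2 R⟦X⟧⟦X⟧ g n :=
  (dCen R μ ν * kCen R g n μ ν) • (1 : Mat2 R⟦X⟧⟦X⟧ g n) +
    (sCen R c * rCen R μ ν * kCen R g n μ ν) • (opP : Mat2 R⟦X⟧⟦X⟧ g n) -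
    (sCen R c * rCen R μ ν * dCen R μ ν) • (opQ : Mat2 R⟦X⟧⟦X⟧ g n)

/-- The `RTT` relations for a pair of `T`-operators. -/
def RTT (T : Sgn → Matrix (Ix g n) (Ix g n) R⟦X⟧) (μ ν : Sgn) : Prop :=
  rMat R g n μ ν * mat12 (T μ) (T ν) = mat21 (T μ) (T ν) * rMat R g n μ ν

theorem sCen_zero : sCen R 0 = 0 := Subtype.ext (by simp [sCen])

theorem mulLin_mulLin_cM (μ ν : Sgn) (F : Mat2 R⟦X⟧⟦X⟧ g n) (a b : ℤ) :
    mulLin 0 (mulLin (PowerSeries.C (kappa g n) * c) (cM μ ν 0 F)) a b =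
      cM μ ν 2 ((dCen R μ ν * kCen R g n μ ν) • F) a b := by
  rw [mulLin_cM, mulLin_cM, sCen_zero, zero_mul, add_zero, mul_smul]
  rfl

theorem smul_mulLin_kappa_cM (μ ν : Sgn) (F : Mat2 R⟦X⟧⟦X⟧ g n) (a b : ℤ) :
    c • mulLin (PowerSeries.C (kappa g n) * c) (cM μ ν 0 F) a b =
      cM μ ν 2 ((sCen R c * rCen R μ ν * kCen R g n μ ν) • F) a b := by
  rw [mulLin_cM, smul_cM, cM_succ, mul_comm (sCen R c), mul_smul, mul_smul]
  rfl

theorem smul_mulLin_zero_cM (μ ν : Sgn) (F : Mat2 R⟦X⟧⟦X⟧ g n) (a b : ℤ) :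
    c • mulLin 0 (cM μ ν 0 F) a b =
      cM μ ν 2 ((sCen R c * rCen R μ ν * dCen R μ ν) • F) a b := by
  rw [mulLin_cM, smul_cM, cM_succ, sCen_zero, zero_mul, add_zero, mul_comm (sCen R c), mul_smul,
    mul_smul]
  rfl

/-- Multiplying a distribution by a linear factor in u and v is multiplying a numerator series by a
central element while the exponent of the denominators rises by one. Two factors give exponent 2, so
all relators are coefficients of one identity of power series. -/
theorem rttDefect_eq (t : Ix g n → Ix g n → ℤ → R) (μ ν : Sgn) (a b : ℤ) :
    rttDefect t μ ν a b = cM μ ν 2 (rMat R g n μ ν * mat12 (tOp t μ) (tOp t ν) -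
      mat21 (tOp t μ) (tOp t ν) * rMat R g n μ ν) a b := by
  have h12 : prod12 t μ ν = cM μ ν 0 (mat12 (tOp t μ) (tOp t ν)) := by
    funext a b
    ext x y
    simp only [prod12, cM, mat12, cW_inl_inr]
  have h21 : prod21 t μ ν = cM μ ν 0 (mat21 (tOp t μ) (tOp t ν)) := by
    funext a b
    ext x y
    simp only [prod21, cM, mat21, cW_inr_inl]
  have hadd : ∀ F G : Mat2 R⟦X⟧⟦X⟧ g n,
      cM μ ν 2 F a b + cM μ ν 2 G a b = cM μ ν 2 (F + G) a b := by
    intro F G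
    ext x y
    simp only [cM, Matrix.add_apply, cW_add]
  have hsub : ∀ F G : Mat2 R⟦X⟧⟦X⟧ g n,
      cM μ ν 2 F a b - cM μ ν 2 G a b = cM μ ν 2 (F - G) a b := by
    intro F G
    ext x y
    simp only [cM, Matrix.sub_apply, cW_sub]
  have e1 : ∀ F : Mat2 R⟦X⟧⟦X⟧ g n, (fun a b => opP * cM μ ν 0 F a b) = cM μ ν 0 (opP * F) :=
    fun F => funext₂ fun a b => opP_mul_cM μ ν 0 F a b
  have e2 : ∀ F : Mat2 R⟦X⟧⟦X⟧ g n, (fun a b => opQ * cM μ ν 0 F a b) = cM μ ν 0 (opQ * F) :=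
    fun F => funext₂ fun a b => opQ_mul_cM μ ν 0 F a b
  have e3 : ∀ F : Mat2 R⟦X⟧⟦X⟧ g n, (fun a b => cM μ ν 0 F a b * opP) = cM μ ν 0 (F * opP) :=
    fun F => funext₂ fun a b => cM_mul_opP μ ν 0 F a b
  have e4 : ∀ F : Mat2 R⟦X⟧⟦X⟧ g n, (fun a b => cM μ ν 0 F a b * opQ) = cM μ ν 0 (F * opQ) :=
    fun F => funext₂ fun a b => cM_mul_opQ μ ν 0 F a b
  simp only [rttDefect]
  rw [h12, h21, e1, e2, e3, e4, mulLin_mulLin_cM, mulLin_mulLin_cM, smul_mulLin_kappa_cM,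
    smul_mulLin_kappa_cM, smul_mulLin_zero_cM, smul_mulLin_zero_cM, hadd, hadd, hsub, hsub, hsub]
  refine congrArg (fun F => cM μ ν 2 F a b) ?_
  rw [rMat, sub_mul, add_mul, mul_sub, mul_add, smul_mul_assoc, smul_mul_assoc, smul_mul_assoc,
    mul_smul_comm, mul_smul_comm, mul_smul_comm, one_mul, mul_one]

theorem rtt_iff (t : Ix g n → Ix g n → ℤ → R) (μ ν : Sgn) :
    (∀ a b x y, rttDefect t μ ν a b x y = 0) ↔ RTT (tOp t) μ ν := by
  simp only [rttDefect_eq, RTT]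
  rw [← sub_eq_zero]
  constructor
  · intro h
    ext1 x y
    exact cW_ext μ ν 2 _ fun a b => h a b x y
  · intro h a b x y
    rw [h]
    exact map_zero (cWHom μ ν 2 a b)

end RTT

end YangianDouble

end
noncomputable section

namespace YangianDouble

open PowerSeries Finset.HasAntidiagonal

/-! ### From the `RTT` relations to the relations of `𝔤𝔩`-type -/

section GLFromRTT

/-- If h + ac kills x, each coefficient of x is -ac times the next, so all are infinitely divisible
by `c`. -/
theorem hCen_add_reg {S : Type*} [Ring S] [Algebra ℂ⟦X⟧ S] [CComplete S] (a : ℂ) (x : S⟦X⟧)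
    (hx : X * x + (PowerSeries.C a * c : ℂ⟦X⟧) • x = 0) : x = 0 := by
  have h : ∀ m, coeff m x = -((PowerSeries.C a * c : ℂ⟦X⟧) • coeff (m + 1) x) := by
    intro m
    rw [eq_neg_iff_add_eq_zero]
    simpa [coeff_succ_X_mul] using congrArg (coeff (m + 1)) hx
  have hN : ∀ N m, coeff m x ∈ cPow S N := by
    intro N
    induction N with
    | zero => exact fun m => mem_cPow.2 ⟨coeff m x, by simp⟩
    | succ N ih =>
      intro m
      obtain ⟨z, hz⟩ := mem_cPow.1 (ih (m + 1))
      rw [h m, hz]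
      refine Submodule.neg_mem _ (mem_cPow.2 ⟨(PowerSeries.C a : ℂ⟦X⟧) • z, ?_⟩)
      rw [smul_smul, smul_smul, pow_succ]
      congr 1
      ring
  ext m
  exact CComplete.separated _ fun N => hN N m

variable {R : Type*} [Ring R] {g : Series} {n : ℕ}

theorem opP_mul_apply (F : Mat2 R g n) (x y : Ix g n × Ix g n) :
    ((opP : Mat2 R g n) * F) x y = F (x.2, x.1) y := by
  rw [Matrix.mul_apply, Finset.sum_eq_single (x.2, x.1)]
  · simp [opP]
  · rintro ⟨a, b⟩ - h
    rw [opP, if_neg, zero_mul]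
    rintro ⟨h1, h2⟩
    exact h (Prod.ext h2.symm h1.symm)
  · simp

theorem mul_opP_apply (F : Mat2 R g n) (x y : Ix g n × Ix g n) :
    (F * (opP : Mat2 R g n)) x y = F x (y.2, y.1) := by
  rw [Matrix.mul_apply, Finset.sum_eq_single (y.2, y.1)]
  · simp [opP]
  · rintro ⟨a, b⟩ - h
    rw [opP, if_neg, mul_zero]
    rintro ⟨h1, h2⟩
    exact h (Prod.ext h1 h2)
  · simp

theorem opQ_mul_apply (F : Mat2 R g n) {x : Ix g n × Ix g n} (hx : x.2 ≠ opp x.1)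
    (y : Ix g n × Ix g n) : ((opQ : Mat2 R g n) * F) x y = 0 := by
  rw [Matrix.mul_apply]
  exact Finset.sum_eq_zero fun z _ => by rw [opQ, if_neg fun h => hx h.1, zero_mul]

theorem mul_opQ_apply (F : Mat2 R g n) (x : Ix g n × Ix g n) {y : Ix g n × Ix g n}
    (hy : y.2 ≠ opp y.1) : (F * (opQ : Mat2 R g n)) x y = 0 := by
  rw [Matrix.mul_apply]
  exact Finset.sum_eq_zero fun z _ => by rw [opQ, if_neg fun h => hy h.2, mul_zero]

variable [Algebra ℂ⟦X⟧ R]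

/-- On rows whose two indices are not opposite Q vanishes, and then u - v + cκ is a common factor of
the cleared R-matrix. It can be cancelled, because it becomes h + cκ. -/
theorem rMat_mul_apply (μ ν : Sgn) (F : Mat2 R⟦X⟧⟦X⟧ g n) {x : Ix g n × Ix g n}
    (hx : x.2 ≠ opp x.1) (y : Ix g n × Ix g n) : (rMat R g n μ ν * F) x y =
      kCen R g n μ ν • (dCen R μ ν • F x y + sCen R c • rCen R μ ν • F (x.2, x.1) y) := by
  rw [rMat, sub_mul, add_mul, smul_mul_assoc, smul_mul_assoc, smul_mul_assoc, one_mul,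
    Matrix.sub_apply, Matrix.add_apply, Matrix.smul_apply, Matrix.smul_apply, Matrix.smul_apply,
    opP_mul_apply, opQ_mul_apply _ hx, smul_zero, sub_zero, smul_add, smul_smul, smul_smul,
    smul_smul, mul_comm (dCen R μ ν), mul_comm (sCen R c * rCen R μ ν), mul_assoc]

theorem mul_rMat_apply (μ ν : Sgn) (F : Mat2 R⟦X⟧⟦X⟧ g n) (x : Ix g n × Ix g n)
    {y : Ix g n × Ix g n} (hy : y.2 ≠ opp y.1) : (F * rMat R g n μ ν) x y =
      kCen R g n μ ν • (dCen R μ ν • F x y + sCen R c • rCen R μ ν • F x (y.2, y.1)) := by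
  rw [rMat, mul_sub, mul_add, mul_smul_comm, mul_smul_comm, mul_smul_comm, mul_one,
    Matrix.sub_apply, Matrix.add_apply, Matrix.smul_apply, Matrix.smul_apply, Matrix.smul_apply,
    mul_opP_apply, mul_opQ_apply _ _ hy, smul_zero, sub_zero, smul_add, smul_smul, smul_smul,
    smul_smul, mul_comm (dCen R μ ν), mul_comm (sCen R c * rCen R μ ν), mul_assoc]

theorem theta_dCen (μ : Sgn) (F : R⟦X⟧⟦X⟧) :
    theta μ (dCen R μ μ • F) = rho μ * (X * theta μ F) := by
  change theta μ ((inl (num μ) * inr (den μ) - inl (den μ) * inr (num μ)) * F) = _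
  rw [map_mul, theta_diff, mul_assoc, rho_comm, rho_comm, mul_assoc]

theorem theta_rCen (μ : Sgn) (F : R⟦X⟧⟦X⟧) : theta μ (rCen R μ μ • F) = rho μ * theta μ F := by
  change theta μ ((inl (den μ) * inr (den μ)) * F) = _
  rw [map_mul, theta_den]

variable [CComplete R]

theorem theta_kCen_reg (μ : Sgn) (F : R⟦X⟧⟦X⟧) (h : theta μ (kCen R g n μ μ • F) = 0) :
    theta μ F = 0 := by
  rw [kCen, add_smul, map_add, mul_smul, sCen_smul, theta_smul, theta_dCen, theta_rCen,
    ← mul_smul_comm, ← mul_add] at h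
  exact hCen_add_reg _ _ (rho_reg μ _ h)

theorem theta_comm_eq {T : Matrix (Ix g n) (Ix g n) R⟦X⟧} {μ : Sgn}
    (H : rMat R g n μ μ * mat12 T T = mat21 T T * rMat R g n μ μ) {i k j l : Ix g n}
    (hik : k ≠ opp i) (hjl : l ≠ opp j) :
    X * (C (T i j) * taylor (dU μ) (T k l) - taylor (dU μ) (T k l) * C (T i j)) =
      c • (taylor (dU μ) (T k j) * C (T i l) - C (T k j) * taylor (dU μ) (T i l)) := by
  have h := congrFun₂ H (i, k) (j, l)
  rw [rMat_mul_apply _ _ _ hik, mul_rMat_apply _ _ _ _ hjl, ← sub_eq_zero, ← smul_sub] at h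
  have h := theta_kCen_reg (g := g) (n := n) μ _ ((congrArg (theta μ) h).trans (map_zero _))
  simp only [map_sub, map_add, sCen_smul, theta_smul, theta_dCen, theta_rCen, mat12, mat21, map_mul,
    theta_inl, theta_inr] at h
  rw [← mul_smul_comm c (rho μ), ← mul_smul_comm c (rho μ), ← mul_add, ← mul_add, ← mul_sub] at h
  have h := rho_reg μ _ h
  rw [← sub_eq_zero, ← h, mul_sub, smul_sub]
  abel

/-- `theta_comm_eq` has the two products on its right side in the opposite order. The difference Z
of the two orders and its companion Z' satisfy hZ = -cZ' and hZ' = -cZ, so (h² - c²)Z = 0 and Z = 0.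
-/
theorem glSer_of_rtt {T : Matrix (Ix g n) (Ix g n) R⟦X⟧} {μ : Sgn}
    (H : rMat R g n μ μ * mat12 T T = mat21 T T * rMat R g n μ μ) {i k j l : Ix g n}
    (hik : k ≠ opp i) (hjl : l ≠ opp j) : GLSer (dU μ) T i k j l := by
  have hki : i ≠ opp k := by
    rintro rfl
    apply hik
    apply Subtype.ext
    simp only [opp]
    cases g <;> simp
  have hlj : j ≠ opp l := by
    rintro rfl
    apply hjl
    apply Subtype.ext
    simp only [opp]
    cases g <;> simp
  have h1 := theta_comm_eq H hik hjl
  have h2 := theta_comm_eq H hki hlj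
  have h3 := theta_comm_eq H hik hlj
  have h4 := theta_comm_eq H hki hjl
  set t := fun a b => (C (T a b) : R⟦X⟧⟦X⟧)
  set s := fun a b => taylor (dU μ) (T a b)
  change X * (t i j * s k l - s k l * t i j) = c • (s k j * t i l - t k j * s i l) at h1
  change X * (t k l * s i j - s i j * t k l) = c • (s i l * t k j - t i l * s k j) at h2
  change X * (t i l * s k j - s k j * t i l) = c • (s k l * t i j - t k l * s i j) at h3
  change X * (t k j * s i l - s i l * t k j) = c • (s i j * t k l - t i j * s k l) at h4
  have hX : ∀ x : R⟦X⟧⟦X⟧, X * x = hCen R⟦X⟧ • x := fun x => rfl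
  have hc : ∀ x : R⟦X⟧⟦X⟧, c • x = cCen R⟦X⟧ • x := fun x => (cCen_smul x).symm
  rw [hX, hc] at h1 h2 h3 h4
  set Z := (t i l * s k j - s k j * t i l) + (t k j * s i l - s i l * t k j)
  set Z' := (t i j * s k l - s k l * t i j) + (t k l * s i j - s i j * t k l)
  have hZ : hCen R⟦X⟧ • Z = -(cCen R⟦X⟧ • Z') := by
    rw [smul_add, h3, h4, ← smul_add, ← smul_neg]
    congr 1
    simp only [Z']
    abel
  have hZ' : hCen R⟦X⟧ • Z' = -(cCen R⟦X⟧ • Z) := by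
    rw [smul_add, h1, h2, ← smul_add, ← smul_neg]
    congr 1
    simp only [Z]
    abel
  -- First h - c is cancelled, then h + c.
  have h0 : Z = 0 := by
    refine hCen_add_reg 1 Z ?_
    refine hCen_sub_reg _ ?_
    have h : (hCen R⟦X⟧ - cCen R⟦X⟧) • (hCen R⟦X⟧ • Z + cCen R⟦X⟧ • Z) =
        hCen R⟦X⟧ • hCen R⟦X⟧ • Z - cCen R⟦X⟧ • cCen R⟦X⟧ • Z := by module
    rw [map_one, one_mul, hX, hc, h, hZ, smul_neg, smul_comm, hZ', smul_neg, neg_neg, sub_self]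
  change hCen R⟦X⟧ • (t i j * s k l - s k l * t i j) = cCen R⟦X⟧ • (t i l * s k j - s i l * t k j)
  rw [h1]
  congr 1
  rw [← sub_eq_zero, ← neg_eq_zero, ← h0]
  simp only [Z]
  abel

end GLFromRTT

end YangianDouble

end
noncomputable section

namespace YangianDouble

open PowerSeries Finset.HasAntidiagonal

/-! ### Existence and uniqueness of Gauss decompositions -/

section GaussExists

variable {S : Type*} [Ring S] [Algebra ℂ⟦X⟧ S]

/-- A submodule `Q` closed under products such that `1 + c Q` is a group. -/
structure IsNear (Q : Submodule ℂ⟦X⟧ S) : Prop where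
  mul_mem : ∀ x ∈ Q, ∀ y ∈ Q, x * y ∈ Q
  exists_inv : ∀ x ∈ Q, ∃ p, p * (1 + c • x) = 1 ∧ (1 + c • x) * p = 1 ∧ ∃ z ∈ Q, p = 1 + c • z

/-- The entries of the matrix `T` are `δ_{ij} + c y_{ij}`, where `y_{ij} ∈ Q`. -/
def NearOne (Q : Submodule ℂ⟦X⟧ S) (a b : ℤ) (T y : ℤ → ℤ → S) : Prop :=
  ∀ i ∈ Finset.Icc a b, ∀ j ∈ Finset.Icc a b,
    y i j ∈ Q ∧ T i j = (if i = j then 1 else 0) + c • y i j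

/-- The Gauss coordinates of a matrix `1 + c y` modulo `c ^ 2`. -/
structure GaussData.Near {a b : ℤ} (G : GaussData S a b) (Q : Submodule ℂ⟦X⟧ S)
    (y : ℤ → ℤ → S) : Prop where
  k_near : ∀ l ∈ Finset.Icc a b, ∃ z ∈ Q, G.k l = 1 + c • (y l l + c • z)
  F_near : ∀ i l, a ≤ i → i < l → l ≤ b → ∃ z ∈ Q, G.F l i = c • (y i l + c • z)
  E_near : ∀ i l, a ≤ i → i < l → l ≤ b → ∃ z ∈ Q, G.E i l = c • (y l i + c • z)

/-- Gauss elimination of the top index b, by induction on the number r of indices. The control by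
`Q` is carried along so that the same construction serves the whole double and the Borel subalgebra.
-/
theorem exists_gaussData {Q : Submodule ℂ⟦X⟧ S} (hQ : IsNear Q) (a : ℤ) (r : ℕ)
    {T y : ℤ → ℤ → S} (hT : NearOne Q a (a + r - 1) T y) :
    ∃ G : GaussData S a (a + r - 1),
      (∀ i ∈ Finset.Icc a (a + r - 1), ∀ j ∈ Finset.Icc a (a + r - 1),
        G.part (a + r - 1) i j = T i j) ∧ G.Near Q y := by
  induction r generalizing T y with
  | zero =>
    refine ⟨⟨0, 0, 0, 0, ?_, ?_, ?_, ?_⟩, ?_, ?_, ?_, ?_⟩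
    iterate 5 { intro i hi; rw [Finset.mem_Icc] at hi; push_cast at hi; omega }
    iterate 3 { intros; simp at *; try omega }
  | succ r ih =>
    set b : ℤ := a + r
    have eb : a + (r + 1 : ℕ) - 1 = b := by push_cast; ring
    have hbb : b ∈ Finset.Icc a b := by rw [Finset.mem_Icc]; omega
    rw [eb] at hT ⊢
    obtain ⟨hyb, hTb⟩ := hT b hbb b hbb
    obtain ⟨p, hp1, hp2, w, hw, hpw⟩ := hQ.exists_inv _ hyb
    rw [if_pos rfl] at hTb
    have hlt : ∀ i, i ∈ Finset.Icc a (a + r - 1) ↔ i ∈ Finset.Icc a b ∧ i < b := by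
      intro i
      simp only [Finset.mem_Icc]
      omega
    have hTi : ∀ i ∈ Finset.Icc a b, i < b → y i b ∈ Q ∧ T i b = c • y i b := by
      intro i hi hib
      have := hT i hi b hbb
      rwa [if_neg (by omega), zero_add] at this
    have hTj : ∀ i ∈ Finset.Icc a b, i < b → y b i ∈ Q ∧ T b i = c • y b i := by
      intro i hi hib
      have := hT b hbb i hi
      rwa [if_neg (by omega), zero_add] at this
    have hip : ∀ x ∈ Q, x * p ∈ Q := fun x hx => by
      rw [hpw, mul_add, mul_one, mul_smul_comm]
      exact Q.add_mem hx (Q.smul_mem _ (hQ.mul_mem _ hx _ hw))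
    -- Off-diagonal entries are divisible by `c`, so the Schur complement changes T only by c² times
    -- an element of `Q`: the leading terms of the coordinates are those of T.
    have hS : NearOne Q a (a + r - 1) (schur T p b) fun i j => y i j - c • (y i b * p * y b j) := by
      intro i hi j hj
      obtain ⟨hi, hib⟩ := (hlt i).1 hi
      obtain ⟨hj, hjb⟩ := (hlt j).1 hj
      obtain ⟨h1, h2⟩ := hTi i hi hib
      obtain ⟨h3, h4⟩ := hTj j hj hjb
      refine ⟨Q.sub_mem (hT i hi j hj).1 (Q.smul_mem _ (hQ.mul_mem _ (hip _ h1) _ h3)), ?_⟩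
      rw [schur, (hT i hi j hj).2, h2, h4, smul_sub, smul_mul_assoc, smul_mul_assoc, mul_smul_comm,
        add_sub_assoc]
    obtain ⟨G, hG, hN⟩ := ih hS
    have hlt' : ∀ i ∈ Finset.Icc a b, i ≠ b → i ∈ Finset.Icc a (a + r - 1) := by
      intro i hi hib
      rw [Finset.mem_Icc] at hi ⊢
      omega
    refine ⟨⟨fun l i => if l = b then (if i = b then 1 else T i b * p) else G.F l i,
      fun i l => if l = b then (if i = b then 1 else p * T b i) else G.E i l,
      fun l => if l = b then T b b else G.k l, fun l => if l = b then p else G.ki l,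
      ?_, ?_, ?_, ?_⟩, ?_, ?_, ?_, ?_⟩
    · intro i hi
      by_cases h : i = b
      · simp [h]
      · simpa [h] using G.F_diag i (hlt' i hi h)
    · intro i hi
      by_cases h : i = b
      · simp [h]
      · simpa [h] using G.E_diag i (hlt' i hi h)
    · intro i hi
      by_cases h : i = b
      · simp [h, hTb, hp1]
      · simpa [h] using G.ki_mul i (hlt' i hi h)
    · intro i hi
      by_cases h : i = b
      · simp [h, hTb, hp2]
      · simpa [h] using G.mul_ki i (hlt' i hi h)
    · intro i hi j hj
      have hib := (Finset.mem_Icc.1 hi).2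
      have hjb := (Finset.mem_Icc.1 hj).2
      have hpT : p * T b b = 1 := by rw [hTb, hp1]
      have hTp : T b b * p = 1 := by rw [hTb, hp2]
      rw [GaussData.part]
      by_cases h : i = b
      · subst h
        rw [max_eq_left hjb, Finset.Icc_self, Finset.sum_singleton]
        by_cases h' : j = b
        · subst h'
          simp
        · simp only [if_true, if_neg h', one_mul]
          rw [← mul_assoc, hTp, one_mul]
      · by_cases h' : j = b
        · subst h'
          rw [max_eq_right hib, Finset.Icc_self, Finset.sum_singleton]
          simp only [if_true, if_neg h, mul_one]
          rw [mul_assoc, hpT, mul_one]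
        · have hi' : i < b := by omega
          have hj' : j < b := by omega
          have e : Finset.Icc (max i j) b = insert b (Finset.Icc (max i j) (a + r - 1)) := by
            ext x
            simp only [Finset.mem_insert, Finset.mem_Icc]
            have := max_lt hi' hj'
            omega
          rw [e, Finset.sum_insert (by simp only [Finset.mem_Icc]; omega)]
          simp only [if_true, if_neg h, if_neg h']
          have e2 : ∑ x ∈ Finset.Icc (max i j) (a + r - 1), (if x = b then T i b * p else G.F x i) *
              (if x = b then T b b else G.k x) * (if x = b then p * T b j else G.E j x) =
              G.part (a + r - 1) i j := by
            refine Finset.sum_congr rfl fun x hx => ?_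
            rw [Finset.mem_Icc] at hx
            have hx : x ≠ b := by omega
            simp only [if_neg hx]
          rw [e2, hG i (hlt' i hi h) j (hlt' j hj h'), schur, mul_assoc (T i b), hpT, mul_one,
            ← mul_assoc]
          abel
    · intro l hl
      by_cases h : l = b
      · subst h
        exact ⟨0, Q.zero_mem, by simp [hTb]⟩
      · obtain ⟨z, hz, hk⟩ := hN.k_near l (hlt' l hl h)
        have hl' := hlt' l hl h
        obtain ⟨hl, hlb⟩ := (hlt l).1 hl'
        refine ⟨z - y l b * p * y b l, Q.sub_mem hz (hQ.mul_mem _ (hip _ (hTi l hl hlb).1) _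
          (hTj l hl hlb).1), ?_⟩
        simp only [if_neg h, hk]
        congr 2
        rw [smul_sub]
        abel
    · intro i l hi hil hl
      by_cases h : l = b
      · subst h
        have h1 := hTi i (Finset.mem_Icc.2 ⟨hi, by omega⟩) hil
        refine ⟨y i b * w, hQ.mul_mem _ h1.1 _ hw, ?_⟩
        simp only [if_true, if_neg hil.ne, h1.2, hpw]
        rw [mul_add, mul_one, smul_mul_assoc, mul_smul_comm, smul_add]
      · obtain ⟨z, hz, hk⟩ := hN.F_near i l hi hil (by omega)
        refine ⟨z - y i b * p * y b l, Q.sub_mem hz (hQ.mul_mem _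
          (hip _ (hTi i (Finset.mem_Icc.2 ⟨hi, by omega⟩) (by omega)).1) _
          (hTj l (Finset.mem_Icc.2 ⟨by omega, by omega⟩) (by omega)).1), ?_⟩
        simp only [if_neg h, hk]
        congr 1
        rw [smul_sub]
        abel
    · intro i l hi hil hl
      by_cases h : l = b
      · subst h
        have h1 := hTj i (Finset.mem_Icc.2 ⟨hi, by omega⟩) hil
        refine ⟨w * y b i, hQ.mul_mem _ hw _ h1.1, ?_⟩
        simp only [if_true, if_neg hil.ne, h1.2, hpw]
        rw [add_mul, one_mul, mul_smul_comm, smul_mul_assoc, smul_add]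
      · obtain ⟨z, hz, hk⟩ := hN.E_near i l hi hil (by omega)
        refine ⟨z - y l b * p * y b i, Q.sub_mem hz (hQ.mul_mem _
          (hip _ (hTi l (Finset.mem_Icc.2 ⟨by omega, by omega⟩) (by omega)).1) _
          (hTj i (Finset.mem_Icc.2 ⟨hi, by omega⟩) (by omega)).1), ?_⟩
        simp only [if_neg h, hk]
        congr 1
        rw [smul_sub]
        abel

-- The top pivot is a matrix entry, so equal matrices have equal Schur complements, and one descends
-- to all smaller blocks.
omit [Algebra ℂ⟦X⟧ S] in
theorem GaussData.part_eq_part {a b : ℤ} {G G' : GaussData S a b}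
    (h : ∀ i ∈ Finset.Icc a b, ∀ j ∈ Finset.Icc a b, G.part b i j = G'.part b i j) (r : ℕ) :
    ∀ i ∈ Finset.Icc a (b - r), ∀ j ∈ Finset.Icc a (b - r),
      G.part (b - r) i j = G'.part (b - r) i j := by
  induction r with
  | zero => simpa using h
  | succ r ih =>
    intro i hi j hj
    rw [Finset.mem_Icc] at hi hj
    push_cast at hi hj ⊢
    have hm : b - r ∈ Finset.Icc a b := by rw [Finset.mem_Icc]; omega
    have hm' : b - r ∈ Finset.Icc a (b - r) := by rw [Finset.mem_Icc]; omega
    have hi' : i ∈ Finset.Icc a (b - r) := by rw [Finset.mem_Icc]; omega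
    have hj' : j ∈ Finset.Icc a (b - r) := by rw [Finset.mem_Icc]; omega
    have hk : G.k (b - r) = G'.k (b - r) := by rw [← G.part_diag hm, ← G'.part_diag hm, ih _ hm' _ hm']
    have hki : G.ki (b - r) = G'.ki (b - r) := left_inv_eq_right_inv (G.ki_mul _ hm)
      (by rw [hk, G'.mul_ki _ hm])
    rw [← sub_sub, ← G.part_schur hm (by omega) (by omega), ← G'.part_schur hm (by omega) (by omega),
      schur, schur, ih _ hi' _ hj', ih _ hi' _ hm', ih _ hm' _ hj', hki]

omit [Algebra ℂ⟦X⟧ S] in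
theorem GaussData.unique {a b : ℤ} {G G' : GaussData S a b}
    (h : ∀ i ∈ Finset.Icc a b, ∀ j ∈ Finset.Icc a b, G.part b i j = G'.part b i j)
    {i l : ℤ} (hi : a ≤ i) (hil : i ≤ l) (hl : l ≤ b) :
    G.k l = G'.k l ∧ G.F l i = G'.F l i ∧ G.E i l = G'.E i l := by
  have hlm : l ∈ Finset.Icc a b := by rw [Finset.mem_Icc]; omega
  have key := GaussData.part_eq_part h (b - l).toNat
  rw [show b - ((b - l).toNat : ℤ) = l by omega] at key
  have hl' : l ∈ Finset.Icc a l := by rw [Finset.mem_Icc]; omega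
  have hi' : i ∈ Finset.Icc a l := by rw [Finset.mem_Icc]; omega
  have hk : G.k l = G'.k l := by rw [← G.part_diag hlm, ← G'.part_diag hlm, key _ hl' _ hl']
  refine ⟨hk, ?_, ?_⟩
  · have := key i hi' l hl'
    rw [G.part_right hlm hil, G'.part_right hlm hil, hk] at this
    have := congrArg (· * G'.ki l) this
    simpa only [mul_assoc, G'.mul_ki l hlm, mul_one] using this
  · have := key l hl' i hi'
    rw [G.part_left hlm hil, G'.part_left hlm hil, hk] at this
    have := congrArg (G'.ki l * ·) this
    simpa only [← mul_assoc, G'.ki_mul l hlm, one_mul] using this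

theorem GaussData.Near.of_part_eq {a b : ℤ} {G G' : GaussData S a b}
    (h : ∀ i ∈ Finset.Icc a b, ∀ j ∈ Finset.Icc a b, G.part b i j = G'.part b i j)
    {Q : Submodule ℂ⟦X⟧ S} {y : ℤ → ℤ → S} (hN : G'.Near Q y) : G.Near Q y where
  k_near l hl := by
    rw [(GaussData.unique h (Finset.mem_Icc.1 hl).1 le_rfl (Finset.mem_Icc.1 hl).2).1]
    exact hN.k_near l hl
  F_near i l hi hil hl := by
    rw [(GaussData.unique h hi hil.le hl).2.1]
    exact hN.F_near i l hi hil hl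
  E_near i l hi hil hl := by
    rw [(GaussData.unique h hi hil.le hl).2.2]
    exact hN.E_near i l hi hil hl

/-- 1 + hx is invertible in the ring of series in h; the inverse is evaluated at h = c. -/
theorem isNear_top [CComplete S] : IsNear (⊤ : Submodule ℂ⟦X⟧ S) where
  mul_mem _ _ _ _ := trivial
  exists_inv x _ := by
    have h1 := mul_invOfUnit (1 + X * C x : S⟦X⟧) 1 (by simp)
    have h2 := invOfUnit_mul (1 + X * C x : S⟦X⟧) 1 (by simp)
    have e : evHom S 1 (1 + X * C x) = 1 + c • x := by
      rw [map_add, map_one, map_mul, evHom_X, evHom_C, map_one, one_mul, smul_mul_assoc, one_mul]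
    have h1 := congrArg (evHom S 1) h1
    have h2 := congrArg (evHom S 1) h2
    rw [map_mul, map_one, e] at h1 h2
    refine ⟨_, h2, h1, -(x * evHom S 1 (invOfUnit (1 + X * C x) 1)), trivial, ?_⟩
    rw [add_mul, one_mul, smul_mul_assoc] at h1
    rw [smul_neg, ← h1]
    abel

end GaussExists

/-! ### Series with coefficients in a subalgebra -/

section

variable {R : Type*} [Ring R] [Algebra ℂ⟦X⟧ R]

/-- The series without constant term and with coefficients in a subalgebra. -/
def seriesIn (B : Subalgebra ℂ⟦X⟧ R) : Submodule ℂ⟦X⟧ R⟦X⟧ where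
  carrier := {f | coeff 0 f = 0 ∧ ∀ m, coeff m f ∈ B}
  zero_mem' := by simp [B.zero_mem]
  add_mem' := by
    rintro f f' ⟨h, h'⟩ ⟨k, k'⟩
    exact ⟨by rw [map_add, h, k, add_zero], fun m => by rw [map_add]; exact B.add_mem (h' m) (k' m)⟩
  smul_mem' := by
    rintro r f ⟨h, h'⟩
    exact ⟨by rw [PowerSeries.coeff_smul, h, smul_zero],
      fun m => by rw [PowerSeries.coeff_smul]; exact B.smul_mem (h' m) r⟩

theorem seriesIn_mul {B : Subalgebra ℂ⟦X⟧ R} {f f' : R⟦X⟧} (hf : f ∈ seriesIn B)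
    (hf' : ∀ m, coeff m f' ∈ B) : f * f' ∈ seriesIn B := by
  refine ⟨by simp [coeff_mul, hf.1], fun m => ?_⟩
  rw [coeff_mul]
  exact B.sum_mem fun p _ => B.mul_mem (hf.2 _) (hf' _)

/-- `B` need not be closed in the `c`-adic topology, so the geometric series in `c` is of no use.
Instead the constant term in the spectral variable is 1, and the coefficients of the inverse are
finite recursive expressions in `B`. -/
theorem isNear_seriesIn (B : Subalgebra ℂ⟦X⟧ R) : IsNear (seriesIn B) where
  mul_mem f hf f' hf' := seriesIn_mul hf hf'.2
  exists_inv f hf := by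
    have h0 : constantCoeff (1 + c • f) = ((1 : Rˣ) : R) := by
      have : constantCoeff f = 0 := by simpa using hf.1
      have h2 : constantCoeff (c • f) = c • constantCoeff f := by
        rw [← coeff_zero_eq_constantCoeff_apply, PowerSeries.coeff_smul,
          coeff_zero_eq_constantCoeff_apply]
      rw [map_add, h2, this, smul_zero]
      simp
    have h1 := mul_invOfUnit _ _ h0
    have h2 := invOfUnit_mul _ _ h0
    set p := invOfUnit (1 + c • f) 1
    have hp : p = 1 - c • (f * p) := by
      rw [add_mul, one_mul, smul_mul_assoc] at h1
      rw [← h1]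
      abel
    have hpB : ∀ m, coeff m p ∈ B := by
      intro m
      induction m using Nat.strong_induction_on with
      | _ m ih =>
        rw [hp, map_sub, PowerSeries.coeff_smul, coeff_mul]
        refine B.sub_mem ?_ (B.smul_mem (B.sum_mem fun q hq => ?_) _)
        · rw [coeff_one]
          split_ifs
          exacts [B.one_mem, B.zero_mem]
        · by_cases h : q.1 = 0
          · rw [h, hf.1, zero_mul]
            exact B.zero_mem
          · have := mem_antidiagonal.1 hq
            exact B.mul_mem (hf.2 _) (ih _ (by omega))
    refine ⟨p, h2, h1, -(f * p), Submodule.neg_mem _ (seriesIn_mul hf hpB), ?_⟩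
    rw [smul_neg, ← sub_eq_add_neg]
    exact hp

end

end YangianDouble

end
noncomputable section

namespace YangianDouble

open PowerSeries Finset.HasAntidiagonal

/-! ### Functoriality of the relations -/

section Functor

variable {R R' : Type*} [Ring R] [Algebra ℂ⟦X⟧ R] [Ring R'] [Algebra ℂ⟦X⟧ R'] {g : Series} {n : ℕ}

/-- Homomorphisms over ℂ⟦c⟧ are automatically continuous. Hence shifts, and with them the relators,
are natural. -/
theorem IsCSum.map (φ : R →ₐ[ℂ⟦X⟧] R') {f : ℕ → R} {s : R} (h : IsCSum f s) :
    IsCSum (fun m => φ (f m)) (φ s) := by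
  intro N
  obtain ⟨y, hy⟩ := h N
  exact ⟨φ y, by rw [← map_smul, ← hy, map_sub, map_sum]⟩

theorem shift_map [CComplete R] [CComplete R'] (φ : R →ₐ[ℂ⟦X⟧] R') (μ : Sgn) (a : ℂ) (f : R⟦X⟧) :
    PowerSeries.map (φ : R →+* R') (shift μ a f) = shift μ a (PowerSeries.map (φ : R →+* R') f) := by
  ext q
  cases μ with
  | plus =>
    simp only [shift, PowerSeries.coeff_map, coeff_mk, map_sum]
    exact Finset.sum_congr rfl fun p _ => map_smul φ _ _
  | minus =>
    simp only [shift, PowerSeries.coeff_map, coeff_mk]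
    refine (IsCSum.csum_eq ?_).symm
    have h := (isCSum_csum (g := fun m => (((q + m).choose m : ℂ⟦X⟧) *
      (-(PowerSeries.C a * c)) ^ m) • coeff (q + m) f) fun m => ?_).map φ
    · simp only [map_smul] at h
      exact h
    · rw [mul_smul]
      refine Submodule.smul_mem _ _ ?_
      rw [neg_pow, mul_smul]
      exact Submodule.smul_mem _ _ (smul_pow_mem_cPow _ _ _)

theorem tOp_map (φ : R →ₐ[ℂ⟦X⟧] R') (t : Ix g n → Ix g n → ℤ → R) (μ : Sgn) :
    tOp (fun i j l => φ (t i j l)) μ = (tOp t μ).map (PowerSeries.map (φ : R →+* R')) := by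
  ext i j p
  change coeff p (tOp _ μ i j) = coeff p (PowerSeries.map _ (tOp t μ i j))
  cases μ <;> simp only [tOp, coeff_mk, PowerSeries.coeff_map] <;>
    split_ifs <;> simp

theorem coeffZ_map (φ : R →ₐ[ℂ⟦X⟧] R') (μ : Sgn) (f : R⟦X⟧) (e : ℤ) :
    coeffZ μ (PowerSeries.map (φ : R →+* R') f) e = φ (coeffZ μ f e) := by
  cases μ <;> simp only [coeffZ] <;> split_ifs <;> simp

theorem mulLin_map (φ : R →ₐ[ℂ⟦X⟧] R') (z : ℂ⟦X⟧) (f : ℤ → ℤ → Mat2 R g n) :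
    mulLin z (fun a b => φ.mapMatrix (f a b)) = fun a b => φ.mapMatrix (mulLin z f a b) := by
  funext a b
  simp only [mulLin, map_add, map_sub, map_smul]

theorem rttDefect_map (φ : R →ₐ[ℂ⟦X⟧] R') (t : Ix g n → Ix g n → ℤ → R) (μ ν : Sgn) (a b : ℤ) :
    rttDefect (fun i j l => φ (t i j l)) μ ν a b = φ.mapMatrix (rttDefect t μ ν a b) := by
  have h12 : prod12 (fun i j l => φ (t i j l)) μ ν = fun a b => φ.mapMatrix (prod12 t μ ν a b) := by
    funext a b
    ext x y
    simp only [prod12, tOp_map, Matrix.map_apply, coeffZ_map, AlgHom.mapMatrix_apply, map_mul]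
  have h21 : prod21 (fun i j l => φ (t i j l)) μ ν = fun a b => φ.mapMatrix (prod21 t μ ν a b) := by
    funext a b
    ext x y
    simp only [prod21, tOp_map, Matrix.map_apply, coeffZ_map, AlgHom.mapMatrix_apply, map_mul]
  have hP : (opP : Mat2 R' g n) = φ.mapMatrix opP := by
    ext x y
    simp only [opP, AlgHom.mapMatrix_apply, Matrix.map_apply]
    split_ifs <;> simp
  have hQ : (opQ : Mat2 R' g n) = φ.mapMatrix opQ := by
    ext x y
    simp only [opQ, AlgHom.mapMatrix_apply, Matrix.map_apply]
    split_ifs <;> simp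
  simp only [rttDefect, h12, h21, hP, hQ, ← map_mul, mulLin_map, map_sub, map_add, map_smul]

theorem transp_map {S S' : Type*} [Ring S] [Ring S'] (φ : S →+* S')
    (M : Matrix (Ix g n) (Ix g n) S) : transp (M.map φ) = (transp M).map φ := by
  ext i j
  simp [transp]

theorem tOpShift_map [CComplete R] [CComplete R'] (φ : R →ₐ[ℂ⟦X⟧] R')
    (t : Ix g n → Ix g n → ℤ → R) (μ : Sgn) :
    tOpShift (fun i j l => φ (t i j l)) μ = (tOpShift t μ).map (PowerSeries.map (φ : R →+* R')) := by
  rw [tOpShift, tOp_map, tOpShift]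
  ext1 i j
  simp only [Matrix.map_apply, shift_map]

theorem relators_map [CComplete R] [CComplete R'] (φ : R →ₐ[ℂ⟦X⟧] R')
    (t : Ix g n → Ix g n → ℤ → R) : relators (fun i j l => φ (t i j l)) = φ '' relators t := by
  have h1 : ∀ μ i j p, coeff p ((transp (tOpShift (fun i j l => φ (t i j l)) μ) *
      tOp (fun i j l => φ (t i j l)) μ - 1) i j) =
      φ (coeff p ((transp (tOpShift t μ) * tOp t μ - 1) i j)) := by
    intro μ i j p
    rw [tOpShift_map, tOp_map, transp_map, ← Matrix.map_mul, Matrix.sub_apply, Matrix.map_apply,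
      Matrix.sub_apply, map_sub, map_sub, map_sub, PowerSeries.coeff_map, Matrix.one_apply,
      Matrix.one_apply]
    congr 1
    split_ifs <;> simp [coeff_one, apply_ite φ]
  have h2 : ∀ μ i j p, coeff p ((tOp (fun i j l => φ (t i j l)) μ *
      transp (tOpShift (fun i j l => φ (t i j l)) μ) - 1) i j) =
      φ (coeff p ((tOp t μ * transp (tOpShift t μ) - 1) i j)) := by
    intro μ i j p
    rw [tOpShift_map, tOp_map, transp_map, ← Matrix.map_mul, Matrix.sub_apply, Matrix.map_apply,
      Matrix.sub_apply, map_sub, map_sub, map_sub, PowerSeries.coeff_map, Matrix.one_apply,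
      Matrix.one_apply]
    congr 1
    split_ifs <;> simp [coeff_one, apply_ite φ]
  ext r
  simp only [relators, h1, h2, rttDefect_map, AlgHom.mapMatrix_apply, Matrix.map_apply,
    Set.mem_union, Set.mem_setOf_eq, Set.mem_image]
  constructor
  · rintro ((⟨μ, ν, a, b, x, y, h⟩ | ⟨μ, i, j, p, h⟩) | ⟨μ, i, j, p, h⟩)
    · exact ⟨_, Or.inl (Or.inl ⟨μ, ν, a, b, x, y, rfl⟩), h.symm⟩
    · exact ⟨_, Or.inl (Or.inr ⟨μ, i, j, p, rfl⟩), h.symm⟩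
    · exact ⟨_, Or.inr ⟨μ, i, j, p, rfl⟩, h.symm⟩
  · rintro ⟨s, (⟨μ, ν, a, b, x, y, rfl⟩ | ⟨μ, i, j, p, rfl⟩) | ⟨μ, i, j, p, rfl⟩, h⟩
    · exact Or.inl (Or.inl ⟨μ, ν, a, b, x, y, h.symm⟩)
    · exact Or.inl (Or.inr ⟨μ, i, j, p, h.symm⟩)
    · exact Or.inr ⟨μ, i, j, p, h.symm⟩

theorem mem_cPow_freeMode {N : ℕ} {x : FreeMode g n} : x ∈ cPow (FreeMode g n) N ↔
    ∀ m < N, coeff (R := FreeAlgebra ℂ (Ix g n × Ix g n × ℤ)) m x = 0 := by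
  refine mem_cPow.trans (Iff.trans ?_ X_pow_dvd_iff)
  constructor
  · rintro ⟨z, rfl⟩
    exact ⟨z, c_smul_free N z⟩
  · rintro ⟨z, rfl⟩
    exact ⟨z, (c_smul_free N z).symm⟩

instance : CComplete (FreeMode g n) where
  torsion_free x hx := by
    refine PowerSeries.ext fun m => ?_
    have h1 := (c_smul_free 1 x).symm.trans (by rw [pow_one, hx])
    have h2 : PowerSeries.coeff (m + 1)
        (PowerSeries.X ^ 1 * x : PowerSeries (FreeAlgebra ℂ (Ix g n × Ix g n × ℤ))) =
        PowerSeries.coeff m x := (coeff_X_pow_mul' _ _ _).trans (if_pos (by omega))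
    exact h2.symm.trans ((congrArg _ h1).trans (map_zero _))
  separated x hx := PowerSeries.ext fun m => mem_cPow_freeMode.1 (hx (m + 1)) m (by omega)
  complete f := ⟨_, csum_spec_free _ fun m => ⟨f m, rfl⟩⟩

theorem relators_mode {r : DY g n} (hr : r ∈ relators (mode (g := g) (n := n))) : r = 0 := by
  have h := relators_map (proj g n) (freeMode (g := g) (n := n))
  obtain ⟨s, hs, rfl⟩ := h.subset hr
  exact (proj_eq_zero s).2 ((relIdeal_admissible g n).1 hs)

/-- The passage from coefficients to matrix identities over series, which is used both for the
double and for the construction of its representations. -/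
theorem relators_eq_zero_iff [CComplete R] (t : Ix g n → Ix g n → ℤ → R) :
    (∀ r ∈ relators t, r = 0) ↔ (∀ μ ν, RTT (tOp t) μ ν) ∧
      ∀ μ, transp ((tOp t μ).map (sigma (dU μ) (kappa g n))) * tOp t μ = 1 ∧
        tOp t μ * transp ((tOp t μ).map (sigma (dU μ) (kappa g n))) = 1 := by
  have hs : ∀ μ, (tOp t μ).map (sigma (dU μ) (kappa g n)) = tOpShift t μ := by
    intro μ
    ext1 i j
    simp only [Matrix.map_apply, tOpShift, shift_eq_sigma]
  simp only [hs]
  constructor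
  · intro h
    refine ⟨fun μ ν => (rtt_iff t μ ν).1 fun a b x y =>
      h _ (Or.inl (Or.inl ⟨μ, ν, a, b, x, y, rfl⟩)), fun μ => ⟨?_, ?_⟩⟩
    · refine sub_eq_zero.1 (Matrix.ext fun i j => PowerSeries.ext fun p => ?_)
      exact h _ (Or.inl (Or.inr ⟨μ, i, j, p, rfl⟩))
    · refine sub_eq_zero.1 (Matrix.ext fun i j => PowerSeries.ext fun p => ?_)
      exact h _ (Or.inr ⟨μ, i, j, p, rfl⟩)
  · rintro ⟨h1, h2⟩ r ((⟨μ, ν, a, b, x, y, rfl⟩ | ⟨μ, i, j, p, rfl⟩) | ⟨μ, i, j, p, rfl⟩)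
    · exact (rtt_iff t μ ν).2 (h1 μ ν) a b x y
    · rw [(h2 μ).1, sub_self]
      exact map_zero _
    · rw [(h2 μ).2, sub_self]
      exact map_zero _

theorem rtt_mode (μ ν : Sgn) : RTT (T g n) μ ν :=
  ((relators_eq_zero_iff mode).1 fun _ hr => relators_mode hr).1 μ ν

theorem unitary_mode (μ : Sgn) :
    transp ((T g n μ).map (sigma (dU μ) (kappa g n))) * T g n μ = 1 ∧
      T g n μ * transp ((T g n μ).map (sigma (dU μ) (kappa g n))) = 1 :=
  ((relators_eq_zero_iff mode).1 fun _ hr => relators_mode hr).2 μ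

end Functor

/-! ### Gauss coordinates of the Yangian double -/

section GaussDY

variable {g : Series} {n : ℕ}

/-- A matrix as a function of integers. -/
def extend {S : Type*} [Zero S] (M : Matrix (Ix g n) (Ix g n) S) (i j : ℤ) : S :=
  if h : i ∈ Finset.Icc (lo g n) (n : ℤ) ∧ j ∈ Finset.Icc (lo g n) (n : ℤ) then
    M ⟨i, h.1⟩ ⟨j, h.2⟩ else 0

theorem extend_apply {S : Type*} [Zero S] (M : Matrix (Ix g n) (Ix g n) S) (i j : Ix g n) :
    extend M i j = M i j := dif_pos ⟨i.2, j.2⟩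

theorem extend_mk {S : Type*} [Zero S] (M : Matrix (Ix g n) (Ix g n) S) {i j : ℤ}
    (hi : i ∈ Finset.Icc (lo g n) (n : ℤ)) (hj : j ∈ Finset.Icc (lo g n) (n : ℤ)) :
    extend M i j = M ⟨i, hi⟩ ⟨j, hj⟩ := dif_pos ⟨hi, hj⟩

theorem lo_le (g : Series) (n : ℕ) : lo g n ≤ n + 1 := by cases g <;> simp only [lo] <;> omega

/-- Gauss coordinates as Gauss data. -/
def IsGauss.data {M : Matrix (Ix g n) (Ix g n) (DY g n)⟦X⟧} {G : Gauss g n} (h : IsGauss M G) :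
    GaussData (DY g n)⟦X⟧ (lo g n) n where
  F := G.F
  E := G.E
  k := G.k
  ki l := Ring.inverse (G.k l)
  F_diag := h.F_diag
  E_diag := h.E_diag
  ki_mul l hl := Ring.inverse_mul_cancel _ (h.k_unit l hl)
  mul_ki l hl := Ring.mul_inverse_cancel _ (h.k_unit l hl)

theorem IsGauss.part_eq {M : Matrix (Ix g n) (Ix g n) (DY g n)⟦X⟧} {G : Gauss g n}
    (h : IsGauss M G) : ∀ i ∈ Finset.Icc (lo g n) (n : ℤ), ∀ j ∈ Finset.Icc (lo g n) (n : ℤ),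
    h.data.part n i j = extend M i j := by
  intro i hi j hj
  rw [extend_mk M hi hj, h.decomp]
  rfl

/-- The series `∑ t_{ij}[ℓ] u^{-ℓ-1}`. -/
def ser {R : Type*} [Ring R] (t : Ix g n → Ix g n → ℤ → R) (μ : Sgn) :
    Matrix (Ix g n) (Ix g n) R⟦X⟧ := fun i j =>
  match μ with
  | .plus => PowerSeries.mk fun p => if p = 0 then 0 else t i j ((p : ℤ) - 1)
  | .minus => PowerSeries.mk fun p => t i j (-(p : ℤ) - 1)

theorem tOp_apply_eq_ser {R : Type*} [Ring R] [Algebra ℂ⟦X⟧ R] (t : Ix g n → Ix g n → ℤ → R)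
    (μ : Sgn) (i j : Ix g n) : tOp t μ i j = (if i = j then 1 else 0) + c • ser t μ i j := by
  ext p
  cases μ with
  | plus =>
    simp only [tOp, ser, coeff_mk, map_add, PowerSeries.coeff_smul]
    by_cases hp : p = 0
    · subst hp
      simp only [if_true, smul_zero, add_zero]
      split_ifs <;> simp
    · rw [if_neg hp, if_neg hp]
      split_ifs <;> simp [coeff_one, hp]
  | minus =>
    simp only [tOp, ser, coeff_mk, map_add, PowerSeries.coeff_smul]
    congr 1
    by_cases hp : p = 0 <;> split_ifs <;> simp_all [coeff_one]

/-- The series `∑ t_{ij}[ℓ] u^{-ℓ-1}` of the Yangian double. -/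
def tSeries (μ : Sgn) : Matrix (Ix g n) (Ix g n) (DY g n)⟦X⟧ := ser mode μ

theorem T_eq_tSeries (μ : Sgn) (i j : Ix g n) :
    T g n μ i j = (if i = j then 1 else 0) + c • tSeries μ i j := tOp_apply_eq_ser _ _ _ _

theorem nearOne_T (μ : Sgn) {Q : Submodule ℂ⟦X⟧ (DY g n)⟦X⟧}
    (hQ : ∀ i j, tSeries (g := g) (n := n) μ i j ∈ Q) :
    NearOne Q (lo g n) n (extend (T g n μ)) (extend (tSeries μ)) := by
  intro i hi j hj
  rw [extend_mk _ hi hj, extend_mk _ hi hj]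
  refine ⟨hQ _ _, ?_⟩
  rw [T_eq_tSeries]
  simp [Subtype.ext_iff]

theorem exists_gaussData_T (μ : Sgn) {Q : Submodule ℂ⟦X⟧ (DY g n)⟦X⟧} (hQ : IsNear Q)
    (hT : ∀ i j, tSeries (g := g) (n := n) μ i j ∈ Q) :
    ∃ G : GaussData (DY g n)⟦X⟧ (lo g n) n, (∀ i ∈ Finset.Icc (lo g n) (n : ℤ),
      ∀ j ∈ Finset.Icc (lo g n) (n : ℤ), G.part n i j = extend (T g n μ) i j) ∧
        G.Near Q (extend (tSeries μ)) := by
  have e : (n : ℤ) = lo g n + (n + 1 - lo g n).toNat - 1 := by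
    have := lo_le g n
    omega
  have := exists_gaussData hQ (lo g n) (n + 1 - lo g n).toNat (T := extend (T g n μ))
    (y := extend (tSeries μ)) (by rw [← e]; exact nearOne_T μ hT)
  rwa [← e] at this

theorem IsGauss.near {μ : Sgn} {G : Gauss g n} (h : IsGauss (T g n μ) G)
    {Q : Submodule ℂ⟦X⟧ (DY g n)⟦X⟧} (hQ : IsNear Q)
    (hT : ∀ i j, tSeries (g := g) (n := n) μ i j ∈ Q) : h.data.Near Q (extend (tSeries μ)) := by
  obtain ⟨G', hG', hN⟩ := exists_gaussData_T μ hQ hT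
  exact GaussData.Near.of_part_eq (fun i hi j hj => by rw [h.part_eq i hi j hj, hG' i hi j hj]) hN

/-- Elimination provides coordinates on the index range only; they are cut off to zero outside it,
which makes them unique as functions of integers. -/
theorem existsUnique_gauss (g : Series) (n : ℕ) (μ : Sgn) : ∃! G : Gauss g n, IsGauss (T g n μ) G := by
  obtain ⟨G, hG, -⟩ := exists_gaussData_T (g := g) (n := n) μ isNear_top fun _ _ => trivial
  refine ⟨⟨fun j i => if lo g n ≤ i ∧ i ≤ j ∧ j ≤ n then G.F j i else 0,
    fun i j => if lo g n ≤ i ∧ i ≤ j ∧ j ≤ n then G.E i j else 0,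
    fun l => if l ∈ Finset.Icc (lo g n) (n : ℤ) then G.k l else 0⟩,
    ⟨?_, ?_, ?_, ?_, ?_, ?_, ?_⟩, ?_⟩
  · intro i hi
    have h := Finset.mem_Icc.1 hi
    simpa [h.1, h.2] using G.F_diag i hi
  · intro i hi
    have h := Finset.mem_Icc.1 hi
    simpa [h.1, h.2] using G.E_diag i hi
  · exact fun i j h => if_neg h
  · exact fun i j h => if_neg h
  · intro l hl
    simp only [if_pos hl]
    exact ⟨⟨G.k l, G.ki l, G.mul_ki l hl, G.ki_mul l hl⟩, rfl⟩
  · exact fun l hl => if_neg hl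
  · intro i j
    rw [← extend_apply (T g n μ), ← hG i i.2 j j.2]
    refine Finset.sum_congr rfl fun l hl => ?_
    rw [Finset.mem_Icc, max_le_iff] at hl
    have hi := Finset.mem_Icc.1 i.2
    have hj := Finset.mem_Icc.1 j.2
    have hlm : l ∈ Finset.Icc (lo g n) (n : ℤ) := Finset.mem_Icc.2 ⟨by omega, hl.2⟩
    dsimp only
    rw [if_pos ⟨hi.1, hl.1.1, hl.2⟩, if_pos hlm, if_pos ⟨hj.1, hl.1.2, hl.2⟩]
  · intro G' hG'
    have key : ∀ {i l : ℤ}, lo g n ≤ i → i ≤ l → l ≤ n → _ := fun hi hil hl =>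
      GaussData.unique (G := hG'.data) (G' := G)
        (fun i hi j hj => by rw [hG'.part_eq i hi j hj, hG i hi j hj]) hi hil hl
    ext1
    · funext j i
      dsimp only
      by_cases h : lo g n ≤ i ∧ i ≤ j ∧ j ≤ n
      · rw [if_pos h]
        exact (key h.1 h.2.1 h.2.2).2.1
      · rw [if_neg h, hG'.F_zero i j h]
    · funext i j
      dsimp only
      by_cases h : lo g n ≤ i ∧ i ≤ j ∧ j ≤ n
      · rw [if_pos h]
        exact (key h.1 h.2.1 h.2.2).2.2
      · rw [if_neg h, hG'.E_zero i j h]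
    · funext l
      dsimp only
      by_cases h : l ∈ Finset.Icc (lo g n) (n : ℤ)
      · rw [if_pos h]
        exact (key (Finset.mem_Icc.1 h).1 le_rfl (Finset.mem_Icc.1 h).2).1
      · rw [if_neg h, hG'.k_zero l h]

/-- The symmetry data of the classical series. -/
def sym : Series → SymData
  | .B => ⟨0, fun _ => 1, fun _ => rfl, -1 / 2⟩
  | .C => ⟨1, fun i => if 1 ≤ i then -1 else 1, fun i => by split_ifs <;> rfl, 1⟩
  | .D => ⟨1, fun _ => 1, fun _ => rfl, -1⟩

theorem lo_eq (g : Series) (n : ℕ) : (sym g).s - n = lo g n := by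
  cases g <;> simp only [sym, lo] <;> ring

theorem opp_eq (i : Ix g n) : (opp i : ℤ) = (sym g).s - i := by
  cases g <;> simp only [sym, opp] <;> ring

theorem eps_eq (i : Ix g n) : eps i = (sym g).ε i := by
  cases g <;> simp only [sym, eps]

theorem kappa_eq (g : Series) (n : ℕ) : kappa g n = ((n : ℤ) : ℂ) + (sym g).σ := by
  cases g <;> simp only [sym, kappa] <;> push_cast <;> ring

theorem sum_Ix {S : Type*} [AddCommMonoid S] (f : ℤ → S) :
    ∑ i : Ix g n, f i = ∑ i ∈ Finset.Icc (lo g n) (n : ℤ), f i :=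
  Finset.sum_coe_sort (Finset.Icc (lo g n) (n : ℤ)) f

/-- The start of the descent: in full rank unitarity holds without a correcting factor, so v = 1. -/
theorem stage_top {μ : Sgn} {G : Gauss g n} (h : IsGauss (T g n μ) G) :
    Stage (sym g) (dU μ) (h.data.part n) n 1 1 := by
  have hp := h.part_eq
  have tr : ∀ i j : Ix g n, transp ((T g n μ).map (sigma (dU μ) (kappa g n))) i j =
      (sym g).dual (dU μ) (h.data.part n) n 1 i j := by
    intro i j
    rw [transp, SymData.dual, mul_one, ← opp_eq, ← opp_eq, hp _ (opp j).2 _ (opp i).2, extend_apply,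
      eps_eq, eps_eq, ← kappa_eq, Matrix.map_apply]
  refine ⟨?_, ⟨?_, ?_⟩, one_mul 1, one_mul 1, fun _ _ _ _ _ => Commute.one_left _⟩
  · rw [lo_eq]
    intro i hi k hk j hj l hl hik hjl
    have := glSer_of_rtt (rtt_mode (g := g) (n := n) μ μ) (i := ⟨i, hi⟩) (k := ⟨k, hk⟩)
      (j := ⟨j, hj⟩) (l := ⟨l, hl⟩)
      (fun e => hik (by have := congrArg Subtype.val e; rw [opp_eq] at this; simp only at this; omega))
      (fun e => hjl (by have := congrArg Subtype.val e; rw [opp_eq] at this; simp only at this; omega))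
    unfold GLSer GLRel at this ⊢
    simpa only [hp _ hi _ hj, hp _ hi _ hl, hp _ hk _ hj, hp _ hk _ hl, extend_mk _ hi hj,
      extend_mk _ hi hl, extend_mk _ hk hj, extend_mk _ hk hl] using this
  · rw [lo_eq]
    intro i hi j hj
    have := congrFun₂ (unitary_mode (g := g) (n := n) μ).2 ⟨i, hi⟩ ⟨j, hj⟩
    rw [Matrix.mul_apply, Matrix.one_apply] at this
    simp only [Subtype.mk.injEq] at this
    rw [← this, ← sum_Ix]
    refine Finset.sum_congr rfl fun l _ => ?_
    rw [tr, hp i hi l l.2, extend_mk _ hi l.2]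
  · rw [lo_eq]
    intro i hi j hj
    have := congrFun₂ (unitary_mode (g := g) (n := n) μ).1 ⟨i, hi⟩ ⟨j, hj⟩
    rw [Matrix.mul_apply, Matrix.one_apply] at this
    simp only [Subtype.mk.injEq] at this
    rw [← this, ← sum_Ix]
    refine Finset.sum_congr rfl fun l _ => ?_
    rw [tr, hp l l.2 j hj, extend_mk _ l.2 hj]

/-- The product of the Cartan factors with indices from `l + 1` to `n`. -/
def cartanProd (G : Gauss g n) (μ : Sgn) (σ : ℂ) (l : ℕ) : (DY g n)⟦X⟧ :=
  ((List.range' (l + 1) (n - l)).map fun s : ℕ =>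
    shift μ (s + σ - 1) (G.k s) * Ring.inverse (shift μ (s + σ) (G.k s))).prod

theorem cartanProd_self (G : Gauss g n) (μ : Sgn) (σ : ℂ) : cartanProd G μ σ n = 1 := by
  simp [cartanProd]

theorem cartanProd_succ (G : Gauss g n) (μ : Sgn) (σ : ℂ) {l : ℕ} (hl : l < n) :
    cartanProd G μ σ l = shift μ ((l + 1 : ℕ) + σ - 1) (G.k (l + 1 : ℕ)) *
      Ring.inverse (shift μ ((l + 1 : ℕ) + σ) (G.k (l + 1 : ℕ))) * cartanProd G μ σ (l + 1) := by
  rw [cartanProd, show n - l = n - (l + 1) + 1 by omega, List.range'_succ, List.map_cons,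
    List.prod_cons, cartanProd]

theorem s_mem (g : Series) : (sym g).s = 0 ∨ (sym g).s = 1 := by cases g <;> simp [sym]

theorem inverse_shift {G : Gauss g n} {μ : Sgn} {M : Matrix (Ix g n) (Ix g n) (DY g n)⟦X⟧}
    (h : IsGauss M G) {l : ℤ} (hl : l ∈ Finset.Icc (lo g n) (n : ℤ)) (a : ℂ) :
    Ring.inverse (shift μ a (G.k l)) = sigma (dU μ) a (h.data.ki l) := by
  rw [shift_eq_sigma]
  have h1 : sigma (dU μ) a (G.k l) * sigma (dU μ) a (h.data.ki l) = 1 := by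
    rw [← map_mul, ← map_one (sigma (dU μ) a)]
    exact congrArg _ (h.data.mul_ki l hl)
  have h2 : sigma (dU μ) a (h.data.ki l) * sigma (dU μ) a (G.k l) = 1 := by
    rw [← map_mul, ← map_one (sigma (dU μ) a)]
    exact congrArg _ (h.data.ki_mul l hl)
  exact Ring.inverse_unit (⟨_, _, h1, h2⟩ : ((DY g n)⟦X⟧)ˣ)

theorem mem_of_natCast {l : ℕ} (h1 : 1 ≤ l ∨ g = .B) (hl : l ≤ n) :
    (l : ℤ) ∈ Finset.Icc (lo g n) (n : ℤ) := by
  rw [Finset.mem_Icc]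
  rcases h1 with h1 | rfl
  · cases g <;> simp only [lo] <;> omega
  · simp only [lo]
    omega

/-- Descent from n to l. Each step multiplies the factor from the left by a ratio of shifted
diagonal coordinates, which is the product in the order of increasing s. -/
theorem stage_all {μ : Sgn} {G : Gauss g n} (h : IsGauss (T g n μ) G) (r l : ℕ) (hr : l + r = n) :
    ∃ vi, Stage (sym g) (dU μ) (h.data.part l) l (cartanProd G μ (sym g).σ l) vi := by
  induction r generalizing l with
  | zero =>
    obtain rfl : l = n := hr
    exact ⟨1, by rw [cartanProd_self]; exact stage_top h⟩
  | succ r ih =>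
    obtain ⟨vi, hv⟩ := ih (l + 1) (by omega)
    have hs := s_mem g
    have := hv.step (by rw [← lo_eq]; omega) (by omega) (by omega)
    have hmem : ((l + 1 : ℕ) : ℤ) ∈ Finset.Icc (lo g n) (n : ℤ) := mem_of_natCast (by simp) (by omega)
    rw [show ((l + 1 : ℕ) : ℤ) - 1 = l by push_cast; ring] at this
    have e : cartanProd G μ (sym g).σ l = sigma (dU μ) (((l + 1 : ℕ) : ℤ) + (sym g).σ - 1)
        (h.data.k (l + 1 : ℕ)) * sigma (dU μ) (((l + 1 : ℕ) : ℤ) + (sym g).σ)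
        (h.data.ki (l + 1 : ℕ)) * cartanProd G μ (sym g).σ (l + 1) := by
      rw [cartanProd_succ _ _ _ (by omega), inverse_shift h hmem, shift_eq_sigma, Int.cast_natCast]
      rfl
    rw [← e] at this
    exact ⟨_, this⟩

theorem gauss_k_eq {μ : Sgn} {G : Gauss g n} (h : IsGauss (T g n μ) G) {l : ℕ}
    (h1 : 1 ≤ l ∨ g = .B) (hl : l ≤ n) :
    G.k ((sym g).s - l) = cartanRHS G μ (sym g).σ l := by
  obtain ⟨vi, hv⟩ := stage_all h (n - l) l (by omega)
  have hs := s_mem g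
  have := hv.k_eq (by rw [← lo_eq]; omega) (by omega) (by
    rcases h1 with h1 | rfl
    · omega
    · simp [sym])
  rw [cartanRHS, inverse_shift h (mem_of_natCast h1 hl)]
  exact this

theorem gauss_fe_eq {μ : Sgn} {G : Gauss g n} (h : IsGauss (T g n μ) G) {i : ℕ}
    (h1 : 1 ≤ i ∨ g = .B) (hi : i + 1 ≤ n) :
    G.F ((sym g).s - i) ((sym g).s - i - 1) = -shift μ (i + (sym g).σ) (G.F (i + 1) i) ∧
      G.E ((sym g).s - i - 1) ((sym g).s - i) = -shift μ (i + (sym g).σ) (G.E i (i + 1)) := by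
  obtain ⟨vi, hv⟩ := stage_all h (n - (i + 1)) (i + 1) (by omega)
  have hs := s_mem g
  have := hv.fe_eq (by rw [← lo_eq]; omega) (by omega) (by
    rcases h1 with h1 | rfl
    · omega
    · simp [sym]; omega) (by
    rcases h1 with h1 | rfl
    -- In the symplectic case the two neighbouring indices are -i and -i+1 with i ≥ 1, hence both at
    -- most 0, so their signs agree.
    · cases g <;> simp only [sym, mul_one]
      rw [if_neg (by push_cast; omega), if_neg (by push_cast; omega), one_mul]
    · simp [sym])
  rw [show (sym g).s - ((i + 1 : ℕ) : ℤ) + 1 = (sym g).s - i by push_cast; ring,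
    show (sym g).s - ((i + 1 : ℕ) : ℤ) = (sym g).s - i - 1 by push_cast; ring,
    show (((i + 1 : ℕ) : ℤ) : ℂ) + (sym g).σ - 1 = i + (sym g).σ by push_cast; ring,
    show ((i + 1 : ℕ) : ℤ) - 1 = i by push_cast; ring, Nat.cast_succ] at this
  rw [shift_eq_sigma, shift_eq_sigma]
  exact this

end GaussDY

end YangianDouble

end
noncomputable section

namespace YangianDouble

open PowerSeries Finset.HasAntidiagonal

/-! ### Solutions of the defining relations -/

section Solutions

variable {g : Series} {n : ℕ}

/-- The elements `t` satisfy the defining relations. -/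
def Sol {R : Type*} [Ring R] [Algebra ℂ⟦X⟧ R] (t : Ix g n → Ix g n → ℤ → R) : Prop :=
  ∀ r ∈ relators t, r = 0

/-- Expanding a scalar in powers of `c` and evaluating gives the scalar back; this makes the map out
of the completed free algebra linear over ℂ⟦c⟧. -/
theorem evHom_base {R : Type*} [Ring R] [Algebra ℂ⟦X⟧ R] [CComplete R] (r : ℂ⟦X⟧) :
    evHom R 1 (PowerSeries.mk fun m => algebraMap ℂ⟦X⟧ R (PowerSeries.C (coeff m r))) =
      algebraMap ℂ⟦X⟧ R r := by
  rw [evHom_apply]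
  refine (isCSum_evc 1 _).unique ?_
  have h : IsCSum (fun m => (PowerSeries.C (1 : ℂ) * c) ^ m • (PowerSeries.C (coeff m r) : ℂ⟦X⟧)) r := by
    refine isCSum_iff.2 fun N => mem_cPow_base.2 fun m hm => ?_
    have e : ∀ k : ℕ, ((PowerSeries.C (1 : ℂ) * c) ^ k • (PowerSeries.C (coeff k r) : ℂ⟦X⟧)) =
        PowerSeries.C (coeff k r) * PowerSeries.X ^ k := by
      intro k
      rw [map_one, one_mul, smul_eq_mul, mul_comm]
      rfl
    simp only [e, map_sub, map_sum, PowerSeries.coeff_C_mul, coeff_X_pow]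
    rw [Finset.sum_eq_single m]
    · simp
    · intro b _ hb
      rw [if_neg hb.symm, mul_zero]
    · simp [hm]
  have h := h.map (Algebra.ofId ℂ⟦X⟧ R)
  refine (congrArg (fun f => IsCSum f (algebraMap ℂ⟦X⟧ R r)) (funext fun m => ?_)).mp h
  rw [map_smul, coeff_mk]
  rfl

/-- The universal property. A map out of the free algebra is extended to series in `c` by
evaluation. -/
theorem Sol.exists_lift {R : Type*} [Ring R] [Algebra ℂ⟦X⟧ R] [CComplete R]
    {t : Ix g n → Ix g n → ℤ → R} (ht : Sol t) :
    ∃ ψ : DY g n →ₐ[ℂ⟦X⟧] R, ∀ i j l, ψ (mode i j l) = t i j l := by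
  letI : Algebra ℂ R := Algebra.compHom R (PowerSeries.C (R := ℂ))
  let f0 : FreeAlgebra ℂ (Ix g n × Ix g n × ℤ) →ₐ[ℂ] R :=
    FreeAlgebra.lift ℂ fun m => t m.1 m.2.1 m.2.2
  let f1 : FreeMode g n →+* R := (evHom R 1).comp (PowerSeries.map (f0 : _ →+* R))
  let f : FreeMode g n →ₐ[ℂ⟦X⟧] R :=
    { f1 with
      commutes' := fun r => by
        refine Eq.trans (congrArg (evHom R 1) ?_) (evHom_base r)
        refine PowerSeries.ext fun m => ?_
        rw [coeff_mk]
        refine (PowerSeries.coeff_map _ _ _).trans ?_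
        exact (congrArg f0 (PowerSeries.coeff_map (algebraMap ℂ (FreeAlgebra ℂ (Ix g n × Ix g n × ℤ)))
          m r)).trans (f0.commutes _) }
  have hf : ∀ i j l, f (freeMode i j l) = t i j l := by
    intro i j l
    change evHom R 1 (PowerSeries.map (f0 : _ →+* R) (PowerSeries.C (FreeAlgebra.ι ℂ (i, j, l)))) = _
    rw [PowerSeries.map_C, evHom_C]
    exact FreeAlgebra.lift_ι_apply _ _
  -- The kernel is saturated because the target has no `c`-torsion, and closed because the target is
  -- separated, so it contains the defining ideal.
  have hker : TwoSidedIdeal.ker f ∈ admissibleIdeals g n := by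
    refine ⟨fun r hr => ?_, fun x hx => ?_, fun x hx => ?_⟩
    · refine (TwoSidedIdeal.mem_ker f).2 (ht _ ?_)
      have h := relators_map f (freeMode (g := g) (n := n))
      simp only [hf] at h
      rw [h]
      exact ⟨r, hr, rfl⟩
    · rw [TwoSidedIdeal.mem_ker, map_smul] at hx
      exact (TwoSidedIdeal.mem_ker f).2 (CComplete.torsion_free _ hx)
    · refine (TwoSidedIdeal.mem_ker f).2 (CComplete.separated _ fun N => ?_)
      obtain ⟨y, hy, z, hz⟩ := hx N
      rw [TwoSidedIdeal.mem_ker] at hy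
      refine mem_cPow.2 ⟨f z, ?_⟩
      rw [← map_smul, ← hz, map_sub, hy, sub_zero]
  have hle : relIdeal g n ≤ TwoSidedIdeal.ker f := sInf_le hker
  have hrel : (relIdeal g n).ringCon ≤ RingCon.ker (f : FreeMode g n →+* R) := fun x y h => by
    have h' := (TwoSidedIdeal.mem_ker f).1 (hle ((TwoSidedIdeal.rel_iff _ _ _).1 h))
    rw [map_sub, sub_eq_zero] at h'
    exact h'
  let ψ1 : DY g n →+* R := (relIdeal g n).ringCon.lift (f : FreeMode g n →+* R) hrel
  have hψ : ∀ x, ψ1 (proj g n x) = f x := fun x => rfl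
  refine ⟨{ ψ1 with commutes' := fun r => ?_ }, fun i j l => ?_⟩
  · refine Eq.trans ?_ (f.commutes r)
    rw [← hψ, AlgHom.commutes]
    rfl
  · exact (hψ _).trans (hf i j l)

variable {R R' : Type*} [Ring R] [Algebra ℂ⟦X⟧ R] [CComplete R] [Ring R'] [Algebra ℂ⟦X⟧ R']
  [CComplete R']

theorem Sol.map {t : Ix g n → Ix g n → ℤ → R} (ht : Sol t) (φ : R →ₐ[ℂ⟦X⟧] R') :
    Sol fun i j l => φ (t i j l) := by
  intro r hr
  rw [relators_map] at hr
  obtain ⟨s, hs, rfl⟩ := hr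
  rw [ht s hs, map_zero]

/-- The elements with generating series `w`. -/
def modesOf (w : Sgn → Matrix (Ix g n) (Ix g n) R⟦X⟧) (i j : Ix g n) (l : ℤ) : R :=
  if 0 ≤ l then coeff (l + 1).toNat (w .plus i j) else coeff (-l - 1).toNat (w .minus i j)

omit [Algebra ℂ⟦X⟧ R] [CComplete R] in
theorem ser_modesOf {w : Sgn → Matrix (Ix g n) (Ix g n) R⟦X⟧}
    (hw : ∀ i j, coeff 0 (w .plus i j) = 0) (μ : Sgn) : ser (modesOf w) μ = w μ := by
  ext i j p
  cases μ with
  | plus =>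
    simp only [ser, modesOf, coeff_mk]
    by_cases h : p = 0
    · rw [if_pos h, h, hw]
    · rw [if_neg h, if_pos (by omega), show ((p : ℤ) - 1 + 1).toNat = p by omega]
  | minus =>
    simp only [ser, modesOf, coeff_mk]
    rw [if_neg (by omega), show (-(-(p : ℤ) - 1) - 1).toNat = p by omega]

omit [Algebra ℂ⟦X⟧ R] [CComplete R] in
theorem modesOf_ser (t : Ix g n → Ix g n → ℤ → R) : modesOf (ser t) = t := by
  funext i j l
  simp only [modesOf, ser, coeff_mk]
  by_cases h : 0 ≤ l
  · rw [if_pos h, if_neg (by omega), show (((l + 1).toNat : ℕ) : ℤ) - 1 = l by omega]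
  · rw [if_neg h, show -(((-l - 1).toNat : ℕ) : ℤ) - 1 = l by omega]

omit [CComplete R] in
theorem tOp_eq_ser (t : Ix g n → Ix g n → ℤ → R) (μ : Sgn) : tOp t μ = 1 + c • ser t μ := by
  ext1 i j
  rw [tOp_apply_eq_ser, Matrix.add_apply, Matrix.one_apply]
  rfl

theorem opp_opp (i : Ix g n) : opp (opp i) = i := by
  apply Subtype.ext
  rw [opp_eq, opp_eq, sub_sub_cancel]

theorem eps_mul_self (i : Ix g n) : eps i * eps i = 1 := by
  rw [eps_eq]
  exact (sym g).ε_sq _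

theorem transp_mul {S : Type*} [Ring S] {M N : Matrix (Ix g n) (Ix g n) S}
    (h : ∀ i j k l, Commute (M i j) (N k l)) : transp (M * N) = transp N * transp M := by
  ext1 i j
  rw [transp, Matrix.mul_apply, Matrix.mul_apply, Finset.smul_sum]
  refine Finset.sum_nbij' opp opp (by simp) (by simp) (fun a _ => opp_opp a) (fun a _ => opp_opp a)
    fun a _ => ?_
  rw [transp, transp, opp_opp, (h _ _ _ _).eq, smul_mul_assoc, mul_smul_comm, smul_smul]
  congr 1
  rw [mul_assoc, ← mul_assoc (eps (opp a)), eps_mul_self, one_mul]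

omit [Algebra ℂ⟦X⟧ R] [CComplete R] in
theorem inl_inr_commute {f f' : R⟦X⟧} (h : ∀ p q, Commute (coeff p f) (coeff q f')) :
    Commute (inl f) (inr f') := by
  ext q p
  have e1 : coeff p (coeff q (inl f * inr f')) = coeff p f * coeff q f' := by
    rw [inl, coeff_C_mul, inr, PowerSeries.coeff_map, coeff_mul_C]
  have e2 : coeff p (coeff q (inr f' * inl f)) = coeff q f' * coeff p f := by
    rw [inl, coeff_mul_C, inr, PowerSeries.coeff_map, coeff_C_mul]
  rw [e1, e2, (h p q).eq]

omit [Algebra ℂ⟦X⟧ R] [CComplete R] in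
theorem mat12_mul {M N M' N' : Matrix (Ix g n) (Ix g n) R⟦X⟧}
    (h : ∀ i j k l p q, Commute (coeff p (N i j)) (coeff q (M' k l))) :
    mat12 (M * N) (M' * N') = mat12 M M' * mat12 N N' := by
  ext1 x y
  rw [Matrix.mul_apply, mat12, Matrix.mul_apply, Matrix.mul_apply, map_sum, map_sum,
    Finset.sum_mul_sum, Fintype.sum_prod_type]
  refine Finset.sum_congr rfl fun a _ => Finset.sum_congr rfl fun b _ => ?_
  rw [mat12, mat12, map_mul, map_mul, mul_assoc, ← mul_assoc (inl (N a y.1)),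
    (inl_inr_commute (h _ _ _ _)).eq]
  simp only [mul_assoc]

omit [Algebra ℂ⟦X⟧ R] [CComplete R] in
theorem mat21_mul {M N M' N' : Matrix (Ix g n) (Ix g n) R⟦X⟧}
    (h : ∀ i j k l p q, Commute (coeff p (M i j)) (coeff q (N' k l))) :
    mat21 (M * N) (M' * N') = mat21 M M' * mat21 N N' := by
  ext1 x y
  rw [Matrix.mul_apply, mat21, Matrix.mul_apply, Matrix.mul_apply, map_sum, map_sum,
    Finset.sum_mul_sum, Finset.sum_comm, Fintype.sum_prod_type]
  refine Finset.sum_congr rfl fun a _ => Finset.sum_congr rfl fun b _ => ?_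
  rw [mat21, mat21, map_mul, map_mul, mul_assoc, ← mul_assoc (inr (N' b y.2)),
    ← (inl_inr_commute (h _ _ _ _)).eq]
  simp only [mul_assoc]

omit [CComplete R] in
theorem tOp_commute {t s : Ix g n → Ix g n → ℤ → R}
    (h : ∀ i j l i' j' l', Commute (t i j l) (s i' j' l')) (μ ν : Sgn) (i j i' j' : Ix g n)
    (p q : ℕ) : Commute (coeff p (tOp t μ i j)) (coeff q (tOp s ν i' j')) := by
  have key : ∀ μ i j p, ∀ x : R, (∀ i j l, Commute (t i j l) x) →
      Commute (coeff p (tOp t μ i j)) x := by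
    intro μ i j p x hx
    cases μ <;> simp only [tOp, coeff_mk] <;> split_ifs <;>
      simp [Commute.smul_left, hx, Commute.add_left]
  have key' : ∀ ν i j p, ∀ x : R, (∀ i j l, Commute x (s i j l)) →
      Commute x (coeff p (tOp s ν i j)) := by
    intro μ i j p x hx
    cases μ <;> simp only [tOp, coeff_mk] <;> split_ifs <;>
      simp [Commute.smul_right, hx, Commute.add_right]
  exact key μ i j p _ fun i j l => key' ν i' j' q _ fun i' j' l' => h _ _ _ _ _ _

/-- The coproduct: the product of two T-operators with mutually commuting entries satisfies the RTT
relations, and unitarity because transposition reverses such products. From (1+cY)(1+cZ) the modes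
add up modulo `c`. -/
theorem Sol.mul {t s : Ix g n → Ix g n → ℤ → R} (ht : Sol t) (hs : Sol s)
    (h : ∀ i j l i' j' l', Commute (t i j l) (s i' j' l')) :
    ∃ r : Ix g n → Ix g n → ℤ → R, Sol r ∧ ∀ i j l, ∃ z, r i j l = t i j l + s i j l + c • z := by
  set w : Sgn → Matrix (Ix g n) (Ix g n) R⟦X⟧ := fun μ =>
    ser t μ + ser s μ + c • (ser t μ * ser s μ) with hw
  have h0 : ∀ i j, coeff 0 (w .plus i j) = 0 := by
    intro i j
    simp only [hw, Matrix.add_apply, Matrix.smul_apply, Matrix.mul_apply, map_add,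
      PowerSeries.coeff_smul, map_sum]
    have : ∀ (t : Ix g n → Ix g n → ℤ → R) i j, coeff 0 (ser t .plus i j) = 0 := by
      intro t i j
      simp [ser]
    simp [this, coeff_mul]
  have hr : ∀ μ, tOp (modesOf w) μ = tOp t μ * tOp s μ := by
    intro μ
    rw [tOp_eq_ser, tOp_eq_ser, tOp_eq_ser, ser_modesOf h0]
    simp only [hw, mul_add, add_mul, mul_one, one_mul, smul_add, smul_mul_assoc, mul_smul_comm]
    abel
  have hc : ∀ μ ν i j i' j', Commute (tOp t μ i j) (tOp s ν i' j') := by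
    intro μ ν i j i' j'
    ext p
    rw [coeff_mul, coeff_mul, ← Finset.Nat.sum_antidiagonal_swap]
    exact Finset.sum_congr rfl fun q _ => tOp_commute h μ ν i j i' j' q.2 q.1
  refine ⟨modesOf w, ?_, ?_⟩
  · refine (relators_eq_zero_iff _).2 ⟨fun μ ν => ?_, fun μ => ?_⟩
    · obtain ⟨h1, -⟩ := (relators_eq_zero_iff t).1 ht
      obtain ⟨h2, -⟩ := (relators_eq_zero_iff s).1 hs
      have h1 := h1 μ ν
      have h2 := h2 μ ν
      unfold RTT at h1 h2 ⊢
      rw [hr, hr, mat12_mul fun i j k l p q => (tOp_commute h ν μ k l i j q p).symm,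
        mat21_mul fun i j k l p q => tOp_commute h μ ν i j k l p q, ← mul_assoc, h1, mul_assoc, h2,
        mul_assoc]
    · obtain ⟨h1, h1'⟩ := ((relators_eq_zero_iff t).1 ht).2 μ
      obtain ⟨h2, h2'⟩ := ((relators_eq_zero_iff s).1 hs).2 μ
      rw [hr, Matrix.map_mul, transp_mul]
      · constructor
        · rw [mul_assoc, ← mul_assoc _ (tOp t μ), h1, one_mul, h2]
        · rw [mul_assoc, ← mul_assoc (tOp s μ), h2', one_mul, h1']
      · exact fun i j k l => (hc μ μ i j k l).map (sigma (dU μ) (kappa g n))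
  · intro i j l
    refine ⟨modesOf (fun μ => ser t μ * ser s μ) i j l, ?_⟩
    have e1 := congrFun (congrFun (congrFun (modesOf_ser t) i) j) l
    have e2 := congrFun (congrFun (congrFun (modesOf_ser s) i) j) l
    rw [← e1, ← e2]
    simp only [modesOf, hw]
    split_ifs <;> simp only [Matrix.add_apply, Matrix.smul_apply, map_add, PowerSeries.coeff_smul]

end Solutions

end YangianDouble

end
noncomputable section

namespace YangianDouble

open PowerSeries Finset.HasAntidiagonal

/-! ### The Yang-Baxter equation -/

section YangBaxter

/-- The Yang-Baxter equation in an abstract algebra of Brauer type, with s = P₁₂, r = P₂₃, q = Q₁₂;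
the other permutations and contractions are conjugates of these. Spectral parameters are fractions
p/x and p'/x', so that one computation covers expansions in u and in u⁻¹. Everything is reduced to
normal words, whose coefficients agree by N = 2κ + 2θ. -/
theorem yangBaxter_aux {Z A : Type*} [CommRing Z] [Ring A] [Algebra Z A] {s r q : A} {θ N : Z}
    (hθ : θ = 1 ∨ θ = -1) (hs : s * s = 1) (hr : r * r = 1) (hb : r * (s * r) = s * (r * s))
    (hsq : s * q = θ • q) (hqs : q * s = θ • q) (hqq : q * q = N • q) (hqr : q * (r * q) = q)
    {c κ : Z} (hN : N = 2 * κ + 2 * θ) (p x p' x' : Z) :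
    (((p * x' - p' * x) * (p * x' - p' * x + c * κ * (x * x'))) • (1 : A) +
        (c * (x * x') * (p * x' - p' * x + c * κ * (x * x'))) • s -
        (c * (x * x') * (p * x' - p' * x)) • q) *
      (((p * (p + c * κ * x)) • (1 : A) + (c * x * (p + c * κ * x)) • (s * (r * s)) -
          (c * x * p) • (r * (q * r))) *
        ((p' * (p' + c * κ * x')) • (1 : A) + (c * x' * (p' + c * κ * x')) • r -
          (c * x' * p') • (s * (r * (q * (r * s)))))) =
    (((p' * (p' + c * κ * x')) • (1 : A) + (c * x' * (p' + c * κ * x')) • r -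
          (c * x' * p') • (s * (r * (q * (r * s))))) *
        ((p * (p + c * κ * x)) • (1 : A) + (c * x * (p + c * κ * x)) • (s * (r * s)) -
          (c * x * p) • (r * (q * r)))) *
      (((p * x' - p' * x) * (p * x' - p' * x + c * κ * (x * x'))) • (1 : A) +
        (c * (x * x') * (p * x' - p' * x + c * κ * (x * x'))) • s -
        (c * (x * x') * (p * x' - p' * x)) • q) := by
  have hs' : ∀ y, s * (s * y) = y := fun y => by rw [← mul_assoc, hs, one_mul]
  have hr' : ∀ y, r * (r * y) = y := fun y => by rw [← mul_assoc, hr, one_mul]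
  have hb' : ∀ y, r * (s * (r * y)) = s * (r * (s * y)) := fun y => by
    simpa only [mul_assoc] using congrArg (· * y) hb
  have hsq' : ∀ y, s * (q * y) = θ • (q * y) := fun y => by rw [← mul_assoc, hsq, smul_mul_assoc]
  have hqs' : ∀ y, q * (s * y) = θ • (q * y) := fun y => by rw [← mul_assoc, hqs, smul_mul_assoc]
  have hqq' : ∀ y, q * (q * y) = N • (q * y) := fun y => by rw [← mul_assoc, hqq, smul_mul_assoc]
  have hqr' : ∀ y, q * (r * (q * y)) = q * y := fun y => by
    simpa only [mul_assoc] using congrArg (· * y) hqr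
  -- The scalars are kept atomic while the words are normalised, and restored for the comparison of
  -- coefficients.
  generalize hα : (p * x' - p' * x) * (p * x' - p' * x + c * κ * (x * x')) = α
  generalize hβ : c * (x * x') * (p * x' - p' * x + c * κ * (x * x')) = β
  generalize hγ : c * (x * x') * (p * x' - p' * x) = γ
  generalize hα1 : p * (p + c * κ * x) = α1
  generalize hβ1 : c * x * (p + c * κ * x) = β1
  generalize hγ1 : c * x * p = γ1
  generalize hα2 : p' * (p' + c * κ * x') = α2
  generalize hβ2 : c * x' * (p' + c * κ * x') = β2
  generalize hγ2 : c * x' * p' = γ2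
  simp only [mul_add, add_mul, mul_sub, sub_mul, smul_mul_assoc, mul_smul_comm, mul_assoc, mul_one,
    one_mul, hs, hs', hr, hr', hb, hb', hsq, hsq', hqs, hqs', hqq, hqq', hqr, hqr']
  subst hα hβ hγ hα1 hβ1 hγ1 hα2 hβ2 hγ2 hN
  rcases hθ with rfl | rfl
  · match_scalars <;> ring
  · match_scalars <;> ring

end YangBaxter

end YangianDouble

end
noncomputable section

namespace YangianDouble

open PowerSeries Finset.HasAntidiagonal

/-! ### Operators on a threefold tensor product -/

section Operators

variable {S : Type*} [Ring S] {g : Series} {n : ℕ}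

/-- An operator acting in the first factor. -/
def first (M : Matrix (Ix g n) (Ix g n) S) : Mat2 S g n := fun x y => if x.2 = y.2 then M x.1 y.1 else 0

/-- An operator acting in the second factor. -/
def second (M : Matrix (Ix g n) (Ix g n) S) : Mat2 S g n := fun x y => if x.1 = y.1 then M x.2 y.2 else 0

theorem mul_second_apply (F : Mat2 S g n) (N : Matrix (Ix g n) (Ix g n) S) (x y : Ix g n × Ix g n) :
    (F * second N) x y = ∑ k, F x (y.1, k) * N k y.2 := by
  rw [Matrix.mul_apply, Fintype.sum_prod_type, Finset.sum_eq_single y.1]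
  · simp [second]
  · intro k _ hk
    exact Finset.sum_eq_zero fun l _ => by rw [second, if_neg hk, mul_zero]
  · simp

theorem second_mul_apply (F : Mat2 S g n) (N : Matrix (Ix g n) (Ix g n) S) (x y : Ix g n × Ix g n) :
    (second N * F) x y = ∑ k, N x.2 k * F (x.1, k) y := by
  rw [Matrix.mul_apply, Fintype.sum_prod_type, Finset.sum_eq_single x.1]
  · simp [second]
  · intro k _ hk
    exact Finset.sum_eq_zero fun l _ => by rw [second, if_neg (Ne.symm hk), zero_mul]
  · simp

theorem first_mul_second_apply (M N : Matrix (Ix g n) (Ix g n) S) (x y : Ix g n × Ix g n) :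
    (first M * second N) x y = M x.1 y.1 * N x.2 y.2 := by
  rw [mul_second_apply, Finset.sum_eq_single x.2]
  · simp [first]
  · intro k _ hk
    rw [first, if_neg (Ne.symm hk), zero_mul]
  · simp

theorem second_mul_first_apply (M N : Matrix (Ix g n) (Ix g n) S) (x y : Ix g n × Ix g n) :
    (second N * first M) x y = N x.2 y.2 * M x.1 y.1 := by
  rw [second_mul_apply, Finset.sum_eq_single y.2]
  · simp [first]
  · intro k _ hk
    rw [first, if_neg hk, mul_zero]
  · simp

theorem second_mul_second (M N : Matrix (Ix g n) (Ix g n) S) :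
    second M * second N = second (M * N) := by
  ext x y
  rw [mul_second_apply, second]
  split_ifs with h
  · rw [Matrix.mul_apply]
    exact Finset.sum_congr rfl fun k _ => by rw [second, if_pos h]
  · exact Finset.sum_eq_zero fun k _ => by rw [second, if_neg h, zero_mul]

theorem second_one : second (1 : Matrix (Ix g n) (Ix g n) S) = 1 := by
  ext x y
  simp only [second, Matrix.one_apply, Prod.ext_iff]
  split_ifs <;> simp_all

theorem first_one : first (1 : Matrix (Ix g n) (Ix g n) S) = 1 := by
  ext x y
  simp only [first, Matrix.one_apply, Prod.ext_iff]
  split_ifs <;> simp_all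

theorem opP_mul_second_mul_opP (M : Matrix (Ix g n) (Ix g n) S) :
    opP * (second M * opP) = first M := by
  ext x y
  rw [opP_mul_apply, mul_opP_apply]
  rfl

theorem opP_mul_first_mul_opP (M : Matrix (Ix g n) (Ix g n) S) :
    opP * (first M * opP) = second M := by
  ext x y
  rw [opP_mul_apply, mul_opP_apply]
  rfl

theorem opP_mul_opP : (opP : Mat2 S g n) * opP = 1 := by
  ext x y
  rw [opP_mul_apply, opP, Matrix.one_apply]
  simp only [Prod.ext_iff]
  split_ifs <;> simp_all

theorem opQ_mul_apply' (F : Mat2 S g n) (x y : Ix g n × Ix g n) :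
    ((opQ : Mat2 S g n) * F) x y =
    if x.2 = opp x.1 then ∑ k, (eps x.1 * eps k) • F (k, opp k) y else 0 := by
  rw [Matrix.mul_apply, Fintype.sum_prod_type]
  split_ifs with h
  · refine Finset.sum_congr rfl fun k _ => ?_
    rw [Finset.sum_eq_single (opp k)]
    · simp [opQ, h, zsmul_eq_mul]
    · intro l _ hl
      rw [opQ, if_neg fun h => hl h.2, zero_mul]
    · simp
  · exact Finset.sum_eq_zero fun k _ => Finset.sum_eq_zero fun l _ => by
      rw [opQ, if_neg fun h' => h h'.1, zero_mul]

/-- The sign of the involution: `ε_{i'} = θ ε_i`. -/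
def th : Series → ℤ
  | .B => 1
  | .C => -1
  | .D => 1

theorem th_sq (g : Series) : th g * th g = 1 := by cases g <;> rfl

theorem eps_opp (i : Ix g n) : eps (opp i) = th g * eps i := by
  rw [eps_eq, eps_eq, opp_eq]
  cases g <;> simp only [sym, th] <;> first | rfl | (split_ifs <;> first | omega | rfl)

theorem opP_mul_opQ : (opP : Mat2 S g n) * opQ = th g • opQ := by
  ext x y
  rw [opP_mul_apply, Matrix.smul_apply, opQ, opQ]
  by_cases h : x.2 = opp x.1
  · have h' : x.1 = opp x.2 := by rw [h, opp_opp]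
    simp only [h', true_and, opp_opp]
    split_ifs
    · rw [eps_opp, zsmul_eq_mul, ← Int.cast_mul, mul_assoc, ← mul_assoc (th g), th_sq, one_mul]
    · simp
  · have h' : x.1 ≠ opp x.2 := fun h' => h (by rw [h', opp_opp])
    simp [h, h']

theorem opQ_mul_opP : (opQ : Mat2 S g n) * opP = th g • opQ := by
  ext x y
  rw [mul_opP_apply, Matrix.smul_apply, opQ, opQ]
  by_cases h : y.2 = opp y.1
  · have h' : y.1 = opp y.2 := by rw [h, opp_opp]
    simp only [h', and_true, opp_opp]
    split_ifs
    · rw [eps_opp, zsmul_eq_mul, ← Int.cast_mul]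
      congr 1
      rw [mul_left_comm, ← mul_assoc (th g), th_sq, one_mul]
    · simp
  · have h' : y.1 ≠ opp y.2 := fun h' => h (by rw [h', opp_opp])
    simp [h, h']

theorem opQ_mul_opQ : (opQ : Mat2 S g n) * opQ = (Fintype.card (Ix g n)) • opQ := by
  ext x y
  rw [opQ_mul_apply', Matrix.smul_apply]
  simp only [opQ, true_and]
  by_cases h : x.2 = opp x.1
  · by_cases h' : y.2 = opp y.1
    · simp only [h, h', if_true, and_self, zsmul_eq_mul, ← Int.cast_mul]
      rw [Finset.sum_congr rfl fun k _ => show ((eps x.1 * eps k * (eps k * eps y.1) : ℤ) : S) =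
        ((eps x.1 * eps y.1 : ℤ) : S) by
          rw [mul_assoc, ← mul_assoc (eps k), eps_mul_self, one_mul]]
      simp
    · simp [h']
  · simp [h]

variable {E : Ix g n → Ix g n → S}

/-- The matrix `∑ e_{ij} ⊗ e_{ji}`. -/
def unitP (E : Ix g n → Ix g n → S) : Matrix (Ix g n) (Ix g n) S := fun i j => E j i

/-- The matrix `∑ ε_i ε_j e_{ij} ⊗ e_{i'j'}`. -/
def unitQ (E : Ix g n → Ix g n → S) : Matrix (Ix g n) (Ix g n) S :=
  fun i j => (eps i * eps j) • E (opp i) (opp j)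

/-- The elements `E_{ij}` are matrix units. -/
structure IsUnits (E : Ix g n → Ix g n → S) : Prop where
  mul_eq : ∀ i j k l, E i j * E k l = if j = k then E i l else 0
  sum_eq : ∑ i, E i i = 1

variable (hE : IsUnits E)

include hE

theorem unitP_sq : unitP E * unitP E = 1 := by
  ext i j
  simp only [Matrix.mul_apply, unitP, hE.mul_eq, Matrix.one_apply]
  by_cases h : i = j
  · simp only [h, if_true]
    exact hE.sum_eq
  · simp [h]

theorem second_unitP_sq : second (unitP E) * second (unitP E) = 1 := by
  rw [second_mul_second, unitP_sq hE, second_one]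

theorem braid_unitP : second (unitP E) * (opP * second (unitP E)) =
    opP * (second (unitP E) * opP) := by
  have h : opP * second (unitP E) = first (unitP E) * opP := by
    rw [← opP_mul_second_mul_opP, mul_assoc, mul_assoc, opP_mul_opP, mul_one]
  rw [h, opP_mul_second_mul_opP, ← mul_assoc]
  ext x y
  rw [mul_opP_apply, second_mul_first_apply, unitP, unitP, first, unitP, hE.mul_eq]

theorem unitP_mul_opQ : second (unitP E) * opQ = first (unitQ E) * second (unitP E) := by
  ext x y
  rw [first_mul_second_apply, second_mul_apply, Finset.sum_eq_single (opp x.1)]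
  · simp only [opQ, unitP, unitQ, smul_mul_assoc, hE.mul_eq, true_and, eq_comm (a := y.2)]
    split_ifs
    · rw [zsmul_eq_mul, (Int.cast_commute _ _).eq]
    · simp
  · intro k _ hk
    rw [opQ, if_neg fun h => hk h.1, mul_zero]
  · simp

theorem first_unitQ : first (unitQ E) = second (unitP E) * (opQ * second (unitP E)) := by
  rw [← mul_assoc, unitP_mul_opQ hE, mul_assoc, second_unitP_sq hE, mul_one]

theorem second_unitQ : second (unitQ E) =
    opP * (second (unitP E) * (opQ * (second (unitP E) * opP))) := by
  rw [← opP_mul_first_mul_opP, first_unitQ hE]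
  simp only [mul_assoc]

/-- In tensor notation Q₁₂Q₁₃ = Q₁₂P₂₃. Since Q₁₃ = P₂₃Q₁₂P₂₃, this yields Q₁₂P₂₃Q₁₂ = Q₁₂ in the
next lemma. -/
theorem opQ_mul_first_unitQ : opQ * first (unitQ E) = opQ * second (unitP E) := by
  ext x y
  rw [opQ_mul_apply', opQ_mul_apply']
  split_ifs with h
  · rw [Finset.sum_eq_single (opp y.2), Finset.sum_eq_single y.1]
    · simp only [first, second, unitQ, unitP, opp_opp, if_true, smul_smul]
      congr 1
      rw [mul_assoc, ← mul_assoc (eps (opp y.2)), eps_mul_self, one_mul]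
    · intro k _ hk
      rw [second, if_neg hk, smul_zero]
    · simp
    · intro k _ hk
      rw [first, if_neg, smul_zero]
      intro h
      exact hk (by rw [← h, opp_opp])
    · simp
  · rfl

theorem opQ_mul_unitP_mul_opQ : opQ * (second (unitP E) * opQ) = opQ := by
  have h := opQ_mul_first_unitQ hE
  rw [first_unitQ hE] at h
  have h := congrArg (· * second (unitP E)) h
  simpa only [mul_assoc, second_unitP_sq hE, mul_one] using h

theorem unitQ_sq : unitQ E * unitQ E = (Fintype.card (Ix g n)) • unitQ E := by
  ext i j
  rw [Matrix.mul_apply, Finset.sum_congr rfl fun k _ => show unitQ E i k * unitQ E k j = unitQ E i j by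
    rw [unitQ, unitQ, unitQ, smul_mul_assoc, mul_smul_comm, smul_smul, hE.mul_eq, if_pos rfl,
      mul_assoc, ← mul_assoc (eps k), eps_mul_self, one_mul]]
  simp

theorem unitP_mul_unitQ : unitP E * unitQ E = th g • unitQ E := by
  ext i j
  rw [Matrix.mul_apply, Finset.sum_eq_single (opp i)]
  · rw [unitP, unitQ, Matrix.smul_apply, unitQ, mul_smul_comm, hE.mul_eq, opp_opp, if_pos rfl,
      smul_smul, eps_opp, mul_assoc]
  · intro k _ hk
    rw [unitP, unitQ, mul_smul_comm, hE.mul_eq, if_neg, smul_zero]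
    intro h
    exact hk (by rw [h, opp_opp])
  · simp

theorem unitQ_mul_unitP : unitQ E * unitP E = th g • unitQ E := by
  ext i j
  rw [Matrix.mul_apply, Finset.sum_eq_single (opp j)]
  · rw [unitP, unitQ, Matrix.smul_apply, unitQ, smul_mul_assoc, hE.mul_eq, opp_opp, if_pos rfl,
      smul_smul, eps_opp]
    congr 1
    ring
  · intro k _ hk
    rw [unitP, unitQ, smul_mul_assoc, hE.mul_eq, if_neg, smul_zero]
    intro h
    exact hk (by rw [← h, opp_opp])
  · simp

omit hE

theorem transp_unitP : transp (unitP E) = unitQ E := by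
  ext i j
  simp [transp, unitP, unitQ]

theorem transp_unitQ : transp (unitQ E) = unitP E := by
  ext i j
  rw [transp, unitP, unitQ, opp_opp, opp_opp, smul_smul, eps_opp, eps_opp]
  have : eps i * eps j * (th g * eps j * (th g * eps i)) =
      (th g * th g) * (eps i * eps i) * (eps j * eps j) := by ring
  rw [this, th_sq, eps_mul_self, eps_mul_self, one_mul, one_mul, one_smul]

end Operators

end YangianDouble

end
noncomputable section

namespace YangianDouble

open PowerSeries Finset.HasAntidiagonal

/-! ### The vector representation: `RTT` relations -/

section VectorRTT

/-- The choice of κ in the three series amounts to this identity; the Yang-Baxter equation and the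
unitarity of the vector representation both rest on it. -/
theorem card_Ix (g : Series) (n : ℕ) : (Fintype.card (Ix g n) : ℂ) = 2 * kappa g n + 2 * th g := by
  have h : Fintype.card (Ix g n) = (n + 1 - lo g n).toNat := by
    rw [Fintype.card_coe, Int.card_Icc]
  rw [h]
  cases g
  · rw [show ((n : ℤ) + 1 - lo .B n).toNat = 2 * n + 1 by simp only [lo]; omega]
    simp only [kappa, th]
    push_cast
    ring
  · rw [show ((n : ℤ) + 1 - lo .C n).toNat = 2 * n by simp only [lo]; omega]
    simp only [kappa, th]
    push_cast
    ring
  · rw [show ((n : ℤ) + 1 - lo .D n).toNat = 2 * n by simp only [lo]; omega]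
    simp only [kappa, th]
    push_cast
    ring

variable {K S : Type*} [CommRing K] [Ring S] [Algebra K S] {g : Series} {n : ℕ}

theorem map_algebraMap_commute {K S : Type*} [CommRing K] [Ring S] (φ : K →+* S)
    (h : ∀ k s, φ k * s = s * φ k) (f : K⟦X⟧) (x : S⟦X⟧) :
    PowerSeries.map φ f * x = x * PowerSeries.map φ f := by
  ext m
  rw [PowerSeries.coeff_mul, PowerSeries.coeff_mul, ← Finset.Nat.sum_antidiagonal_swap]
  refine Finset.sum_congr rfl fun p _ => ?_
  simp [h]

variable (K S) in
/-- Central series with coefficients in the scalars. -/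
def cenOne : K⟦X⟧ →+* Subring.center S⟦X⟧ :=
  (PowerSeries.map (algebraMap K S)).codRestrict _ fun f => Subring.mem_center_iff.2 fun x =>
    (map_algebraMap_commute _ Algebra.commutes f x).symm

variable (K S) in
/-- Central series in two variables with coefficients in the scalars. -/
def cenTwo : K⟦X⟧⟦X⟧ →+* Subring.center S⟦X⟧⟦X⟧ :=
  (PowerSeries.map (PowerSeries.map (algebraMap K S))).codRestrict _ fun f =>
    Subring.mem_center_iff.2 fun x =>
      (map_algebraMap_commute _ (map_algebraMap_commute _ Algebra.commutes) f x).symm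

theorem inl_cenOne_smul (f : K⟦X⟧) (x : S⟦X⟧) :
    inl (cenOne K S f • x) = cenTwo K S (inl f) • inl x := by
  change inl (PowerSeries.map (algebraMap K S) f * x) =
    PowerSeries.map (PowerSeries.map (algebraMap K S)) (inl f) * inl x
  rw [map_mul, inl, inl, PowerSeries.map_C]

theorem inr_cenOne_smul (f : K⟦X⟧) (x : S⟦X⟧) :
    inr (cenOne K S f • x) = cenTwo K S (inr f) • inr x := by
  change inr (PowerSeries.map (algebraMap K S) f * x) =
    PowerSeries.map (PowerSeries.map (algebraMap K S)) (inr f) * inr x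
  rw [map_mul]
  congr 1
  ext
  simp [inr]

theorem map_num (φ : K →+* S) (μ : Sgn) : PowerSeries.map φ (num μ) = num μ := by
  cases μ <;> simp [num]

theorem map_den (φ : K →+* S) (μ : Sgn) : PowerSeries.map φ (den μ) = den μ := by
  cases μ <;> simp [den]

theorem map_map_inl (φ : K →+* S) (f : K⟦X⟧) :
    PowerSeries.map (PowerSeries.map φ) (inl f) = inl (PowerSeries.map φ f) := by
  rw [inl, PowerSeries.map_C, inl]

theorem map_map_inr (φ : K →+* S) (f : K⟦X⟧) :
    PowerSeries.map (PowerSeries.map φ) (inr f) = inr (PowerSeries.map φ f) := by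
  ext
  simp [inr]

theorem dCen_eq (μ ν : Sgn) : dCen S μ ν = cenTwo K S (inl (num μ)) * cenTwo K S (inr (den ν)) -
    cenTwo K S (inl (den μ)) * cenTwo K S (inr (num ν)) := by
  apply Subtype.ext
  change inl (num μ) * inr (den ν) - inl (den μ) * inr (num ν) =
    PowerSeries.map (PowerSeries.map (algebraMap K S)) (inl (num μ)) *
      PowerSeries.map (PowerSeries.map (algebraMap K S)) (inr (den ν)) -
    PowerSeries.map (PowerSeries.map (algebraMap K S)) (inl (den μ)) *
      PowerSeries.map (PowerSeries.map (algebraMap K S)) (inr (num ν))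
  simp only [map_map_inl, map_map_inr, map_num, map_den]

theorem rCen_eq (μ ν : Sgn) :
    rCen S μ ν = cenTwo K S (inl (den μ)) * cenTwo K S (inr (den ν)) := by
  apply Subtype.ext
  change inl (den μ) * inr (den ν) =
    PowerSeries.map (PowerSeries.map (algebraMap K S)) (inl (den μ)) *
      PowerSeries.map (PowerSeries.map (algebraMap K S)) (inr (den ν))
  simp only [map_map_inl, map_map_inr, map_den]

theorem mat12_eq (T T' : Matrix (Ix g n) (Ix g n) S⟦X⟧) :
    mat12 T T' = first (T.map inl) * second (T'.map inr) := by
  ext1 x y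
  rw [first_mul_second_apply]
  rfl

theorem mat21_eq (T T' : Matrix (Ix g n) (Ix g n) S⟦X⟧) :
    mat21 T T' = second (T'.map inr) * first (T.map inl) := by
  ext1 x y
  rw [second_mul_first_apply]
  rfl

theorem first_combination {W : Type*} [Ring W] (a b d : Subring.center W)
    (M N L : Matrix (Ix g n) (Ix g n) W) :
    first (a • M + b • N - d • L) = a • first M + b • first N - d • first L := by
  ext x y
  simp only [first, Matrix.sub_apply, Matrix.add_apply, Matrix.smul_apply]
  split_ifs <;> simp

theorem second_combination {W : Type*} [Ring W] (a b d : Subring.center W)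
    (M N L : Matrix (Ix g n) (Ix g n) W) :
    second (a • M + b • N - d • L) = a • second M + b • second N - d • second L := by
  ext x y
  simp only [second, Matrix.sub_apply, Matrix.add_apply, Matrix.smul_apply]
  split_ifs <;> simp

/-- The matrix units as constant series. -/
def constUnits (e : Ix g n → Ix g n → S) (i j : Ix g n) : S⟦X⟧ := C (e i j)

theorem IsUnits.const {e : Ix g n → Ix g n → S} (he : IsUnits e) : IsUnits (constUnits e) where
  mul_eq i j k l := by
    rw [constUnits, constUnits, ← map_mul, he.mul_eq]
    split_ifs <;> simp [constUnits]
  sum_eq := by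
    simp only [constUnits]
    rw [← map_sum, he.sum_eq, map_one]

theorem map_combination (a b d : K⟦X⟧) (e : Ix g n → Ix g n → S) :
    (cenOne K S a • (1 : Matrix (Ix g n) (Ix g n) S⟦X⟧) + cenOne K S b • unitP (constUnits e) -
      cenOne K S d • unitQ (constUnits e)).map inl =
    cenTwo K S (inl a) • 1 + cenTwo K S (inl b) • unitP (constUnits (constUnits e)) -
      cenTwo K S (inl d) • unitQ (constUnits (constUnits e)) := by
  ext1 i j
  simp only [Matrix.map_apply, Matrix.sub_apply, Matrix.add_apply, Matrix.smul_apply, map_sub,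
    map_add, inl_cenOne_smul, Matrix.one_apply, unitP, unitQ, map_zsmul]
  congr 3
  split_ifs <;> simp

theorem map_combination' (a b d : K⟦X⟧) (e : Ix g n → Ix g n → S) :
    (cenOne K S a • (1 : Matrix (Ix g n) (Ix g n) S⟦X⟧) + cenOne K S b • unitP (constUnits e) -
      cenOne K S d • unitQ (constUnits e)).map inr =
    cenTwo K S (inr a) • 1 + cenTwo K S (inr b) • unitP (constUnits (constUnits e)) -
      cenTwo K S (inr d) • unitQ (constUnits (constUnits e)) := by
  have h : ∀ i j, inr (constUnits e i j) = constUnits (constUnits e) i j := by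
    intro i j
    simp [inr, constUnits]
  ext1 i j
  simp only [Matrix.map_apply, Matrix.sub_apply, Matrix.add_apply, Matrix.smul_apply, map_sub,
    map_add, inr_cenOne_smul, Matrix.one_apply, unitP, unitQ, map_zsmul, h]
  congr 3
  split_ifs <;> simp

variable [Algebra ℂ⟦X⟧ K] [Algebra ℂ⟦X⟧ S] [IsScalarTower ℂ⟦X⟧ K S]

variable (K) in
/-- Scalars as constant series. -/
def scal : ℂ⟦X⟧ →+* K⟦X⟧ := (PowerSeries.C).comp (algebraMap ℂ⟦X⟧ K)

theorem cenTwo_inl_scal (r : ℂ⟦X⟧) : cenTwo K S (inl (scal K r)) = sCen S r := by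
  apply Subtype.ext
  change PowerSeries.map (PowerSeries.map (algebraMap K S)) (inl (C (algebraMap ℂ⟦X⟧ K r))) =
    C (C (r • 1))
  rw [map_map_inl, inl, PowerSeries.map_C, ← IsScalarTower.algebraMap_apply,
    Algebra.algebraMap_eq_smul_one]

theorem cenTwo_inr_scal (r : ℂ⟦X⟧) : cenTwo K S (inr (scal K r)) = sCen S r := by
  rw [← cenTwo_inl_scal (K := K)]
  congr 1
  simp [inl, inr, scal]

variable (K) in
/-- The denominator `u - a`, multiplied by the denominator of `u`. -/
def linSer (a : ℂ) (μ : Sgn) : K⟦X⟧ := num μ - scal K (PowerSeries.C a) * den μ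

variable (K) in
/-- The matrix `(u - a) (u - a + c κ) R(u - a)`, multiplied by the square of the denominator
of `u`. -/
def polyVec (e : Ix g n → Ix g n → S) (a : ℂ) (μ : Sgn) : Matrix (Ix g n) (Ix g n) S⟦X⟧ :=
  cenOne K S (linSer K a μ * (linSer K a μ + scal K c * scal K (PowerSeries.C (kappa g n)) * den μ)) •
      (1 : Matrix (Ix g n) (Ix g n) S⟦X⟧) +
    cenOne K S (scal K c * den μ *
      (linSer K a μ + scal K c * scal K (PowerSeries.C (kappa g n)) * den μ)) •
      unitP (constUnits e) -
    cenOne K S (scal K c * den μ * linSer K a μ) • unitQ (constUnits e)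

variable (S) in
/-- `sCen` as a ring homomorphism. -/
def sHom : ℂ⟦X⟧ →+* Subring.center S⟦X⟧⟦X⟧ := (cenTwo ℂ⟦X⟧ S).comp (inl.comp C)

theorem sHom_apply (r : ℂ⟦X⟧) : sHom S r = sCen S r := by
  apply Subtype.ext
  change PowerSeries.map (PowerSeries.map (algebraMap ℂ⟦X⟧ S)) (inl (C r)) = C (C (r • 1))
  rw [map_map_inl, inl, PowerSeries.map_C, Algebra.algebraMap_eq_smul_one]

/-- The Yang-Baxter equation with spectral parameters u - a and v - a, the scalars being the centre
of the ring of series in two variables. -/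
theorem rtt_polyVec {e : Ix g n → Ix g n → S} (he : IsUnits e) (a : ℂ) (μ ν : Sgn) :
    RTT (polyVec K e a) μ ν := by
  unfold RTT
  have hE := he.const.const
  have hN : ((Fintype.card (Ix g n) : ℕ) : Subring.center S⟦X⟧⟦X⟧) =
      2 * sHom S (PowerSeries.C (kappa g n)) + 2 * ((th g : ℤ) : Subring.center S⟦X⟧⟦X⟧) := by
    have h := congrArg ((sHom S).comp PowerSeries.C) (card_Ix g n)
    simp only [map_natCast, map_add, map_mul, map_ofNat, map_intCast] at h
    exact h
  have hθ : ((th g : ℤ) : Subring.center S⟦X⟧⟦X⟧) = 1 ∨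
      ((th g : ℤ) : Subring.center S⟦X⟧⟦X⟧) = -1 := by
    cases g <;> simp [th]
  have key := yangBaxter_aux (Z := Subring.center S⟦X⟧⟦X⟧) (A := Mat2 S⟦X⟧⟦X⟧ g n) (s := opP)
    (r := second (unitP (constUnits (constUnits e)))) (q := opQ) hθ opP_mul_opP
    (second_unitP_sq hE) (braid_unitP hE)
    (by rw [opP_mul_opQ, Int.cast_smul_eq_zsmul]) (by rw [opQ_mul_opP, Int.cast_smul_eq_zsmul])
    (by rw [opQ_mul_opQ, Nat.cast_smul_eq_nsmul]) (opQ_mul_unitP_mul_opQ hE)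
    (c := sHom S c) hN (cenTwo K S (inl (linSer K a μ))) (cenTwo K S (inl (den μ)))
    (cenTwo K S (inr (linSer K a ν))) (cenTwo K S (inr (den ν)))
  -- u - v = (u - a) - (v - a), with denominators cleared.
  have hd : dCen S μ ν = cenTwo K S (inl (linSer K a μ)) * cenTwo K S (inr (den ν)) -
      cenTwo K S (inr (linSer K a ν)) * cenTwo K S (inl (den μ)) := by
    rw [dCen_eq (K := K)]
    simp only [linSer, map_sub, map_mul, cenTwo_inl_scal, cenTwo_inr_scal]
    ring
  have hk : sCen S (PowerSeries.C (kappa g n) * c) =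
      sHom S c * sHom S (PowerSeries.C (kappa g n)) := by
    rw [← sHom_apply, map_mul, mul_comm]
  rw [rMat, kCen, hd, rCen_eq (K := K), hk, ← sHom_apply, mat12_eq, mat21_eq, polyVec, polyVec, map_combination, map_combination',
    first_combination, second_combination, first_one, second_one, first_unitQ hE,
    second_unitQ hE, ← opP_mul_second_mul_opP]
  simp only [map_mul, map_add, cenTwo_inl_scal, cenTwo_inr_scal, ← sHom_apply]
  exact key

theorem RTT.smul {T : Sgn → Matrix (Ix g n) (Ix g n) S⟦X⟧} {μ ν : Sgn} (h : RTT T μ ν)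
    (f : Sgn → K⟦X⟧) : RTT (fun μ => cenOne K S (f μ) • T μ) μ ν := by
  unfold RTT at h ⊢
  have h12 : mat12 (cenOne K S (f μ) • T μ) (cenOne K S (f ν) • T ν) =
      (cenTwo K S (inl (f μ)) * cenTwo K S (inr (f ν))) • mat12 (T μ) (T ν) := by
    ext1 x y
    simp only [mat12, Matrix.smul_apply, inl_cenOne_smul, inr_cenOne_smul, smul_mul_assoc,
      mul_smul_comm, mul_smul]
    rw [smul_comm]
  have h21 : mat21 (cenOne K S (f μ) • T μ) (cenOne K S (f ν) • T ν) =
      (cenTwo K S (inl (f μ)) * cenTwo K S (inr (f ν))) • mat21 (T μ) (T ν) := by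
    ext1 x y
    simp only [mat21, Matrix.smul_apply, inl_cenOne_smul, inr_cenOne_smul, smul_mul_assoc,
      mul_smul_comm, mul_smul]
  rw [h12, h21, mul_smul_comm, h, smul_mul_assoc]

end VectorRTT

end YangianDouble

end
noncomputable section

namespace YangianDouble

open PowerSeries Finset.HasAntidiagonal

/-! ### The normalising scalar series -/

section Normalisation

/-- The `c`-adic contraction principle: each iteration gains one power of `c`. -/
theorem exists_fixed {S : Type*} [Ring S] [Algebra ℂ⟦X⟧ S] [CComplete S] {Φ : S → S}
    (hΦ : ∀ N x y, x - y ∈ cPow S N → Φ x - Φ y ∈ cPow S N) (w : S) : ∃ y, y = w + c • Φ y := by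
  let it : ℕ → S := fun k => (fun y => w + c • Φ y)^[k] 0
  have hit : ∀ k, it (k + 1) = w + c • Φ (it k) := fun k => Function.iterate_succ_apply' _ _ _
  have hstep : ∀ N x y, x - y ∈ cPow S N → (w + c • Φ x) - (w + c • Φ y) ∈ cPow S (N + 1) := by
    intro N x y h
    obtain ⟨z, hz⟩ := mem_cPow.1 (hΦ N x y h)
    refine mem_cPow.2 ⟨z, ?_⟩
    rw [add_sub_add_left_eq_sub, ← smul_sub, hz, smul_smul, pow_succ']
  have hd : ∀ k, it (k + 1) - it k ∈ cPow S k := by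
    intro k
    induction k with
    | zero => exact mem_cPow.2 ⟨_, by rw [pow_zero, one_smul]⟩
    | succ k ih =>
      rw [hit (k + 1), hit k]
      exact hstep k _ _ (by rw [← hit k]; exact ih)
  choose z hz using fun k => mem_cPow.1 (hd k)
  obtain ⟨y, hy⟩ := CComplete.complete z
  have hy' : ∀ N, y - it N ∈ cPow S N := by
    intro N
    have h := isCSum_iff.1 hy N
    have e : ∑ m ∈ Finset.range N, c ^ m • z m = it N := by
      simp only [← hz]
      rw [Finset.sum_range_sub]
      exact sub_zero _
    rwa [e] at h
  refine ⟨y, sub_eq_zero.1 (CComplete.separated _ fun N => ?_)⟩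
  have h1 := cPow_anti (Nat.le_succ N) (hy' (N + 1))
  have h2 := cPow_anti (Nat.le_succ N) (hstep N _ _ (hy' N))
  have := Submodule.sub_mem _ h1 h2
  rw [hit] at this
  convert this using 1
  abel

variable {K : Type*} [CommRing K] [Algebra ℂ⟦X⟧ K] [CComplete K]

theorem half_smul {S : Type*} [Ring S] [Algebra ℂ⟦X⟧ S] (x : S) :
    (2 : S) * ((PowerSeries.C (1 / 2) : ℂ⟦X⟧) • x) = x := by
  have h : (2 : ℂ⟦X⟧) * PowerSeries.C (1 / 2) = 1 := by
    rw [← map_ofNat (PowerSeries.C (R := ℂ)), ← map_mul]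
    norm_num
  have h2 : ∀ y : S, (2 : S) * y = (2 : ℂ⟦X⟧) • y := fun y => by
    rw [two_mul, two_smul]
  rw [h2, smul_smul, h, one_smul]

theorem half_smul' {S : Type*} [Ring S] [Algebra ℂ⟦X⟧ S] (x : S) :
    (PowerSeries.C (1 / 2) : ℂ⟦X⟧) • ((2 : S) * x) = x := by
  rw [← mul_smul_comm, half_smul]

theorem exists_sqrt_shift (d : Deriv K) (b : ℂ) {w : K} (hw : w ∈ cPow K 1) :
    ∃ y ∈ cPow K 1, (1 + c • y) * sigma d b (1 + c • y) = 1 + c • w := by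
  choose δ hδ using fun x => mem_cPow.1 (sigma_sub_mem d b x)
  simp only [pow_one] at hδ
  have hδN : ∀ N x y, x - y ∈ cPow K N → δ x - δ y ∈ cPow K N := by
    intro N x y h
    obtain ⟨z, hz⟩ := mem_cPow.1 h
    refine mem_cPow.2 ⟨δ z, c_smul_inj ?_⟩
    have e : c • (δ x - δ y) = sigma d b (x - y) - (x - y) := by
      rw [smul_sub, ← hδ, ← hδ, map_sub]
      ring
    rw [e, hz, sigma_smul, ← smul_sub, hδ, smul_comm]
  have hσN : ∀ N x y, x - y ∈ cPow K N → sigma d b x - sigma d b y ∈ cPow K N := by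
    intro N x y h
    obtain ⟨z, hz⟩ := mem_cPow.1 h
    rw [← map_sub, hz, sigma_smul]
    exact smul_mem_cPow _ _
  -- Writing y(u-bc) = y + c δ(y), the equation becomes y = w/2 - (c/2)(δ(y) + y·y(u-bc)), a
  -- contraction.
  obtain ⟨y, hy⟩ := exists_fixed (Φ := fun y : K =>
      -((PowerSeries.C (1 / 2) : ℂ⟦X⟧) • (δ y + y * sigma d b y)))
    (fun N x y h => by
      rw [neg_sub_neg, ← smul_sub]
      refine Submodule.smul_mem _ _ ?_
      have e : δ y + y * sigma d b y - (δ x + x * sigma d b x) =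
          -((δ x - δ y) + (x - y) * sigma d b x + y * (sigma d b x - sigma d b y)) := by ring
      rw [e]
      exact Submodule.neg_mem _ (Submodule.add_mem _ (Submodule.add_mem _ (hδN N x y h)
        (mul_mem_cPow_right _ h)) (mul_mem_cPow_left _ (hσN N x y h))))
    ((PowerSeries.C (1 / 2) : ℂ⟦X⟧) • w)
  refine ⟨y, ?_, ?_⟩
  · rw [hy]
    exact Submodule.add_mem _ (Submodule.smul_mem _ _ hw) (mem_cPow.2 ⟨_, by rw [pow_one]⟩)
  · have h2 := congrArg (2 * ·) hy
    simp only [mul_add, mul_smul_comm, mul_neg, smul_add, half_smul'] at h2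
    have hs : sigma d b y = y + c • δ y := by rw [← hδ]; ring
    rw [map_add, map_one, sigma_smul]
    have e : (1 + c • y) * (1 + c • sigma d b y) =
        1 + c • (y + sigma d b y + c • (y * sigma d b y)) := by
      simp only [Algebra.smul_def]
      ring
    rw [e]
    congr 2
    have : w = 2 * y + c • δ y + c • (y * sigma d b y) := by
      rw [h2]
      simp only [smul_neg, smul_add]
      ring
    rw [this]
    nth_rewrite 1 [hs]
    ring

/-- The equation is c·y·2(1 + cy/2) = 0, where the last factors are units. -/
theorem sq_eq_one {y : K} (h : (1 + c • y) * (1 + c • y) = 1) : y = 0 := by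
  obtain ⟨p, hp, -⟩ := (isNear_top (S := K)).exists_inv ((PowerSeries.C (1 / 2) : ℂ⟦X⟧) • y) trivial
  have h1 : c • (y * (2 * (1 + c • (PowerSeries.C (1 / 2) : ℂ⟦X⟧) • y))) = 0 := by
    have e : c • (y * (2 * (1 + c • (PowerSeries.C (1 / 2) : ℂ⟦X⟧) • y))) =
        (1 + c • y) * (1 + c • y) - 1 := by
      rw [mul_add, mul_smul_comm, half_smul]
      simp only [Algebra.smul_def]
      ring
    rw [e, h, sub_self]
  have h2 := CComplete.torsion_free _ h1
  have h3 : (2 : K) * y = 0 := by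
    calc (2 : K) * y = (y * (2 * (1 + c • (PowerSeries.C (1 / 2) : ℂ⟦X⟧) • y))) * p +
          2 * y * (1 - p * (1 + c • (PowerSeries.C (1 / 2) : ℂ⟦X⟧) • y)) := by ring
      _ = 0 := by rw [h2, hp]; ring
  calc y = (PowerSeries.C (1 / 2) : ℂ⟦X⟧) • (2 * y) := by rw [← mul_smul_comm, half_smul]
    _ = 0 := by rw [h3, smul_zero]

variable (K) in
/-- The expansions of `1 / (u - a)`. -/
def geo (a : ℂ) : Sgn → K⟦X⟧
  | .plus => PowerSeries.mk fun p => if p = 0 then 0 else algebraMap ℂ⟦X⟧ K (PowerSeries.C (a ^ (p - 1)))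
  | .minus => PowerSeries.mk fun p => algebraMap ℂ⟦X⟧ K (PowerSeries.C (-a⁻¹ ^ (p + 1)))

omit [CComplete K] in
theorem geo_mul (a : ℂ) (ha : a ≠ 0) (μ : Sgn) : geo K a μ * linSer K a μ = den μ := by
  cases μ with
  | plus =>
    have e : linSer K a .plus = 1 - C (algebraMap ℂ⟦X⟧ K (PowerSeries.C a)) * X := rfl
    rw [e, mul_sub, mul_one, ← mul_assoc]
    ext p
    rcases p with _ | _ | p
    · simp [geo, den]
    · simp [geo, den, coeff_succ_mul_X]
    · rw [map_sub, coeff_succ_mul_X, coeff_mul_C]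
      simp only [geo, den, coeff_mk, coeff_X]
      rw [if_neg (by omega), if_neg (by omega), if_neg (by omega), ← map_mul, ← map_mul, ← map_sub,
        ← map_sub]
      simp [pow_succ]
  | minus =>
    have e : linSer K a .minus = X - C (algebraMap ℂ⟦X⟧ K (PowerSeries.C a)) := by
      simp [linSer, num, den, scal]
    rw [e, mul_sub]
    ext p
    rcases p with _ | p
    · rw [map_sub, coeff_mul_C]
      simp only [geo, den, coeff_mk]
      rw [← map_mul, ← map_mul]
      simp [ha]
    · rw [map_sub, coeff_succ_mul_X, coeff_mul_C]
      simp only [geo, den, coeff_mk, coeff_one]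
      rw [if_neg (by omega), ← map_mul, ← map_mul, ← map_sub, ← map_sub]
      have : -a⁻¹ ^ (p + 1) - -a⁻¹ ^ (p + 1 + 1) * a = 0 := by
        rw [pow_succ _ (p + 1)]
        field_simp
        ring
      rw [this, map_zero, map_zero]

omit [CComplete K] in
theorem dU_C (μ : Sgn) (r : K) : (dU μ).map (C r) = 0 := by
  have h := hasse_succ (dU μ).map 0 (C r)
  rw [hasse_zero, hasse_C] at h
  simpa using h

omit [CComplete K] in
theorem isUnit_linSer (a : ℂ) (ha : a ≠ 0) (μ : Sgn) : IsUnit (linSer K a μ) := by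
  cases μ with
  | plus =>
    rw [isUnit_iff_constantCoeff]
    simp [linSer, num, den]
  | minus =>
    exact IsUnit.of_mul_eq_one _ ((mul_comm _ _).trans (geo_mul a ha .minus))

omit [CComplete K] in
theorem dU_geo (a : ℂ) (ha : a ≠ 0) (μ : Sgn) : (dU μ).map (geo K a μ) = -(geo K a μ * geo K a μ) := by
  have h := congrArg (dU μ).map (geo_mul (K := K) a ha μ)
  rw [(dU μ).leibniz] at h
  have hX : (dU .plus).map (X : K⟦X⟧) = -(X * X) := by
    ext q
    rcases q with _ | _ | q
    · simp [coeff_zero_dU_plus]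
    · simp [coeff_succ_dU_plus, coeff_X, coeff_succ_X_mul]
    · rw [coeff_succ_dU_plus, map_neg, coeff_succ_X_mul, coeff_X]
      by_cases hq : q = 0
      · simp [hq]
      · simp [hq]
  have hX' : (dU .minus).map (X : K⟦X⟧) = 1 := by
    ext q
    rw [coeff_dU_minus, coeff_X, coeff_one]
    by_cases hq : q = 0
    · simp [hq]
    · simp [hq]
  refine (isUnit_linSer a ha μ).mul_right_cancel ?_
  have h0 := geo_mul (K := K) a ha μ
  cases μ with
  | plus =>
    have e : linSer K a .plus = 1 - C (algebraMap ℂ⟦X⟧ K (PowerSeries.C a)) * X := rfl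
    rw [e] at h h0 ⊢
    rw [map_sub, (dU .plus).leibniz, (dU .plus).map_one, dU_C] at h
    simp only [den, hX] at h h0
    linear_combination h + (X + geo K a .plus) * h0
  | minus =>
    have e : linSer K a .minus = X - C (algebraMap ℂ⟦X⟧ K (PowerSeries.C a)) := by
      simp [linSer, num, den, scal]
    rw [e] at h h0 ⊢
    rw [map_sub, dU_C, hX'] at h
    simp only [den, (dU .minus).map_one] at h h0
    linear_combination h + geo K a .minus * h0

/-- The partial fraction identity for 1/(u-a-bc) and 1/(u-a). As α = 1/(u-a) satisfies α' = -α², its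
Taylor expansion at u - h is the geometric series ∑ hᵐαᵐ⁺¹, which gives the identity before
evaluation at h = bc. -/
theorem sigma_geo (a : ℂ) (ha : a ≠ 0) (μ : Sgn) (b : ℂ) :
    sigma (dU μ) b (geo K a μ) - geo K a μ =
      scal K (PowerSeries.C b * c) * geo K a μ * sigma (dU μ) b (geo K a μ) := by
  set α := geo K a μ
  have h1 : ∀ m, hasse (dU μ).map m α = (-1 : ℂ⟦X⟧) ^ m • α ^ (m + 1) := by
    refine hasse_ext (by simp) fun m => ?_
    have hp : ∀ k : ℕ, (dU μ).map (α ^ (k + 1)) = -((k + 1 : ℕ) : ℂ⟦X⟧) • α ^ (k + 2) := by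
      intro k
      induction k with
      | zero => rw [zero_add, pow_one, dU_geo a ha]; simp [pow_two, α]
      | succ k ih =>
        rw [pow_succ, (dU μ).leibniz, ih, dU_geo a ha, smul_mul_assoc, ← pow_succ, mul_neg,
          ← pow_two, ← pow_add]
        simp only [Nat.cast_succ, neg_smul, add_smul, one_smul]
        ring
    rw [map_smul, hp, smul_smul, smul_smul]
    congr 1
    ring
  have h2 : taylor (dU μ) α - C α = X * C α * taylor (dU μ) α := by
    ext1 m
    rw [map_sub, coeff_taylor, h1, smul_smul, ← mul_pow, neg_one_mul, neg_neg, one_pow, one_smul,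
      mul_assoc]
    rcases m with _ | m
    · simp
    · rw [coeff_succ_X_mul, coeff_C_mul, coeff_taylor, h1, smul_smul, ← mul_pow, neg_one_mul,
        neg_neg, one_pow, one_smul, coeff_C, if_neg (by omega), sub_zero, pow_succ']
  have h3 := congrArg (evHom K⟦X⟧ b) h2
  rw [map_sub, map_mul, map_mul, evHom_C, evHom_X] at h3
  have e : scal K (PowerSeries.C b * c) = (PowerSeries.C b * c) • (1 : K⟦X⟧) := by
    ext q
    simp [scal, coeff_C, coeff_one, Algebra.algebraMap_eq_smul_one]
  rw [e]
  exact h3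

theorem coeff_zero_sigma_plus {R : Type*} [Ring R] [Algebra ℂ⟦X⟧ R] [CComplete R] (b : ℂ)
    (f : R⟦X⟧) : coeff 0 (sigma (dU .plus) b f) = coeff 0 f := by
  rw [← shift_eq_sigma]
  simp [shift]

/-- The scalar f = 1 + cy makes f(u)R(u-a) unitary. Divisibility of y by `c` keeps f from
contributing to the modes modulo `c`, and its vanishing constant term for the sign `plus` keeps T⁺
equal to 1 at u = ∞. -/
theorem exists_normalisation (a : ℂ) (ha : a ≠ 0) (b : ℂ) (μ : Sgn) :
    ∃ y ∈ cPow K⟦X⟧ 1, (1 + c • y) * sigma (dU μ) b (1 + c • y) *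
      (1 - scal K c * scal K c * geo K a μ * geo K a μ) = 1 ∧ (μ = .plus → coeff 0 y = 0) := by
  have hc : ∀ x : K⟦X⟧, c • x = scal K c * x := by
    intro x
    ext
    rw [PowerSeries.coeff_smul, scal, RingHom.comp_apply, coeff_C_mul, Algebra.smul_def]
  set q : K⟦X⟧ := -(c • (geo K a μ * geo K a μ))
  obtain ⟨p, hp1, -, w, -, hw⟩ := (isNear_top (S := K⟦X⟧)).exists_inv q trivial
  have hq : 1 - scal K c * scal K c * geo K a μ * geo K a μ = 1 + c • q := by
    simp only [q, hc]
    ring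
  have hwq : w = -(q * p) := by
    refine c_smul_inj ?_
    have : c • w = p - 1 := by rw [hw]; ring
    rw [this, ← hp1]
    simp only [hc]
    ring
  have hwc : w ∈ cPow K⟦X⟧ 1 := by
    rw [hwq]
    refine Submodule.neg_mem _ (mul_mem_cPow_right _ (Submodule.neg_mem _ ?_))
    exact mem_cPow.2 ⟨_, by rw [pow_one]⟩
  obtain ⟨y, hy, hyw⟩ := exists_sqrt_shift (dU μ) b hwc
  refine ⟨y, hy, ?_, ?_⟩
  · rw [hyw, hq, ← hw, hp1]
  -- At u = ∞ the shift acts trivially and the equation becomes f² = 1, with f = 1 modulo `c`.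
  · rintro rfl
    have h0 := congrArg (coeff 0) hyw
    have hg : coeff 0 (geo K a .plus) = 0 := by simp [geo]
    have hw0 : coeff 0 w = 0 := by
      rw [hwq]
      simp only [q, map_neg, coeff_zero_eq_constantCoeff, map_mul, hc] at hg ⊢
      simp [hg]
    have hs := coeff_zero_sigma_plus b (1 + c • y)
    simp only [coeff_zero_eq_constantCoeff, map_mul] at h0 hs
    rw [hs] at h0
    rw [← coeff_zero_eq_constantCoeff_apply, ← coeff_zero_eq_constantCoeff_apply] at h0
    simp only [map_add, PowerSeries.coeff_smul, hw0, smul_zero, add_zero, coeff_zero_one] at h0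
    exact sq_eq_one h0

end Normalisation

end YangianDouble

end
noncomputable section

namespace YangianDouble

open PowerSeries Finset.HasAntidiagonal

/-! ### The vector representation -/

section VectorRep

/-- Transposition exchanges P and Q, so this is the product of the shifted transpose with T. The
opposite order has the same expansion, so a single set of scalar identities gives both halves of
unitarity. -/
theorem brauer_mul {Z A : Type*} [CommRing Z] [Ring A] [Algebra Z A] {P Q : A} {θ N : Z}
    (hP : P * P = 1) (hPQ : P * Q = θ • Q) (hQP : Q * P = θ • Q) (hQ : Q * Q = N • Q)
    (a b d a' b' d' : Z) :
    (a • (1 : A) + b • Q - d • P) * (a' • (1 : A) + b' • P - d' • Q) =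
      (a * a' - d * b') • (1 : A) + (a * b' - d * a') • P +
        (b * a' - a * d' + θ * (b * b' + d * d') - N * (b * d')) • Q := by
  simp only [mul_add, add_mul, mul_sub, sub_mul, smul_mul_assoc, mul_smul_comm, mul_one, one_mul,
    hP, hPQ, hQP, hQ]
  module

theorem brauer_mul' {Z A : Type*} [CommRing Z] [Ring A] [Algebra Z A] {P Q : A} {θ N : Z}
    (hP : P * P = 1) (hPQ : P * Q = θ • Q) (hQP : Q * P = θ • Q) (hQ : Q * Q = N • Q)
    (a b d a' b' d' : Z) :
    (a' • (1 : A) + b' • P - d' • Q) * (a • (1 : A) + b • Q - d • P) =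
      (a * a' - d * b') • (1 : A) + (a * b' - d * a') • P +
        (b * a' - a * d' + θ * (b * b' + d * d') - N * (b * d')) • Q := by
  simp only [mul_add, add_mul, mul_sub, sub_mul, smul_mul_assoc, mul_smul_comm, mul_one, one_mul,
    hP, hPQ, hQP, hQ]
  module

variable {K S : Type*} [CommRing K] [Ring S] [Algebra K S] {g : Series} {n : ℕ}

theorem transp_combination {W : Type*} [Ring W] (a b d : Subring.center W)
    (M N L : Matrix (Ix g n) (Ix g n) W) : transp (a • M + b • N - d • L) =
      a • transp M + b • transp N - d • transp L := by
  ext1 i j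
  simp only [transp, Matrix.sub_apply, Matrix.add_apply, Matrix.smul_apply, smul_add, smul_sub]
  rw [smul_comm a, smul_comm b, smul_comm d]

theorem transp_one {W : Type*} [Ring W] : transp (1 : Matrix (Ix g n) (Ix g n) W) = 1 := by
  ext1 i j
  simp only [transp, Matrix.one_apply]
  by_cases h : i = j
  · simp [h, eps_mul_self]
  · rw [if_neg, if_neg h, smul_zero]
    intro h'
    exact h (by rw [← opp_opp i, ← h', opp_opp])

variable [Algebra ℂ⟦X⟧ K] [Algebra ℂ⟦X⟧ S] [IsScalarTower ℂ⟦X⟧ K S]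

theorem cenOne_smul_smul (r : ℂ⟦X⟧) (f : K⟦X⟧) (x : S⟦X⟧) :
    cenOne K S (r • f) • x = r • (cenOne K S f • x) := by
  change PowerSeries.map (algebraMap K S) (r • f) * x = r • (PowerSeries.map (algebraMap K S) f * x)
  rw [← smul_mul_assoc]
  congr 1
  ext m
  rw [PowerSeries.coeff_map, PowerSeries.coeff_smul, PowerSeries.coeff_smul, PowerSeries.coeff_map,
    Algebra.smul_def, map_mul, ← IsScalarTower.algebraMap_apply, Algebra.smul_def]

omit [Algebra ℂ⟦X⟧ K] [Algebra ℂ⟦X⟧ S] [IsScalarTower ℂ⟦X⟧ K S] in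
theorem coeff_cenOne_smul (f : K⟦X⟧) (s : S) (p : ℕ) :
    coeff p (cenOne K S f • (C s : S⟦X⟧)) = algebraMap K S (coeff p f) * s := by
  change coeff p (PowerSeries.map (algebraMap K S) f * C s) = _
  rw [coeff_mul_C, PowerSeries.coeff_map]

variable [CComplete K] [CComplete S]

omit [CComplete K] in
theorem sigma_C (μ : Sgn) (b : ℂ) (s : S) : sigma (dU μ) b (C s) = C s := by
  have h : taylor (dU μ) (C s) = C (C s) := by
    ext1 m
    rw [coeff_taylor, hasse_C, coeff_C]
    split_ifs with h
    · rw [h, pow_zero, one_smul]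
    · rw [smul_zero]
  change evHom S⟦X⟧ b (taylor (dU μ) (C s)) = _
  rw [h, evHom_C]

theorem sigma_cenOne_smul (μ : Sgn) (b : ℂ) (f : K⟦X⟧) (x : S⟦X⟧) :
    sigma (dU μ) b (cenOne K S f • x) =
      cenOne K S (sigma (dU μ) b f) • sigma (dU μ) b x := by
  change sigma (dU μ) b (PowerSeries.map (algebraMap K S) f * x) =
    PowerSeries.map (algebraMap K S) (sigma (dU μ) b f) * _
  rw [map_mul]
  congr 1
  rw [← shift_eq_sigma, ← shift_eq_sigma]
  exact (shift_map (IsScalarTower.toAlgHom ℂ⟦X⟧ K S) μ b f).symm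

theorem map_sigma_combination (μ : Sgn) (b : ℂ) (x y z : K⟦X⟧) (e : Ix g n → Ix g n → S) :
    (cenOne K S x • (1 : Matrix (Ix g n) (Ix g n) S⟦X⟧) + cenOne K S y • unitP (constUnits e) -
      cenOne K S z • unitQ (constUnits e)).map (sigma (dU μ) b) =
    cenOne K S (sigma (dU μ) b x) • 1 + cenOne K S (sigma (dU μ) b y) • unitP (constUnits e) -
      cenOne K S (sigma (dU μ) b z) • unitQ (constUnits e) := by
  have h : ∀ i j, sigma (dU μ) b (constUnits e i j) = constUnits e i j := fun i j => sigma_C μ b _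
  ext1 i j
  simp only [Matrix.map_apply, Matrix.sub_apply, Matrix.add_apply, Matrix.smul_apply, map_sub,
    map_add, sigma_cenOne_smul, Matrix.one_apply, unitP, unitQ, map_zsmul, h]
  congr 3
  split_ifs <;> simp

/-- The evaluation representation f(u)R(u-a). Its modes modulo `c` are the coefficients of 1/(u-a)
times an element of 𝔤; the sign for ℓ < 0 comes from expanding at u = 0 instead of u = ∞. -/
theorem exists_vectorSol {e : Ix g n → Ix g n → S} (he : IsUnits e) (a : ℂ) (ha : a ≠ 0) (K : Type*)
    [CommRing K] [Algebra K S] [Algebra ℂ⟦X⟧ K] [IsScalarTower ℂ⟦X⟧ K S] [CComplete K] :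
    ∃ t : Ix g n → Ix g n → ℤ → S, Sol t ∧ ∀ i j l, ∃ z,
      t i j l = (PowerSeries.C ((if 0 ≤ l then 1 else -1) * a ^ l) : ℂ⟦X⟧) •
        (e j i - (eps i * eps j) • e (opp i) (opp j)) + c • z := by
  set κ := kappa g n
  choose y hy hy1 hy0 using fun μ => exists_normalisation (K := K) a ha κ μ
  set α : Sgn → K⟦X⟧ := geo K a with hα
  set β : Sgn → K⟦X⟧ := fun μ => sigma (dU μ) (-κ) (α μ) with hβ
  set f : Sgn → K⟦X⟧ := fun μ => 1 + c • y μ with hf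
  have hc : ∀ x : K⟦X⟧, c • x = scal K c * x := by
    intro x
    ext
    rw [PowerSeries.coeff_smul, scal, RingHom.comp_apply, coeff_C_mul, Algebra.smul_def]
  have hαβ : ∀ μ, α μ - β μ = scal K c * scal K (PowerSeries.C κ) * α μ * β μ := by
    intro μ
    have h := sigma_geo (K := K) a ha μ (-κ)
    rw [map_neg, neg_mul, map_neg, map_mul] at h
    linear_combination -h
  have hβα : ∀ μ, sigma (dU μ) κ (β μ) = α μ := by
    intro μ
    rw [hβ]
    simp only
    rw [sigma_sigma, add_neg_cancel, sigma_zero]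
  set Tm : Sgn → Matrix (Ix g n) (Ix g n) S⟦X⟧ := fun μ => cenOne K S (f μ) • 1 +
    cenOne K S (scal K c * f μ * α μ) • unitP (constUnits e) -
      cenOne K S (scal K c * f μ * β μ) • unitQ (constUnits e) with hTm
  have hrtt : ∀ μ ν, RTT Tm μ ν := by
    have hu : ∀ μ, IsUnit (linSer K a μ + scal K c * scal K (PowerSeries.C κ) * den μ) := by
      intro μ
      cases μ with
      | plus =>
        rw [isUnit_iff_constantCoeff]
        simp [linSer, num, den]
      | minus =>
        refine IsUnit.of_mul_eq_one (β .minus) ?_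
        have h0 := geo_mul (K := K) a ha .minus
        have h1 := hαβ .minus
        simp only [den] at h0 ⊢
        rw [← hα] at h0
        linear_combination h0 - linSer K a .minus * h1 -
          scal K c * scal K (PowerSeries.C κ) * β .minus * h0
    choose v1 hv1 using fun μ => (isUnit_linSer (K := K) a ha μ).exists_left_inv
    choose v2 hv2 using fun μ => (hu μ).exists_left_inv
    intro μ ν
    have h := (rtt_polyVec (K := K) he a μ ν).smul (K := K) fun μ => f μ * v1 μ * v2 μ
    have e1 : ∀ μ, α μ = den μ * v1 μ := by
      intro μ
      have h0 := geo_mul (K := K) a ha μ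
      linear_combination v1 μ * h0 - α μ * hv1 μ
    have e2 : ∀ μ, β μ = den μ * v2 μ := by
      intro μ
      have h0 := geo_mul (K := K) a ha μ
      rw [← hα] at h0
      have h1 := hαβ μ
      have h2 : β μ * (linSer K a μ + scal K c * scal K (PowerSeries.C κ) * den μ) = den μ := by
        linear_combination h0 - linSer K a μ * h1 -
          scal K c * scal K (PowerSeries.C κ) * β μ * h0
      linear_combination v2 μ * h2 - β μ * hv2 μ
    have e3 : Tm = fun μ => cenOne K S (f μ * v1 μ * v2 μ) • polyVec K e a μ := by
      funext μ
      have hsc : scal K (c * PowerSeries.C κ) = scal K c * scal K (PowerSeries.C κ) := map_mul _ _ _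
      have f1 : f μ = f μ * v1 μ * v2 μ *
          (linSer K a μ * (linSer K a μ + scal K (c * PowerSeries.C κ) * den μ)) := by
        rw [hsc]
        linear_combination -(f μ) * hv1 μ - f μ * v1 μ * linSer K a μ * hv2 μ
      have f2 : scal K c * f μ * α μ = f μ * v1 μ * v2 μ *
          (scal K c * den μ * (linSer K a μ + scal K (c * PowerSeries.C κ) * den μ)) := by
        rw [hsc, e1]
        linear_combination -(scal K c * f μ * den μ * v1 μ) * hv2 μ
      have f3 : scal K c * f μ * β μ = f μ * v1 μ * v2 μ *
          (scal K c * den μ * linSer K a μ) := by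
        rw [e2]
        linear_combination -(scal K c * f μ * den μ * v2 μ) * hv1 μ
      simp only [hTm, polyVec, smul_sub, smul_add, ← mul_smul, ← map_mul]
      rw [f2, f3]
      nth_rewrite 1 [f1]
      simp only [mul_assoc, mul_comm, mul_left_comm]
      rfl
    rw [e3]
    exact h
  have hE := he.const
  have hN : ((Fintype.card (Ix g n) : ℕ) : K⟦X⟧) =
      2 * scal K (PowerSeries.C κ) + 2 * ((th g : ℤ) : K⟦X⟧) := by
    have h := congrArg ((scal K).comp PowerSeries.C) (card_Ix g n)
    simp only [map_natCast, map_add, map_mul, map_ofNat, map_intCast] at h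
    exact h
  have hQ2 : unitQ (constUnits e) * unitQ (constUnits e) =
      cenOne K S ((Fintype.card (Ix g n) : ℕ) : K⟦X⟧) • unitQ (constUnits e) := by
    rw [unitQ_sq hE, map_natCast, Nat.cast_smul_eq_nsmul]
  have hPQ : unitP (constUnits e) * unitQ (constUnits e) =
      cenOne K S ((th g : ℤ) : K⟦X⟧) • unitQ (constUnits e) := by
    rw [unitP_mul_unitQ hE, map_intCast, Int.cast_smul_eq_zsmul]
  have hQP : unitQ (constUnits e) * unitP (constUnits e) =
      cenOne K S ((th g : ℤ) : K⟦X⟧) • unitQ (constUnits e) := by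
    rw [unitQ_mul_unitP hE, map_intCast, Int.cast_smul_eq_zsmul]
  have htr : ∀ μ, transp ((Tm μ).map (sigma (dU μ) κ)) =
      cenOne K S (sigma (dU μ) κ (f μ)) • 1 +
      cenOne K S (scal K c * sigma (dU μ) κ (f μ) * sigma (dU μ) κ (α μ)) • unitQ (constUnits e) -
      cenOne K S (scal K c * sigma (dU μ) κ (f μ) * α μ) • unitP (constUnits e) := by
    intro μ
    have hsc : sigma (dU μ) κ (scal K c) = scal K c := sigma_C μ κ _
    rw [hTm]
    simp only
    rw [map_sigma_combination, transp_combination, transp_one, transp_unitP, transp_unitQ]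
    simp only [map_mul, hβα, hsc]
  have hid : ∀ μ, cenOne K S (sigma (dU μ) κ (f μ)) * cenOne K S (f μ) -
      cenOne K S (scal K c * sigma (dU μ) κ (f μ) * α μ) * cenOne K S (scal K c * f μ * α μ) = 1 := by
    intro μ
    rw [← map_mul, ← map_mul, ← map_sub, ← map_one (cenOne K S), ← hy1 μ]
    congr 1
    simp only [hf, hα]
    ring
  have hid2 : ∀ μ, cenOne K S (sigma (dU μ) κ (f μ)) * cenOne K S (scal K c * f μ * α μ) -
      cenOne K S (scal K c * sigma (dU μ) κ (f μ) * α μ) * cenOne K S (f μ) = 0 := by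
    intro μ
    rw [← map_mul, ← map_mul, ← map_sub, ← map_zero (cenOne K S)]
    congr 1
    ring
  -- The coefficient of Q vanishes by the partial fraction identities for the shifts by ±κ together
  -- with N = 2κ + 2θ.
  have hid3 : ∀ μ, cenOne K S (scal K c * sigma (dU μ) κ (f μ) * sigma (dU μ) κ (α μ)) *
        cenOne K S (f μ) -
      cenOne K S (sigma (dU μ) κ (f μ)) * cenOne K S (scal K c * f μ * β μ) +
      cenOne K S ((th g : ℤ) : K⟦X⟧) *
        (cenOne K S (scal K c * sigma (dU μ) κ (f μ) * sigma (dU μ) κ (α μ)) *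
          cenOne K S (scal K c * f μ * α μ) +
        cenOne K S (scal K c * sigma (dU μ) κ (f μ) * α μ) *
          cenOne K S (scal K c * f μ * β μ)) -
      cenOne K S ((Fintype.card (Ix g n) : ℕ) : K⟦X⟧) *
        (cenOne K S (scal K c * sigma (dU μ) κ (f μ) * sigma (dU μ) κ (α μ)) *
          cenOne K S (scal K c * f μ * β μ)) = 0 := by
    intro μ
    have h1 := hαβ μ
    have h2 := sigma_geo (K := K) a ha μ κ
    rw [map_mul, ← hα] at h2
    rw [hN]
    simp only [← map_mul, ← map_sub, ← map_add]
    rw [← map_zero (cenOne K S)]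
    congr 1
    linear_combination scal K c * sigma (dU μ) κ (f μ) * f μ * (h1 + h2 +
      scal K c * (scal K (PowerSeries.C κ) + ((th g : ℤ) : K⟦X⟧)) *
        (sigma (dU μ) κ (α μ) * h1 - β μ * h2))
  have hun : ∀ μ, transp ((Tm μ).map (sigma (dU μ) κ)) * Tm μ = 1 ∧
      Tm μ * transp ((Tm μ).map (sigma (dU μ) κ)) = 1 := by
    intro μ
    rw [htr, hTm]
    simp only
    rw [brauer_mul (unitP_sq hE) hPQ hQP hQ2, brauer_mul' (unitP_sq hE) hPQ hQP hQ2, hid, hid2, hid3]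
    simp
  set w : Sgn → Matrix (Ix g n) (Ix g n) S⟦X⟧ := fun μ => cenOne K S (y μ) • 1 +
    cenOne K S (f μ * α μ) • unitP (constUnits e) -
      cenOne K S (f μ * β μ) • unitQ (constUnits e) with hw
  have hTw : ∀ μ, Tm μ = 1 + c • w μ := by
    intro μ
    have hm : ∀ (x : K⟦X⟧) (M : Matrix (Ix g n) (Ix g n) S⟦X⟧),
        c • (cenOne K S x • M) = cenOne K S (c • x) • M := by
      intro x M
      ext1 i j
      exact (cenOne_smul_smul _ _ _).symm
    simp only [hTm, hw, smul_sub, smul_add, hm, hf]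
    rw [map_add, add_smul, map_one, one_smul]
    simp only [hc, mul_assoc]
    abel
  have hα0 : coeff 0 (α .plus) = 0 := by simp [hα, geo]
  have hw0 : ∀ i j, coeff 0 (w .plus i j) = 0 := by
    have hm : ∀ (x : K⟦X⟧) (z : S⟦X⟧), coeff 0 x = 0 → coeff 0 (cenOne K S x • z) = 0 := by
      intro x z hx
      change coeff 0 (PowerSeries.map (algebraMap K S) x * z) = 0
      rw [coeff_mul]
      simp [hx]
    have hm2 : ∀ x z : K⟦X⟧, coeff 0 z = 0 → coeff 0 (x * z) = 0 := by
      intro x z hz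
      rw [coeff_mul]
      simp [hz]
    intro i j
    simp only [hw, Matrix.sub_apply, Matrix.add_apply, Matrix.smul_apply, map_sub, map_add]
    rw [hm _ _ (hy0 .plus rfl), hm _ _ (hm2 _ _ hα0), hm _ _ (hm2 _ _ ?_)]
    · simp
    · simp only [hβ]
      rw [coeff_zero_sigma_plus, hα0]
  have htT : ∀ μ, tOp (modesOf w) μ = Tm μ := by
    intro μ
    rw [tOp_eq_ser, ser_modesOf hw0, hTw]
  refine ⟨modesOf w, (relators_eq_zero_iff _).2 ⟨fun μ ν => ?_, fun μ => ?_⟩, ?_⟩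
  · have := hrtt μ ν
    unfold RTT at this ⊢
    rwa [htT, htT]
  · rw [htT]
    exact hun μ
  · have hfα : ∀ μ, f μ * α μ - α μ ∈ cPow K⟦X⟧ 1 := by
      intro μ
      refine mem_cPow.2 ⟨y μ * α μ, ?_⟩
      rw [pow_one, ← smul_mul_assoc, hf]
      ring
    have hfβ : ∀ μ, f μ * β μ - α μ ∈ cPow K⟦X⟧ 1 := by
      intro μ
      have e : f μ * β μ - α μ = c • (y μ * β μ) + (β μ - α μ) := by
        rw [← smul_mul_assoc, hf]
        ring
      rw [e]
      exact Submodule.add_mem _ (mem_cPow.2 ⟨_, by rw [pow_one]⟩) (sigma_sub_mem _ _ _)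
    choose x1 hx1 using fun μ => mem_cPow.1 (hfα μ)
    choose x2 hx2 using fun μ => mem_cPow.1 (hfβ μ)
    choose x3 hx3 using fun μ => mem_cPow.1 (hy μ)
    simp only [pow_one] at hx1 hx2 hx3
    have hcoef : ∀ μ p i j, ∃ z, coeff p (w μ i j) = algebraMap K S (coeff p (α μ)) *
        (e j i - (eps i * eps j) • e (opp i) (opp j)) + c • z := by
      intro μ p i j
      refine ⟨coeff p (cenOne K S (x3 μ) • (1 : Matrix (Ix g n) (Ix g n) S⟦X⟧) i j +
        cenOne K S (x1 μ) • unitP (constUnits e) i j -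
        cenOne K S (x2 μ) • unitQ (constUnits e) i j), ?_⟩
      rw [← PowerSeries.coeff_smul, smul_sub, smul_add, ← cenOne_smul_smul, ← cenOne_smul_smul,
        ← cenOne_smul_smul, ← hx1, ← hx2, ← hx3]
      have e1 : algebraMap K S (coeff p (α μ)) * (e j i - (eps i * eps j) • e (opp i) (opp j)) =
          coeff p (cenOne K S (α μ) • unitP (constUnits e) i j -
            cenOne K S (α μ) • unitQ (constUnits e) i j) := by
        rw [map_sub, mul_sub, unitP, unitQ, constUnits, constUnits, coeff_cenOne_smul, ← map_zsmul,
          coeff_cenOne_smul]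
      rw [e1, ← map_add]
      congr 1
      simp only [hw, Matrix.sub_apply, Matrix.add_apply, Matrix.smul_apply, map_sub, sub_smul]
      abel
    intro i j l
    rw [modesOf]
    split_ifs with hl
    · obtain ⟨z, hz⟩ := hcoef .plus (l + 1).toNat i j
      refine ⟨z, ?_⟩
      rw [hz]
      congr 1
      obtain ⟨m, rfl⟩ : ∃ m : ℕ, l = m := ⟨l.toNat, by omega⟩
      rw [show ((m : ℤ) + 1).toNat = m + 1 by omega, hα, geo, coeff_mk, if_neg (by omega),
        Nat.add_sub_cancel, ← IsScalarTower.algebraMap_apply, ← Algebra.smul_def, one_mul,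
        zpow_natCast]
    · obtain ⟨z, hz⟩ := hcoef .minus (-l - 1).toNat i j
      refine ⟨z, ?_⟩
      rw [hz]
      congr 1
      obtain ⟨m, rfl⟩ : ∃ m : ℕ, l = -(m + 1 : ℕ) := ⟨(-l - 1).toNat, by omega⟩
      rw [show (-(-((m + 1 : ℕ) : ℤ)) - 1).toNat = m by omega, hα, geo, coeff_mk,
        ← IsScalarTower.algebraMap_apply, ← Algebra.smul_def, zpow_neg, zpow_natCast, inv_pow,
        neg_one_mul]

end VectorRep

end YangianDouble

end
noncomputable section

namespace YangianDouble

open PowerSeries Finset.HasAntidiagonal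

/-! ### Functionals on the Yangian double -/

section Functionals

theorem prod_congr_mod {R : Type*} [Ring R] [Algebra ℂ⟦X⟧ R] {ι : Type*} {f h : ι → R} (L : List ι)
    (hf : ∀ x, ∃ z, f x = h x + c • z) : ∃ z, (L.map f).prod = (L.map h).prod + c • z := by
  induction L with
  | nil => exact ⟨0, by simp⟩
  | cons x L ih =>
    obtain ⟨z, hz⟩ := ih
    obtain ⟨w, hw⟩ := hf x
    refine ⟨h x * z + w * (L.map f).prod, ?_⟩
    rw [List.map_cons, List.prod_cons, List.map_cons, List.prod_cons, smul_add, ← mul_smul_comm,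
      ← smul_mul_assoc, ← add_assoc, ← mul_add, ← hz, ← add_mul, ← hw]

/-- A sum over the elements `x` of `L`, with prefix `P`: `∑ φ x * G (P ++ L.erase x)`. -/
def insSum {T A : Type*} [Semiring A] (φ : T → A) (G : List T → A) : List T → List T → A
  | _, [] => 0
  | P, x :: L => φ x * G (P ++ L) + insSum φ G (P ++ [x]) L

/-- The sum over the bijections from `φ₁, …, φ_d` to the letters of a word of the products of the
values. -/
def permSum {T A : Type*} [Semiring A] : List (T → A) → List T → A
  | [], [] => 1
  | [], _ :: _ => 0
  | φ :: φs, L => insSum φ (permSum φs) [] L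

theorem insSum_eq_zero {T A : Type*} [Semiring A] {φ : T → A} {G : List T → A} {d : ℕ}
    (hG : ∀ L, L.length < d → G L = 0) (P L : List T) (h : (P ++ L).length < d + 1) :
    insSum φ G P L = 0 := by
  induction L generalizing P with
  | nil => rfl
  | cons x L ih =>
    rw [insSum, ih _ (by simpa using h), hG _ (by simp at h ⊢; omega), mul_zero, add_zero]

theorem permSum_eq_zero {T A : Type*} [Semiring A] (φs : List (T → A)) (L : List T)
    (h : L.length < φs.length) : permSum φs L = 0 := by
  induction φs generalizing L with
  | nil => simp at h
  | cons φ φs ih => exact insSum_eq_zero ih [] L (by simpa using h)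

variable {g : Series} {n : ℕ}

/-- The entry `M_{ji} - ε_i ε_j M_{i'j'}` of a matrix. -/
def skewEntry {A : Type*} [Ring A] (i j : Ix g n) : Matrix (Ix g n) (Ix g n) A →+ A where
  toFun M := M j i - (eps i * eps j) • M (opp i) (opp j)
  map_zero' := by simp
  map_add' M N := by simp only [Matrix.add_apply, smul_add]; abel

theorem skewEntry_apply {A : Type*} [Ring A] (i j : Ix g n) (M : Matrix (Ix g n) (Ix g n) A) :
    skewEntry i j M = M j i - (eps i * eps j) • M (opp i) (opp j) := rfl

theorem opp_inj {i j : Ix g n} : opp i = opp j ↔ i = j :=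
  ⟨fun h => by rw [← opp_opp i, h, opp_opp], congrArg opp⟩

/-- A tensor factor that receives no letter of the word thus contributes zero, so only words with at
least as many letters as factors survive. -/
theorem skewEntry_one {A : Type*} [Ring A] (i j : Ix g n) :
    skewEntry i j (1 : Matrix (Ix g n) (Ix g n) A) = 0 := by
  rw [skewEntry_apply, Matrix.one_apply, Matrix.one_apply]
  by_cases h : i = j
  · simp [h, eps_mul_self]
  · rw [if_neg (Ne.symm h), if_neg (by rwa [opp_inj]), smul_zero, sub_zero]

theorem skewEntry_scalar_mul {A : Type*} [Ring A] (i j : Ix g n) (y : A)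
    (M : Matrix (Ix g n) (Ix g n) A) :
    skewEntry i j (Matrix.scalar (Ix g n) y * M) = y * skewEntry i j M := by
  simp only [skewEntry_apply, Matrix.scalar_apply, Matrix.diagonal_mul, mul_sub, mul_smul_comm]

/-- The matrix `e_{ji} - ε_i ε_j e_{i'j'}`. -/
def skewUnit (i j : Ix g n) : Matrix (Ix g n) (Ix g n) ℂ⟦X⟧ :=
  Matrix.single j i 1 - (eps i * eps j) • Matrix.single (opp i) (opp j) 1

/-- The values on the modes of the functional given by an evaluation representation. -/
def siteValue (i j : Ix g n) (a : ℂ) (x : Ix g n × Ix g n × ℤ) : ℂ :=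
  ((if 0 ≤ x.2.2 then 1 else -1) * a ^ x.2.2) *
    constantCoeff (skewEntry i j (skewUnit x.1 x.2.1))

/-- There is a functional on the Yangian double modulo `c`, whose values on the words of length at
most `d` in the modes are given by `permSum`. -/
def Realizable (φs : List (Ix g n × Ix g n × ℤ → ℂ)) : Prop :=
  ∃ Θ : DY g n →+ ℂ, (∀ (r : ℂ⟦X⟧) x, Θ (r • x) = constantCoeff r * Θ x) ∧
    ∀ L : List (Ix g n × Ix g n × ℤ), L.length ≤ φs.length →
      Θ ((L.map fun x => mode x.1 x.2.1 x.2.2).prod) = permSum φs L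

theorem sol_zero {R : Type*} [Ring R] [Algebra ℂ⟦X⟧ R] [CComplete R] :
    Sol (g := g) (n := n) (0 : Ix g n → Ix g n → ℤ → R) := by
  have h1 : ∀ μ, tOp (0 : Ix g n → Ix g n → ℤ → R) μ = 1 := by
    intro μ
    rw [tOp_eq_ser]
    have h2 : ser (0 : Ix g n → Ix g n → ℤ → R) μ = 0 := by
      ext i j p
      cases μ <;> simp [ser]
    rw [h2, smul_zero, add_zero]
  have h12 : mat12 (1 : Matrix (Ix g n) (Ix g n) R⟦X⟧) 1 = 1 := by
    ext1 x y
    rw [mat12, Matrix.one_apply, Matrix.one_apply, Matrix.one_apply]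
    simp only [Prod.ext_iff]
    split_ifs <;> simp_all
  have h21 : mat21 (1 : Matrix (Ix g n) (Ix g n) R⟦X⟧) 1 = 1 := by
    ext1 x y
    rw [mat21, Matrix.one_apply, Matrix.one_apply, Matrix.one_apply]
    simp only [Prod.ext_iff]
    split_ifs <;> simp_all
  have hm : ∀ μ, (1 : Matrix (Ix g n) (Ix g n) R⟦X⟧).map (sigma (dU μ) (kappa g n)) = 1 := by
    intro μ
    rw [Matrix.map_one _ (map_zero _) (map_one _)]
  refine (relators_eq_zero_iff _).2 ⟨fun μ ν => ?_, fun μ => ?_⟩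
  · rw [RTT, h1, h1, h12, h21, mul_one, one_mul]
  · rw [h1, hm, transp_one, mul_one]
    exact ⟨rfl, rfl⟩

theorem isUnits_single {A : Type*} [Ring A] :
    IsUnits fun i j : Ix g n => (Matrix.single i j 1 : Matrix (Ix g n) (Ix g n) A) where
  mul_eq i j k l := by
    by_cases h : j = k
    · rw [if_pos h, h, Matrix.single_mul_single_same, mul_one]
    · rw [if_neg h, Matrix.single_mul_single_of_ne _ _ _ _ h]
  sum_eq := by
    ext i j
    rw [Matrix.sum_apply]
    simp only [Matrix.single_apply, Matrix.one_apply]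
    by_cases h : i = j
    · simp [h]
    · rw [if_neg h]
      refine Finset.sum_eq_zero fun k _ => if_neg fun h' => h (h'.1.symm.trans h'.2)

/-- Induction on the number of tensor factors, starting from the trivial representation T = 1.
Modulo `c` a mode acts on a product as a sum of its actions on the factors; in the new factor the
functional `skewEntry` is applied, followed by the functional already constructed. -/
theorem exists_model (sites : List (Ix g n × Ix g n × ℂ)) (ha : ∀ s ∈ sites, s.2.2 ≠ 0) :
    ∃ (R : Type) (_ : Ring R) (_ : Algebra ℂ⟦X⟧ R) (_ : CComplete R) (t : Ix g n → Ix g n → ℤ → R)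
      (Θ : R →+ ℂ), Sol t ∧ (∀ (r : ℂ⟦X⟧) x, Θ (r • x) = constantCoeff r * Θ x) ∧
      ∀ L : List (Ix g n × Ix g n × ℤ), L.length ≤ sites.length →
        Θ ((L.map fun x => t x.1 x.2.1 x.2.2).prod) =
          permSum (sites.map fun s => siteValue s.1 s.2.1 s.2.2) L := by
  induction sites with
  | nil =>
    refine ⟨ℂ⟦X⟧, inferInstance, inferInstance, inferInstance, 0,
      (constantCoeff : ℂ⟦X⟧ →+* ℂ).toAddMonoidHom, sol_zero, fun r x => ?_, fun L hL => ?_⟩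
    · exact map_mul (constantCoeff : ℂ⟦X⟧ →+* ℂ) _ _
    · obtain rfl : L = [] := List.eq_nil_of_length_eq_zero (by simpa using hL)
      exact map_one (constantCoeff : ℂ⟦X⟧ →+* ℂ)
  | cons s sites ih =>
    obtain ⟨R, _, _, _, t, Θ, ht, hΘ, hL⟩ := ih fun s hs => ha s (List.mem_cons_of_mem _ hs)
    obtain ⟨i, j, a⟩ := s
    set φs := sites.map fun s => siteValue s.1 s.2.1 s.2.2 with hφs
    obtain ⟨v, hv, hv0⟩ := exists_vectorSol (isUnits_single (g := g) (n := n) (A := ℂ⟦X⟧)) a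
      (ha _ List.mem_cons_self) ℂ⟦X⟧
    let ιm : Matrix (Ix g n) (Ix g n) ℂ⟦X⟧ →ₐ[ℂ⟦X⟧] Matrix (Ix g n) (Ix g n) R :=
      (Algebra.ofId ℂ⟦X⟧ R).mapMatrix
    let ιs : R →ₐ[ℂ⟦X⟧] Matrix (Ix g n) (Ix g n) R := Matrix.scalarAlgHom (Ix g n) ℂ⟦X⟧
    have hcomm : ∀ y M, Commute (ιs y) (ιm M) := by
      intro y M
      refine (Matrix.scalar_commute_iff.2 ?_)
      ext p q
      simp only [Matrix.smul_apply, MulOpposite.smul_eq_mul_unop, smul_eq_mul, ιm,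
        AlgHom.mapMatrix_apply, Matrix.map_apply, MulOpposite.unop_op]
      exact (Algebra.commutes _ _).symm
    obtain ⟨r, hr, hr0⟩ := (ht.map ιs).mul (hv.map ιm) fun _ _ _ _ _ _ => hcomm _ _
    have hc0 : constantCoeff (c : ℂ⟦X⟧) = 0 := constantCoeff_X
    let Ξ : Matrix (Ix g n) (Ix g n) R →+ ℂ := Θ.comp (skewEntry i j)
    have hΞ : ∀ (r : ℂ⟦X⟧) x, Ξ (r • x) = constantCoeff r * Ξ x := by
      intro r x
      refine Eq.trans (congrArg Θ ?_) (hΘ _ _)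
      simp only [skewEntry_apply, Matrix.smul_apply, smul_sub]
      rw [smul_comm r]
    let B : Ix g n × Ix g n × ℤ → Matrix (Ix g n) (Ix g n) ℂ⟦X⟧ := fun x =>
      (PowerSeries.C ((if 0 ≤ x.2.2 then 1 else -1) * a ^ x.2.2) : ℂ⟦X⟧) • skewUnit x.1 x.2.1
    let y : Ix g n × Ix g n × ℤ → R := fun x => t x.1 x.2.1 x.2.2
    have hval : ∀ x, constantCoeff (skewEntry i j (B x)) = siteValue i j a x := by
      intro x
      simp only [B, siteValue, skewEntry_apply, Matrix.smul_apply]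
      rw [smul_comm, ← smul_sub, smul_eq_mul, map_mul]
      simp
    have hB : ∀ x, ∃ z, r x.1 x.2.1 x.2.2 = ιs (y x) + ιm (B x) + c • z := by
      intro x
      obtain ⟨z, hz⟩ := hr0 x.1 x.2.1 x.2.2
      obtain ⟨w, hw⟩ := hv0 x.1 x.2.1 x.2.2
      refine ⟨ιm w + z, ?_⟩
      rw [hz, hw, map_add, map_smul ιm c, smul_add, add_assoc, add_assoc, add_assoc]
      rfl
    have hent : ∀ y M, Ξ (ιs y * ιm M) = constantCoeff (skewEntry i j M) * Θ y := by
      intro y M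
      rw [← hΘ]
      change Θ (skewEntry i j (Matrix.scalar (Ix g n) y * ιm M)) = _
      rw [skewEntry_scalar_mul, Algebra.smul_def, Algebra.commutes]
      congr 2
      simp only [skewEntry_apply, ιm, AlgHom.mapMatrix_apply, Matrix.map_apply, map_sub, map_zsmul]
      rfl
    -- Once the new factor has absorbed a letter, giving M, it absorbs no other: that would leave
    -- too few letters for the remaining factors. P collects the letters already passed on.
    have h2 : ∀ (L P : List (Ix g n × Ix g n × ℤ)) M, (P ++ L).length ≤ sites.length →
        Ξ (ιs ((P.map y).prod) * ιm M * (L.map fun x => ιs (y x) + ιm (B x)).prod) =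
          constantCoeff (skewEntry i j M) * permSum φs (P ++ L) := by
      intro L
      induction L with
      | nil =>
        intro P M h
        rw [List.map_nil, List.prod_nil, mul_one, hent, List.append_nil, ← hL]
        simpa using h
      | cons x L ih =>
        intro P M h
        rw [List.map_cons, List.prod_cons, ← mul_assoc, mul_add, add_mul, map_add,
          mul_assoc _ (ιm M) (ιm (B x)), ← map_mul ιm, mul_assoc _ (ιm M), ← (hcomm _ _).eq,
          ← mul_assoc, ← map_mul ιs]
        have e1 := ih (P ++ [x]) M (by simpa using h)
        rw [List.map_append, List.prod_append, List.map_singleton, List.prod_singleton,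
          List.append_assoc, List.singleton_append] at e1
        rw [e1, ih P (M * B x) (by simp at h ⊢; omega), permSum_eq_zero φs (P ++ L), mul_zero,
          add_zero]
        simp [φs] at h ⊢
        omega
    -- The new factor has not yet received a letter; the alternatives for the next one are the
    -- recursion of `insSum`.
    have h1 : ∀ L P : List (Ix g n × Ix g n × ℤ), (P ++ L).length ≤ sites.length + 1 →
        Ξ (ιs ((P.map y).prod) * (L.map fun x => ιs (y x) + ιm (B x)).prod) =
          insSum (siteValue i j a) (permSum φs) P L := by
      intro L
      induction L with
      | nil =>
        intro P h
        rw [List.map_nil, List.prod_nil, ← map_one ιm, hent, skewEntry_one, map_zero, zero_mul]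
        rfl
      | cons x L ih =>
        intro P h
        rw [List.map_cons, List.prod_cons, ← mul_assoc, mul_add, add_mul, map_add, ← map_mul ιs]
        have e1 := ih (P ++ [x]) (by simpa using h)
        rw [List.map_append, List.prod_append, List.map_singleton, List.prod_singleton] at e1
        rw [e1, h2 L P (B x) (by simp at h ⊢; omega), hval, insSum, add_comm]
    refine ⟨Matrix (Ix g n) (Ix g n) R, inferInstance, inferInstance, inferInstance, r, Ξ, hr, hΞ,
      fun L hLL => ?_⟩
    obtain ⟨z, hz⟩ := prod_congr_mod L hB
    rw [hz, map_add, hΞ, hc0, zero_mul, add_zero]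
    have := h1 L [] (by simpa using hLL)
    rw [List.map_nil, List.prod_nil, map_one, one_mul] at this
    exact this

theorem realizable_sites (sites : List (Ix g n × Ix g n × ℂ)) (ha : ∀ s ∈ sites, s.2.2 ≠ 0) :
    Realizable (sites.map fun s => siteValue s.1 s.2.1 s.2.2) := by
  obtain ⟨R, _, _, _, t, Θ, ht, hΘ, hL⟩ := exists_model sites ha
  obtain ⟨ψ, hψ⟩ := ht.exists_lift
  refine ⟨Θ.comp (ψ : DY g n →+ R), fun r x => ?_, fun L h => ?_⟩
  · change Θ (ψ (r • x)) = constantCoeff r * Θ (ψ x)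
    rw [map_smul, hΘ]
  · rw [← hL L (by simpa using h)]
    change Θ (ψ _) = _
    rw [map_list_prod, List.map_map]
    congr 3
    funext x
    exact hψ _ _ _

end Functionals

end YangianDouble

end
noncomputable section

namespace YangianDouble

open PowerSeries Finset.HasAntidiagonal

/-! ### Linear independence of ordered monomials -/

section Independence

theorem insSum_add_left {T A : Type*} [Semiring A] (φ ψ : T → A) (G : List T → A) (P L : List T) :
    insSum (φ + ψ) G P L = insSum φ G P L + insSum ψ G P L := by
  induction L generalizing P with
  | nil => simp [insSum]
  | cons x L ih =>
    simp only [insSum, ih, Pi.add_apply, add_mul]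
    abel

theorem insSum_smul_left {T A : Type*} [Semiring A] (a : A) (φ : T → A) (G : List T → A)
    (P L : List T) : insSum (a • φ) G P L = a * insSum φ G P L := by
  induction L generalizing P with
  | nil => simp [insSum]
  | cons x L ih => simp only [insSum, ih, Pi.smul_apply, smul_eq_mul, mul_add, mul_assoc]

theorem insSum_add_right {T A : Type*} [Semiring A] (φ : T → A) (G H : List T → A) (P L : List T) :
    insSum φ (G + H) P L = insSum φ G P L + insSum φ H P L := by
  induction L generalizing P with
  | nil => simp [insSum]
  | cons x L ih =>
    simp only [insSum, ih, Pi.add_apply, mul_add]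
    abel

theorem insSum_smul_right {T A : Type*} [CommSemiring A] (a : A) (φ : T → A) (G : List T → A)
    (P L : List T) : insSum φ (a • G) P L = a * insSum φ G P L := by
  induction L generalizing P with
  | nil => simp [insSum]
  | cons x L ih => simp only [insSum, ih, Pi.smul_apply, smul_eq_mul, mul_add, mul_left_comm]

theorem permSum_add {T A : Type*} [Semiring A] (pre post : List (T → A)) (φ ψ : T → A) :
    permSum (pre ++ (φ + ψ) :: post) =
      permSum (pre ++ φ :: post) + permSum (pre ++ ψ :: post) := by
  induction pre with
  | nil => exact funext fun L => insSum_add_left φ ψ _ [] L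
  | cons χ pre ih =>
    funext L
    change insSum χ (permSum (pre ++ (φ + ψ) :: post)) [] L = _
    rw [ih]
    exact insSum_add_right χ _ _ [] L

theorem permSum_smul {T A : Type*} [CommSemiring A] (pre post : List (T → A)) (a : A) (φ : T → A) :
    permSum (pre ++ (a • φ) :: post) = a • permSum (pre ++ φ :: post) := by
  induction pre with
  | nil => exact funext fun L => insSum_smul_left a φ _ [] L
  | cons χ pre ih =>
    funext L
    change insSum χ (permSum (pre ++ (a • φ) :: post)) [] L = _
    rw [ih]
    exact insSum_smul_right a χ _ [] L

variable {g : Series} {n : ℕ}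

theorem Realizable.add {pre post : List (Ix g n × Ix g n × ℤ → ℂ)} {φ ψ : Ix g n × Ix g n × ℤ → ℂ}
    (h1 : Realizable (pre ++ φ :: post)) (h2 : Realizable (pre ++ ψ :: post)) :
    Realizable (pre ++ (φ + ψ) :: post) := by
  obtain ⟨Θ, h, hL⟩ := h1
  obtain ⟨Θ', h', hL'⟩ := h2
  refine ⟨Θ + Θ', fun r x => ?_, fun L hl => ?_⟩
  · rw [AddMonoidHom.add_apply, h, h', AddMonoidHom.add_apply, mul_add]
  · rw [AddMonoidHom.add_apply, hL L (by simpa using hl), hL' L (by simpa using hl), permSum_add]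
    rfl

theorem Realizable.smul {pre post : List (Ix g n × Ix g n × ℤ → ℂ)} {φ : Ix g n × Ix g n × ℤ → ℂ}
    (h1 : Realizable (pre ++ φ :: post)) (a : ℂ) : Realizable (pre ++ (a • φ) :: post) := by
  obtain ⟨Θ, h, hL⟩ := h1
  refine ⟨(AddMonoidHom.mulLeft a).comp Θ, fun r x => ?_, fun L hl => ?_⟩
  · simp only [AddMonoidHom.comp_apply, AddMonoidHom.coe_mulLeft, h, mul_left_comm]
  · simp only [AddMonoidHom.comp_apply, AddMonoidHom.coe_mulLeft]
    rw [hL L (by simpa using hl), permSum_smul]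
    rfl

variable (g n) in
/-- The span of the values of the evaluation functionals. -/
def siteSpan : Submodule ℂ (Ix g n × Ix g n × ℤ → ℂ) :=
  Submodule.span ℂ {φ | ∃ i j a, a ≠ 0 ∧ φ = siteValue i j a}

/-- By multilinearity of `permSum`, the entries of the list are released one at a time from
evaluation functionals to their linear combinations. -/
theorem realizable_append (pre : List (Ix g n × Ix g n × ℂ)) (ha : ∀ s ∈ pre, s.2.2 ≠ 0)
    (post : List (Ix g n × Ix g n × ℤ → ℂ)) (hpost : ∀ φ ∈ post, φ ∈ siteSpan g n) :
    Realizable (pre.map (fun s => siteValue s.1 s.2.1 s.2.2) ++ post) := by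
  induction post generalizing pre with
  | nil =>
    rw [List.append_nil]
    exact realizable_sites pre ha
  | cons φ post ih =>
    have hp : ∀ φ ∈ post, φ ∈ siteSpan g n := fun ψ hψ => hpost ψ (List.mem_cons_of_mem _ hψ)
    have hb : ∀ i j a, a ≠ 0 → Realizable
        (pre.map (fun s => siteValue s.1 s.2.1 s.2.2) ++ siteValue i j a :: post) := by
      intro i j a h
      have := ih (pre ++ [(i, j, a)]) (fun s hs => by
        rcases List.mem_append.1 hs with hs | hs
        · exact ha s hs
        · rw [List.mem_singleton.1 hs]
          exact h) hp
      simpa using this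
    have hφ := hpost φ List.mem_cons_self
    induction hφ using Submodule.span_induction with
    | mem φ h =>
      obtain ⟨i, j, a, h, rfl⟩ := h
      exact hb i j a h
    | zero =>
      -- Zero is 0 times an evaluation functional, provided there is an index; without indices the
      -- empty word is the only one.
      have hne : Nonempty (Ix g n) ∨ IsEmpty (Ix g n) := (isEmpty_or_nonempty _).symm
      rcases hne with ⟨⟨i⟩⟩ | hne
      · have := (hb i i 1 one_ne_zero).smul 0
        rwa [zero_smul] at this
      · refine ⟨0, fun r x => by simp, fun L hl => ?_⟩
        cases L with
        | nil => 
          symm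
          exact permSum_eq_zero _ _ (by simp)
        | cons x L => exact hne.elim x.1
    | add φ ψ hφ hψ h1 h2 => 
      exact (h1 fun χ hχ => (List.mem_cons.1 hχ).elim (fun h => h ▸ hφ) (hp χ)).add
        (h2 fun χ hχ => (List.mem_cons.1 hχ).elim (fun h => h ▸ hψ) (hp χ))
    | smul a φ hφ h1 =>
      exact (h1 fun χ hχ => (List.mem_cons.1 hχ).elim (fun h => h ▸ hφ) (hp χ)).smul a

theorem realizable_of_mem (φs : List (Ix g n × Ix g n × ℤ → ℂ)) (h : ∀ φ ∈ φs, φ ∈ siteSpan g n) :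
    Realizable φs :=
  realizable_append [] (by simp) φs h

/-- Fourier inversion over roots of unity: the loop degree enters an evaluation functional through
aˡ, and averaging over a selects one degree. -/
theorem exists_delta (N : ℕ) (i j : Ix g n) (l₀ : ℤ) (h₀ : l₀.natAbs ≤ N) :
    ∃ φ ∈ siteSpan g n, ∀ x : Ix g n × Ix g n × ℤ, x.2.2.natAbs ≤ N → φ x =
      if x.2.2 = l₀ then constantCoeff (skewEntry i j (skewUnit x.1 x.2.1)) else 0 := by
  -- The order 2N+1 exceeds every difference of two degrees in [-N, N]. The sign `e` below undoes
  -- the one attached to negative degrees.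
  set ζ : ℂ := Complex.exp (2 * Real.pi * Complex.I / (2 * N + 1 : ℕ))
  have hζ : IsPrimitiveRoot ζ (2 * N + 1) := Complex.isPrimitiveRoot_exp _ (by omega)
  have hζ0 : ζ ≠ 0 := hζ.ne_zero (by omega)
  set e : ℂ := if 0 ≤ l₀ then 1 else -1 with he
  refine ⟨∑ k ∈ Finset.range (2 * N + 1), (e * ((2 * N + 1 : ℕ) : ℂ)⁻¹ * (ζ ^ k) ^ (-l₀)) •
    siteValue i j (ζ ^ k), Submodule.sum_mem _ fun k _ => Submodule.smul_mem _ _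
      (Submodule.subset_span ⟨i, j, ζ ^ k, pow_ne_zero _ hζ0, rfl⟩), fun x hx => ?_⟩
  rw [Finset.sum_apply]
  have h1 : ∀ k, ((e * ((2 * N + 1 : ℕ) : ℂ)⁻¹ * (ζ ^ k) ^ (-l₀)) • siteValue i j (ζ ^ k)) x =
      e * ((2 * N + 1 : ℕ) : ℂ)⁻¹ * (if 0 ≤ x.2.2 then 1 else -1) *
        constantCoeff (skewEntry i j (skewUnit x.1 x.2.1)) * (ζ ^ (x.2.2 - l₀)) ^ k := by
    intro k
    have : (ζ ^ (x.2.2 - l₀)) ^ k = (ζ ^ k) ^ (-l₀) * (ζ ^ k) ^ x.2.2 := by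
      rw [← zpow_natCast, ← zpow_natCast, ← zpow_mul, ← zpow_mul, ← zpow_mul, ← zpow_add₀ hζ0]
      congr 1
      ring
    rw [this, Pi.smul_apply, smul_eq_mul, siteValue]
    ring
  simp only [h1]
  rw [← Finset.mul_sum]
  by_cases h : x.2.2 = l₀
  · have hN : ((2 * N + 1 : ℕ) : ℂ) ≠ 0 := Nat.cast_ne_zero.2 (by omega)
    have he2 : e * e = 1 := by rw [he]; split_ifs <;> simp
    simp only [h, if_true, sub_self, zpow_zero, one_pow, Finset.sum_const, Finset.card_range, nsmul_one]
    rw [← he]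
    field_simp
    linear_combination constantCoeff (skewEntry i j (skewUnit x.1 x.2.1)) * he2
  · have hw : ζ ^ (x.2.2 - l₀) ≠ 1 := by
      rw [Ne, hζ.zpow_eq_one_iff_dvd]
      intro hd
      have := Int.eq_zero_of_abs_lt_dvd hd (by rw [abs_lt]; omega)
      omega
    have hz : (ζ ^ (x.2.2 - l₀)) ^ (2 * N + 1) = 1 := by
      rw [← zpow_natCast, ← zpow_mul, mul_comm, zpow_mul, zpow_natCast, hζ.pow_eq_one, one_zpow]
    rw [geom_sum_eq hw, hz, sub_self, zero_div, mul_zero, if_neg h]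

/-- With dual functionals the sum counts the matchings of two words. It is a natural number, so no
cancellation can occur, and repeated letters only produce multiplicities that are nonzero in ℂ. -/
theorem permSum_delta {T M : Type*} [DecidableEq M] (κ : M → T) (S : Set M) (ms : List M)
    (φ : M → T → ℂ) (h : ∀ m ∈ ms, ∀ m' ∈ S, φ m (κ m') = if m' = m then 1 else 0) (L : List M)
    (hL : ∀ x ∈ L, x ∈ S) : ∃ k : ℕ, permSum (ms.map φ) (L.map κ) = k ∧
      (k ≠ 0 → ms.Perm L) ∧ (ms = L → k ≠ 0) := by
  induction ms generalizing L with
  | nil =>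
    cases L with
    | nil => exact ⟨1, by simp [permSum], by simp, by simp⟩
    | cons x L => exact ⟨0, by simp [permSum], by simp, by simp⟩
  | cons m ms ih =>
    have ih' := ih fun m' hm' => h m' (List.mem_cons_of_mem _ hm')
    have key : ∀ L P : List M, (∀ x ∈ P ++ L, x ∈ S) → ∃ k : ℕ,
        insSum (φ m) (permSum (ms.map φ)) (P.map κ) (L.map κ) = k ∧
          (k ≠ 0 → (m :: ms).Perm (P ++ L)) ∧ (P = [] → m :: ms = L → k ≠ 0) := by
      intro L
      induction L with
      | nil => exact fun P _ => ⟨0, by simp [insSum], by simp, by simp⟩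
      | cons x L ihL =>
        intro P hP
        obtain ⟨k1, h1, h1', h1''⟩ := ih' (P ++ L) fun y hy => hP y (by
          simp only [List.mem_append, List.mem_cons] at hy ⊢; tauto)
        obtain ⟨k2, h2, h2', -⟩ := ihL (P ++ [x]) (by simpa using hP)
        refine ⟨(if x = m then 1 else 0) * k1 + k2, ?_, fun hk => ?_, fun h3 h4 => ?_⟩
        · simp only [List.map_cons, insSum]
          rw [h m List.mem_cons_self x (hP x (by simp)), ← List.map_append, h1]
          rw [List.map_append, List.map_singleton] at h2
          rw [h2]
          push_cast
          rfl
        · by_cases hx : x = m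
          · by_cases hk1 : k1 = 0
            · rw [hk1, mul_zero, zero_add] at hk
              simpa using h2' hk
            · rw [hx]
              exact ((h1' hk1).cons m).trans List.perm_middle.symm
          · rw [if_neg hx, zero_mul, zero_add] at hk
            simpa using h2' hk
        · obtain ⟨rfl, rfl⟩ := List.cons.inj h4
          have := h1'' (by rw [h3]; rfl)
          rw [if_pos rfl]
          omega
    obtain ⟨k, h1, h2, h3⟩ := key L [] (by simpa using hL)
    exact ⟨k, h1, h2, h3 rfl⟩

/-- If the coefficients of every relation are divisible by `c`, then, without torsion, `c` can be
cancelled and the quotient is again a relation; iteration shows that they are zero. -/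
theorem linearIndependent_of_constantCoeff {ι M : Type*} [AddCommGroup M] [Module ℂ⟦X⟧ M]
    (hM : ∀ x : M, c • x = 0 → x = 0) (v : ι → M)
    (h : ∀ l : ι →₀ ℂ⟦X⟧, Finsupp.linearCombination ℂ⟦X⟧ v l = 0 →
      ∀ i, constantCoeff (l i) = 0) : LinearIndependent ℂ⟦X⟧ v := by
  rw [linearIndependent_iff]
  have key : ∀ (N : ℕ) (l : ι →₀ ℂ⟦X⟧), Finsupp.linearCombination ℂ⟦X⟧ v l = 0 →
      ∀ i, coeff N (l i) = 0 := by
    intro N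
    induction N with
    | zero =>
      intro l hl i
      rw [coeff_zero_eq_constantCoeff]
      exact h l hl i
    | succ N ih =>
      intro l hl i
      let l' : ι →₀ ℂ⟦X⟧ := l.mapRange (fun f => PowerSeries.mk fun p => coeff (p + 1) f) (by
        ext p
        simp)
      have hl' : l = c • l' := by
        ext i p
        rw [Finsupp.smul_apply, smul_eq_mul, c]
        cases p with
        | zero =>
          rw [coeff_zero_X_mul, coeff_zero_eq_constantCoeff]
          exact h l hl i
        | succ p => simp [l', coeff_succ_X_mul]
      rw [hl', map_smul] at hl
      have := ih l' (hM _ hl) i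
      simpa [l'] using this
  intro l hl
  ext i N
  rw [key N l hl i]
  simp

/-- The loop degree of the modes of series. -/
def loopDeg : Sgn → ℕ → ℤ
  | .plus, p => p
  | .minus, p => -p - 1

theorem loopDeg_inj {μ ν : Sgn} {p q : ℕ} (h : loopDeg μ p = loopDeg ν q) : μ = ν ∧ p = q := by
  cases μ <;> cases ν <;> simp only [loopDeg] at h <;>
    first
    | exact ⟨rfl, by omega⟩
    | omega

/-- The argument of Poincaré, Birkhoff and Witt without a filtration: `h0` and `h1` say that the
chosen elements of 𝔤 are orthogonal and not isotropic, so each letter has a dual functional. -/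
theorem linearIndependent_monomials {J : Type} {y : Sgn × J × ℕ → DY g n} (idx : J → Ix g n × Ix g n)
    (hy : ∀ m, ∃ z, y m = mode (idx m.2.1).1 (idx m.2.1).2 (loopDeg m.1 m.2.2) + c • z)
    (h0 : ∀ a, constantCoeff
      (skewEntry (idx a).1 (idx a).2 (skewUnit (idx a).1 (idx a).2)) ≠ 0)
    (h1 : ∀ a b, a ≠ b → constantCoeff
      (skewEntry (idx a).1 (idx a).2 (skewUnit (idx b).1 (idx b).2)) = 0)
    (r : Sgn × J × ℕ → Sgn × J × ℕ → Prop) (hr : IsLinearOrder (Sgn × J × ℕ) r) :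
    LinearIndependent ℂ⟦X⟧ fun L : {L : List (Sgn × J × ℕ) // L.Pairwise r} =>
      (L.1.map y).prod := by
  classical
  refine linearIndependent_of_constantCoeff c_smul_eq_zero _ fun l hl => ?_
  by_contra! hne
  obtain ⟨L₁, hL₁⟩ := hne
  set κ : Sgn × J × ℕ → Ix g n × Ix g n × ℤ := fun m =>
    ((idx m.2.1).1, (idx m.2.1).2, loopDeg m.1 m.2.2) with hκ
  -- A longest word among those whose coefficient is nonzero modulo `c`; all competing words then
  -- lie in the range of lengths on which the functional is known.
  obtain ⟨L₀, hL₀, hmax⟩ := Finset.exists_max_image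
    (l.support.filter fun L => constantCoeff (l L) ≠ 0) (fun L => L.1.length)
    ⟨L₁, by
      rw [Finset.mem_filter, Finsupp.mem_support_iff]
      exact ⟨fun h => hL₁ (by rw [h, map_zero]), hL₁⟩⟩
  rw [Finset.mem_filter] at hL₀
  set S : Finset (Sgn × J × ℕ) := l.support.biUnion fun L => L.1.toFinset with hS
  have hmem : ∀ L ∈ l.support, ∀ m ∈ L.1, m ∈ S := by
    intro L hL m hm
    exact Finset.mem_biUnion.2 ⟨L, hL, List.mem_toFinset.2 hm⟩
  set N := S.sup fun m => (κ m).2.2.natAbs with hN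
  have hle : ∀ m ∈ S, (κ m).2.2.natAbs ≤ N := fun m hm =>
    Finset.le_sup (f := fun m => (κ m).2.2.natAbs) hm
  have hdelta : ∀ m : Sgn × J × ℕ, ∃ φ ∈ siteSpan g n, m ∈ S → ∀ m' ∈ S,
      φ (κ m') = if m' = m then 1 else 0 := by
    intro m
    by_cases hm : m ∈ S
    swap
    · exact ⟨0, Submodule.zero_mem _, fun h => absurd h hm⟩
    obtain ⟨φ, hφ, hφ'⟩ := exists_delta N (idx m.2.1).1 (idx m.2.1).2 (κ m).2.2 (hle m hm)
    refine ⟨(constantCoeff (skewEntry (idx m.2.1).1 (idx m.2.1).2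
      (skewUnit (idx m.2.1).1 (idx m.2.1).2)))⁻¹ • φ, Submodule.smul_mem _ _ hφ,
      fun _ m' hm' => ?_⟩
    rw [Pi.smul_apply, hφ' _ (hle m' hm')]
    obtain ⟨μ, a, p⟩ := m
    obtain ⟨ν, b, q⟩ := m'
    simp only [hκ, Prod.mk.injEq, smul_eq_mul]
    by_cases hd : loopDeg ν q = loopDeg μ p
    · obtain ⟨rfl, rfl⟩ := loopDeg_inj hd
      by_cases hab : b = a
      · subst hab
        simp [h0 b]
      · simp [h1 a b (Ne.symm hab), hab]
    · rw [if_neg hd, mul_zero, if_neg]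
      rintro ⟨rfl, -, rfl⟩
      exact hd rfl
  choose φ hφ hφ' using hdelta
  obtain ⟨Θ, hΘ, hΘL⟩ := realizable_of_mem (L₀.1.map φ) (by
    intro ψ hψ
    obtain ⟨m, -, rfl⟩ := List.mem_map.1 hψ
    exact hφ m)
  have hc0 : constantCoeff (c : ℂ⟦X⟧) = 0 := constantCoeff_X
  have hval : ∀ L : {L : List (Sgn × J × ℕ) // L.Pairwise r}, L ∈ l.support →
      L.1.length ≤ L₀.1.length → ∃ k : ℕ, Θ ((L.1.map y).prod) = k ∧
        (k ≠ 0 → L₀.1.Perm L.1) ∧ (L₀.1 = L.1 → k ≠ 0) := by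
    intro L hL hlen
    obtain ⟨z, hz⟩ := prod_congr_mod L.1 hy
    obtain ⟨k, hk, hk'⟩ := permSum_delta κ (S : Set (Sgn × J × ℕ)) L₀.1 φ
      (fun m hm => hφ' m (hmem _ hL₀.1 m hm)) L.1 (hmem _ hL)
    refine ⟨k, ?_, hk'⟩
    rw [← hk, ← hΘL _ (by simpa using hlen), hz, map_add, hΘ, hc0, zero_mul, add_zero,
      List.map_map]
    rfl
  have hsum : constantCoeff (l L₀) * Θ ((L₀.1.map y).prod) = 0 := by
    rw [← map_zero Θ, ← hl, Finsupp.linearCombination_apply, Finsupp.sum, map_sum]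
    symm
    rw [Finset.sum_eq_single L₀]
    · exact hΘ _ _
    · intro L hL hne
      rw [hΘ]
      by_cases hL0 : constantCoeff (l L) = 0
      · rw [hL0, zero_mul]
      obtain ⟨k, hk, hk', -⟩ := hval L hL (hmax L (Finset.mem_filter.2 ⟨hL, hL0⟩))
      rw [hk]
      by_cases hk0 : k = 0
      · rw [hk0, Nat.cast_zero, mul_zero]
      -- Two ordered words with the same letters coincide; this is the only place where the total
      -- order enters.
      · have := (hk' hk0).eq_of_pairwise (fun a b _ _ h1 h2 => hr.antisymm a b h1 h2) L₀.2 L.2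
        exact absurd (Subtype.ext this.symm) hne
    · exact fun h => absurd hL₀.1 h
  obtain ⟨k, hk, -, hk'⟩ := hval L₀ hL₀.1 le_rfl
  rw [hk] at hsum
  rcases mul_eq_zero.1 hsum with h | h
  · exact hL₀.2 h
  · exact hk' rfl (Nat.cast_eq_zero.1 h)

end Independence

end YangianDouble

end
noncomputable section

namespace YangianDouble

open PowerSeries Finset.HasAntidiagonal

/-! ### Commutators with the zero modes -/

section Bracket

variable {g : Series} {n : ℕ}

/-- The exponent of the coefficient of a series which carries the mode `p`. -/
def modeExp : Sgn → ℕ → ℕ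
  | .plus, p => p + 1
  | .minus, p => p

theorem coeff_modeExp_tSeries (μ : Sgn) (p : ℕ) (i j : Ix g n) :
    coeff (modeExp μ p) (tSeries μ i j) = mode i j (loopDeg μ p) := by
  cases μ with
  | plus =>
    rw [modeExp, tSeries, ser, coeff_mk, if_neg (Nat.succ_ne_zero p), loopDeg]
    push_cast
    rw [add_sub_cancel_right]
  | minus => rw [modeExp, tSeries, ser, coeff_mk, loopDeg]

theorem seriesMode_smul (μ : Sgn) (p : ℕ) (f : (DY g n)⟦X⟧) :
    seriesMode μ (c • f) p = coeff (modeExp μ p) f := by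
  cases μ <;> simp only [seriesMode, modeExp, PowerSeries.coeff_smul, cdiv_smul]

/-- The first nontrivial coefficient in u: T⁺ starts with 1, so the terms with u⁰ commute and only
the commutator with the coefficient of u⁻¹, together with P and Q, remains. -/
theorem rttDefect_one {R : Type*} [Ring R] [Algebra ℂ⟦X⟧ R] (t : Ix g n → Ix g n → ℤ → R) (ν : Sgn)
    (b : ℤ) : rttDefect t .plus ν 1 b =
      prod12 t .plus ν (-1) b - prod21 t .plus ν (-1) b +
        c • (opP * prod12 t .plus ν 0 b - prod12 t .plus ν 0 b * opP) -
        c • (opQ * prod12 t .plus ν 0 b - prod12 t .plus ν 0 b * opQ) := by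
  have h0 : ∀ b, prod21 t .plus ν 0 b = prod12 t .plus ν 0 b := by
    intro b
    ext x y
    simp only [prod21, prod12, coeffZ, le_refl, if_true, neg_zero, Int.toNat_zero, tOp, coeff_mk]
    split_ifs <;> simp
  have h1 : ∀ b, prod12 t .plus ν 1 b = 0 := by
    intro b
    ext x y
    simp [prod12, coeffZ]
  have h2 : ∀ b, prod21 t .plus ν 1 b = 0 := by
    intro b
    ext x y
    simp [prod21, coeffZ]
  simp only [rttDefect, mulLin, sub_self, zero_sub, h0, h1, h2, zero_smul, mul_zero, zero_mul,
    smul_zero, sub_zero, add_zero]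
  simp only [smul_sub]
  abel

theorem prod12_zero {R : Type*} [Ring R] [Algebra ℂ⟦X⟧ R] (t : Ix g n → Ix g n → ℤ → R) (ν : Sgn)
    (b : ℤ) (x y : Ix g n × Ix g n) : prod12 t .plus ν 0 b x y =
      if x.1 = y.1 then coeffZ ν (tOp t ν x.2 y.2) b else 0 := by
  simp only [prod12, coeffZ, le_refl, if_true, neg_zero, Int.toNat_zero, tOp, coeff_mk]
  split_ifs <;> simp

theorem opQ_mul_prod12 {R : Type*} [Ring R] [Algebra ℂ⟦X⟧ R] (t : Ix g n → Ix g n → ℤ → R)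
    (ν : Sgn) (b : ℤ) (x y : Ix g n × Ix g n) :
    ((opQ : Mat2 R g n) * prod12 t .plus ν 0 b) x y =
      if x.2 = opp x.1 then (eps x.1 * eps y.1) • coeffZ ν (tOp t ν (opp y.1) y.2) b else 0 := by
  split_ifs with h
  · rw [Matrix.mul_apply, Finset.sum_eq_single (y.1, opp y.1)]
    · rw [prod12_zero, if_pos rfl, opQ, if_pos ⟨h, rfl⟩, zsmul_eq_mul]
    · intro z _ hz
      rw [prod12_zero, opQ]
      by_cases h1 : z.2 = opp z.1
      · by_cases h2 : z.1 = y.1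
        · exact absurd (by rw [← h2, ← h1]) hz
        · rw [if_neg h2, mul_zero]
      · rw [if_neg fun h => h1 h.2, zero_mul]
    · simp
  · exact opQ_mul_apply _ h y

theorem prod12_mul_opQ {R : Type*} [Ring R] [Algebra ℂ⟦X⟧ R] (t : Ix g n → Ix g n → ℤ → R)
    (ν : Sgn) (b : ℤ) (x y : Ix g n × Ix g n) :
    (prod12 t .plus ν 0 b * (opQ : Mat2 R g n)) x y =
      if y.2 = opp y.1 then (eps x.1 * eps y.1) • coeffZ ν (tOp t ν x.2 (opp x.1)) b else 0 := by
  split_ifs with h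
  · rw [Matrix.mul_apply, Finset.sum_eq_single (x.1, opp x.1)]
    · rw [prod12_zero, if_pos rfl, opQ, if_pos ⟨rfl, h⟩, zsmul_eq_mul, Int.cast_comm]
    · intro z _ hz
      rw [prod12_zero, opQ]
      by_cases h1 : z.2 = opp z.1
      · by_cases h2 : x.1 = z.1
        · exact absurd (by rw [h2, ← h1]) hz
        · rw [if_neg h2, zero_mul]
      · rw [if_neg (c := z.2 = opp z.1 ∧ _) fun h => h1 h.1, mul_zero]
    · simp
  · exact mul_opQ_apply _ x h

/-- The exponent of `v` which carries the mode `p`. -/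
def modeDeg : Sgn → ℕ → ℤ
  | .plus, p => -(p : ℤ) - 1
  | .minus, p => p

theorem coeffZ_tOp (ν : Sgn) (p : ℕ) : ∃ d : ℤ, ∀ k l : Ix g n,
    coeffZ ν (tOp mode ν k l) (modeDeg ν p) =
      d • (if k = l then (1 : DY g n) else 0) + c • mode k l (loopDeg ν p) := by
  cases ν with
  | plus =>
    refine ⟨0, fun k l => ?_⟩
    rw [modeDeg, coeffZ, if_pos (by omega), show (-(-(p : ℤ) - 1)).toNat = p + 1 by omega, tOp,
      coeff_mk, if_neg (Nat.succ_ne_zero p), zero_smul, zero_add, loopDeg]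
    push_cast
    rw [add_sub_cancel_right]
  | minus =>
    refine ⟨if p = 0 then 1 else 0, fun k l => ?_⟩
    rw [modeDeg, coeffZ, if_pos (by omega), Int.toNat_natCast, tOp, coeff_mk, loopDeg]
    congr 1
    by_cases hp : p = 0 <;> by_cases hk : k = l <;> simp [hp, hk]

/-- The zero modes act by the loop algebra bracket exactly, not only modulo `c`. -/
theorem mode_bracket (i j k l : Ix g n) (ν : Sgn) (p : ℕ) :
    mode i j 0 * mode k l (loopDeg ν p) - mode k l (loopDeg ν p) * mode i j 0 =
      (if i = l then mode k j (loopDeg ν p) else 0) -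
      (if k = j then mode i l (loopDeg ν p) else 0) +
      (if k = opp i then (eps i * eps j) • mode (opp j) l (loopDeg ν p) else 0) -
      (if l = opp j then (eps i * eps j) • mode k (opp i) (loopDeg ν p) else 0) := by
  obtain ⟨d, hd⟩ := coeffZ_tOp (g := g) (n := n) ν p
  have h : rttDefect (mode (g := g) (n := n)) .plus ν 1 (modeDeg ν p) (i, k) (j, l) = 0 :=
    relators_mode (Or.inl (Or.inl ⟨_, _, _, _, _, _, rfl⟩))
  have h1 : coeffZ .plus (tOp (mode (g := g) (n := n)) .plus i j) (-1) = c • mode i j 0 := by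
    simp [coeffZ, tOp]
  rw [rttDefect_one] at h
  simp only [Matrix.sub_apply, Matrix.add_apply, Matrix.smul_apply, opP_mul_apply, mul_opP_apply,
    opQ_mul_prod12, prod12_mul_opQ] at h
  simp only [prod12_zero] at h
  simp only [prod12, prod21, h1, hd] at h
  -- Each of the two T-operators contributes one factor `c` to the commutator; on the other side one
  -- comes from the R-matrix and one from the mode. The identity part of T^ν drops out.
  have hkey : c • (c • (mode i j 0 * mode k l (loopDeg ν p) - mode k l (loopDeg ν p) * mode i j 0) -
      c • ((if i = l then mode k j (loopDeg ν p) else 0) -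
      (if k = j then mode i l (loopDeg ν p) else 0) +
      (if k = opp i then (eps i * eps j) • mode (opp j) l (loopDeg ν p) else 0) -
      (if l = opp j then (eps i * eps j) • mode k (opp i) (loopDeg ν p) else 0))) =
      (0 : DY g n) := by
    refine Eq.trans ?_ h
    have hu : mode i j 0 * (if k = l then (1 : DY g n) else 0) =
        (if k = l then (1 : DY g n) else 0) * mode i j 0 := by split_ifs <;> simp
    simp only [eq_comm (a := opp j) (b := l), mul_add, add_mul, mul_smul_comm, smul_mul_assoc, hu]
    clear hu h h1 hd
    split_ifs <;> simp only [smul_add, smul_sub, smul_zero, smul_comm d c,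
      smul_comm (eps i * eps j) c] <;> abel
  have := CComplete.torsion_free _ hkey
  rw [← smul_sub] at this
  exact sub_eq_zero.1 (CComplete.torsion_free _ this)

end Bracket

end YangianDouble

end
noncomputable section

namespace YangianDouble

open PowerSeries Finset.HasAntidiagonal

/-! ### Generation modulo `c` -/

section Generation

variable {g : Series} {n : ℕ}

/-- The subalgebra `A + c B`. -/
def addC {S : Type*} [Ring S] [Algebra ℂ⟦X⟧ S] (A B : Subalgebra ℂ⟦X⟧ S) (h : A ≤ B) :
    Subalgebra ℂ⟦X⟧ S where
  carrier := {x | ∃ a ∈ A, ∃ b ∈ B, x = a + c • b}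
  mul_mem' := by
    rintro _ _ ⟨a, ha, b, hb, rfl⟩ ⟨a', ha', b', hb', rfl⟩
    refine ⟨a * a', A.mul_mem ha ha', a * b' + b * a' + c • (b * b'), B.add_mem (B.add_mem
      (B.mul_mem (h ha) hb') (B.mul_mem hb (h ha'))) (B.smul_mem (B.mul_mem hb hb') _), ?_⟩
    simp only [add_mul, mul_add, smul_mul_assoc, mul_smul_comm, smul_add]
    abel
  add_mem' := by
    rintro _ _ ⟨a, ha, b, hb, rfl⟩ ⟨a', ha', b', hb', rfl⟩
    refine ⟨a + a', A.add_mem ha ha', b + b', B.add_mem hb hb', ?_⟩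
    rw [smul_add]
    abel
  algebraMap_mem' r := ⟨algebraMap _ _ r, A.algebraMap_mem r, 0, B.zero_mem, by simp⟩

/-- Generation modulo `c` implies generation modulo every power, provided the remainder stays in
`B`, so that it can be approximated again. -/
theorem exists_approx {S : Type*} [Ring S] [Algebra ℂ⟦X⟧ S] {A B : Subalgebra ℂ⟦X⟧ S} (h : A ≤ B)
    (hB : B ≤ addC A B h) (N : ℕ) : ∀ x ∈ B, ∃ y ∈ A, ∃ z ∈ B, x = y + c ^ N • z := by
  induction N with
  | zero => exact fun x hx => ⟨0, A.zero_mem, x, hx, by simp⟩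
  | succ N ih =>
    intro x hx
    obtain ⟨y, hy, z, hz, rfl⟩ := ih x hx
    obtain ⟨a, ha, b, hb, rfl⟩ := hB hz
    refine ⟨y + c ^ N • a, A.add_mem hy (A.smul_mem ha _), b, hb, ?_⟩
    rw [smul_add, smul_smul, ← pow_succ, add_assoc]

theorem subset_closedAdjoin {S : Set (DY g n)} {B : Subalgebra ℂ⟦X⟧ (DY g n)}
    (h : Algebra.adjoin ℂ⟦X⟧ S ≤ B) (hB : B ≤ addC _ B h) {x : DY g n}
    (hx : ∀ N : ℕ, ∃ y ∈ B, ∃ z, x - y = c ^ N • z) : x ∈ closedAdjoin S := by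
  intro N
  obtain ⟨y, hy, z, hz⟩ := hx N
  obtain ⟨a, ha, b, -, rfl⟩ := exists_approx h hB N y hy
  refine ⟨a, ha, z + b, ?_⟩
  rw [smul_add, ← hz]
  abel

theorem closedAdjoin_mono {S S' : Set (DY g n)} (h : S ⊆ Algebra.adjoin ℂ⟦X⟧ S') :
    closedAdjoin S ⊆ closedAdjoin S' := by
  intro x hx N
  obtain ⟨y, hy, z, hz⟩ := hx N
  exact ⟨y, Algebra.adjoin_le h hy, z, hz⟩

variable (g n) in
/-- The constants in the completed free algebra. -/
def constFree : FreeAlgebra ℂ (Ix g n × Ix g n × ℤ) →+* FreeMode g n :=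
  (PowerSeries.C : _ →+* PowerSeries (FreeAlgebra ℂ (Ix g n × Ix g n × ℤ)))

theorem exists_eq_constFree (f : FreeMode g n) : ∃ a f', f = constFree g n a + c • f' := by
  have key : ∀ F : PowerSeries (FreeAlgebra ℂ (Ix g n × Ix g n × ℤ)),
      F = PowerSeries.C (coeff 0 F) + X ^ 1 * PowerSeries.mk fun p => coeff (p + 1) F := by
    intro F
    rw [pow_one, add_comm, coeff_zero_eq_constantCoeff_apply]
    exact eq_X_mul_shift_add_const F
  let f' : FreeMode g n := (PowerSeries.mk fun p => PowerSeries.coeff (p + 1) f :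
    PowerSeries (FreeAlgebra ℂ (Ix g n × Ix g n × ℤ)))
  refine ⟨PowerSeries.coeff (R := FreeAlgebra ℂ (Ix g n × Ix g n × ℤ)) 0 f, f', (key f).trans ?_⟩
  have h1 := c_smul_free 1 f'
  rw [pow_one c] at h1
  exact (congrArg (fun x : FreeMode g n => constFree g n _ + x) h1).symm

variable (g n) in
/-- The modes generate the Yangian double modulo `c`. -/
theorem exists_mem_adjoin_mode (x : DY g n) :
    ∃ y ∈ Algebra.adjoin ℂ⟦X⟧ {x : DY g n | ∃ i j l, x = mode i j l}, ∃ z, x = y + c • z := by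
  obtain ⟨f, rfl⟩ := proj_surjective g n x
  have key : ∀ a, proj g n (constFree g n a) ∈
      Algebra.adjoin ℂ⟦X⟧ {x : DY g n | ∃ i j l, x = mode i j l} := by
    intro a
    induction a using FreeAlgebra.induction with
    | grade0 r =>
      have : constFree g n (algebraMap ℂ _ r) = algebraMap ℂ⟦X⟧ (FreeMode g n) (PowerSeries.C r) :=
        (PowerSeries.map_C _ _).symm
      rw [this, AlgHom.commutes]
      exact Subalgebra.algebraMap_mem _ _
    | grade1 x => exact Algebra.subset_adjoin ⟨x.1, x.2.1, x.2.2, rfl⟩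
    | mul a b ha hb =>
      rw [map_mul, map_mul]
      exact Subalgebra.mul_mem _ ha hb
    | add a b ha hb =>
      rw [map_add, map_add]
      exact Subalgebra.add_mem _ ha hb
  obtain ⟨a, f', rfl⟩ := exists_eq_constFree f
  exact ⟨_, key a, proj g n f', by rw [map_add, map_smul]⟩

/-- A set of pairs of indices which is closed under the commutators of the modes `t_{ij}[0]` and
the symmetry of the modes. -/
structure BracketClosed (V : Ix g n → Ix g n → Prop) : Prop where
  symm_opp : ∀ i j, V i j → V (opp j) (opp i)
  mul : ∀ i j l, V i j → V j l → i ≠ l → j ≠ opp i → l ≠ opp j → V i l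
  mul_opp : th g = -1 → ∀ i l, V i (opp i) → V (opp i) l → l ≠ i → V i l
  self : th g = 1 → ∀ i, V i (opp i)

/-- Brackets are taken with zero modes only, so one sign at a time can be treated. For opposite
indices the symplectic bracket acquires the coefficient 2, which is invertible, and in the
orthogonal case t_{ii'} vanishes modulo `c`. -/
theorem bracketClosed_of_mem {A B : Subalgebra ℂ⟦X⟧ (DY g n)} (h : A ≤ B) (M : Sgn → Prop)
    (hp : M .plus)
    (hsym : ∀ i j μ p, M μ → ∃ b ∈ B, mode i j (loopDeg μ p) +
      (eps i * eps j) • mode (opp j) (opp i) (loopDeg μ p) = c • b) :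
    BracketClosed fun i j : Ix g n => ∀ μ p, M μ → mode i j (loopDeg μ p) ∈ addC A B h where
  symm_opp i j hV μ p hμ := by
    obtain ⟨b, hb, hb'⟩ := hsym (opp j) (opp i) μ p hμ
    rw [opp_opp, opp_opp] at hb'
    rw [eq_sub_of_add_eq hb']
    exact Subalgebra.sub_mem _ ⟨0, A.zero_mem, b, hb, by simp⟩
      (Subalgebra.zsmul_mem _ (hV μ p hμ) _)
  mul i j l h1 h2 h3 h4 h5 μ p hμ := by
    have hb := mode_bracket i j j l μ p
    rw [if_neg h3, if_pos rfl, if_neg h4, if_neg h5, zero_sub, add_zero, sub_zero] at hb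
    rw [← neg_neg (mode i l _), ← hb]
    have h0 : mode i j 0 ∈ addC A B h := h1 .plus 0 hp
    exact Subalgebra.neg_mem _ (Subalgebra.sub_mem _ (Subalgebra.mul_mem _ h0 (h2 μ p hμ))
      (Subalgebra.mul_mem _ (h2 μ p hμ) h0))
  mul_opp hth i l h1 h2 h3 μ p hμ := by
    have hb := mode_bracket i (opp i) (opp i) l μ p
    have he : eps i * eps (opp i) = -1 := by
      rw [eps_opp, hth, mul_left_comm, eps_mul_self, mul_one]
    rw [if_neg h3.symm, if_pos rfl, if_pos rfl, opp_opp, if_neg h3, zero_sub, sub_zero, he] at hb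
    have h0 : mode i (opp i) 0 ∈ addC A B h := h1 .plus 0 hp
    have h4 := Subalgebra.neg_mem _ (Subalgebra.sub_mem _ (Subalgebra.mul_mem _ h0 (h2 μ p hμ))
      (Subalgebra.mul_mem _ (h2 μ p hμ) h0))
    rw [hb, show -(-mode i l (loopDeg μ p) + (-1 : ℤ) • mode i l (loopDeg μ p)) =
      2 * mode i l (loopDeg μ p) by rw [neg_one_smul, two_mul]; abel] at h4
    have h5 := Subalgebra.smul_mem _ h4 (PowerSeries.C (1 / 2 : ℂ))
    rwa [half_smul'] at h5
  self hth i μ p hμ := by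
    obtain ⟨b, hb, hb'⟩ := hsym i (opp i) μ p hμ
    have he : eps i * eps (opp i) = 1 := by
      rw [eps_opp, hth, mul_left_comm, eps_mul_self, mul_one]
    rw [opp_opp, he, one_smul, ← two_mul] at hb'
    refine ⟨0, A.zero_mem, (PowerSeries.C (1 / 2) : ℂ⟦X⟧) • b, B.smul_mem hb _, ?_⟩
    rw [← half_smul' (mode i (opp i) (loopDeg μ p)), hb', zero_add, smul_comm]

end Generation

end YangianDouble

end
noncomputable section

namespace YangianDouble

open PowerSeries Finset.HasAntidiagonal

/-! ### Independent generating sets -/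

section Criterion

variable {g : Series} {n : ℕ}

/-- The modes of sign `μ` and the coefficients of the Gauss coordinates of sign `μ` can be taken in
the subalgebra `B`. -/
def Allowed (B : Subalgebra ℂ⟦X⟧ (DY g n)) (μ : Sgn) : Prop :=
  (μ = .plus ∧ ∀ i j l, 0 ≤ l → mode i j l ∈ B) ∨ B = ⊤

theorem Allowed.exists_near {B : Subalgebra ℂ⟦X⟧ (DY g n)} {μ : Sgn} (h : Allowed B μ) :
    ∃ Q : Submodule ℂ⟦X⟧ (DY g n)⟦X⟧, IsNear Q ∧
      (∀ i j, tSeries (g := g) (n := n) μ i j ∈ Q) ∧ ∀ z ∈ Q, ∀ p, coeff p z ∈ B := by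
  rcases h with ⟨rfl, h⟩ | rfl
  · refine ⟨seriesIn B, isNear_seriesIn B, fun i j => ⟨by simp [tSeries, ser], fun p => ?_⟩,
      fun z hz => hz.2⟩
    rw [tSeries, ser, coeff_mk]
    split_ifs with hp
    · exact B.zero_mem
    · exact h _ _ _ (by omega)
  · exact ⟨⊤, isNear_top, fun _ _ => trivial, fun _ _ _ => trivial⟩

/-- That a shift is trivial modulo `c` is not enough: the cofactor has to lie in `B`, which may fail
to be closed. For the sign `plus` the finite binomial formula provides this. -/
theorem Allowed.sigma_coeff {B : Subalgebra ℂ⟦X⟧ (DY g n)} {μ : Sgn} (h : Allowed B μ) (a : ℂ)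
    (i j : Ix g n) (p : ℕ) : ∃ b ∈ B, coeff p (sigma (dU μ) a (tSeries μ i j)) =
      coeff p (tSeries μ i j) + c • b := by
  obtain ⟨Q, -, hQ, hQB⟩ := h.exists_near
  rcases h with ⟨rfl, h⟩ | rfl
  · rw [← shift_eq_sigma, shift, coeff_mk, Finset.sum_range_succ]
    have hs : ∀ q ∈ Finset.range p, ∃ b ∈ B, (((p - 1).choose (p - q) : ℂ⟦X⟧) *
        (PowerSeries.C a * c) ^ (p - q)) • coeff q (tSeries .plus i j) = c • b := by
      intro q hq
      rw [Finset.mem_range] at hq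
      obtain ⟨m, hm⟩ : ∃ m, p - q = m + 1 := ⟨p - q - 1, by omega⟩
      refine ⟨(((p - 1).choose (p - q) : ℂ⟦X⟧) * (PowerSeries.C a * c) ^ m * PowerSeries.C a) •
        coeff q (tSeries .plus i j), B.smul_mem (hQB _ (hQ i j) q) _, ?_⟩
      rw [smul_smul, hm]
      congr 1
      ring
    have hs' : ∃ b ∈ B, ∑ q ∈ Finset.range p, (((p - 1).choose (p - q) : ℂ⟦X⟧) *
        (PowerSeries.C a * c) ^ (p - q)) • coeff q (tSeries .plus i j) = c • b := by
      choose! b hb hb' using hs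
      exact ⟨∑ q ∈ Finset.range p, b q, B.sum_mem hb, by
        rw [Finset.smul_sum]; exact Finset.sum_congr rfl hb'⟩
    obtain ⟨b, hb, hb'⟩ := hs'
    refine ⟨b, hb, ?_⟩
    rw [hb', Nat.sub_self, pow_zero, Nat.choose_zero_right, Nat.cast_one, one_mul, one_smul,
      add_comm]
  · obtain ⟨z, hz⟩ := mem_cPow.1 (sigma_sub_mem (dU μ) a (tSeries μ i j))
    refine ⟨coeff p z, trivial, ?_⟩
    rw [← PowerSeries.coeff_smul, ← map_add, sub_eq_iff_eq_add'.1 hz, pow_one]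

/-- The first order of unitarity: from (1+cZ)(1+cY) = 1 follows Z + Y = -cZY, and Z is the transpose
of Y up to a shift. -/
theorem Allowed.symm_mode {B : Subalgebra ℂ⟦X⟧ (DY g n)} {μ : Sgn} (h : Allowed B μ) (i j : Ix g n)
    (p : ℕ) : ∃ b ∈ B, mode i j (loopDeg μ p) +
      (eps i * eps j) • mode (opp j) (opp i) (loopDeg μ p) = c • b := by
  obtain ⟨Q, -, hQ, hQB⟩ := h.exists_near
  have h1 := congrFun (congrFun (unitary_mode (g := g) (n := n) μ).1 i) j
  have hT : T g n μ = 1 + c • tSeries μ := by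
    ext1 i j
    rw [T_eq_tSeries, Matrix.add_apply, Matrix.one_apply, Matrix.smul_apply]
  set Y := tSeries (g := g) (n := n) μ with hY
  have hS : transp ((T g n μ).map (sigma (dU μ) (kappa g n))) =
      1 + c • transp (Y.map (sigma (dU μ) (kappa g n))) := by
    rw [hT]
    ext1 i j
    have h0 : ∀ i j, sigma (dU μ) (kappa g n) ((1 : Matrix (Ix g n) (Ix g n) (DY g n)⟦X⟧) i j) =
        (1 : Matrix (Ix g n) (Ix g n) (DY g n)⟦X⟧) i j := by
      intro i j
      rw [Matrix.one_apply]
      split_ifs <;> simp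
    have h1 := congrFun (congrFun (transp_one (g := g) (n := n) (W := (DY g n)⟦X⟧)) i) j
    simp only [transp, Matrix.map_apply, Matrix.add_apply, Matrix.smul_apply, map_add, sigma_smul,
      h0, smul_add]
    rw [← h1]
    simp only [transp]
    rw [smul_comm c]
  rw [hS, hT] at h1
  set Z := transp (Y.map (sigma (dU μ) (kappa g n))) with hZ
  have h2 : (Z + Y + c • (Z * Y)) i j = 0 := by
    apply CComplete.torsion_free
    have : (1 + c • Z) * (1 + c • Y) = 1 + c • (Z + Y + c • (Z * Y)) := by
      simp only [mul_add, add_mul, mul_one, one_mul, smul_add, smul_mul_assoc, mul_smul_comm]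
      abel
    rw [this, Matrix.add_apply, Matrix.smul_apply, add_eq_left] at h1
    exact h1
  have hσ := fun i j => h.sigma_coeff (kappa g n) (i : Ix g n) j (modeExp μ p)
  have hσB : ∀ i j q, coeff q (Z i j) ∈ B := by
    intro i j q
    obtain ⟨b, hb, hb'⟩ := h.sigma_coeff (kappa g n) (opp j) (opp i) q
    rw [hZ, transp, map_zsmul, Matrix.map_apply, hb']
    exact Subalgebra.zsmul_mem _ (B.add_mem (hQB _ (hQ _ _) _) (B.smul_mem hb _)) _
  have h3 := congrArg (coeff (modeExp μ p)) h2
  obtain ⟨b, hb, hb'⟩ := hσ (opp j) (opp i)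
  rw [Matrix.add_apply, Matrix.add_apply, Matrix.smul_apply, map_add, map_add,
    PowerSeries.coeff_smul, map_zero, hZ, transp, map_zsmul, Matrix.map_apply, hb',
    coeff_modeExp_tSeries, hY, coeff_modeExp_tSeries, ← hY, ← hZ] at h3
  refine ⟨-((eps i * eps j) • b + coeff (modeExp μ p) ((Z * Y) i j)), B.neg_mem (B.add_mem
    (Subalgebra.zsmul_mem _ hb _) ?_), ?_⟩
  · rw [Matrix.mul_apply, map_sum]
    refine B.sum_mem fun k _ => ?_
    rw [coeff_mul]
    exact B.sum_mem fun q _ => B.mul_mem (hσB _ _ _) (hQB _ (hQ _ _) _)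
  · rw [smul_add, smul_comm _ c] at h3
    rw [smul_neg, smul_add, eq_neg_iff_add_eq_zero, ← h3]
    abel

/-- Modulo `c`, the modes of the series `x a` are the modes `t_{ij}[ℓ]`, where `(i, j) = idx a`. -/
def NearModes {J : Type} (x : Sgn → J → (DY g n)⟦X⟧) (idx : J → Ix g n × Ix g n) : Prop :=
  ∀ B μ, Allowed B μ → ∀ a p, ∃ z ∈ B,
    seriesMode μ (x μ a) p = mode (idx a).1 (idx a).2 (loopDeg μ p) + c • z

theorem NearModes.generates {J : Type} {x : Sgn → J → (DY g n)⟦X⟧} {idx : J → Ix g n × Ix g n}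
    (hx : NearModes x idx)
    (hV : ∀ V : Ix g n → Ix g n → Prop, BracketClosed V → (∀ a, V (idx a).1 (idx a).2) →
      ∀ i j, V i j) {A B : Subalgebra ℂ⟦X⟧ (DY g n)} (h : A ≤ B) (M : Sgn → Prop) (hp : M .plus)
    (hM : ∀ μ, M μ → Allowed B μ) (hA : ∀ μ a p, M μ → seriesMode μ (x μ a) p ∈ A) :
    ∀ i j μ p, M μ → mode i j (loopDeg μ p) ∈ addC A B h := by
  refine fun i j => hV _ (bracketClosed_of_mem h M hp fun i j μ p hμ => (hM μ hμ).symm_mode i j p)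
    (fun a μ p hμ => ?_) i j
  obtain ⟨z, hz, hz'⟩ := hx B μ (hM μ hμ) a p
  refine ⟨_, hA μ a p hμ, -z, B.neg_mem hz, ?_⟩
  rw [hz', smul_neg, add_neg_cancel_right]

theorem exists_loopDeg (l : ℤ) : ∃ μ p, loopDeg μ p = l ∧ (0 ≤ l → μ = .plus) := by
  by_cases h : 0 ≤ l
  · exact ⟨.plus, l.toNat, by rw [loopDeg]; omega, fun _ => rfl⟩
  · exact ⟨.minus, (-l - 1).toNat, by rw [loopDeg]; omega, fun h' => absurd h' h⟩

/-- Reduces the claim to finite combinatorics of index pairs. Generation is applied twice, with `B`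
the whole algebra for both signs, and with `B` the uncompleted algebra of positive modes for the
sign `plus`. -/
theorem NearModes.isIndependentGeneratingSet {J : Type} {x : Sgn → J → (DY g n)⟦X⟧}
    {idx : J → Ix g n × Ix g n} (hx : NearModes x idx)
    (h0 : ∀ a, constantCoeff
      (skewEntry (idx a).1 (idx a).2 (skewUnit (idx a).1 (idx a).2)) ≠ 0)
    (h1 : ∀ a b, a ≠ b → constantCoeff
      (skewEntry (idx a).1 (idx a).2 (skewUnit (idx b).1 (idx b).2)) = 0)
    (hV : ∀ V : Ix g n → Ix g n → Prop, BracketClosed V → (∀ a, V (idx a).1 (idx a).2) →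
      ∀ i j, V i j) : IsIndependentGeneratingSet x where
  generates := by
    refine Set.eq_univ_of_forall fun y => subset_closedAdjoin (B := ⊤) le_top ?_ fun N =>
      ⟨y, trivial, 0, by simp⟩
    have hm := hx.generates hV (A := Algebra.adjoin ℂ⟦X⟧ {y | ∃ μ a p, y = seriesMode μ (x μ a) p})
      le_top (fun _ => True) trivial (fun _ _ => Or.inr rfl)
      (fun μ a p _ => Algebra.subset_adjoin ⟨μ, a, p, rfl⟩)
    intro w _
    obtain ⟨v, hv, z, rfl⟩ := exists_mem_adjoin_mode g n w
    refine Subalgebra.add_mem _ (Algebra.adjoin_le ?_ hv) ⟨0, Subalgebra.zero_mem _, z, trivial, by simp⟩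
    rintro _ ⟨i, j, l, rfl⟩
    obtain ⟨μ, p, rfl, -⟩ := exists_loopDeg l
    exact hm i j μ p trivial
  generates_borel := by
    set S : Set (DY g n) := {x | ∃ i j : Ix g n, ∃ l : ℤ, 0 ≤ l ∧ x = mode i j l} with hS
    set B := Algebra.adjoin ℂ⟦X⟧ S
    have hB : Allowed B .plus := Or.inl ⟨rfl, fun i j l hl => Algebra.subset_adjoin ⟨i, j, l, hl, rfl⟩⟩
    have hsub : {y | ∃ a p, y = seriesMode .plus (x .plus a) p} ⊆ (B : Set (DY g n)) := by
      rintro _ ⟨a, p, rfl⟩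
      obtain ⟨z, hz, hz'⟩ := hx B .plus hB a p
      rw [hz']
      exact B.add_mem (Algebra.subset_adjoin ⟨_, _, _, by simp [loopDeg], rfl⟩) (B.smul_mem hz _)
    refine Set.Subset.antisymm (closedAdjoin_mono hsub) fun y hy => ?_
    have hAB : Algebra.adjoin ℂ⟦X⟧ {y | ∃ a p, y = seriesMode .plus (x .plus a) p} ≤ B :=
      Algebra.adjoin_le hsub
    have hm := hx.generates hV hAB (fun μ => μ = .plus) rfl (by rintro _ rfl; exact hB)
      (by rintro _ a p rfl; exact Algebra.subset_adjoin ⟨a, p, rfl⟩)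
    refine subset_closedAdjoin hAB (Algebra.adjoin_le ?_) hy
    rintro _ ⟨i, j, l, hl, rfl⟩
    obtain ⟨μ, p, rfl, hμ⟩ := exists_loopDeg l
    exact hm i j μ p (hμ hl)
  independent r hr :=
    linearIndependent_monomials (y := fun s => seriesMode s.1 (x s.1 s.2.1) s.2.2) idx (fun m => by
      obtain ⟨z, -, hz⟩ := hx ⊤ m.1 (Or.inr rfl) m.2.1 m.2.2
      exact ⟨z, hz⟩) h0 h1 r hr

end Criterion

end YangianDouble

end
noncomputable section

namespace YangianDouble

open PowerSeries Finset.HasAntidiagonal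

/-! ### The simple root series -/

section Families

variable {g : Series} {n : ℕ}

/-- Up to sign the elements attached to (i,j) and (j',i') coincide, and distinct elements are
orthogonal; hence exactly two pairs contribute. -/
theorem skewEntry_skewUnit (i j k l : Ix g n) :
    constantCoeff (skewEntry i j (skewUnit k l)) =
      2 * (if k = i ∧ l = j then 1 else 0) -
        2 * (eps i * eps j) * (if k = opp j ∧ l = opp i then 1 else 0) := by
  have e1 : (opp k = j ∧ opp l = i) ↔ (k = opp j ∧ l = opp i) := by
    constructor <;> rintro ⟨rfl, rfl⟩ <;> simp only [opp_opp, and_self]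
  have e2 : (l = opp i ∧ k = opp j) ↔ (k = opp j ∧ l = opp i) := and_comm
  have e3 : eps (opp j) * eps (opp i) = eps i * eps j := by
    rw [eps_opp, eps_opp, mul_mul_mul_comm, th_sq, one_mul, mul_comm]
  have e4 : (l = j ∧ k = i) ↔ (k = i ∧ l = j) := and_comm
  have e5 : eps i * eps j * (eps i * eps j) = 1 := by
    rw [mul_mul_mul_comm, eps_mul_self, eps_mul_self, one_mul]
  have e6 : ((eps i : ℂ) * eps j) * (eps i * eps j) = 1 := by exact_mod_cast congrArg (Int.cast) e5
  simp only [skewEntry_apply, skewUnit, Matrix.sub_apply, Matrix.smul_apply, Matrix.single_apply,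
    e1, e2, e4, opp_inj]
  simp only [zsmul_eq_mul, map_sub, map_mul, map_intCast, apply_ite constantCoeff,
    map_one, map_zero]
  have e7 : ((eps k * eps l : ℤ) : ℂ) * (if k = opp j ∧ l = opp i then 1 else 0) =
      ((eps i * eps j : ℤ) : ℂ) * (if k = opp j ∧ l = opp i then 1 else 0) := by
    split_ifs with h
    · rw [h.1, h.2, e3]
    · rw [mul_zero, mul_zero]
  have e8 : ((eps k * eps l : ℤ) : ℂ) * (if k = i ∧ l = j then 1 else 0) =
      ((eps i * eps j : ℤ) : ℂ) * (if k = i ∧ l = j then 1 else 0) := by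
    split_ifs with h
    · rw [h.1, h.2]
    · rw [mul_zero, mul_zero]
  push_cast at e7 e8 ⊢
  linear_combination -e7 + eps i * eps j * e8 + (if k = i ∧ l = j then 1 else 0) * e6

/-- The predicate on pairs of integers which a predicate on pairs of indices defines. -/
def onInt (V : Ix g n → Ix g n → Prop) (i j : ℤ) : Prop :=
  ∀ a b : Ix g n, (a : ℤ) = i → (b : ℤ) = j → V a b

theorem onInt_mk {V : Ix g n → Ix g n → Prop} {a b : Ix g n} (h : V a b) : onInt V a b := by
  intro a' b' ha hb
  rwa [Subtype.ext ha, Subtype.ext hb]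

theorem onInt_self {V : Ix g n → Ix g n → Prop} (hV : BracketClosed V) (hg : th g = 1) (i : ℤ) :
    onInt V i ((sym g).s - i) := by
  intro a b ha hb
  rw [show b = opp a from Subtype.ext (by rw [opp_eq, ha, hb])]
  exact hV.self hg a

theorem onInt.symm_opp {V : Ix g n → Ix g n → Prop} (hV : BracketClosed V) {i j : ℤ}
    (h : onInt V i j) : onInt V ((sym g).s - j) ((sym g).s - i) := by
  intro a b ha hb
  have := hV.symm_opp (opp b) (opp a) (h _ _ (by rw [opp_eq, hb]; ring) (by rw [opp_eq, ha]; ring))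
  rwa [opp_opp, opp_opp] at this

theorem onInt.mul {V : Ix g n → Ix g n → Prop} (hV : BracketClosed V) {i j l : ℤ}
    (h : onInt V i j) (h' : onInt V j l) (hj : j ∈ Finset.Icc ((sym g).s - n) (n : ℤ)) (h1 : i ≠ l)
    (h2 : i + j ≠ (sym g).s) (h3 : j + l ≠ (sym g).s) : onInt V i l := by
  intro a b ha hb
  rw [lo_eq] at hj
  refine hV.mul a ⟨j, hj⟩ b (h _ _ ha rfl) (h' _ _ rfl hb) (fun h => h1 ?_) (fun h => h2 ?_)
    (fun h => h3 ?_)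
  · rw [← ha, ← hb, h]
  · have := congrArg Subtype.val h
    rw [opp_eq] at this
    simp only at this
    omega
  · have := congrArg Subtype.val h
    rw [opp_eq] at this
    simp only at this
    omega

theorem onInt.mul_opp {V : Ix g n → Ix g n → Prop} (hV : BracketClosed V) (hg : th g = -1) {i l : ℤ}
    (h : onInt V i ((sym g).s - i)) (h' : onInt V ((sym g).s - i) l) (h1 : l ≠ i) :
    onInt V i l := by
  intro a b ha hb
  refine hV.mul_opp hg a b (h _ _ ha (by rw [opp_eq, ha])) (h' _ _ (by rw [opp_eq, ha]) hb)
    (fun h => h1 ?_)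
  rw [← ha, ← hb, h]

/-- The subalgebra 𝔤𝔩_n on the positive indices, by induction on the distance |i - j|. The sum of
two positive indices is at least 2, so they are never opposite. -/
theorem onInt_pos {V : Ix g n → Ix g n → Prop} (hV : BracketClosed V)
    (h1 : ∀ i : ℤ, 1 ≤ i → i + 1 ≤ n → onInt V i (i + 1) ∧ onInt V (i + 1) i)
    (h2 : ∀ i : ℤ, 1 ≤ i → i ≤ n → onInt V i i) (i j : ℤ) (hi : 1 ≤ i) (hi' : i ≤ n) (hj : 1 ≤ j)
    (hj' : j ≤ n) : onInt V i j := by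
  have hs := s_mem g
  have key : ∀ (d : ℕ) (i : ℤ), 1 ≤ i → i + d ≤ n → onInt V i (i + d) ∧ onInt V (i + d) i := by
    intro d
    induction d with
    | zero => exact fun i h h' => by simpa using h2 i h (by simpa using h')
    | succ d ih =>
      intro i hi hd
      push_cast at hd ⊢
      obtain ⟨k1, k2⟩ := ih i hi (by omega)
      obtain ⟨k3, k4⟩ := h1 (i + d) (by omega) (by omega)
      rw [← add_assoc]
      have hm : i + d ∈ Finset.Icc ((sym g).s - n) (n : ℤ) := by rw [Finset.mem_Icc]; omega
      exact ⟨k1.mul hV k3 hm (by omega) (by omega) (by omega),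
        k4.mul hV k2 hm (by omega) (by omega) (by omega)⟩
  rcases le_total i j with h | h
  · have := (key (j - i).toNat i hi (by omega)).1
    rwa [show i + ((j - i).toNat : ℤ) = j by omega] at this
  · have := (key (i - j).toNat j hj (by omega)).2
    rwa [show j + ((i - j).toNat : ℤ) = i by omega] at this

/-- Every pair of distinct nonzero indices is reached through the self-opposite index 0; the row and
column of 0 come from the short root and 𝔤𝔩_n. -/
theorem bracketClosed_B {V : Ix .B n → Ix .B n → Prop} (hV : BracketClosed V)
    (h1 : ∀ i : ℤ, 0 ≤ i → i + 1 ≤ n → onInt V i (i + 1) ∧ onInt V (i + 1) i)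
    (h2 : ∀ i : ℤ, 1 ≤ i → i ≤ n → onInt V i i) (i j : Ix .B n) : V i j := by
  have hp := onInt_pos hV (fun i h => h1 i (by omega)) h2
  have hs : (sym .B).s = 0 := rfl
  have h0 : ∀ j : ℤ, 1 ≤ j → j ≤ n → onInt V 0 j ∧ onInt V j 0 := by
    intro j hj hj'
    obtain ⟨k1, k2⟩ := h1 0 le_rfl (by omega)
    have hm : (0 + 1 : ℤ) ∈ Finset.Icc ((sym .B).s - n) (n : ℤ) := by rw [Finset.mem_Icc, hs]; omega
    exact ⟨k1.mul hV (hp _ _ (by omega) (by omega) hj hj') hm (by omega) (by rw [hs]; omega)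
        (by rw [hs]; omega),
      (hp j (0 + 1) hj hj' (by omega) (by omega)).mul hV k2 hm (by omega) (by rw [hs]; omega)
        (by rw [hs]; omega)⟩
  have hneg : ∀ {i j : ℤ}, onInt V i j → onInt V (-j) (-i) := by
    intro i j h
    have := h.symm_opp hV
    rwa [hs, zero_sub, zero_sub] at this
  have h00 : ∀ i : ℤ, onInt V i (-i) := by
    intro i
    have := onInt_self hV rfl i
    rwa [hs, zero_sub] at this
  have hall : ∀ i j : ℤ, -n ≤ i → i ≤ n → -n ≤ j → j ≤ n → onInt V i j := by
    have hz : ∀ j : ℤ, -n ≤ j → j ≤ n → onInt V 0 j ∧ onInt V j 0 := by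
      intro j hj hj'
      rcases lt_trichotomy j 0 with h | rfl | h
      · obtain ⟨k1, k2⟩ := h0 (-j) (by omega) (by omega)
        have k1 := hneg k1
        have k2 := hneg k2
        rw [neg_neg, neg_zero] at k1 k2
        exact ⟨k2, k1⟩
      · simpa using h00 0
      · exact h0 j (by omega) hj'
    intro i j hi hi' hj hj'
    by_cases hij : i = j
    · subst hij
      rcases lt_trichotomy i 0 with h | rfl | h
      · have := hneg (h2 (-i) (by omega) (by omega))
        rwa [neg_neg] at this
      · exact (hz 0 hi hi').1
      · exact h2 i (by omega) hi'
    · by_cases hi0 : i = 0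
      · rw [hi0]
        exact (hz j hj hj').1
      · by_cases hj0 : j = 0
        · rw [hj0]
          exact (hz i hi hi').2
        · exact (hz i hi hi').2.mul hV (hz j hj hj').1 (by rw [Finset.mem_Icc, hs]; omega) hij
            (by rw [hs]; omega) (by rw [hs]; omega)
  have hi := Finset.mem_Icc.1 i.2
  have hj := Finset.mem_Icc.1 j.2
  exact hall i j hi.1 hi.2 hj.1 hj.2 i j rfl rfl

/-- Types C and D: the opposite of 0 is 1, so the symmetry carries the row and column of 0 to those
of 1, and mixed pairs are reached through 1. -/
theorem bracketClosed_of_zero {V : Ix g n → Ix g n → Prop} (hV : BracketClosed V)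
    (hs : (sym g).s = 1)
    (hp : ∀ i j : ℤ, 1 ≤ i → i ≤ n → 1 ≤ j → j ≤ n → onInt V i j)
    (h0 : ∀ i : ℤ, 1 ≤ i → i ≤ n → onInt V 0 i ∧ onInt V i 0) (i j : Ix g n) : V i j := by
  have hneg : ∀ {i j : ℤ}, onInt V i j → onInt V (1 - j) (1 - i) := by
    intro i j h
    have := h.symm_opp hV
    rwa [hs] at this
  have h1 : ∀ i : ℤ, 1 ≤ i → i ≤ n → onInt V (1 - i) 1 ∧ onInt V 1 (1 - i) := by
    intro i hi hi'
    obtain ⟨k1, k2⟩ := h0 i hi hi'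
    simpa using And.intro (hneg k1) (hneg k2)
  have hmix : ∀ i j : ℤ, 1 ≤ i → i ≤ n → 1 ≤ j → j ≤ n →
      onInt V (1 - i) j ∧ onInt V j (1 - i) := by
    intro i j hi hi' hj hj'
    by_cases hi1 : i = 1
    · simpa [hi1] using h0 j hj hj'
    by_cases hj1 : j = 1
    · rw [hj1]
      exact h1 i hi hi'
    have hm : (1 : ℤ) ∈ Finset.Icc ((sym g).s - n) (n : ℤ) := by rw [Finset.mem_Icc, hs]; omega
    exact ⟨(h1 i hi hi').1.mul hV (hp 1 j le_rfl (by omega) hj hj') hm (by omega)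
        (by rw [hs]; omega) (by rw [hs]; omega),
      (hp j 1 hj hj' le_rfl (by omega)).mul hV (h1 i hi hi').2 hm (by omega)
        (by rw [hs]; omega) (by rw [hs]; omega)⟩
  have hi := Finset.mem_Icc.1 i.2
  have hj := Finset.mem_Icc.1 j.2
  have hlo := lo_eq g n
  rw [hs] at hlo
  suffices h : onInt V i j from h i j rfl rfl
  by_cases hi0 : 1 ≤ (i : ℤ) <;> by_cases hj0 : 1 ≤ (j : ℤ)
  · exact hp i j hi0 hi.2 hj0 hj.2
  · have := (hmix (1 - j) i (by omega) (by omega) hi0 hi.2).2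
    rwa [sub_sub_cancel] at this
  · have := (hmix (1 - i) j (by omega) (by omega) hj0 hj.2).1
    rwa [sub_sub_cancel] at this
  · have := hneg (hp (1 - j) (1 - i) (by omega) (by omega) (by omega) (by omega))
    rwa [sub_sub_cancel, sub_sub_cancel] at this

/-- The long root vector has the opposite indices 0 and 1, so products through it use the rule
`mul_opp`. -/
theorem bracketClosed_C {V : Ix .C n → Ix .C n → Prop} (hV : BracketClosed V)
    (h1 : ∀ i : ℤ, 0 ≤ i → i + 1 ≤ n → onInt V i (i + 1) ∧ onInt V (i + 1) i)
    (h2 : ∀ i : ℤ, 1 ≤ i → i ≤ n → onInt V i i) (i j : Ix .C n) : V i j := by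
  have hp := onInt_pos hV (fun i h => h1 i (by omega)) h2
  have hs : (sym .C).s = 1 := rfl
  refine bracketClosed_of_zero hV hs hp (fun j hj hj' => ?_) i j
  obtain ⟨k1, k2⟩ := h1 0 le_rfl (by omega)
  rw [zero_add] at k1 k2
  have e1 : ∀ j : ℤ, 1 ≤ j → j ≤ n → onInt V 0 j := by
    intro j hj hj'
    exact onInt.mul_opp hV rfl (by simpa [hs] using k1)
      (by simpa [hs] using hp 1 j le_rfl (by omega) hj hj') (by omega)
  have e2 : onInt V 1 (1 - j) := by
    refine onInt.mul_opp hV rfl (by simpa [hs] using k2) ?_ (by omega)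
    have := (hp j 1 hj hj' le_rfl (by omega)).symm_opp hV
    simpa [hs] using this
  have := e2.symm_opp hV
  rw [hs, sub_sub_cancel, sub_self] at this
  exact ⟨e1 j hj hj', this⟩

/-- The indices 0 and 1 are opposite and give no root vector; the row and column of 0 are reached
through 2. -/
theorem bracketClosed_D (hn : 2 ≤ n) {V : Ix .D n → Ix .D n → Prop} (hV : BracketClosed V)
    (h0 : onInt V 0 2 ∧ onInt V 2 0)
    (h1 : ∀ i : ℤ, 1 ≤ i → i + 1 ≤ n → onInt V i (i + 1) ∧ onInt V (i + 1) i)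
    (h2 : ∀ i : ℤ, 1 ≤ i → i ≤ n → onInt V i i) (i j : Ix .D n) : V i j := by
  have hp := onInt_pos hV h1 h2
  have hs : (sym .D).s = 1 := rfl
  refine bracketClosed_of_zero hV hs hp (fun j hj hj' => ?_) i j
  have hm : (2 : ℤ) ∈ Finset.Icc ((sym .D).s - n) (n : ℤ) := by rw [Finset.mem_Icc, hs]; omega
  exact ⟨h0.1.mul hV (hp 2 j (by omega) (by omega) hj hj') hm (by omega) (by rw [hs]; omega)
      (by rw [hs]; omega),
    (hp j 2 hj hj' (by omega) (by omega)).mul hV h0.2 hm (by omega) (by rw [hs]; omega)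
      (by rw [hs]; omega)⟩

end Families

end YangianDouble

end
noncomputable section

namespace YangianDouble

open PowerSeries Finset.HasAntidiagonal

/-! ### The families of simple series -/

section Simple

variable {g : Series} {n : ℕ}

/-- The pairs of indices with given values. -/
def mkIdx {J : Type} (v : J → ℤ × ℤ)
    (hv : ∀ a, (v a).1 ∈ Finset.Icc (lo g n) (n : ℤ) ∧ (v a).2 ∈ Finset.Icc (lo g n) (n : ℤ)) (a : J) :
    Ix g n × Ix g n := (⟨(v a).1, (hv a).1⟩, ⟨(v a).2, (hv a).2⟩)

theorem IsGauss.F_mode {μ : Sgn} {G : Gauss g n} (h : IsGauss (T g n μ) G)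
    {B : Subalgebra ℂ⟦X⟧ (DY g n)} (hB : Allowed B μ) {i l : ℤ}
    (hi : i ∈ Finset.Icc (lo g n) (n : ℤ)) (hl : l ∈ Finset.Icc (lo g n) (n : ℤ)) (hil : i < l)
    (p : ℕ) : ∃ z ∈ B, seriesMode μ (G.F l i) p = mode ⟨i, hi⟩ ⟨l, hl⟩ (loopDeg μ p) + c • z := by
  obtain ⟨Q, hQ, hT, hQB⟩ := hB.exists_near
  obtain ⟨z, hz, hz'⟩ := (h.near hQ hT).F_near i l (Finset.mem_Icc.1 hi).1 hil (Finset.mem_Icc.1 hl).2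
  refine ⟨coeff (modeExp μ p) z, hQB z hz _, ?_⟩
  rw [show G.F l i = _ from hz', seriesMode_smul, extend_mk _ hi hl, map_add,
    coeff_modeExp_tSeries, PowerSeries.coeff_smul]

theorem IsGauss.E_mode {μ : Sgn} {G : Gauss g n} (h : IsGauss (T g n μ) G)
    {B : Subalgebra ℂ⟦X⟧ (DY g n)} (hB : Allowed B μ) {i l : ℤ}
    (hi : i ∈ Finset.Icc (lo g n) (n : ℤ)) (hl : l ∈ Finset.Icc (lo g n) (n : ℤ)) (hil : i < l)
    (p : ℕ) : ∃ z ∈ B, seriesMode μ (G.E i l) p = mode ⟨l, hl⟩ ⟨i, hi⟩ (loopDeg μ p) + c • z := by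
  obtain ⟨Q, hQ, hT, hQB⟩ := hB.exists_near
  obtain ⟨z, hz, hz'⟩ := (h.near hQ hT).E_near i l (Finset.mem_Icc.1 hi).1 hil (Finset.mem_Icc.1 hl).2
  refine ⟨coeff (modeExp μ p) z, hQB z hz _, ?_⟩
  rw [show G.E i l = _ from hz', seriesMode_smul, extend_mk _ hl hi, map_add,
    coeff_modeExp_tSeries, PowerSeries.coeff_smul]

theorem IsGauss.k_mode {μ : Sgn} {G : Gauss g n} (h : IsGauss (T g n μ) G)
    {B : Subalgebra ℂ⟦X⟧ (DY g n)} (hB : Allowed B μ) {i l : ℤ}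
    (hi : i ∈ Finset.Icc (lo g n) (n : ℤ)) (hl : l ∈ Finset.Icc (lo g n) (n : ℤ)) (hil : i = l)
    (p : ℕ) : ∃ z ∈ B, seriesMode μ (G.k i - 1) p = mode ⟨i, hi⟩ ⟨l, hl⟩ (loopDeg μ p) + c • z := by
  subst hil
  obtain ⟨Q, hQ, hT, hQB⟩ := hB.exists_near
  obtain ⟨z, hz, hz'⟩ := (h.near hQ hT).k_near i hi
  refine ⟨coeff (modeExp μ p) z, hQB z hz _, ?_⟩
  rw [show G.k i = _ from hz', add_sub_cancel_left, seriesMode_smul, extend_mk _ hi hi, map_add,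
    coeff_modeExp_tSeries, PowerSeries.coeff_smul]

/-- `hopp` excludes listing a pair together with its mirror image, which would be dependent modulo
`c`. A pair equal to its own mirror image is nonzero in 𝔤 only in the symplectic case, where the
pairing is 2 + 2 instead of 2 - 2. -/
theorem NearModes.isIndependent_of_values {J : Type} {x : Sgn → J → (DY g n)⟦X⟧} (v : J → ℤ × ℤ)
    (hv : ∀ a, (v a).1 ∈ Finset.Icc (lo g n) (n : ℤ) ∧ (v a).2 ∈ Finset.Icc (lo g n) (n : ℤ))
    (hx : NearModes x (mkIdx v hv)) (hinj : Function.Injective v)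
    (hopp : ∀ a b, v b = ((sym g).s - (v a).2, (sym g).s - (v a).1) → a = b)
    (hself : ∀ a, (v a).1 + (v a).2 = (sym g).s → th g = -1)
    (hV : ∀ V : Ix g n → Ix g n → Prop, BracketClosed V → (∀ a, onInt V (v a).1 (v a).2) →
      ∀ i j, V i j) : IsIndependentGeneratingSet x := by
  refine hx.isIndependentGeneratingSet (fun a => ?_) (fun a b hab => ?_)
    fun V h h' => hV V h fun a => onInt_mk (h' a)
  · rw [skewEntry_skewUnit, if_pos ⟨rfl, rfl⟩]
    split_ifs with h
    · have h1 := congrArg Subtype.val h.1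
      rw [opp_eq] at h1
      have hth := hself a (by
        change (v a).1 = _ - (v a).2 at h1
        omega)
      have he : eps (mkIdx v hv a).1 * eps (mkIdx v hv a).2 = -1 := by
        rw [h.1, eps_opp, hth, mul_assoc, eps_mul_self, mul_one]
      have he' : (eps (mkIdx v hv a).1 : ℂ) * eps (mkIdx v hv a).2 = -1 := by exact_mod_cast he
      rw [he']
      norm_num
    · norm_num
  · rw [skewEntry_skewUnit, if_neg, if_neg, mul_zero, mul_zero, sub_zero]
    · rintro ⟨h1, h2⟩
      have h1 := congrArg Subtype.val h1
      have h2 := congrArg Subtype.val h2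
      rw [opp_eq] at h1 h2
      exact hab (hopp a b (Prod.ext h1 h2))
    · rintro ⟨h1, h2⟩
      exact hab (hinj (Prod.ext (congrArg Subtype.val h1) (congrArg Subtype.val h2))).symm

variable (n) in
/-- The values of the indices of the simple series. -/
def simpleVal : Fin n ⊕ Fin n ⊕ Fin n → ℤ × ℤ
  | .inl i => (i, i + 1)
  | .inr (.inl i) => (i + 1, i)
  | .inr (.inr j) => (j + 1, j + 1)

variable (n) in
/-- The values of the indices of the simple series on the negative side. -/
def simpleValNeg : Fin n ⊕ Fin n ⊕ Fin n → ℤ × ℤ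
  | .inl m => (-m - 1, -m)
  | .inr (.inl m) => (-m, -m - 1)
  | .inr (.inr m) => (-m - 1, -m - 1)

variable (n) in
/-- The values of the indices of the simple series in type `D`. -/
def simpleValD : Fin n ⊕ Fin n ⊕ Fin n → ℤ × ℤ
  | .inl i => if (i : ℕ) = 0 then (0, 2) else (i, i + 1)
  | .inr (.inl i) => if (i : ℕ) = 0 then (2, 0) else (i + 1, i)
  | .inr (.inr j) => (j + 1, j + 1)

theorem mem_Icc_lo {g : Series} {n : ℕ} (hn : 1 ≤ n) {i : ℤ} (h : 0 ≤ i) (h' : i ≤ n) :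
    i ∈ Finset.Icc (lo g n) (n : ℤ) := by
  rw [Finset.mem_Icc]
  cases g <;> simp only [lo] <;> omega

theorem isIndependentGeneratingSet_simple (hg : (sym g).s = 0 ∨ th g = -1)
    (hV : ∀ V : Ix g n → Ix g n → Prop, BracketClosed V →
      (∀ i : ℤ, 0 ≤ i → i + 1 ≤ n → onInt V i (i + 1) ∧ onInt V (i + 1) i) →
      (∀ i : ℤ, 1 ≤ i → i ≤ n → onInt V i i) → ∀ i j, V i j)
    {G : Sgn → Gauss g n} (h : ∀ μ, IsGauss (T g n μ) (G μ)) :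
    IsIndependentGeneratingSet (simpleSeries G) := by
  have hs := s_mem g
  have hv : ∀ a, (simpleVal n a).1 ∈ Finset.Icc (lo g n) (n : ℤ) ∧
      (simpleVal n a).2 ∈ Finset.Icc (lo g n) (n : ℤ) := by
    rintro (i | i | i) <;> have := i.2 <;> simp only [simpleVal] <;> constructor <;>
      exact mem_Icc_lo (by omega) (by omega) (by omega)
  refine NearModes.isIndependent_of_values (simpleVal n) hv ?_ ?_ ?_ ?_ ?_
  · rintro B μ hB (i | i | i) p
    · exact (h μ).F_mode hB (hv (.inl i)).1 (hv (.inl i)).2 (by simp [simpleVal]) p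
    · exact (h μ).E_mode hB (hv (.inr (.inl i))).2 (hv (.inr (.inl i))).1 (by simp [simpleVal]) p
    · exact (h μ).k_mode hB (hv (.inr (.inr i))).1 (hv (.inr (.inr i))).2 rfl p
  · rintro (i | i | i) (j | j | j) hij <;> simp only [simpleVal, Prod.mk.injEq] at hij <;>
      first
      | omega
      | rw [show i = j from Fin.ext (by omega)]
  · rintro (i | i | i) (j | j | j) hij <;> simp only [simpleVal, Prod.mk.injEq] at hij <;>
      first
      | omega
      | rw [show i = j from Fin.ext (by omega)]
  · rintro (i | i | i) hi <;> simp only [simpleVal] at hi <;>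
      exact hg.resolve_left (by omega)
  · intro V hV' ha
    refine hV V hV' (fun i hi hi' => ?_) fun i hi hi' => ?_
    · have h1 := ha (.inl ⟨i.toNat, by omega⟩)
      have h2 := ha (.inr (.inl ⟨i.toNat, by omega⟩))
      simp only [simpleVal, Int.toNat_of_nonneg hi] at h1 h2
      exact ⟨h1, h2⟩
    · have h1 := ha (.inr (.inr ⟨(i - 1).toNat, by omega⟩))
      simpa only [simpleVal, Int.toNat_of_nonneg (sub_nonneg.2 hi), sub_add_cancel] using h1

/-- Modulo `c` the negative series agree up to sign with the mirrored positive ones, so the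
combinatorics of the positive family applies after reflection. -/
theorem isIndependentGeneratingSet_simpleNeg {G : Sgn → Gauss .B n}
    (h : ∀ μ, IsGauss (T .B n μ) (G μ)) : IsIndependentGeneratingSet (simpleSeriesNeg G) := by
  have hs : (sym .B).s = 0 := rfl
  have hv : ∀ a, (simpleValNeg n a).1 ∈ Finset.Icc (lo .B n) (n : ℤ) ∧
      (simpleValNeg n a).2 ∈ Finset.Icc (lo .B n) (n : ℤ) := by
    rintro (i | i | i) <;> have := i.2 <;> simp only [simpleValNeg, lo, Finset.mem_Icc] <;> omega
  refine NearModes.isIndependent_of_values (simpleValNeg n) hv ?_ ?_ ?_ ?_ ?_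
  · rintro B μ hB (i | i | i) p
    · exact (h μ).F_mode hB (hv (.inl i)).1 (hv (.inl i)).2 (by simp [simpleValNeg]) p
    · exact (h μ).E_mode hB (hv (.inr (.inl i))).2 (hv (.inr (.inl i))).1 (by simp [simpleValNeg]) p
    · exact (h μ).k_mode hB (hv (.inr (.inr i))).1 (hv (.inr (.inr i))).2 rfl p
  · rintro (i | i | i) (j | j | j) hij <;> simp only [simpleValNeg, Prod.mk.injEq] at hij <;>
      first
      | omega
      | rw [show i = j from Fin.ext (by omega)]
  · rintro (i | i | i) (j | j | j) hij <;> simp only [simpleValNeg, Prod.mk.injEq, hs] at hij <;> omega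
  · rintro (i | i | i) hi <;> simp only [simpleValNeg, hs] at hi <;> omega
  · intro V hV' ha
    have hneg : ∀ {i j : ℤ}, onInt V i j → onInt V (-j) (-i) := by
      intro i j h
      have := h.symm_opp hV'
      rwa [hs, zero_sub, zero_sub] at this
    refine bracketClosed_B hV' (fun i hi hi' => ?_) fun i hi hi' => ?_
    · have h1 := hneg (ha (.inl ⟨i.toNat, by omega⟩))
      have h2 := hneg (ha (.inr (.inl ⟨i.toNat, by omega⟩)))
      simp only [simpleValNeg, Int.toNat_of_nonneg hi, neg_neg, neg_sub, sub_neg_eq_add] at h1 h2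
      rw [add_comm] at h1 h2
      exact ⟨h1, h2⟩
    · have h1 := hneg (ha (.inr (.inr ⟨(i - 1).toNat, by omega⟩)))
      simp only [simpleValNeg, Int.toNat_of_nonneg (sub_nonneg.2 hi)] at h1
      rwa [show -(-(i - 1) - 1) = i by ring] at h1

theorem isIndependentGeneratingSet_simpleD (hn : 2 ≤ n) {G : Sgn → Gauss .D n}
    (h : ∀ μ, IsGauss (T .D n μ) (G μ)) : IsIndependentGeneratingSet (simpleSeriesD G) := by
  have hs : (sym .D).s = 1 := rfl
  have hv : ∀ a, (simpleValD n a).1 ∈ Finset.Icc (lo .D n) (n : ℤ) ∧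
      (simpleValD n a).2 ∈ Finset.Icc (lo .D n) (n : ℤ) := by
    rintro (i | i | i) <;> have := i.2 <;> simp only [simpleValD, lo, Finset.mem_Icc] <;>
      (try split_ifs) <;> (try simp only) <;> omega
  refine NearModes.isIndependent_of_values (simpleValD n) hv ?_ ?_ ?_ ?_ ?_
  · rintro B μ hB (i | i | i) p
    · have := (h μ).F_mode hB (hv (.inl i)).1 (hv (.inl i)).2 (by
        simp only [simpleValD]; split_ifs <;> simp) p
      have e : simpleSeriesD G μ (.inl i) =
          (G μ).F (simpleValD n (.inl i)).2 (simpleValD n (.inl i)).1 := by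
        simp only [simpleSeriesD, simpleValD]
        split_ifs <;> rfl
      rw [e]
      exact this
    · have := (h μ).E_mode hB (hv (.inr (.inl i))).2 (hv (.inr (.inl i))).1 (by
        simp only [simpleValD]; split_ifs <;> simp) p
      have e : simpleSeriesD G μ (.inr (.inl i)) =
          (G μ).E (simpleValD n (.inr (.inl i))).2 (simpleValD n (.inr (.inl i))).1 := by
        simp only [simpleSeriesD, simpleValD]
        split_ifs <;> rfl
      rw [e]
      exact this
    · exact (h μ).k_mode hB (hv (.inr (.inr i))).1 (hv (.inr (.inr i))).2 rfl p
  · rintro (i | i | i) (j | j | j) hij <;> simp only [simpleValD] at hij <;> (try split_ifs at hij) <;>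
      simp only [Prod.mk.injEq] at hij <;>
      first
      | omega
      | rw [show i = j from Fin.ext (by omega)]
  · rintro (i | i | i) (j | j | j) hij <;> simp only [simpleValD, hs] at hij <;>
      (try split_ifs at hij) <;> simp only [Prod.mk.injEq] at hij <;> omega
  · rintro (i | i | i) hi <;> simp only [simpleValD, hs] at hi <;> (try split_ifs at hi) <;>
      (try simp only at hi) <;> omega
  · intro V hV' ha
    refine bracketClosed_D hn hV' ?_ (fun i hi hi' => ?_) fun i hi hi' => ?_
    · have h1 := ha (.inl ⟨0, by omega⟩)
      have h2 := ha (.inr (.inl ⟨0, by omega⟩))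
      simp only [simpleValD, if_true] at h1 h2
      exact ⟨h1, h2⟩
    · have h1 := ha (.inl ⟨i.toNat, by omega⟩)
      have h2 := ha (.inr (.inl ⟨i.toNat, by omega⟩))
      have hi0 : ¬i.toNat = 0 := by omega
      simp only [simpleValD, if_neg hi0, Int.toNat_of_nonneg (zero_le_one.trans hi)] at h1 h2
      exact ⟨h1, h2⟩
    · have h1 := ha (.inr (.inr ⟨(i - 1).toNat, by omega⟩))
      simpa only [simpleValD, Int.toNat_of_nonneg (sub_nonneg.2 hi), sub_add_cancel] using h1

end Simple

end YangianDouble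

end
-- Specialisation to the three series
theorem mainTheorem2 (n : ℕ) (hn : 2 ≤ n) :
    (∀ (g : YangianDouble.Series) (μ : YangianDouble.Sgn),
      ∃! G : YangianDouble.Gauss g n, YangianDouble.IsGauss (YangianDouble.T g n μ) G) ∧
    (∀ G : YangianDouble.Sgn → YangianDouble.Gauss .B n,
      (∀ μ, YangianDouble.IsGauss (YangianDouble.T .B n μ) (G μ)) →
        (∀ μ, ∀ i : ℕ, i ≤ n - 1 →
          (G μ).F (-(i : ℤ)) (-(i : ℤ) - 1) =
              -YangianDouble.shift μ ((i : ℂ) - 1 / 2) ((G μ).F ((i : ℤ) + 1) i) ∧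
          (G μ).E (-(i : ℤ) - 1) (-(i : ℤ)) =
              -YangianDouble.shift μ ((i : ℂ) - 1 / 2) ((G μ).E i ((i : ℤ) + 1))) ∧
        (∀ μ, ∀ l : ℕ, l ≤ n →
          (G μ).k (-(l : ℤ)) = YangianDouble.cartanRHS (G μ) μ (-1 / 2) l) ∧
        YangianDouble.IsIndependentGeneratingSet (YangianDouble.simpleSeries G) ∧
        YangianDouble.IsIndependentGeneratingSet (YangianDouble.simpleSeriesNeg G)) ∧
    (∀ G : YangianDouble.Sgn → YangianDouble.Gauss .C n,
      (∀ μ, YangianDouble.IsGauss (YangianDouble.T .C n μ) (G μ)) →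
        (∀ μ, ∀ i : ℕ, 1 ≤ i → i ≤ n - 1 →
          (G μ).F (-(i : ℤ) + 1) (-(i : ℤ)) =
              -YangianDouble.shift μ ((i : ℂ) + 1) ((G μ).F ((i : ℤ) + 1) i) ∧
          (G μ).E (-(i : ℤ)) (-(i : ℤ) + 1) =
              -YangianDouble.shift μ ((i : ℂ) + 1) ((G μ).E i ((i : ℤ) + 1))) ∧
        (∀ μ, ∀ l : ℕ, 1 ≤ l → l ≤ n →
          (G μ).k (-(l : ℤ) + 1) = YangianDouble.cartanRHS (G μ) μ 1 l) ∧
        YangianDouble.IsIndependentGeneratingSet (YangianDouble.simpleSeries G)) ∧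
    (∀ G : YangianDouble.Sgn → YangianDouble.Gauss .D n,
      (∀ μ, YangianDouble.IsGauss (YangianDouble.T .D n μ) (G μ)) →
        (∀ μ, ∀ i : ℕ, 1 ≤ i → i ≤ n - 1 →
          (G μ).F (-(i : ℤ) + 1) (-(i : ℤ)) =
              -YangianDouble.shift μ ((i : ℂ) - 1) ((G μ).F ((i : ℤ) + 1) i) ∧
          (G μ).E (-(i : ℤ)) (-(i : ℤ) + 1) =
              -YangianDouble.shift μ ((i : ℂ) - 1) ((G μ).E i ((i : ℤ) + 1))) ∧
        (∀ μ, ∀ l : ℕ, 1 ≤ l → l ≤ n →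
          (G μ).k (-(l : ℤ) + 1) = YangianDouble.cartanRHS (G μ) μ (-1) l) ∧
        YangianDouble.IsIndependentGeneratingSet (YangianDouble.simpleSeriesD G)) := by
  refine ⟨fun g μ => YangianDouble.existsUnique_gauss g n μ, fun G hG => ⟨?_, ?_, ?_, ?_⟩,
    fun G hG => ⟨?_, ?_, ?_⟩, fun G hG => ⟨?_, ?_, ?_⟩⟩
  · intro μ i hi
    have h := YangianDouble.gauss_fe_eq (hG μ) (i := i) (Or.inr rfl) (by omega)
    have hσ : (i : ℂ) + (YangianDouble.sym .B).σ = i - 1 / 2 := by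
      simp only [YangianDouble.sym]
      ring
    rw [hσ, show (YangianDouble.sym .B).s = 0 from rfl, zero_sub] at h
    exact h
  · intro μ l hl
    have h := YangianDouble.gauss_k_eq (hG μ) (l := l) (Or.inr rfl) hl
    rw [show (YangianDouble.sym .B).s = 0 from rfl, zero_sub] at h
    exact h
  · exact YangianDouble.isIndependentGeneratingSet_simple (Or.inl rfl)
      (fun _ hV h1 h2 => YangianDouble.bracketClosed_B hV h1 h2) hG
  · exact YangianDouble.isIndependentGeneratingSet_simpleNeg hG
  · intro μ i hi hi'
    have h := YangianDouble.gauss_fe_eq (hG μ) (i := i) (Or.inl hi) (by omega)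
    rw [show (YangianDouble.sym .C).s = 1 from rfl, show (1 : ℤ) - i - 1 = -i by ring,
      show (1 : ℤ) - i = -i + 1 by ring] at h
    exact h
  · intro μ l hl hl'
    have h := YangianDouble.gauss_k_eq (hG μ) (l := l) (Or.inl hl) hl'
    rw [show (YangianDouble.sym .C).s = 1 from rfl, show (1 : ℤ) - l = -l + 1 by ring] at h
    exact h
  · exact YangianDouble.isIndependentGeneratingSet_simple (Or.inr rfl)
      (fun _ hV h1 h2 => YangianDouble.bracketClosed_C hV h1 h2) hG
  · intro μ i hi hi'
    have h := YangianDouble.gauss_fe_eq (hG μ) (i := i) (Or.inl hi) (by omega)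
    rw [show (YangianDouble.sym .D).s = 1 from rfl, show (1 : ℤ) - i - 1 = -i by ring,
      show (1 : ℤ) - i = -i + 1 by ring,
      show (i : ℂ) + (YangianDouble.sym .D).σ = i - 1 from (sub_eq_add_neg _ _).symm] at h
    exact h
  · intro μ l hl hl'
    have h := YangianDouble.gauss_k_eq (hG μ) (l := l) (Or.inl hl) hl'
    rw [show (YangianDouble.sym .D).s = 1 from rfl, show (1 : ℤ) - l = -l + 1 by ring] at h
    exact h
  · exact YangianDouble.isIndependentGeneratingSet_simpleD hn hG
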